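/- **Lemma (Local commutation properties).** *Setting.* Let $k\ge 0$ be an integer and let $T\subset\mathbb R^3$ be a cell: a bounded open convex polyhedron whose boundary $\partial T$ is the union of the closures of finitely many pairwise disjoint relatively open convex polygons (the faces $F\in\mathcal F_T$), the relative boundary of each $F$ being the union of the closures of finitely many open segments (its edges $E\in\mathcal E_F$, distinct edges being disjoint), the endpoints of which are the vertices $V$, with coordinates $x_V$. (Every edge belongs to a face of $T$ and every vertex to an edge.) Fix points $x_T\in T$, $x_F\in F$, a unit normal $n_F$ of each face and a unit tangent $t_E$ of each edge. Let $n_{FE}=n_F\times t_E$, so that $(t_E,n_{FE},n_F)$ is right-handed; $\omega_{TF},\omega_{FE}\in\{-1,1\}$ are such that $\omega_{TF}n_F$ points out of $T$ and $\omega_{FE}n_{FE}$ points out of $F$. Each $F$ is given an orthonormal basis $(n_1,n_2)$ of its plane, oriented by $n_F$; ${}^\perp$ is the rotation by $\pi/2$ in this oriented plane. On $F$, $\nabla$ and $\mathrm{div}$ are the tangential operators, $\mathbf{rot}\,r$ is $\nabla r$ rotated by $-\pi/2$, and $\mathrm{rot}\,v=\partial_1v_2-\partial_2v_1$. A dot over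 an edge polynomial is the derivative along $t_E$, and $v_t$ is the tangential part on $F$ of a vector field $v$. Divergences of matrix fields are taken row by row, $(\nabla v)_{ij}=\partial_jv_i$, and $A:B=\sum_{ij}A_{ij}B_{ij}$. *Polynomial spaces.* For $X\in\{T,F,E\}$, $P^m(X)$ is the space of polynomials of total degree at most $m$ on $X$ ($\{0\}$ if $m<0$); vector fields on $F$ in $P^m(F)^2$ are tangential. $P^{0,m}(X)$ is the subspace of zero mean. Put $$G^m(X)=\nabla P^{m+1}(X),\quad R^{c,m}(X)=(x-x_X)P^{m-1}(X)\qquad(X\in\{T,F\}),$$ $$G^{c,m}(T)=(x-x_T)\times P^{m-1}(T)^3,\quad R^m(T)=\mathrm{curl}\,P^{m+1}(T)^3,\quad G^{c,m}(F)=(x-x_F)^\perp P^{m-1}(F),\quad R^m(F)=\mathbf{rot}\,P^{m+1}(F).$$ Let $d=3$ if $X=T$ and $d=2$ if $X=F$. $R_b^{c,m}(X)$ is the space of $d\times d$ matrix fields with rows in $R^{c,m}(X)$ and zero trace; $R_b^m(X)$ is the space of matrix fields $W$ with rows in $R^{c,m}(X)$ such that $\mathrm{div}\,W=\nabla q$ for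 some $q\in P^{0,m}(X)$. Let $R^m(X)^d$ denote the matrix fields with $d$ rows in $R^m(X)$, and set $$RT_b^{m}(T)=R_b^{c,m}(T)\oplus R_b^{m-1}(T)\oplus R^{m-1}(T)^3,$$ $$FRT_b^{m}(F)=\Big\{\sum_{i,j\in\{1,2\}}V_{ij}\,n_i\otimes n_j+\sum_{j\in\{1,2\}}w_j\,n_F\otimes n_j:\ V\in R_b^{c,m}(F)\oplus R_b^{m}(F)\oplus R^{m}(F)^2,\ w\in P^{m}(F)^2\Big\}.$$ $P_c^m$ denotes families of polynomials of degree at most $m$ on the edges that are continuous at the vertices. $\pi^m_X$ is the $L^2(X)$-orthogonal projection onto $P^m(X)$ (componentwise on vectors) and $\pi_{S}$ the $L^2$-orthogonal projection onto a space $S$. *Discrete spaces.* These are the spaces of tuples - $X_{\mathrm{grad}}$: $(g_V\in\mathbb R^3)_V$, $(q_E)_E\in P_c^{k+1}$, $(g_E\in P^k(E)^3,\ g_E\perp t_E)_E$, $(q_F,g_F\in P^{k-1}(F))_F$, $q_T\in P^{k-1}(T)$; - $X_{\mathrm{curl}}$: $(r_V\in\mathbb R^3)_V$, $(v_E)_E\in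 (P_c^{k+2})^3$, $(r_E\in P^{k+1}(E)^3)_E$, $(v_{R,F}\in R^{k-1}(F),\ v^c_{R,F}\in R^{c,k}(F),\ v_F\in P^{k-1}(F),\ r_{G,F}\in G^k(F),\ r^c_{G,F}\in G^{c,k}(F))_F$, $v_{R,T}\in R^{k-1}(T)$, $v^c_{R,T}\in R^{c,k}(T)$; - $X_\nabla$: $(w_E)_E\in(P_c^{k+3})^3$, $(w_F\in P^k(F),\ w_{G,F}\in G^k(F),\ w^c_{G,F}\in G^{c,k}(F))_F$, $w_{G,T}\in G^{k-1}(T)$, $w^c_{G,T}\in G^{c,k}(T)$; - $X_{L^2}$: $(W_E\in P^{k+2}(E)^3)_E$, $(W_F\in FRT_b^{k+1}(F))_F$, $W_T\in RT_b^{k+1}(T)$. *Interpolators* (components in the above order). - $I_{\mathrm{grad}}q$: $\nabla q(x_V)$; $q_E$ with $\pi^{k-1}_Eq_E=\pi_E^{k-1}q$ and $q_E(x_V)=q(x_V)$ at the endpoints; $\pi^k_E(t_E\times(\nabla q\times t_E))$; $\pi_F^{k-1}q$, $\pi_F^{k-1}(\nabla q\cdot n_F)$; $\pi_T^{k-1}q$.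 - $I_{\mathrm{curl}}v$: $\mathrm{curl}\,v(x_V)$; $v_E$ with $\pi_E^kv_E=\pi_E^kv$, $v_E(x_V)=v(x_V)$; $\pi_E^{k+1}\big((\mathrm{curl}\,v\cdot t_E)t_E+\nabla(v\cdot t_E)\times t_E\big)$; $\pi_{R^{k-1}(F)}v_t$, $\pi_{R^{c,k}(F)}v_t$, $\pi_F^{k-1}(v\cdot n_F)$, $\pi_{G^k(F)}(n_F\times(\nabla v\,n_F))$, $\pi_{G^{c,k}(F)}(n_F\times(\nabla v\,n_F))$; $\pi_{R^{k-1}(T)}v$, $\pi_{R^{c,k}(T)}v$. - $I_\nabla w$: $w_E$ with $\pi_E^{k+1}w_E=\pi_E^{k+1}w$, $w_E(x_V)=w(x_V)$; $\pi_F^k(w\cdot n_F)$, $\pi_{G^k(F)}w_t$, $\pi_{G^{c,k}(F)}w_t$; $\pi_{G^{k-1}(T)}w$, $\pi_{G^{c,k}(T)}w$. - $I_{L^2}W$: $\pi_E^{k+2}(W t_E)$; $\pi_{FRT_b^{k+1}(F)}W$; $\pi_{RT_b^{k+1}(T)}W$. *Discrete gradient* $\underline G_T:X_{\mathrm{grad}}\to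 X_{\mathrm{curl}}$. Let $v_E$ satisfy $\pi_E^kv_E=\dot q_Et_E+g_E$ and $v_E(x_V)=g_V$. Define $G_F,G_F^\perp\in P^k(F)^2$, $\gamma_F\in P^{k+1}(F)$, $G_T\in P^k(T)^3$ by $$\int_FG_F\cdot w=-\int_Fq_F\,\mathrm{div}\,w+\sum_{E\in\mathcal E_F}\omega_{FE}\int_Eq_E\,w\cdot n_{FE}\quad\forall w\in P^k(F)^2,$$ $$\int_FG^\perp_F\cdot w=-\int_Fg_F\,\mathrm{rot}\,w-\sum_{E\in\mathcal E_F}\omega_{FE}\int_E(g_E\cdot n_F)(w\cdot t_E)\quad\forall w\in P^k(F)^2,$$ $$\int_F\gamma_F\,\mathrm{div}\,v=-\int_FG_F\cdot v+\sum_{E\in\mathcal E_F}\omega_{FE}\int_Eq_E\,v\cdot n_{FE}\quad\forall v\in R^{c,k+2}(F),$$ $$\int_TG_T\cdot w=-\int_Tq_T\,\mathrm{div}\,w+\sum_{F\in\mathcal F_T}\omega_{TF}\int_F\gamma_F\,w\cdot n_F\quad\forall w\in P^k(T)^3.$$ The components of $\underline G_T$ are $0$ at the vertices; $v_E$, $\dot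 v_E\times t_E$; $\pi_{R^{k-1}(F)}G_F$, $\pi_{R^{c,k}(F)}G_F$, $g_F$, $\pi_{G^k(F)}G_F^\perp$, $\pi_{G^{c,k}(F)}G_F^\perp$; $\pi_{R^{k-1}(T)}G_T$, $\pi_{R^{c,k}(T)}G_T$. *Discrete curl* $\underline C_T:X_{\mathrm{curl}}\to X_\nabla$. Let $(C_E)_E\in(P_c^{k+3})^3$ satisfy $\pi_E^{k+1}C_E=r_E-\dot v_E\times t_E$ and $C_E(x_V)=r_V$. Define $C_F\in P^k(F)$, $\mathbf C_F\in P^k(F)^2$, $\gamma_{t,F}\in P^k(F)^2$, $C_T\in P^k(T)^3$ by $$\int_FC_F\,r=\int_Fv_{R,F}\cdot\mathbf{rot}\,r-\sum_{E\in\mathcal E_F}\omega_{FE}\int_E(v_E\cdot t_E)r\quad\forall r\in P^k(F),$$ $$\int_F\mathbf C_F\cdot r=\int_Fv_F\,\mathrm{rot}\,r+\sum_{E\in\mathcal E_F}\omega_{FE}\int_E(v_E\cdot n_F)(r\cdot t_E)\quad\forall r\in P^k(F)^2,$$ $$\int_F\gamma_{t,F}\cdot(\mathbf{rot}\,r+w)=\int_FC_F\,r+\sum_{E\in\mathcal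 E_F}\omega_{FE}\int_E(v_E\cdot t_E)r+\int_Fv^c_{R,F}\cdot w\quad\forall r\in P^{0,k+1}(F),\ w\in R^{c,k}(F),$$ $$\int_TC_T\cdot r=\int_Tv_{R,T}\cdot\mathrm{curl}\,r+\sum_{F\in\mathcal F_T}\omega_{TF}\int_F\gamma_{t,F}\cdot(r\times n_F)\quad\forall r\in P^k(T)^3.$$ The components of $\underline C_T$ are $C_E$; $C_F$, $\pi_{G^k(F)}\mathbf C_F+r_{G,F}$, $\pi_{G^{c,k}(F)}\mathbf C_F+r^c_{G,F}$; $\pi_{G^{k-1}(T)}C_T$, $\pi_{G^{c,k}(T)}C_T$. *Discrete Jacobian* $\underline\nabla_T:X_\nabla\to X_{L^2}$ *and divergence.* Define $\nabla_F\in FRT_b^{k+1}(F)$, $\gamma_{\nabla,F}\in P^{k+2}(F)^3$, $\nabla_T\in RT_b^{k+1}(T)$ by $$\int_F\nabla_F:V=-\int_Fw^c_{G,F}\cdot\mathrm{div}\,A-\int_Fw_{G,F}\cdot\mathrm{div}\,B-\int_Fw_F\,\mathrm{div}\,n+\sum_{E\in\mathcal E_F}\omega_{FE}\int_Ew_E\cdot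 V n_{FE}$$ for all $V=(A+B+C)+n_F\otimes n$ with $A\in R_b^{c,k+1}(F)$, $B\in R_b^{k+1}(F)$, $C\in R^{k+1}(F)^2$, $n\in P^{k+1}(F)^2$; $$\int_F\gamma_{\nabla,F}\cdot\mathrm{div}\,V=-\int_F\nabla_F:V+\sum_{E\in\mathcal E_F}\omega_{FE}\int_Ew_E\cdot Vn_{FE}$$ for all $3$-row matrix fields $V$ with rows in $R^{c,k+3}(F)$; and $$\int_T\nabla_T:V=-\int_Tw^c_{G,T}\cdot\mathrm{div}\,A-\int_Tw_{G,T}\cdot\mathrm{div}\,B+\sum_{F\in\mathcal F_T}\omega_{TF}\int_F\gamma_{\nabla,F}\cdot Vn_F$$ for all $V=A+B+C$ with $A\in R_b^{c,k+1}(T)$, $B\in R_b^{k}(T)$, $C\in R^k(T)^3$. The components of $\underline\nabla_T$ are $\dot w_E$; $\nabla_F$; $\nabla_T$, and $D_T=\mathrm{tr}\,\nabla_T$. *Claim.* For every such cell $T$: 1. $\underline G_T(I_{\mathrm{grad}}q)=I_{\mathrm{curl}}(\nabla q)$ for all $q\in C^2(\overline T)$; 2. $\underline C_T(I_{\mathrm{curl}}v)=I_\nabla(\mathrm{curl}\,v)$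 for all $v\in C^1(\overline T)^3$; 3. $\underline\nabla_T(I_\nabla w)=I_{L^2}(\nabla w)$ for all $w\in C^1(\overline T)^3$; 4. $D_T(I_\nabla w)=\pi_T^k(\mathrm{div}\,w)$ for all $w\in C^0(\overline T)^3\cap H^1(T)^3$. -/

import Mathlib

open MeasureTheory Set
open scoped Matrix

noncomputable section

namespace DiscreteStokes

/-- Physical space. Only the dot product `⬝ᵥ` is used as Euclidean structure, never the sup norm;
`volume` is the Lebesgue measure. -/
abbrev R3 := Fin 3 → ℝ

/-- Real polynomials in `d` variables. -/
abbrev Pol (d : ℕ) := MvPolynomial (Fin d) ℝ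

/-- The element singled out by a defining property. It is only used for properties that
characterise exactly one element of `α`. -/
def solve {α : Type*} [Nonempty α] (p : α → Prop) : α := Classical.epsilon p

/-! ### Polynomial spaces -/

/-- `P^m` in `d` variables: total degree at most `m`; it is `{0}` for `m < 0`. -/
def Poly (d : ℕ) (m : ℤ) : Submodule ℝ (Pol d) :=
  MvPolynomial.restrictSupport ℝ {s | ((Finsupp.degree s : ℕ) : ℤ) ≤ m}

/-- Vectors with `c` components in `P^m`. -/
def VPoly (d c : ℕ) (m : ℤ) : Submodule ℝ (Fin c → Pol d) :=
  Submodule.pi Set.univ fun _ => Poly d m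

/-- Matrices with `c` rows, all of them in the space `S` of vector fields. -/
def rows {d : ℕ} (c : ℕ) (S : Submodule ℝ (Fin d → Pol d)) :
    Submodule ℝ (Fin c → Fin d → Pol d) :=
  Submodule.pi Set.univ fun _ => S

/-- Polynomials of one variable (arc length along an edge) of degree at most `m`;
`{0}` for `m < 0`. -/
def EP (m : ℤ) : Submodule ℝ (Polynomial ℝ) := Polynomial.degreeLT ℝ (m + 1).toNat

/-- `ℝ³`-valued polynomials of degree at most `m` on an edge. -/
def EPV (m : ℤ) : Submodule ℝ (Fin 3 → Polynomial ℝ) :=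
  Submodule.pi Set.univ fun _ => EP m

/-! Differential operators on polynomials -/

/-- The partial derivative `∂ᵢ`. -/
def dP {d : ℕ} (i : Fin d) : Pol d →ₗ[ℝ] Pol d :=
  (MvPolynomial.pderiv i : Derivation ℝ (Pol d) (Pol d)).toLinearMap

def gradP (d : ℕ) : Pol d →ₗ[ℝ] (Fin d → Pol d) := LinearMap.pi fun i => dP i

/-- The `i`-th component of a vector field. -/
def cP {d c : ℕ} (i : Fin c) : (Fin c → Pol d) →ₗ[ℝ] Pol d := LinearMap.proj i

def divP (d : ℕ) : (Fin d → Pol d) →ₗ[ℝ] Pol d := ∑ i, dP i ∘ₗ cP i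

/-- Row-wise divergence of a matrix field. -/
def divRows (d c : ℕ) : (Fin c → Fin d → Pol d) →ₗ[ℝ] (Fin c → Pol d) :=
  LinearMap.pi fun i => divP d ∘ₗ LinearMap.proj i

def trP (d : ℕ) : (Fin d → Fin d → Pol d) →ₗ[ℝ] Pol d := ∑ i, cP i ∘ₗ LinearMap.proj i

def curlP : (Fin 3 → Pol 3) →ₗ[ℝ] (Fin 3 → Pol 3) :=
  LinearMap.pi ![dP 1 ∘ₗ cP 2 - dP 2 ∘ₗ cP 1, dP 2 ∘ₗ cP 0 - dP 0 ∘ₗ cP 2,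
    dP 0 ∘ₗ cP 1 - dP 1 ∘ₗ cP 0]

/-- Vector curl of a scalar in the plane: the gradient rotated by `-π/2`. -/
def vrotP : Pol 2 →ₗ[ℝ] (Fin 2 → Pol 2) := LinearMap.pi ![dP 1, -dP 0]

/-- Scalar curl of a planar vector field, `∂₀ v₁ - ∂₁ v₀`. -/
def rotP : (Fin 2 → Pol 2) →ₗ[ℝ] Pol 2 := dP 0 ∘ₗ cP 1 - dP 1 ∘ₗ cP 0

/-- Rotation by `π/2` in the plane. -/
def perp : (Fin 2 → Pol 2) →ₗ[ℝ] (Fin 2 → Pol 2) :=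
  LinearMap.pi ![-cP 1, cP 0]

/-- `p ↦ (x - c) p`. -/
def koszul {d : ℕ} (c : Fin d → ℝ) : Pol d →ₗ[ℝ] (Fin d → Pol d) :=
  LinearMap.pi fun i =>
    LinearMap.mulLeft ℝ (MvPolynomial.X i - MvPolynomial.C (c i) : Pol d)

/-- `v ↦ (x - c) × v`. -/
def koszulCross (c : R3) : (Fin 3 → Pol 3) →ₗ[ℝ] (Fin 3 → Pol 3) :=
  (crossProduct fun i => (MvPolynomial.X i - MvPolynomial.C (c i) : Pol 3)).restrictScalars ℝ

/-! Koszul decompositions. In the plane of a face the coordinates are centred at the point `x_F`,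
so that `x - x_F` is the coordinate vector itself. -/

/-- `G^m = grad P^{m+1}`. -/
def Goly (d : ℕ) (m : ℤ) : Submodule ℝ (Fin d → Pol d) := (Poly d (m + 1)).map (gradP d)

/-- `R^{c,m} = (x - c) P^{m-1}`. -/
def RolyC (d : ℕ) (c : Fin d → ℝ) (m : ℤ) : Submodule ℝ (Fin d → Pol d) :=
  (Poly d (m - 1)).map (koszul c)

/-- `R^m = curl (P^{m+1})³` on a cell. -/
def Roly3 (m : ℤ) : Submodule ℝ (Fin 3 → Pol 3) := (VPoly 3 3 (m + 1)).map curlP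

/-- `G^{c,m} = (x - c) × (P^{m-1})³` on a cell. -/
def GolyC3 (c : R3) (m : ℤ) : Submodule ℝ (Fin 3 → Pol 3) :=
  (VPoly 3 3 (m - 1)).map (koszulCross c)

/-- `R^m = rot P^{m+1}` on a face. -/
def Roly2 (m : ℤ) : Submodule ℝ (Fin 2 → Pol 2) := (Poly 2 (m + 1)).map vrotP

/-- `G^{c,m} = (x - x_F)^⊥ P^{m-1}` on a face. -/
def GolyC2 (m : ℤ) : Submodule ℝ (Fin 2 → Pol 2) :=
  (Poly 2 (m - 1)).map (perp ∘ₗ koszul 0)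

/-- `P^{0,m}` on the region `R`: polynomials of degree at most `m` with zero integral over `R`.
(For a bounded region the spanning set is already a linear subspace.) -/
def Poly0 {d : ℕ} (R : Set (Fin d → ℝ)) (m : ℤ) : Submodule ℝ (Pol d) :=
  Submodule.span ℝ {p | p ∈ Poly d m ∧ ∫ x in R, MvPolynomial.eval x p = 0}

/-- Trace-free matrix fields with rows in `R^{c,m}`. -/
def RolybC (d : ℕ) (c : Fin d → ℝ) (m : ℤ) : Submodule ℝ (Fin d → Fin d → Pol d) :=
  rows d (RolyC d c m) ⊓ LinearMap.ker (trP d)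

/-- The image of `P^{0,m}` under the operator sending `q` to the matrix field `W` with rows in
`R^{c,m}` and row-wise divergence `grad q` (the divergence is bijective `R^{c,m} → P^{m-1}`). -/
def Rolyb (d : ℕ) (c : Fin d → ℝ) (R : Set (Fin d → ℝ)) (m : ℤ) :
    Submodule ℝ (Fin d → Fin d → Pol d) :=
  rows d (RolyC d c m) ⊓ ((Poly0 R m).map (gradP d)).comap (divRows d d)

/-! ### Evaluation and `L²` projections -/

def evV {d c : ℕ} (v : Fin c → Pol d) (x : Fin d → ℝ) : Fin c → ℝ :=
  fun i => MvPolynomial.eval x (v i)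

def evM {d a b : ℕ} (V : Fin a → Fin b → Pol d) (x : Fin d → ℝ) : Fin a → Fin b → ℝ :=
  fun i j => MvPolynomial.eval x (V i j)

def evE (v : Fin 3 → Polynomial ℝ) (s : ℝ) : Fin 3 → ℝ := fun i => (v i).eval s

/-- Frobenius product of matrices. -/
def ddot {a b : ℕ} (A B : Fin a → Fin b → ℝ) : ℝ := ∑ i, A i ⬝ᵥ B i

/-- `L²(R)`-orthogonal projection of a scalar function. -/
def projS {d : ℕ} (R : Set (Fin d → ℝ)) (S : Submodule ℝ (Pol d))
    (f : (Fin d → ℝ) → ℝ) : S :=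
  solve fun p : S => ∀ r ∈ S,
    ∫ x in R, MvPolynomial.eval x p.1 * MvPolynomial.eval x r =
      ∫ x in R, f x * MvPolynomial.eval x r

/-- `L²(R)`-orthogonal projection of a vector field. -/
def projV {d c : ℕ} (R : Set (Fin d → ℝ)) (S : Submodule ℝ (Fin c → Pol d))
    (f : (Fin d → ℝ) → Fin c → ℝ) : S :=
  solve fun p : S => ∀ r ∈ S,
    ∫ x in R, evV p.1 x ⬝ᵥ evV r x = ∫ x in R, f x ⬝ᵥ evV r x

/-- `L²(R)`-orthogonal projection of a matrix field. -/
def projM {d a b : ℕ} (R : Set (Fin d → ℝ)) (S : Submodule ℝ (Fin a → Fin b → Pol d))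
    (f : (Fin d → ℝ) → Fin a → Fin b → ℝ) : S :=
  solve fun p : S => ∀ r ∈ S,
    ∫ x in R, ddot (evM p.1 x) (evM r x) = ∫ x in R, ddot (f x) (evM r x)

/-- `L²(0,L)`-orthogonal projection of a vector field on an edge of length `L`. -/
def projE (L : ℝ) (S : Submodule ℝ (Fin 3 → Polynomial ℝ)) (f : ℝ → Fin 3 → ℝ) : S :=
  solve fun p : S => ∀ r ∈ S,
    ∫ s in (0 : ℝ)..L, evE p.1 s ⬝ᵥ evE r s = ∫ s in (0 : ℝ)..L, f s ⬝ᵥ evE r s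

/-! ### Cells -/

/-- An open bounded convex polyhedron `T` with the decomposition of its boundary into open convex
polygonal faces, open edges and vertices, with the orientations and the interior points of `T` and
of its faces. Coplanar faces and collinear edges are allowed. An edge is oriented from `src`
to `tgt`. -/
structure Cell where
  T : Set R3
  xT : R3
  nF : ℕ
  nE : ℕ
  nV : ℕ
  /-- the coordinates of the vertices -/
  vert : Fin nV → R3
  src : Fin nE → Fin nV
  tgt : Fin nE → Fin nV
  /-- the faces, as subsets of space -/
  face : Fin nF → Set R3
  xF : Fin nF → R3
  /-- the unit normal `n_F` -/
  nrm : Fin nF → R3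
  /-- the first vector of the orthonormal basis of the plane of the face -/
  tan1 : Fin nF → R3
  /-- the edges of a face -/
  edges : Fin nF → Finset (Fin nE)
  isOpen_T : IsOpen T
  convex_T : Convex ℝ T
  bounded_T : Bornology.IsBounded T
  xT_mem : xT ∈ T
  vert_injective : Function.Injective vert
  src_ne_tgt : ∀ e, src e ≠ tgt e
  nrm_unit : ∀ f, nrm f ⬝ᵥ nrm f = 1
  tan1_unit : ∀ f, tan1 f ⬝ᵥ tan1 f = 1
  tan1_nrm : ∀ f, tan1 f ⬝ᵥ nrm f = 0
  xF_mem : ∀ f, xF f ∈ face f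
  convex_face : ∀ f, Convex ℝ (face f)
  /-- a face is a relatively open part of the plane through `x_F` with normal `n_F` -/
  face_open : ∀ f, ∃ U : Set R3, IsOpen U ∧ face f = U ∩ {x | (x - xF f) ⬝ᵥ nrm f = 0}
  faces_disjoint : Pairwise fun f g => Disjoint (face f) (face g)
  frontier_T : frontier T = ⋃ f, closure (face f)
  edges_disjoint : Pairwise fun e e' =>
    Disjoint (openSegment ℝ (vert (src e)) (vert (tgt e)))
      (openSegment ℝ (vert (src e')) (vert (tgt e')))
  frontier_face : ∀ f,
    closure (face f) \ face f = ⋃ e ∈ edges f, segment ℝ (vert (src e)) (vert (tgt e))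
  edge_mem : ∀ e, ∃ f, e ∈ edges f
  vert_mem : ∀ v, ∃ e, src e = v ∨ tgt e = v

namespace Cell

variable (K : Cell)

/-- The length of an edge. -/
def len (e : Fin K.nE) : ℝ :=
  Real.sqrt ((K.vert (K.tgt e) - K.vert (K.src e)) ⬝ᵥ (K.vert (K.tgt e) - K.vert (K.src e)))

/-- The unit tangent `t_E`. -/
def tE (e : Fin K.nE) : R3 := (K.len e)⁻¹ • (K.vert (K.tgt e) - K.vert (K.src e))

/-- Arc-length parametrisation of an edge over `[0, len e]`. -/
def edgePt (e : Fin K.nE) (s : ℝ) : R3 := K.vert (K.src e) + s • K.tE e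

/-- The orthonormal basis `(n₁, n₂, n_F)` of space attached to a face; `n₂ = n_F × n₁`, so that
`(n₁, n₂)` is positively oriented in the plane oriented by `n_F`. -/
def frame (f : Fin K.nF) : Fin 3 → R3 := ![K.tan1 f, K.nrm f ⨯₃ K.tan1 f, K.nrm f]

/-- Components of a vector in the basis `(n₁, n₂, n_F)`. -/
def comps (f : Fin K.nF) (v : R3) : Fin 3 → ℝ := fun i => v ⬝ᵥ K.frame f i

/-- Components in `(n₁, n₂)` of the tangential part of a vector. -/
def tang (f : Fin K.nF) (v : R3) : Fin 2 → ℝ := fun i => K.comps f v i.castSucc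

/-- Isometric parametrisation of the plane of a face. -/
def faceMap (f : Fin K.nF) (y : Fin 2 → ℝ) : R3 :=
  K.xF f + ∑ i : Fin 2, y i • K.frame f i.castSucc

/-- The face in its planar coordinates; polynomials on a face are polynomials in these
coordinates. -/
def faceReg (f : Fin K.nF) : Set (Fin 2 → ℝ) := K.faceMap f ⁻¹' K.face f

/-- Planar coordinates, in the plane of the face, of a point of an edge. -/
def edgeInFace (f : Fin K.nF) (e : Fin K.nE) (s : ℝ) : Fin 2 → ℝ :=
  K.tang f (K.edgePt e s - K.xF f)

/-- `n_FE`, for which `(t_E, n_FE, n_F)` is right-handed. -/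
def nFE (f : Fin K.nF) (e : Fin K.nE) : R3 := K.nrm f ⨯₃ K.tE e

open Classical in
/-- `ω_TF = 1` if `n_F` points out of the cell and `-1` otherwise. -/
def omT (f : Fin K.nF) : ℝ := if ∀ x ∈ K.T, (x - K.xF f) ⬝ᵥ K.nrm f ≤ 0 then 1 else -1

open Classical in
/-- `ω_FE = 1` if `n_FE` points out of the face and `-1` otherwise. -/
def omF (f : Fin K.nF) (e : Fin K.nE) : ℝ :=
  if ∀ x ∈ K.face f, (x - K.vert (K.src e)) ⬝ᵥ K.nFE f e ≤ 0 then 1 else -1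

/-- Integral over the cell. -/
def intT (g : R3 → ℝ) : ℝ := ∫ x in K.T, g x

/-- Integral over a face, of a function of the planar coordinates. -/
def intF (f : Fin K.nF) (g : (Fin 2 → ℝ) → ℝ) : ℝ := ∫ y in K.faceReg f, g y

/-- Integral over an edge, of a function of arc length. -/
def intE (e : Fin K.nE) (g : ℝ → ℝ) : ℝ := ∫ s in (0 : ℝ)..(K.len e), g s

/-- `∑_{E ∈ E_F} ω_FE ∫_E g_E`. -/
def bdF (f : Fin K.nF) (g : Fin K.nE → ℝ → ℝ) : ℝ :=
  ∑ e ∈ K.edges f, K.omF f e * K.intE e (g e)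

/-- `∑_{F ∈ F_T} ω_TF ∫_F g_F`. -/
def bdT (g : Fin K.nF → (Fin 2 → ℝ) → ℝ) : ℝ := ∑ f, K.omT f * K.intF f (g f)

/-! ### Discrete spaces -/

/-- Families of polynomials of degree at most `m` on the edges that are continuous at
the vertices. -/
def EPC (m : ℤ) : Submodule ℝ (Fin K.nE → Polynomial ℝ) where
  carrier := {p | (∀ e, p e ∈ EP m) ∧ ∃ c : Fin K.nV → ℝ,
    ∀ e, (p e).eval 0 = c (K.src e) ∧ (p e).eval (K.len e) = c (K.tgt e)}
  add_mem' := by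
    rintro p q ⟨hp, c, hc⟩ ⟨hq, c', hc'⟩
    refine ⟨fun e => (EP m).add_mem (hp e) (hq e), c + c', fun e => ?_⟩
    simp [hc e, hc' e]
  zero_mem' := ⟨fun _ => (EP m).zero_mem, 0, fun e => by simp⟩
  smul_mem' := by
    rintro a p ⟨hp, c, hc⟩
    refine ⟨fun e => (EP m).smul_mem a (hp e), a • c, fun e => ?_⟩
    simp [hc e]

/-- The `ℝ³`-valued version of `EPC`. -/
def EPCV (m : ℤ) : Submodule ℝ (Fin K.nE → Fin 3 → Polynomial ℝ) :=
  ⨅ i : Fin 3, (K.EPC m).comap (LinearMap.pi fun e => LinearMap.proj i ∘ₗ LinearMap.proj e)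

/-- Polynomial fields of degree at most `m` on an edge, with values in the plane orthogonal
to `t_E`. -/
def EPN (e : Fin K.nE) (m : ℤ) : Submodule ℝ (Fin 3 → Polynomial ℝ) :=
  EPV m ⊓ LinearMap.ker (∑ i, K.tE e i • LinearMap.proj i :
    (Fin 3 → Polynomial ℝ) →ₗ[ℝ] Polynomial ℝ)

/-- The matrix-valued Raviart-Thomas space of the cell. -/
def RTb (m : ℤ) : Submodule ℝ (Fin 3 → Fin 3 → Pol 3) :=
  RolybC 3 K.xT m ⊔ (Rolyb 3 K.xT K.T (m - 1) ⊔ rows 3 (Roly3 (m - 1)))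

/-- The space of tensors `∑ᵢⱼ Wᵢⱼ eᵢ ⊗ nⱼ` on a face, where `(e₀, e₁, e₂) = (n₁, n₂, n_F)`: the rows
`0, 1` form an element of `RolybC ⊕ Rolyb ⊕ (Roly2)²` and the last row is any vector
polynomial. -/
def FRTb (f : Fin K.nF) (m : ℤ) : Submodule ℝ (Fin 3 → Fin 2 → Pol 2) :=
  (RolybC 2 0 m ⊔ (Rolyb 2 0 (K.faceReg f) m ⊔ rows 2 (Roly2 m))).comap
      (LinearMap.funLeft ℝ (Fin 2 → Pol 2) (Fin.castSucc : Fin 2 → Fin 3)) ⊓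
    (VPoly 2 2 m).comap (LinearMap.proj (Fin.last 2))

/-- The local space `X_{grad,T}^k`. -/
structure XGrad (k : ℕ) where
  /-- gradient at the vertices -/
  gV : Fin K.nV → R3
  qE : K.EPC (k + 1)
  /-- normal gradient on the edges -/
  gE : ∀ e, K.EPN e k
  qF : Fin K.nF → Poly 2 (k - 1)
  /-- normal gradient on the faces -/
  gF : Fin K.nF → Poly 2 (k - 1)
  qT : Poly 3 (k - 1)

/-- The local space `X_{curl,T}^k`. -/
structure XCurl (k : ℕ) where
  /-- curl at the vertices -/
  rV : Fin K.nV → R3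
  vE : K.EPCV (k + 2)
  rE : Fin K.nE → EPV (k + 1)
  vRF : Fin K.nF → Roly2 (k - 1)
  vRcF : Fin K.nF → RolyC 2 0 k
  vF : Fin K.nF → Poly 2 (k - 1)
  rGF : Fin K.nF → Goly 2 k
  rGcF : Fin K.nF → GolyC2 k
  vRT : Roly3 (k - 1)
  vRcT : RolyC 3 K.xT k

/-- The local space `X_{∇,T}^k`. -/
structure XNabla (k : ℕ) where
  wE : K.EPCV (k + 3)
  wF : Fin K.nF → Poly 2 k
  wGF : Fin K.nF → Goly 2 k
  wGcF : Fin K.nF → GolyC2 k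
  wGT : Goly 3 (k - 1)
  wGcT : GolyC3 K.xT k

/-- The local tensor space `X_{L²,T}^{k+1}`. -/
structure XTensor (k : ℕ) where
  WE : Fin K.nE → EPV (k + 2)
  WF : ∀ f, K.FRTb f (k + 1)
  WT : K.RTb (k + 1)

/-! ### Differential operators on functions on the closed cell -/

/-- Gradient on the closed cell (one-sided at the boundary). -/
def grad (q : R3 → ℝ) (x : R3) : R3 :=
  fun j => fderivWithin ℝ q (closure K.T) x (Pi.single j 1)

/-- Jacobian `(∂ⱼ vᵢ)ᵢⱼ` on the closed cell. -/
def jac (v : R3 → R3) (x : R3) : Fin 3 → Fin 3 → ℝ :=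
  fun i j => fderivWithin ℝ v (closure K.T) x (Pi.single j 1) i

/-- Curl on the closed cell. -/
def curl (v : R3 → R3) (x : R3) : R3 :=
  ![K.jac v x 2 1 - K.jac v x 1 2, K.jac v x 0 2 - K.jac v x 2 0, K.jac v x 1 0 - K.jac v x 0 1]

/-- `W` is the weak Jacobian of `w` in the open cell. -/
def IsWeakJac (w : R3 → R3) (W : R3 → Fin 3 → Fin 3 → ℝ) : Prop :=
  ∀ φ : R3 → ℝ, ContDiff ℝ (⊤ : ℕ∞) φ → HasCompactSupport φ → tsupport φ ⊆ K.T →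
    ∀ i j, ∫ x in K.T, w x i * fderiv ℝ φ x (Pi.single j 1) = -∫ x in K.T, W x i j * φ x

/-! ### Interpolators -/

/-- Interpolator on `X_{grad,T}^k`. -/
def IGrad (k : ℕ) (q : R3 → ℝ) : K.XGrad k where
  gV v := K.grad q (K.vert v)
  qE := solve fun p : K.EPC (k + 1) =>
    (∀ e, ∀ r ∈ EP (k - 1),
      K.intE e (fun s => (p.1 e).eval s * r.eval s) =
        K.intE e fun s => q (K.edgePt e s) * r.eval s) ∧
    ∀ e, (p.1 e).eval 0 = q (K.vert (K.src e)) ∧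
      (p.1 e).eval (K.len e) = q (K.vert (K.tgt e))
  gE e := projE (K.len e) (K.EPN e k) fun s =>
    K.tE e ⨯₃ (K.grad q (K.edgePt e s) ⨯₃ K.tE e)
  qF f := projS (K.faceReg f) (Poly 2 (k - 1)) fun y => q (K.faceMap f y)
  gF f := projS (K.faceReg f) (Poly 2 (k - 1)) fun y => K.grad q (K.faceMap f y) ⬝ᵥ K.nrm f
  qT := projS K.T (Poly 3 (k - 1)) q

/-- The continuous family of edge polynomials `v_E ∈ P^n(E)³` with `π^m_E v_E = π^m_E v` and with
the values of `v` at the vertices; used with `n = m + 2`. -/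
def edgeInterp (n m : ℤ) (v : R3 → R3) : K.EPCV n :=
  solve fun p : K.EPCV n =>
    (∀ e, ∀ r ∈ EPV m,
      K.intE e (fun s => evE (p.1 e) s ⬝ᵥ evE r s) =
        K.intE e fun s => v (K.edgePt e s) ⬝ᵥ evE r s) ∧
    ∀ e, evE (p.1 e) 0 = v (K.vert (K.src e)) ∧
      evE (p.1 e) (K.len e) = v (K.vert (K.tgt e))

/-- Frame components of `n_F × (∇v n_F)` in the plane of a face. -/
def crossNormalDeriv (f : Fin K.nF) (v : R3 → R3) (y : Fin 2 → ℝ) : Fin 2 → ℝ :=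
  K.tang f (K.nrm f ⨯₃ fun i => K.jac v (K.faceMap f y) i ⬝ᵥ K.nrm f)

/-- Interpolator on `X_{curl,T}^k`. -/
def ICurl (k : ℕ) (v : R3 → R3) : K.XCurl k where
  rV i := K.curl v (K.vert i)
  vE := K.edgeInterp (k + 2) k v
  rE e := projE (K.len e) (EPV (k + 1)) fun s =>
    (K.curl v (K.edgePt e s) ⬝ᵥ K.tE e) • K.tE e +
      K.grad (fun x => v x ⬝ᵥ K.tE e) (K.edgePt e s) ⨯₃ K.tE e
  vRF f := projV (K.faceReg f) (Roly2 (k - 1)) fun y => K.tang f (v (K.faceMap f y))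
  vRcF f := projV (K.faceReg f) (RolyC 2 0 k) fun y => K.tang f (v (K.faceMap f y))
  vF f := projS (K.faceReg f) (Poly 2 (k - 1)) fun y => v (K.faceMap f y) ⬝ᵥ K.nrm f
  rGF f := projV (K.faceReg f) (Goly 2 k) (K.crossNormalDeriv f v)
  rGcF f := projV (K.faceReg f) (GolyC2 k) (K.crossNormalDeriv f v)
  vRT := projV K.T (Roly3 (k - 1)) v
  vRcT := projV K.T (RolyC 3 K.xT k) v

/-- Interpolator on `X_{∇,T}^k`. -/
def INabla (k : ℕ) (w : R3 → R3) : K.XNabla k where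
  wE := K.edgeInterp (k + 3) (k + 1) w
  wF f := projS (K.faceReg f) (Poly 2 k) fun y => w (K.faceMap f y) ⬝ᵥ K.nrm f
  wGF f := projV (K.faceReg f) (Goly 2 k) fun y => K.tang f (w (K.faceMap f y))
  wGcF f := projV (K.faceReg f) (GolyC2 k) fun y => K.tang f (w (K.faceMap f y))
  wGT := projV K.T (Goly 3 (k - 1)) w
  wGcT := projV K.T (GolyC3 K.xT k) w

/-- Interpolator on `X_{L²,T}^{k+1}`; on a face, the component of the tensor `W` along `eᵢ ⊗ nⱼ`
is `eᵢ · W nⱼ`. -/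
def ITensor (k : ℕ) (W : R3 → Fin 3 → Fin 3 → ℝ) : K.XTensor k where
  WE e := projE (K.len e) (EPV (k + 2)) fun s i => W (K.edgePt e s) i ⬝ᵥ K.tE e
  WF f := projM (K.faceReg f) (K.FRTb f (k + 1)) fun y i j =>
    K.frame f i ⬝ᵥ fun a => W (K.faceMap f y) a ⬝ᵥ K.frame f j.castSucc
  WT := projM K.T (K.RTb (k + 1)) W

/-! ### Discrete gradient -/

theorem derivative_mem_EP {n m : ℤ} (h : n ≤ m + 1) {p : Polynomial ℝ} (hp : p ∈ EP n) :
    Polynomial.derivative p ∈ EP m := by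
  unfold EP at *
  rw [Polynomial.mem_degreeLT] at *
  by_cases h0 : Polynomial.derivative p = 0
  · rw [h0, Polynomial.degree_zero]
    exact WithBot.bot_lt_coe _
  · have hp0 : p ≠ 0 := by
      rintro rfl
      simp at h0
    have h1 := Polynomial.degree_derivative_lt hp0
    rw [Polynomial.degree_eq_natDegree h0] at *
    rw [Polynomial.degree_eq_natDegree hp0] at *
    norm_cast at *
    omega

theorem EPCV_mem {n : ℤ} (v : K.EPCV n) (e : Fin K.nE) (i : Fin 3) : v.1 e i ∈ EP n := by
  have h := (Submodule.mem_iInf _).1 v.2 i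
  exact h.1 e

/-- The derivative along an edge of an edge field of degree `n`; it has degree `n - 1 = m`. -/
def dE {n : ℤ} (m : ℤ) (h : n = m + 1) (v : K.EPCV n) (e : Fin K.nE) : EPV m :=
  ⟨fun i => Polynomial.derivative (v.1 e i), fun i _ =>
    derivative_mem_EP h.le (K.EPCV_mem v e i)⟩

theorem cross_mem_EPV {m : ℤ} {v : Fin 3 → Polynomial ℝ} (hv : v ∈ EPV m) (t : R3) :
    (v ⨯₃ fun i => Polynomial.C (t i)) ∈ EPV m := by
  have key : ∀ (i : Fin 3) (c : ℝ), v i * Polynomial.C c ∈ EP m := fun i c => by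
    rw [mul_comm, Polynomial.C_mul']
    exact (EP m).smul_mem c (hv i trivial)
  intro i _
  rw [cross_apply]
  fin_cases i
  · exact (EP m).sub_mem (key 1 _) (key 2 _)
  · exact (EP m).sub_mem (key 2 _) (key 0 _)
  · exact (EP m).sub_mem (key 0 _) (key 1 _)

/-- `v̇_E × t_E` for an edge field of degree `n = m + 1`. -/
def dEcross {n : ℤ} (m : ℤ) (h : n = m + 1) (v : K.EPCV n) (e : Fin K.nE) : EPV m :=
  ⟨(K.dE m h v e).1 ⨯₃ fun i => Polynomial.C (K.tE e i), cross_mem_EPV (K.dE m h v e).2 _⟩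

variable {K} {k : ℕ}

/-- The gradient `G_F^k` on a face. -/
def GF (q : K.XGrad k) (f : Fin K.nF) : VPoly 2 2 k :=
  solve fun g : VPoly 2 2 k => ∀ w ∈ VPoly 2 2 k,
    K.intF f (fun y => evV g.1 y ⬝ᵥ evV w y) =
      -K.intF f (fun y => MvPolynomial.eval y (q.qF f).1 * MvPolynomial.eval y (divP 2 w)) +
      K.bdF f fun e s =>
        (q.qE.1 e).eval s * (evV w (K.edgeInFace f e s) ⬝ᵥ K.tang f (K.nFE f e))

/-- The operator `G_F^{⊥k}` on a face. -/
def GperpF (q : K.XGrad k) (f : Fin K.nF) : VPoly 2 2 k :=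
  solve fun g : VPoly 2 2 k => ∀ w ∈ VPoly 2 2 k,
    K.intF f (fun y => evV g.1 y ⬝ᵥ evV w y) =
      -K.intF f (fun y => MvPolynomial.eval y (q.gF f).1 * MvPolynomial.eval y (rotP w)) -
      K.bdF f fun e s =>
        (evE (q.gE e).1 s ⬝ᵥ K.nrm f) * (evV w (K.edgeInFace f e s) ⬝ᵥ K.tang f (K.tE e))

/-- The scalar trace `γ_{grad,F}^{k+1}`. -/
def traceGrad (q : K.XGrad k) (f : Fin K.nF) : Poly 2 (k + 1) :=
  solve fun g : Poly 2 (k + 1) => ∀ v ∈ RolyC 2 0 (k + 2),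
    K.intF f (fun y => MvPolynomial.eval y g.1 * MvPolynomial.eval y (divP 2 v)) =
      -K.intF f (fun y => evV (GF q f).1 y ⬝ᵥ evV v y) +
      K.bdF f fun e s =>
        (q.qE.1 e).eval s * (evV v (K.edgeInFace f e s) ⬝ᵥ K.tang f (K.nFE f e))

/-- The gradient `G_T^k` in the cell. -/
def GT (q : K.XGrad k) : VPoly 3 3 k :=
  solve fun g : VPoly 3 3 k => ∀ w ∈ VPoly 3 3 k,
    K.intT (fun x => evV g.1 x ⬝ᵥ evV w x) =
      -K.intT (fun x => MvPolynomial.eval x q.qT.1 * MvPolynomial.eval x (divP 3 w)) +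
      K.bdT fun f y =>
        MvPolynomial.eval y (traceGrad q f).1 * (evV w (K.faceMap f y) ⬝ᵥ K.nrm f)

/-- The edge field `v_E` of the discrete gradient: `π^k_E v_E = q̇_E t_E + g_E`, and `v_E` takes the
prescribed values at the vertices. -/
def gradE (q : K.XGrad k) : K.EPCV (k + 2) :=
  solve fun p : K.EPCV (k + 2) =>
    (∀ e, ∀ r ∈ EPV k,
      K.intE e (fun s => evE (p.1 e) s ⬝ᵥ evE r s) =
        K.intE e fun s =>
          ((Polynomial.derivative (q.qE.1 e)).eval s • K.tE e + evE (q.gE e).1 s) ⬝ᵥ evE r s) ∧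
    ∀ e, evE (p.1 e) 0 = q.gV (K.src e) ∧ evE (p.1 e) (K.len e) = q.gV (K.tgt e)

/-- The full discrete gradient `X_{grad,T}^k → X_{curl,T}^k`. -/
def discGrad (q : K.XGrad k) : K.XCurl k where
  rV _ := 0
  vE := gradE q
  rE e := K.dEcross (k + 1) (by ring) (gradE q) e
  vRF f := projV (K.faceReg f) (Roly2 (k - 1)) (evV (GF q f).1)
  vRcF f := projV (K.faceReg f) (RolyC 2 0 k) (evV (GF q f).1)
  vF f := q.gF f
  rGF f := projV (K.faceReg f) (Goly 2 k) (evV (GperpF q f).1)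
  rGcF f := projV (K.faceReg f) (GolyC2 k) (evV (GperpF q f).1)
  vRT := projV K.T (Roly3 (k - 1)) (evV (GT q).1)
  vRcT := projV K.T (RolyC 3 K.xT k) (evV (GT q).1)

/-! ### Discrete curl -/

/-- The edge curl: `π^{k+1}_E C_E = r_E - v̇_E × t_E`, with the prescribed values at the vertices. -/
def CE (v : K.XCurl k) : K.EPCV (k + 3) :=
  solve fun p : K.EPCV (k + 3) =>
    (∀ e, ∀ r ∈ EPV (k + 1),
      K.intE e (fun s => evE (p.1 e) s ⬝ᵥ evE r s) =
        K.intE e fun s =>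
          (evE (v.rE e).1 s - evE (K.dEcross (k + 1) (by ring) v.vE e).1 s) ⬝ᵥ evE r s) ∧
    ∀ e, evE (p.1 e) 0 = v.rV (K.src e) ∧ evE (p.1 e) (K.len e) = v.rV (K.tgt e)

/-- The scalar curl `C_F^k` on a face. -/
def CF (v : K.XCurl k) (f : Fin K.nF) : Poly 2 k :=
  solve fun c : Poly 2 k => ∀ r ∈ Poly 2 k,
    K.intF f (fun y => MvPolynomial.eval y c.1 * MvPolynomial.eval y r) =
      K.intF f (fun y => evV (v.vRF f).1 y ⬝ᵥ evV (vrotP r) y) -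
      K.bdF f fun e s =>
        (evE (v.vE.1 e) s ⬝ᵥ K.tE e) * MvPolynomial.eval (K.edgeInFace f e s) r

/-- The vector curl on a face. -/
def CvecF (v : K.XCurl k) (f : Fin K.nF) : VPoly 2 2 k :=
  solve fun c : VPoly 2 2 k => ∀ r ∈ VPoly 2 2 k,
    K.intF f (fun y => evV c.1 y ⬝ᵥ evV r y) =
      K.intF f (fun y => MvPolynomial.eval y (v.vF f).1 * MvPolynomial.eval y (rotP r)) +
      K.bdF f fun e s =>
        (evE (v.vE.1 e) s ⬝ᵥ K.nrm f) * (evV r (K.edgeInFace f e s) ⬝ᵥ K.tang f (K.tE e))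

/-- The tangential trace `γ_{t,rot,F}^k`. -/
def traceCurl (v : K.XCurl k) (f : Fin K.nF) : VPoly 2 2 k :=
  solve fun g : VPoly 2 2 k => ∀ r ∈ Poly0 (K.faceReg f) (k + 1), ∀ w ∈ RolyC 2 0 k,
    K.intF f (fun y => evV g.1 y ⬝ᵥ evV (vrotP r + w) y) =
      K.intF f (fun y => MvPolynomial.eval y (CF v f).1 * MvPolynomial.eval y r) +
      K.bdF f (fun e s =>
        (evE (v.vE.1 e) s ⬝ᵥ K.tE e) * MvPolynomial.eval (K.edgeInFace f e s) r) +
      K.intF f fun y => evV (v.vRcF f).1 y ⬝ᵥ evV w y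

/-- The curl `C_T^k` in the cell. -/
def CT (v : K.XCurl k) : VPoly 3 3 k :=
  solve fun c : VPoly 3 3 k => ∀ r ∈ VPoly 3 3 k,
    K.intT (fun x => evV c.1 x ⬝ᵥ evV r x) =
      K.intT (fun x => evV v.vRT.1 x ⬝ᵥ evV (curlP r) x) +
      K.bdT fun f y => evV (traceCurl v f).1 y ⬝ᵥ
        K.tang f (evV r (K.faceMap f y) ⨯₃ K.nrm f)

/-- The full discrete curl `X_{curl,T}^k → X_{∇,T}^k`. -/
def discCurl (v : K.XCurl k) : K.XNabla k where
  wE := CE v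
  wF f := CF v f
  wGF f := projV (K.faceReg f) (Goly 2 k) (evV (CvecF v f).1) + v.rGF f
  wGcF f := projV (K.faceReg f) (GolyC2 k) (evV (CvecF v f).1) + v.rGcF f
  wGT := projV K.T (Goly 3 (k - 1)) (evV (CT v).1)
  wGcT := projV K.T (GolyC3 K.xT k) (evV (CT v).1)

/-! ### Discrete Jacobian and divergence -/

/-- The Jacobian `∇_F^{k+1}` on a face. The test tensor has rows `0, 1` (along `n₁, n₂`) equal
to `A + B + C` and last row (along `n_F`) equal to `n`. -/
def nablaF (w : K.XNabla k) (f : Fin K.nF) : K.FRTb f (k + 1) :=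
  solve fun g : K.FRTb f (k + 1) =>
    ∀ A ∈ RolybC 2 0 (k + 1), ∀ B ∈ Rolyb 2 0 (K.faceReg f) (k + 1),
    ∀ C ∈ rows 2 (Roly2 (k + 1)), ∀ n ∈ VPoly 2 2 (k + 1),
    let V : Fin 3 → Fin 2 → Pol 2 := ![(A + B + C) 0, (A + B + C) 1, n]
    K.intF f (fun y => ddot (evM g.1 y) (evM V y)) =
      -K.intF f (fun y => evV (w.wGcF f).1 y ⬝ᵥ evV (divRows 2 2 A) y) -
      K.intF f (fun y => evV (w.wGF f).1 y ⬝ᵥ evV (divRows 2 2 B) y) -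
      K.intF f (fun y => MvPolynomial.eval y (w.wF f).1 * MvPolynomial.eval y (divP 2 n)) +
      K.bdF f fun e s => K.comps f (evE (w.wE.1 e) s) ⬝ᵥ
        fun i => evM V (K.edgeInFace f e s) i ⬝ᵥ K.tang f (K.nFE f e)

/-- The trace `γ_{∇,F}^{k+2}`, in components along `(n₁, n₂, n_F)`. -/
def traceNabla (w : K.XNabla k) (f : Fin K.nF) : VPoly 2 3 (k + 2) :=
  solve fun g : VPoly 2 3 (k + 2) => ∀ V ∈ rows 3 (RolyC 2 0 (k + 3)),
    K.intF f (fun y => evV g.1 y ⬝ᵥ evV (divRows 2 3 V) y) =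
      -K.intF f (fun y => ddot (evM (nablaF w f).1 y) (evM V y)) +
      K.bdF f fun e s => K.comps f (evE (w.wE.1 e) s) ⬝ᵥ
        fun i => evM V (K.edgeInFace f e s) i ⬝ᵥ K.tang f (K.nFE f e)

/-- The Jacobian `∇_T^{k+1}` in the cell. -/
def nablaT (w : K.XNabla k) : K.RTb (k + 1) :=
  solve fun g : K.RTb (k + 1) =>
    ∀ A ∈ RolybC 3 K.xT (k + 1), ∀ B ∈ Rolyb 3 K.xT K.T k, ∀ C ∈ rows 3 (Roly3 k),
    K.intT (fun x => ddot (evM g.1 x) (evM (A + B + C) x)) =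
      -K.intT (fun x => evV w.wGcT.1 x ⬝ᵥ evV (divRows 3 3 A) x) -
      K.intT (fun x => evV w.wGT.1 x ⬝ᵥ evV (divRows 3 3 B) x) +
      K.bdT fun f y => evV (traceNabla w f).1 y ⬝ᵥ
        K.comps f fun i => evM (A + B + C) (K.faceMap f y) i ⬝ᵥ K.nrm f

/-- The full discrete Jacobian `X_{∇,T}^k → X_{L²,T}^{k+1}`. -/
def discNabla (w : K.XNabla k) : K.XTensor k where
  WE e := K.dE (k + 2) (by ring) w.wE e
  WF f := nablaF w f
  WT := nablaT w

/-- The discrete divergence `D_T^k`, the trace of `∇_T^{k+1}`. -/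
def discDiv (w : K.XNabla k) : Pol 3 := trP 3 (nablaT w).1

end Cell

end DiscreteStokes

end

/-!
The discrete operators are defined by integrating by parts on `T` and on its faces against
polynomial test fields, with the unknown boundary values replaced by polynomial traces. The
commutation properties hold because every term of such a formula, evaluated on an interpolate, only
meets the moments that the interpolator reproduces exactly; the formula then becomes the exact
Green formula.

Three ingredients are needed.

*Green formulas.* A cell is, up to a null set, the disjoint union of the open cones from an interior
point `x₀` over its faces. Integrating along the rays of the cones gives the divergence theorem for
the fields `(x - x₀) g` (`IsPolytope.integral_radial`), and varying `x₀` gives it for the fields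
`g v` with `v` constant (`IsPolytope.integral_fderiv`). The same argument serves for a face and its
edges (`isPolytope_T`, `isPolytope_faceReg`). For a function that is only continuous up to the
boundary, with a weak gradient, the formula follows by cutting off near the walls; the gradients
of the cutoff functions are bounded in `L¹`, again by the radial divergence theorem, so that the
boundary term is the limit of integrals over thin layers (`IsPolytope.integral_weak`). The formulas
used below are collected in `GreenT` and `GreenF`.

*Polynomial decompositions.* The operator `a + (x - c) · ∇` is bijective on the polynomials of a
given degree for `a > 0`. Hence `div` maps `(x - c) P^{m-1}` bijectively onto `P^{m-1}`, and one
obtains `P^m = R^m + R^{c,m}` and the other Koszul decompositions. The divergence of a trace-free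
matrix field with rows in `R^{c,m}` is orthogonal to `x - c`, hence of Koszul type. With the Riesz
representation theorem on finite-dimensional spaces this shows that all the problems defining the
discrete operators are uniquely solvable, so that the objects singled out by `solve` do satisfy
their defining equations (`GF_spec`, `traceGrad_spec`, `CF_spec`, `traceCurl_spec`, `nablaF_spec`,
`traceNabla_spec` and so on).

*Degrees on the boundary.* The edge interpolant reproduces moments of two degrees less than its own
degree, and the traces of the interpolates only reproduce low moments (`intF_traceGrad`,
`intF_traceCurl`, `intF_traceNabla`). This suffices because `(x - x_F) · n_FE` is constant on an
edge and `(x - x_T) · n_F` is constant on a face, so that the normal components of fields in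
`R^{c,m}` have degree at most `m - 1` there.

The cell part of the third claim only needs a weak Jacobian (`nablaT_INabla`). The fourth claim is
its trace, tested with multiples of the identity: the trace of
a field in `RT_b^{k+1}(T)` has degree at most `k`, and `p I` belongs to `RT_b^{k+1}(T)` for every
`p` of degree at most `k` (`trP_RTb_mem`, `scalar_mem_RTb`).
-/

noncomputable section

set_option linter.unusedSectionVars false

namespace DiscreteStokes

open MvPolynomial (eval)

/-! ### Integration over cones -/

section Polytope

variable {E E' : Type*}
  [NormedAddCommGroup E] [NormedSpace ℝ E] [MeasurableSpace E] [BorelSpace E]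
  [FiniteDimensional ℝ E]
  [NormedAddCommGroup E'] [NormedSpace ℝ E'] [MeasurableSpace E'] [BorelSpace E']
  [FiniteDimensional ℝ E']

/-- The open cone with apex `x₀` over `S`, without its apex and its base. -/
def coneOver (x₀ : E) (S : Set E) : Set E :=
  {x | ∃ s ∈ Ioo (0 : ℝ) 1, ∃ p ∈ S, x = x₀ + s • (p - x₀)}

/-- The parametrisation `y ↦ c + Ψ (0, y)` of the hyperplane through `c` whose direction is the
image of `{0} × E'`. -/
def hyperPt (Ψ : (ℝ × E') ≃L[ℝ] E) (c : E) (y : E') : E := c + Ψ (0, y)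

theorem continuous_hyperPt (Ψ : (ℝ × E') ≃L[ℝ] E) (c : E) : Continuous (hyperPt Ψ c) := by
  unfold hyperPt
  fun_prop

/-- Membership in a cone in the coordinates `Ψ`, at height `r` above the apex. -/
theorem cone_mem_iff (Ψ : (ℝ × E') ≃L[ℝ] E) {c x₀ : E} (h : 0 < (Ψ.symm (c - x₀)).1)
    (D : Set E') (r : ℝ) (y : E') :
    x₀ + Ψ (r, y) ∈ coneOver x₀ (hyperPt Ψ c '' D) ↔
      r / (Ψ.symm (c - x₀)).1 ∈ Ioo (0 : ℝ) 1 ∧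
      ((Ψ.symm (c - x₀)).1 / r) • y - (Ψ.symm (c - x₀)).2 ∈ D := by
  set h₀ := (Ψ.symm (c - x₀)).1 with h₀def
  set b := (Ψ.symm (c - x₀)).2 with bdef
  have hc : Ψ (h₀, b) = c - x₀ := Ψ.apply_symm_apply (c - x₀)
  constructor
  · rintro ⟨s, hs, p, ⟨z, hz, rfl⟩, hx⟩
    have h1 : Ψ (r, y) = Ψ (s * h₀, s • (b + z)) := by
      have : ((s * h₀, s • (b + z)) : ℝ × E') = s • ((h₀, b) + (0, z)) := by simp
      rw [this, map_smul, map_add, hc]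
      have h2 : hyperPt Ψ c z - x₀ = c - x₀ + Ψ (0, z) := by
        unfold hyperPt; abel
      rw [← h2]
      exact add_left_cancel hx
    have h2 := Ψ.injective h1
    simp only [Prod.mk.injEq] at h2
    obtain ⟨rfl, rfl⟩ := h2
    have hs0 : s ≠ 0 := hs.1.ne'
    refine ⟨by rwa [mul_div_cancel_right₀ _ h.ne'], ?_⟩
    rw [smul_smul]
    have : h₀ / (s * h₀) * s = 1 := by field_simp
    rwa [this, one_smul, add_sub_cancel_left]
  · rintro ⟨hr, hy⟩
    refine ⟨r / h₀, hr, _, ⟨_, hy, rfl⟩, ?_⟩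
    congr 1
    have h2 : ∀ z, hyperPt Ψ c z - x₀ = Ψ ((h₀, b) + (0, z)) := by
      intro z
      rw [map_add, hc]
      unfold hyperPt; abel
    rw [h2, ← map_smul]
    congr 1
    have hr0 : r ≠ 0 := by
      rintro rfl
      simp at hr
    have : r / h₀ * (h₀ / r) = 1 := by field_simp
    ext
    · simp; field_simp
    · simp [smul_smul, this]

theorem measurableSet_cone (Ψ : (ℝ × E') ≃L[ℝ] E) {c x₀ : E} (h : 0 < (Ψ.symm (c - x₀)).1)
    {D : Set E'} (hD : MeasurableSet D) :
    MeasurableSet (coneOver x₀ (hyperPt Ψ c '' D)) := by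
  have key : coneOver x₀ (hyperPt Ψ c '' D) =
      (fun x => (Ψ.symm (x - x₀)).1 / (Ψ.symm (c - x₀)).1) ⁻¹' Ioo (0 : ℝ) 1 ∩
      (fun x => ((Ψ.symm (c - x₀)).1 / (Ψ.symm (x - x₀)).1) • (Ψ.symm (x - x₀)).2 -
        (Ψ.symm (c - x₀)).2) ⁻¹' D := by
    ext x
    have := cone_mem_iff Ψ h D (Ψ.symm (x - x₀)).1 (Ψ.symm (x - x₀)).2
    simp only [Prod.mk.eta, ContinuousLinearEquiv.apply_symm_apply, add_sub_cancel] at this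
    exact this
  rw [key]
  have m1 : Measurable fun x => (Ψ.symm (x - x₀)).1 := by
    have : Continuous fun x => (Ψ.symm (x - x₀)).1 := by fun_prop
    exact this.measurable
  have m2 : Measurable fun x => (Ψ.symm (x - x₀)).2 := by
    have : Continuous fun x => (Ψ.symm (x - x₀)).2 := by fun_prop
    exact this.measurable
  exact ((m1.div_const _) measurableSet_Ioo).inter
    ((((measurable_const.div m1).smul m2).sub_const _) hD)

variable (μ : Measure E) [μ.IsAddHaarMeasure] (μ' : Measure E') [μ'.IsAddHaarMeasure]

/-- Integration over a cone whose base lies in a hyperplane. The height `(Ψ.symm (c - x₀)).1` is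
the distance from the apex to the hyperplane when `Ψ` is an isometry. -/
theorem integral_cone (Ψ : (ℝ × E') ≃L[ℝ] E)
    (hΨ : MeasurePreserving Ψ ((volume : Measure ℝ).prod μ') μ) {c x₀ : E}
    (h : 0 < (Ψ.symm (c - x₀)).1) {D : Set E'} (hD : MeasurableSet D) {G : E → ℝ}
    (hG : IntegrableOn G (coneOver x₀ (hyperPt Ψ c '' D)) μ) :
    ∫ x in coneOver x₀ (hyperPt Ψ c '' D), G x ∂μ =
      (Ψ.symm (c - x₀)).1 * ∫ s in Ioo (0 : ℝ) 1, s ^ Module.finrank ℝ E' *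
        ∫ y in D, G (x₀ + s • (hyperPt Ψ c y - x₀)) ∂μ' := by
  have hmem := cone_mem_iff Ψ h D
  have hms := measurableSet_cone Ψ h hD
  set C := coneOver x₀ (hyperPt Ψ c '' D) with hC
  obtain ⟨h₀, h₀def⟩ : ∃ h₀, h₀ = (Ψ.symm (c - x₀)).1 := ⟨_, rfl⟩
  obtain ⟨b, bdef⟩ : ∃ b, b = (Ψ.symm (c - x₀)).2 := ⟨_, rfl⟩
  have hc : Ψ (h₀, b) = c - x₀ := by rw [h₀def, bdef]; exact Ψ.apply_symm_apply (c - x₀)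
  rw [← h₀def] at h ⊢ hmem
  rw [← bdef] at hmem
  have hint : Integrable (C.indicator G) μ := hG.integrable_indicator hms
  have hint1 : Integrable (fun x => C.indicator G (x₀ + x)) μ := hint.comp_add_left x₀
  have hemb : MeasurableEmbedding Ψ := Ψ.toHomeomorph.measurableEmbedding
  have hint2 : Integrable (fun z => C.indicator G (x₀ + Ψ z)) ((volume : Measure ℝ).prod μ') :=
    (hΨ.integrable_comp_emb hemb).2 hint1
  have key : ∀ s : ℝ, ∫ y, C.indicator G (x₀ + Ψ (h₀ * s, y)) ∂μ' =
      (Ioo (0 : ℝ) 1).indicator (fun s => s ^ Module.finrank ℝ E' *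
        ∫ y in D, G (x₀ + s • (hyperPt Ψ c y - x₀)) ∂μ') s := by
    intro s
    by_cases hs : s ∈ Ioo (0 : ℝ) 1
    · rw [indicator_of_mem hs]
      have e1 : ∫ y, C.indicator G (x₀ + Ψ (h₀ * s, y)) ∂μ' =
          ∫ y, C.indicator G (x₀ + Ψ (h₀ * s, y + s • b)) ∂μ' :=
        (integral_add_right_eq_self (fun y => C.indicator G (x₀ + Ψ (h₀ * s, y))) (s • b)).symm
      -- the slice of the cone at relative height `s` is a translate of `s • D`
      have e2 := Measure.integral_comp_smul μ'
        (fun y => C.indicator G (x₀ + Ψ (h₀ * s, y + s • b))) s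
      have hpow : 0 < s ^ Module.finrank ℝ E' := pow_pos hs.1 _
      rw [abs_of_pos (inv_pos.2 hpow), smul_eq_mul, ← e1] at e2
      have e3 : ∀ y, C.indicator G (x₀ + Ψ (h₀ * s, s • y + s • b)) =
          D.indicator (fun y => G (x₀ + s • (hyperPt Ψ c y - x₀))) y := by
        intro y
        have hpt : s • (hyperPt Ψ c y - x₀) = Ψ (h₀ * s, s • y + s • b) := by
          have : hyperPt Ψ c y - x₀ = Ψ ((h₀, b) + (0, y)) := by
            rw [map_add, hc]; unfold hyperPt; abel
          rw [this, ← map_smul]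
          congr 1
          ext
          · simp [mul_comm]
          · simp [add_comm]
        have hiff : x₀ + Ψ (h₀ * s, s • y + s • b) ∈ C ↔ y ∈ D := by
          rw [hmem]
          have e4 : h₀ * s / h₀ = s := by field_simp
          have e5 : (h₀ / (h₀ * s)) • (s • y + s • b) - b = y := by
            rw [← smul_add, smul_smul]
            have : h₀ / (h₀ * s) * s = 1 := by
              have := hs.1.ne'
              field_simp
            rw [this, one_smul, add_sub_cancel_right]
          rw [e4, e5]
          exact and_iff_right hs
        by_cases hy : y ∈ D
        · rw [indicator_of_mem hy, indicator_of_mem (hiff.2 hy), hpt]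
        · rw [indicator_of_notMem hy, indicator_of_notMem (mt hiff.1 hy)]
      simp_rw [e3] at e2
      rw [integral_indicator hD] at e2
      rw [e2]
      field_simp
    · rw [indicator_of_notMem hs]
      rw [← integral_zero E' ℝ (μ := μ')]
      congr 1
      ext y
      apply indicator_of_notMem
      rw [hmem]
      have e4 : h₀ * s / h₀ = s := by field_simp
      rw [e4]
      exact fun h' => hs h'.1
  calc ∫ x in C, G x ∂μ = ∫ x, C.indicator G x ∂μ := (integral_indicator hms).symm
    _ = ∫ x, C.indicator G (x₀ + x) ∂μ := (integral_add_left_eq_self _ x₀).symm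
    _ = ∫ z, C.indicator G (x₀ + Ψ z) ∂((volume : Measure ℝ).prod μ') :=
        (hΨ.integral_comp hemb (fun x => C.indicator G (x₀ + x))).symm
    _ = ∫ r, ∫ y, C.indicator G (x₀ + Ψ (r, y)) ∂μ' := integral_prod _ hint2
    _ = h₀ * ∫ s, ∫ y, C.indicator G (x₀ + Ψ (h₀ * s, y)) ∂μ' := by
        rw [Measure.integral_comp_mul_left (fun r => ∫ y, C.indicator G (x₀ + Ψ (r, y)) ∂μ') h₀,
          abs_of_pos (inv_pos.2 h), smul_eq_mul]
        field_simp
    _ = _ := by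
        simp_rw [key]
        rw [integral_indicator measurableSet_Ioo]

/-- A cone over a null set is null. -/
theorem measure_cone_null (Ψ : (ℝ × E') ≃L[ℝ] E)
    (hΨ : MeasurePreserving Ψ ((volume : Measure ℝ).prod μ') μ) {c x₀ : E}
    (h : 0 < (Ψ.symm (c - x₀)).1) {D : Set E'} (hD : MeasurableSet D)
    (hfin : μ (coneOver x₀ (hyperPt Ψ c '' D)) ≠ ⊤) (h0 : μ' D = 0) :
    μ (coneOver x₀ (hyperPt Ψ c '' D)) = 0 := by
  have hG : IntegrableOn (fun _ : E => (1 : ℝ)) (coneOver x₀ (hyperPt Ψ c '' D)) μ :=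
    integrableOn_const hfin
  have := integral_cone μ μ' Ψ hΨ h hD hG
  rw [Measure.restrict_eq_zero.2 h0] at this
  simp only [integral_zero_measure, mul_zero, integral_zero] at this
  rw [setIntegral_const, smul_eq_mul, mul_one] at this
  exact (measureReal_eq_zero_iff hfin).1 this

end Polytope

/-! ### The divergence theorem on polytopes -/

section Polytope

variable {E E' ι : Type*}
  [NormedAddCommGroup E] [NormedSpace ℝ E] [MeasurableSpace E] [BorelSpace E]
  [FiniteDimensional ℝ E]
  [NormedAddCommGroup E'] [NormedSpace ℝ E'] [MeasurableSpace E'] [BorelSpace E']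
  [FiniteDimensional ℝ E']

/-- `T` is an open bounded convex set whose boundary is covered by the closures of finitely many
pairwise disjoint facets `c i + Ψ i (0, D i)`. The vector `Ψ i (1, 0)` is the outward normal of the
facet `i`; the relative boundaries of the facets are negligible. -/
structure IsPolytope (μ' : Measure E') (s : Finset ι) (T : Set E) (Ψ : ι → (ℝ × E') ≃L[ℝ] E)
    (c : ι → E) (D : ι → Set E') : Prop where
  isOpen : IsOpen T
  convex : Convex ℝ T
  bounded : Bornology.IsBounded T
  nonempty : T.Nonempty
  meas : ∀ i ∈ s, MeasurableSet (D i)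
  null : ∀ i ∈ s, μ' (closure (D i) \ D i) = 0
  neg : ∀ i ∈ s, ∀ x ∈ T, ((Ψ i).symm (x - c i)).1 < 0
  facet : ∀ i ∈ s, ∀ y ∈ D i, hyperPt (Ψ i) (c i) y ∈ frontier T
  disj : ∀ i ∈ s, ∀ j ∈ s, i ≠ j → ∀ y ∈ D i, ∀ z ∈ D j,
    hyperPt (Ψ i) (c i) y ≠ hyperPt (Ψ j) (c j) z
  cover : ∀ x ∈ frontier T, ∃ i ∈ s, ∃ y ∈ closure (D i), x = hyperPt (Ψ i) (c i) y

/-- A ray from `x₀` through a point of a bounded open set leaves the set. -/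
theorem exists_frontier_of_ray {T : Set E} (ho : IsOpen T) (hb : Bornology.IsBounded T)
    {x₀ x : E} (hx : x ∈ T) (hne : x ≠ x₀) :
    ∃ t : ℝ, 1 < t ∧ x₀ + t • (x - x₀) ∈ frontier T := by
  obtain ⟨R, hR⟩ := hb.subset_closedBall x₀
  have hn : 0 < ‖x - x₀‖ := norm_pos_iff.2 (sub_ne_zero.2 hne)
  obtain ⟨t₁, ht₁, ht₂⟩ : ∃ t : ℝ, 1 < t ∧ R < t * ‖x - x₀‖ := by
    refine ⟨max 2 (|R| / ‖x - x₀‖ + 1), lt_max_of_lt_left (by norm_num), ?_⟩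
    have h1 : |R| / ‖x - x₀‖ + 1 ≤ max 2 (|R| / ‖x - x₀‖ + 1) := le_max_right _ _
    have h2 := mul_le_mul_of_nonneg_right h1 hn.le
    have h3 : (|R| / ‖x - x₀‖ + 1) * ‖x - x₀‖ = |R| + ‖x - x₀‖ := by field_simp
    have := le_abs_self R
    linarith
  by_contra! hcon
  have hcont : Continuous fun t : ℝ => x₀ + t • (x - x₀) := by fun_prop
  set S := (fun t : ℝ => x₀ + t • (x - x₀)) '' Icc 1 t₁ with hS
  have hpre : IsPreconnected S := isPreconnected_Icc.image _ hcont.continuousOn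
  have h1 : S ⊆ T ∪ (closure T)ᶜ := by
    rintro _ ⟨t, ht, rfl⟩
    rcases eq_or_lt_of_le ht.1 with rfl | h
    · left; simpa using hx
    · have := hcon t h
      rw [frontier, ho.interior_eq, mem_sdiff, not_and_or, not_not] at this
      exact this.elim (fun h => Or.inr h) (fun h => Or.inl h)
  have h2 := hpre.subset_left_of_subset_union ho isClosed_closure.isOpen_compl
    (disjoint_compl_right_iff_subset.2 subset_closure) h1
    ⟨x, ⟨1, ⟨le_rfl, ht₁.le⟩, by simp⟩, hx⟩
  have h3 := hR (h2 ⟨t₁, ⟨ht₁.le, le_rfl⟩, rfl⟩)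
  rw [mem_closedBall_iff_norm, add_sub_cancel_left, norm_smul, Real.norm_eq_abs,
    abs_of_pos (by linarith)] at h3
  linarith

theorem ray_mem {T : Set E} (hc : Convex ℝ T) (ho : IsOpen T) {x₀ p : E} (hx : x₀ ∈ T)
    (hp : p ∈ closure T) {s : ℝ} (h0 : 0 ≤ s) (h1 : s < 1) : x₀ + s • (p - x₀) ∈ T := by
  rcases eq_or_lt_of_le h0 with rfl | h0
  · simpa using hx
  have := hc.openSegment_closure_interior_subset_interior hp (ho.interior_eq.symm ▸ hx)
  rw [ho.interior_eq] at this
  refine this ⟨s, 1 - s, h0, by linarith, by ring, ?_⟩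
  module

namespace IsPolytope

variable {μ : Measure E} [μ.IsAddHaarMeasure] {μ' : Measure E'} [μ'.IsAddHaarMeasure]
  {s : Finset ι} {T : Set E} {Ψ : ι → (ℝ × E') ≃L[ℝ] E} {c : ι → E} {D : ι → Set E'}

theorem height_pos (P : IsPolytope μ' s T Ψ c D) {i : ι} (hi : i ∈ s) {x₀ : E} (hx : x₀ ∈ T) :
    0 < ((Ψ i).symm (c i - x₀)).1 := by
  have := P.neg i hi x₀ hx
  rw [← neg_sub, map_neg, Prod.fst_neg] at this
  linarith

theorem closure_facet (P : IsPolytope μ' s T Ψ c D) {i : ι} (hi : i ∈ s) {y : E'}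
    (hy : y ∈ closure (D i)) : hyperPt (Ψ i) (c i) y ∈ frontier T := by
  have h1 := image_closure_subset_closure_image (continuous_hyperPt (Ψ i) (c i))
    (mem_image_of_mem _ hy)
  refine closure_minimal ?_ isClosed_frontier h1
  rintro _ ⟨z, hz, rfl⟩
  exact P.facet i hi z hz

theorem isCompact_closure (P : IsPolytope μ' s T Ψ c D) : IsCompact (closure T) :=
  P.bounded.isCompact_closure

theorem isCompact_closure_facet (P : IsPolytope μ' s T Ψ c D) {i : ι} (hi : i ∈ s) :
    IsCompact (closure (D i)) := by
  have h1 : IsCompact ((fun x => ((Ψ i).symm (x - c i)).2) '' closure T) :=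
    P.isCompact_closure.image (by fun_prop)
  refine h1.of_isClosed_subset isClosed_closure fun y hy => ?_
  refine ⟨_, frontier_subset_closure (P.closure_facet hi hy), ?_⟩
  simp [hyperPt]

theorem cone_subset (P : IsPolytope μ' s T Ψ c D) {i : ι} (hi : i ∈ s) {x₀ : E} (hx : x₀ ∈ T)
    {S : Set E'} (hS : S ⊆ closure (D i)) : coneOver x₀ (hyperPt (Ψ i) (c i) '' S) ⊆ T := by
  rintro _ ⟨t, ht, _, ⟨y, hy, rfl⟩, rfl⟩
  exact ray_mem P.convex P.isOpen hx
    (frontier_subset_closure (P.closure_facet hi (hS hy))) ht.1.le ht.2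

theorem cone_disjoint (P : IsPolytope μ' s T Ψ c D) {x₀ : E} (hx : x₀ ∈ T) {i j : ι}
    (hi : i ∈ s) (hj : j ∈ s) (hij : i ≠ j) :
    Disjoint (coneOver x₀ (hyperPt (Ψ i) (c i) '' D i))
      (coneOver x₀ (hyperPt (Ψ j) (c j) '' D j)) := by
  have aux : ∀ p q : E, p ∈ frontier T → q ∈ frontier T → ∀ a b : ℝ, 0 < a → 0 < b →
      a • (p - x₀) = b • (q - x₀) → b ≤ a := by
    intro p q hp hq a b ha hb h
    by_contra! hlt
    have h1 : q = x₀ + (a / b) • (p - x₀) := by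
      have : q - x₀ = (a / b) • (p - x₀) := by
        rw [div_eq_inv_mul, mul_smul, h, smul_smul, inv_mul_cancel₀ hb.ne', one_smul]
      rw [← this, add_sub_cancel]
    have h2 := ray_mem P.convex P.isOpen hx (frontier_subset_closure hp)
      (s := a / b) (by positivity) ((div_lt_one hb).2 hlt)
    rw [← h1] at h2
    exact (P.isOpen.inter_frontier_eq.subset ⟨h2, hq⟩ : q ∈ (∅ : Set E))
  rw [Set.disjoint_left]
  rintro x ⟨a, ha, _, ⟨y, hy, rfl⟩, hxa⟩ ⟨b, hb, _, ⟨z, hz, rfl⟩, hxb⟩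
  have heq : a • (hyperPt (Ψ i) (c i) y - x₀) = b • (hyperPt (Ψ j) (c j) z - x₀) :=
    add_left_cancel (hxa.symm.trans hxb)
  have h1 := aux _ _ (P.facet i hi y hy) (P.facet j hj z hz) a b ha.1 hb.1 heq
  have h2 := aux _ _ (P.facet j hj z hz) (P.facet i hi y hy) b a hb.1 ha.1 heq.symm
  obtain rfl := le_antisymm h1 h2
  have h3 := smul_right_injective E ha.1.ne' heq
  exact P.disj i hi j hj hij y hy z hz (sub_left_injective h3)

/-- The cones over the facets exhaust the polytope: the remaining points are `x₀` itself and the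
cones over the relative boundaries of the facets. -/
theorem ae_eq_iUnion_cone (P : IsPolytope μ' s T Ψ c D) [Nontrivial E]
    (hΨ : ∀ i ∈ s, MeasurePreserving (Ψ i) ((volume : Measure ℝ).prod μ') μ)
    {x₀ : E} (hx : x₀ ∈ T) :
    (⋃ i ∈ s, coneOver x₀ (hyperPt (Ψ i) (c i) '' D i) : Set E) =ᵐ[μ] T := by
  have hsub : (⋃ i ∈ s, coneOver x₀ (hyperPt (Ψ i) (c i) '' D i) : Set E) ⊆ T :=
    iUnion₂_subset fun i hi => P.cone_subset hi hx subset_closure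
  refine Filter.EventuallyLE.antisymm hsub.eventuallyLE ?_
  rw [ae_le_set]
  have hnull : μ (({x₀} : Set E) ∪ ⋃ i ∈ s,
      coneOver x₀ (hyperPt (Ψ i) (c i) '' (closure (D i) \ D i))) = 0 := by
    rw [measure_union_null_iff]
    refine ⟨measure_singleton _, (measure_biUnion_null_iff s.countable_toSet).2 fun i hi => ?_⟩
    refine measure_cone_null μ μ' (Ψ i) (hΨ i hi) (P.height_pos hi hx)
      (isClosed_closure.measurableSet.diff (P.meas i hi)) ?_ (P.null i hi)
    exact ((measure_mono (P.cone_subset hi hx sdiff_subset)).trans_lt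
      P.bounded.measure_lt_top).ne
  refine measure_mono_null ?_ hnull
  rintro x ⟨hxT, hxn⟩
  by_cases hxx : x = x₀
  · left; exact hxx
  right
  obtain ⟨t, ht, hfr⟩ := exists_frontier_of_ray P.isOpen P.bounded hxT hxx
  obtain ⟨i, hi, y, hy, hxy⟩ := P.cover _ hfr
  have hxe : x = x₀ + t⁻¹ • (hyperPt (Ψ i) (c i) y - x₀) := by
    rw [← hxy, add_sub_cancel_left, smul_smul, inv_mul_cancel₀ (by linarith), one_smul,
      add_sub_cancel]
  have ht' : t⁻¹ ∈ Ioo (0 : ℝ) 1 := ⟨by positivity, inv_lt_one_of_one_lt₀ ht⟩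
  simp only [mem_iUnion, not_exists] at hxn ⊢
  refine ⟨i, hi, t⁻¹, ht', _, ⟨y, ⟨hy, fun hyD => ?_⟩, rfl⟩, hxe⟩
  exact hxn i hi ⟨t⁻¹, ht', _, ⟨y, hyD, rfl⟩, hxe⟩

/-- The divergence theorem for the radial field `(x - x₀) g`, obtained by integrating along the
rays from `x₀`. -/
theorem integral_radial (P : IsPolytope μ' s T Ψ c D) [Nontrivial E]
    (hΨ : ∀ i ∈ s, MeasurePreserving (Ψ i) ((volume : Measure ℝ).prod μ') μ)
    {x₀ : E} (hx : x₀ ∈ T) {g : E → ℝ} {g' : E → E →L[ℝ] ℝ}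
    (hg : ContinuousOn g (closure T)) (hg' : ContinuousOn g' (closure T))
    (hd : ∀ x ∈ T, HasFDerivAt g (g' x) x) :
    ∫ x in T, ((Module.finrank ℝ E' + 1 : ℕ) * g x + g' x (x - x₀)) ∂μ =
      ∑ i ∈ s, ((Ψ i).symm (c i - x₀)).1 * ∫ y in D i, g (hyperPt (Ψ i) (c i) y) ∂μ' := by
  set n := Module.finrank ℝ E' with hn
  set G : E → ℝ := fun x => (n + 1 : ℕ) * g x + g' x (x - x₀) with hGdef
  have hGc : ContinuousOn G (closure T) :=
    (continuousOn_const.mul hg).add (hg'.clm_apply (by fun_prop))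
  have hGi : IntegrableOn G T μ :=
    (hGc.integrableOn_compact P.isCompact_closure).mono_set subset_closure
  rw [← setIntegral_congr_set (P.ae_eq_iUnion_cone hΨ hx),
    integral_biUnion_finset s
      (fun i hi => measurableSet_cone (Ψ i) (P.height_pos hi hx) (P.meas i hi))
      (fun i hi j hj hij => P.cone_disjoint hx hi hj hij)
      (fun i hi => hGi.mono_set (P.cone_subset hi hx subset_closure))]
  refine Finset.sum_congr rfl fun i hi => ?_
  rw [integral_cone μ μ' (Ψ i) (hΨ i hi) (P.height_pos hi hx) (P.meas i hi)
    (hGi.mono_set (P.cone_subset hi hx subset_closure))]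
  congr 1
  have hcl : ∀ y ∈ closure (D i), hyperPt (Ψ i) (c i) y ∈ closure T := fun y hy =>
    frontier_subset_closure (P.closure_facet hi hy)
  have hmaps : ∀ t ∈ Icc (0 : ℝ) 1, ∀ p ∈ closure T, x₀ + t • (p - x₀) ∈ closure T := by
    intro t ht p hp
    have := P.convex.closure (subset_closure hx) hp (a := 1 - t) (b := t)
      (by linarith [ht.2]) ht.1 (by ring)
    convert this using 1
    module
  have hcont : ContinuousOn (fun z : ℝ × E' =>
      z.1 ^ n * G (x₀ + z.1 • (hyperPt (Ψ i) (c i) z.2 - x₀))) (Icc 0 1 ×ˢ closure (D i)) := by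
    refine (by fun_prop : Continuous fun z : ℝ × E' => z.1 ^ n).continuousOn.mul
      (hGc.comp ?_ fun z hz => hmaps _ hz.1 _ (hcl _ hz.2))
    have := continuous_hyperPt (Ψ i) (c i)
    fun_prop
  have hint : IntegrableOn (fun z : ℝ × E' =>
      z.1 ^ n * G (x₀ + z.1 • (hyperPt (Ψ i) (c i) z.2 - x₀))) (Ioo 0 1 ×ˢ D i)
      ((volume : Measure ℝ).prod μ') :=
    (hcont.integrableOn_compact (isCompact_Icc.prod (P.isCompact_closure_facet hi))).mono_set
      (prod_mono Ioo_subset_Icc_self subset_closure)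
  rw [IntegrableOn, ← Measure.prod_restrict] at hint
  simp_rw [← integral_const_mul]
  rw [integral_integral_swap hint]
  refine setIntegral_congr_fun (P.meas i hi) fun y hy => ?_
  have hp := hcl y (subset_closure hy)
  set p := hyperPt (Ψ i) (c i) y
  -- the integrand is the derivative of `t ^ (n + 1) * g (x₀ + t (p - x₀))`
  have hline : Continuous fun t : ℝ => x₀ + t • (p - x₀) := by fun_prop
  have hFTC := intervalIntegral.integral_eq_sub_of_hasDerivAt_of_le (a := 0) (b := 1)
    (f := fun t : ℝ => t ^ (n + 1) * g (x₀ + t • (p - x₀)))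
    (f' := fun t => t ^ n * G (x₀ + t • (p - x₀))) zero_le_one
    ((by fun_prop : Continuous fun t : ℝ => t ^ (n + 1)).continuousOn.mul
      (hg.comp hline.continuousOn fun t ht => hmaps t ht p hp)) ?_ ?_
  · rw [intervalIntegral.integral_of_le zero_le_one, integral_Ioc_eq_integral_Ioo] at hFTC
    simpa using hFTC
  · intro t ht
    have hT := ray_mem P.convex P.isOpen hx hp ht.1.le ht.2
    have h1 : HasDerivAt (fun t : ℝ => x₀ + t • (p - x₀)) (p - x₀) t := by
      simpa using ((hasDerivAt_id t).smul_const (p - x₀)).const_add x₀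
    have h2 := (hd _ hT).comp_hasDerivAt t h1
    have h3 := (hasDerivAt_pow (n + 1) t).mul h2
    refine HasDerivAt.congr_deriv (f' := _) h3 ?_
    symm
    change t ^ n * (((n + 1 : ℕ) : ℝ) * g (x₀ + t • (p - x₀)) +
      g' (x₀ + t • (p - x₀)) (x₀ + t • (p - x₀) - x₀)) = _
    rw [add_sub_cancel_left, map_smul, smul_eq_mul, Nat.add_sub_cancel]
    simp only [Function.comp]
    ring
  · rw [intervalIntegrable_iff_integrableOn_Icc_of_le zero_le_one]
    refine ContinuousOn.integrableOn_compact isCompact_Icc ?_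
    exact (by fun_prop : Continuous fun t : ℝ => t ^ n).continuousOn.mul
      (hGc.comp hline.continuousOn fun t ht => hmaps t ht p hp)

/-- The divergence theorem on a polytope: two radial fields with different centres differ by a
constant vector times `g`. -/
theorem integral_fderiv (P : IsPolytope μ' s T Ψ c D) [Nontrivial E]
    (hΨ : ∀ i ∈ s, MeasurePreserving (Ψ i) ((volume : Measure ℝ).prod μ') μ)
    {g : E → ℝ} {g' : E → E →L[ℝ] ℝ}
    (hg : ContinuousOn g (closure T)) (hg' : ContinuousOn g' (closure T))
    (hd : ∀ x ∈ T, HasFDerivAt g (g' x) x) (v : E) :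
    ∫ x in T, g' x v ∂μ =
      ∑ i ∈ s, ((Ψ i).symm v).1 * ∫ y in D i, g (hyperPt (Ψ i) (c i) y) ∂μ' := by
  obtain ⟨x₀, hx₀⟩ := P.nonempty
  -- compare the radial fields with centres `x₀` and `x₀ + ε v`
  obtain ⟨ε, hε, hx₁⟩ : ∃ ε : ℝ, 0 < ε ∧ x₀ + ε • v ∈ T := by
    have hcont : ContinuousAt (fun t : ℝ => x₀ + t • v) 0 := by fun_prop
    have h1 : ∀ᶠ t in nhds (0 : ℝ), x₀ + t • v ∈ T :=
      hcont.eventually_mem (P.isOpen.mem_nhds (by simpa using hx₀))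
    obtain ⟨δ, hδ, hb⟩ := Metric.eventually_nhds_iff.1 h1
    exact ⟨δ / 2, by positivity, hb (by
      rw [Real.dist_eq, sub_zero, abs_of_pos (by positivity)]; linarith)⟩
  have hint : ∀ x₁, IntegrableOn (fun x => (Module.finrank ℝ E' + 1 : ℕ) * g x + g' x (x - x₁))
      T μ := fun x₁ => (((continuousOn_const.mul hg).add
        (hg'.clm_apply (by fun_prop))).integrableOn_compact P.isCompact_closure).mono_set
        subset_closure
  have h0 := P.integral_radial hΨ hx₀ hg hg' hd
  have h1 := P.integral_radial hΨ hx₁ hg hg' hd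
  have h2 := integral_sub (hint x₀) (hint (x₀ + ε • v))
  rw [h0, h1, ← Finset.sum_sub_distrib] at h2
  have e1 : ∀ x, (((Module.finrank ℝ E' + 1 : ℕ) : ℝ) * g x + g' x (x - x₀)) -
      ((Module.finrank ℝ E' + 1 : ℕ) * g x + g' x (x - (x₀ + ε • v))) = ε * g' x v := by
    intro x
    simp only [map_sub, map_add, map_smul, smul_eq_mul]
    ring
  simp_rw [e1] at h2
  rw [integral_const_mul] at h2
  refine mul_left_cancel₀ hε.ne' (h2.trans ?_)
  rw [Finset.mul_sum]
  refine Finset.sum_congr rfl fun i _ => ?_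
  simp only [map_sub, map_add, map_smul, Prod.fst_sub, Prod.fst_add, Prod.smul_fst, smul_eq_mul]
  ring

end IsPolytope
end Polytope

/-! ### Cutoff functions of a polytope -/

section Cutoff

variable {E E' ι : Type*} [DecidableEq ι]
  [NormedAddCommGroup E] [NormedSpace ℝ E] [MeasurableSpace E] [BorelSpace E]
  [FiniteDimensional ℝ E]
  [NormedAddCommGroup E'] [NormedSpace ℝ E'] [MeasurableSpace E'] [BorelSpace E']
  [FiniteDimensional ℝ E']

/-- The signed distance to the hyperplane of the facet `i`, positive inside the polytope. -/
def wallDist (Ψ : ι → (ℝ × E') ≃L[ℝ] E) (c : ι → E) (i : ι) (x : E) : ℝ :=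
  -((Ψ i).symm (x - c i)).1

/-- A smooth cutoff function: it vanishes at distance at most `δ` from the walls and equals `1`
at distance at least `2 δ` from all of them. -/
def cutoff (s : Finset ι) (Ψ : ι → (ℝ × E') ≃L[ℝ] E) (c : ι → E) (δ : ℝ) (x : E) : ℝ :=
  ∏ i ∈ s, Real.smoothTransition (wallDist Ψ c i x / δ - 1)

/-- The derivative of the cutoff function with respect to the distance to the wall `i`. -/
def layer (s : Finset ι) (Ψ : ι → (ℝ × E') ≃L[ℝ] E) (c : ι → E) (δ : ℝ) (i : ι) (x : E) : ℝ :=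
  (∏ j ∈ s.erase i, Real.smoothTransition (wallDist Ψ c j x / δ - 1)) *
    (deriv Real.smoothTransition (wallDist Ψ c i x / δ - 1) / δ)

variable {s : Finset ι} {Ψ : ι → (ℝ × E') ≃L[ℝ] E} {c : ι → E}

theorem contDiff_wallDist {n : ℕ∞} (i : ι) : ContDiff ℝ n (wallDist Ψ c i) := by
  unfold wallDist
  fun_prop

theorem contDiff_cutoff {n : ℕ∞} (δ : ℝ) : ContDiff ℝ n (cutoff s Ψ c δ) := by
  unfold cutoff
  refine contDiff_prod fun i _ => Real.smoothTransition.contDiff.comp ?_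
  exact ((contDiff_wallDist i).div_const δ).sub contDiff_const

theorem continuous_layer (δ : ℝ) (i : ι) : Continuous (layer s Ψ c δ i) := by
  have h1 : ∀ j, Continuous fun x => wallDist Ψ c j x / δ - 1 := fun j =>
    (((contDiff_wallDist (n := 0) j).continuous).div_const δ).sub continuous_const
  have h2 : Continuous (deriv Real.smoothTransition) :=
    (Real.smoothTransition.contDiff (n := 1)).continuous_deriv le_rfl
  unfold layer
  exact (continuous_finsetProd _ fun j _ => Real.smoothTransition.continuous.comp (h1 j)).mul
    ((h2.comp (h1 i)).div_const δ)

theorem cutoff_nonneg (δ : ℝ) (x : E) : 0 ≤ cutoff s Ψ c δ x :=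
  Finset.prod_nonneg fun _ _ => Real.smoothTransition.nonneg _

theorem cutoff_le_one (δ : ℝ) (x : E) : cutoff s Ψ c δ x ≤ 1 :=
  Finset.prod_le_one (fun _ _ => Real.smoothTransition.nonneg _)
    fun _ _ => Real.smoothTransition.le_one _

theorem layer_nonneg {δ : ℝ} (hδ : 0 < δ) (i : ι) (x : E) : 0 ≤ layer s Ψ c δ i x :=
  mul_nonneg (Finset.prod_nonneg fun _ _ => Real.smoothTransition.nonneg _)
    (div_nonneg Real.smoothTransition.monotone.deriv_nonneg hδ.le)

theorem layer_eq_zero {δ : ℝ} (hδ : 0 < δ) {i : ι} {x : E} (h : 2 * δ < wallDist Ψ c i x) :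
    layer s Ψ c δ i x = 0 := by
  have h1 : 1 < wallDist Ψ c i x / δ - 1 := by
    rw [lt_sub_iff_add_lt, lt_div_iff₀ hδ]
    linarith
  have h2 : Real.smoothTransition =ᶠ[nhds (wallDist Ψ c i x / δ - 1)] fun _ => 1 := by
    filter_upwards [lt_mem_nhds h1] with t ht
    exact Real.smoothTransition.one_of_one_le ht.le
  rw [layer, h2.deriv_eq]
  simp

theorem fderiv_cutoff (δ : ℝ) (x v : E) :
    fderiv ℝ (cutoff s Ψ c δ) x v = -∑ i ∈ s, layer s Ψ c δ i x * ((Ψ i).symm v).1 := by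
  have h1 : ∀ i, HasFDerivAt (wallDist Ψ c i)
      (-((ContinuousLinearMap.fst ℝ ℝ E').comp ((Ψ i).symm : E →L[ℝ] ℝ × E'))) x := by
    intro i
    have := (((ContinuousLinearMap.fst ℝ ℝ E').comp
      ((Ψ i).symm : E →L[ℝ] ℝ × E')).hasFDerivAt.comp x
      ((hasFDerivAt_id x).sub_const (c i))).neg
    exact this
  have h2 : ∀ i ∈ s, HasFDerivAt
      (fun x => Real.smoothTransition (wallDist Ψ c i x / δ - 1))
      (deriv Real.smoothTransition (wallDist Ψ c i x / δ - 1) • (δ⁻¹ •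
        (-((ContinuousLinearMap.fst ℝ ℝ E').comp ((Ψ i).symm : E →L[ℝ] ℝ × E'))))) x := by
    intro i _
    have hd : HasDerivAt Real.smoothTransition
        (deriv Real.smoothTransition (wallDist Ψ c i x / δ - 1)) (wallDist Ψ c i x / δ - 1) :=
      ((Real.smoothTransition.contDiff (n := 1)).differentiable (by simp) _).hasDerivAt
    have h3 : HasFDerivAt (fun x => wallDist Ψ c i x / δ - 1) (δ⁻¹ •
        (-((ContinuousLinearMap.fst ℝ ℝ E').comp ((Ψ i).symm : E →L[ℝ] ℝ × E')))) x := by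
      simp_rw [div_eq_inv_mul]
      exact ((h1 i).const_mul δ⁻¹).sub_const 1
    exact hd.comp_hasFDerivAt x h3
  have h4 := HasFDerivAt.finsetProd h2
  have h5 : HasFDerivAt (cutoff s Ψ c δ) _ x := h4
  rw [h5.fderiv]
  simp only [FunLike.coe_sum, Finset.sum_apply, FunLike.coe_smul,
    Pi.smul_apply, smul_eq_mul, FunLike.coe_neg, Pi.neg_apply, ContinuousLinearMap.comp_apply]
  rw [← Finset.sum_neg_distrib]
  refine Finset.sum_congr rfl fun i _ => ?_
  simp only [layer, ContinuousLinearMap.coe_fst', ContinuousLinearEquiv.coe_coe]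
  ring

namespace IsPolytope

variable {μ : Measure E} [μ.IsAddHaarMeasure] {μ' : Measure E'} [μ'.IsAddHaarMeasure]
  {T : Set E} {D : ι → Set E'}

theorem wallDist_pos (P : IsPolytope μ' s T Ψ c D) {i : ι} (hi : i ∈ s) {x : E} (hx : x ∈ T) :
    0 < wallDist Ψ c i x := neg_pos.2 (P.neg i hi x hx)

/-- A polytope is the intersection of the open half-spaces of its walls. -/
theorem mem_of_wallDist_pos (P : IsPolytope μ' s T Ψ c D) {x : E}
    (h : ∀ i ∈ s, 0 < wallDist Ψ c i x) : x ∈ T := by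
  by_contra hx
  obtain ⟨x₀, hx₀⟩ := P.nonempty
  have hcont : Continuous fun t : ℝ => x₀ + t • (x - x₀) := by fun_prop
  have hpre : IsPreconnected ((fun t : ℝ => x₀ + t • (x - x₀)) '' Icc 0 1) :=
    isPreconnected_Icc.image _ hcont.continuousOn
  have hex : ∃ t ∈ Icc (0 : ℝ) 1, x₀ + t • (x - x₀) ∈ frontier T := by
    by_contra! hcon
    have h1 : (fun t : ℝ => x₀ + t • (x - x₀)) '' Icc 0 1 ⊆ T ∪ (closure T)ᶜ := by
      rintro _ ⟨t, ht, rfl⟩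
      have := hcon t ht
      rw [frontier, P.isOpen.interior_eq, mem_sdiff, not_and_or, not_not] at this
      exact this.elim (fun h => Or.inr h) (fun h => Or.inl h)
    have h2 := hpre.subset_left_of_subset_union P.isOpen isClosed_closure.isOpen_compl
      (disjoint_compl_right_iff_subset.2 subset_closure) h1
      ⟨x₀, ⟨0, by simp, by simp⟩, hx₀⟩
    exact hx (h2 ⟨1, by simp, by simp⟩)
  obtain ⟨t, ht, hfr⟩ := hex
  obtain ⟨i, hi, y, -, hy⟩ := P.cover _ hfr
  have h0 : wallDist Ψ c i (x₀ + t • (x - x₀)) = 0 := by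
    rw [hy]
    simp [wallDist, hyperPt]
  have h1 : wallDist Ψ c i (x₀ + t • (x - x₀)) =
      (1 - t) * wallDist Ψ c i x₀ + t * wallDist Ψ c i x := by
    simp only [wallDist, map_sub, map_add, map_smul, Prod.fst_sub, Prod.fst_add, Prod.smul_fst,
      smul_eq_mul]
    ring
  have h2 := P.wallDist_pos hi hx₀
  have h3 := h i hi
  rcases eq_or_lt_of_le ht.2 with rfl | h4
  · linarith
  · nlinarith [mul_pos (sub_pos.2 h4) h2, mul_nonneg ht.1 h3.le]

theorem cutoff_support (P : IsPolytope μ' s T Ψ c D) {δ : ℝ} (hδ : 0 < δ) :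
    HasCompactSupport (cutoff s Ψ c δ) ∧ tsupport (cutoff s Ψ c δ) ⊆ T := by
  have hcl : IsClosed {x | ∀ i ∈ s, δ ≤ wallDist Ψ c i x} := by
    have : {x | ∀ i ∈ s, δ ≤ wallDist Ψ c i x} =
        ⋂ i ∈ s, {x | δ ≤ wallDist Ψ c i x} := by ext; simp
    rw [this]
    exact isClosed_biInter fun i _ =>
      isClosed_le continuous_const (contDiff_wallDist (n := 0) i).continuous
  have hT : {x | ∀ i ∈ s, δ ≤ wallDist Ψ c i x} ⊆ T := fun x hx =>
    P.mem_of_wallDist_pos fun i hi => hδ.trans_le (hx i hi)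
  have hsupp : Function.support (cutoff s Ψ c δ) ⊆ {x | ∀ i ∈ s, δ ≤ wallDist Ψ c i x} := by
    intro x hx i hi
    by_contra! hlt
    refine hx (Finset.prod_eq_zero hi (Real.smoothTransition.zero_of_nonpos ?_))
    rw [sub_nonpos, div_le_one hδ]
    exact hlt.le
  refine ⟨HasCompactSupport.of_support_subset_isCompact
    (P.isCompact_closure.of_isClosed_subset hcl (hT.trans subset_closure)) hsupp, ?_⟩
  exact (closure_minimal hsupp hcl).trans hT

theorem cutoff_eq_zero (P : IsPolytope μ' s T Ψ c D) {δ : ℝ} (hδ : 0 < δ) {x : E}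
    (hx : x ∈ frontier T) : cutoff s Ψ c δ x = 0 := by
  by_contra h
  have h1 : x ∈ T := (P.cutoff_support hδ).2 (subset_tsupport _ h)
  exact (P.isOpen.inter_frontier_eq.subset ⟨h1, hx⟩ : x ∈ (∅ : Set E))

theorem eventually_cutoff_eq_one (P : IsPolytope μ' s T Ψ c D) {x : E} (hx : x ∈ T) :
    ∀ᶠ δ in nhdsWithin (0 : ℝ) (Ioi 0), cutoff s Ψ c δ x = 1 := by
  have h1 : ∀ᶠ δ in nhdsWithin (0 : ℝ) (Ioi 0), ∀ i ∈ s, 2 * δ ≤ wallDist Ψ c i x := by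
    rw [Filter.eventually_all_finset]
    intro i hi
    have h2 := P.wallDist_pos hi hx
    filter_upwards [nhdsWithin_le_nhds (gt_mem_nhds (half_pos h2))] with δ hδ
    linarith
  filter_upwards [h1, self_mem_nhdsWithin] with δ h2 hδ
  refine Finset.prod_eq_one fun i hi => Real.smoothTransition.one_of_one_le ?_
  have hδ' : (0 : ℝ) < δ := hδ
  rw [le_sub_iff_add_le, le_div_iff₀ hδ']
  linarith [h2 i hi]

/-- The derivatives of the cutoff functions are bounded in `L¹`. This follows from the divergence
theorem for the field `(x - x₀)` times the cutoff function, because `x - x₀` is transversal to all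
the walls. -/
theorem exists_integral_fderiv_cutoff_le (P : IsPolytope μ' s T Ψ c D) [Nontrivial E]
    (hΨ : ∀ i ∈ s, MeasurePreserving (Ψ i) ((volume : Measure ℝ).prod μ') μ) (v : E) :
    ∃ C : ℝ, 0 ≤ C ∧ ∀ᶠ δ in nhdsWithin (0 : ℝ) (Ioi 0),
      ∫ x in T, |fderiv ℝ (cutoff s Ψ c δ) x v| ∂μ ≤ C := by
  obtain ⟨x₀, hx₀⟩ := P.nonempty
  -- `x₀` has distance at least `m` from all the walls
  obtain ⟨m, hm, hmle⟩ : ∃ m : ℝ, 0 < m ∧ ∀ i ∈ s, m ≤ wallDist Ψ c i x₀ := by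
    rcases s.eq_empty_or_nonempty with rfl | hs
    · exact ⟨1, one_pos, by simp⟩
    · refine ⟨s.inf' hs fun i => wallDist Ψ c i x₀, ?_, fun i hi => Finset.inf'_le _ hi⟩
      rw [Finset.lt_inf'_iff]
      exact fun i hi => P.wallDist_pos hi hx₀
  set n := Module.finrank ℝ E' with hn
  set A := ∑ i ∈ s, |((Ψ i).symm v).1| with hA
  have hA0 : 0 ≤ A := Finset.sum_nonneg fun _ _ => abs_nonneg _
  have hTfin : IsFiniteMeasure (μ.restrict T) :=
    ⟨by rw [Measure.restrict_apply_univ]; exact P.bounded.measure_lt_top⟩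
  have hcint : ∀ f : E → ℝ, Continuous f → IntegrableOn f T μ := fun f hf =>
    (hf.continuousOn.integrableOn_compact P.isCompact_closure).mono_set subset_closure
  refine ⟨A * ((m / 2)⁻¹ * ((n + 1 : ℕ) * μ.real T)), by positivity, ?_⟩
  filter_upwards [self_mem_nhdsWithin, nhdsWithin_le_nhds (gt_mem_nhds (by positivity : 0 < m / 4))]
    with δ hδ hδm
  have hδ : (0 : ℝ) < δ := hδ
  have hlc : Continuous fun x => ∑ i ∈ s, layer s Ψ c δ i x :=
    continuous_finsetSum _ fun i _ => continuous_layer δ i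
  have hrad := P.integral_radial hΨ hx₀ (g := cutoff s Ψ c δ)
    (g' := fderiv ℝ (cutoff s Ψ c δ)) (contDiff_cutoff (n := 0) δ).continuous.continuousOn
    ((contDiff_cutoff (n := 1) δ).continuous_fderiv (by simp)).continuousOn
    fun x _ => ((contDiff_cutoff (n := 1) δ).differentiable (by simp) x).hasFDerivAt
  -- the cutoff function vanishes on the boundary, so the boundary terms drop out
  have hzero : ∑ i ∈ s, ((Ψ i).symm (c i - x₀)).1 *
      ∫ y in D i, cutoff s Ψ c δ (hyperPt (Ψ i) (c i) y) ∂μ' = 0 := by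
    refine Finset.sum_eq_zero fun i hi => ?_
    rw [setIntegral_congr_fun (P.meas i hi) fun y hy =>
      P.cutoff_eq_zero hδ (P.facet i hi y hy)]
    simp
  rw [hzero, integral_add ((hcint _ (contDiff_cutoff (n := 0) δ).continuous).const_mul _)
    (hcint _ ?_)] at hrad
  swap
  · have := (contDiff_cutoff (n := 1) δ (s := s) (Ψ := Ψ) (c := c)).continuous_fderiv (by simp)
    exact this.clm_apply (by fun_prop)
  have h1 : ∫ x in T, m / 2 * ∑ i ∈ s, layer s Ψ c δ i x ∂μ ≤
      ∫ x in T, -(fderiv ℝ (cutoff s Ψ c δ) x (x - x₀)) ∂μ := by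
    refine integral_mono ((hcint _ hlc).const_mul _) ?_ fun x => ?_
    · refine (hcint _ ?_).neg
      have := (contDiff_cutoff (n := 1) δ (s := s) (Ψ := Ψ) (c := c)).continuous_fderiv (by simp)
      exact this.clm_apply (by fun_prop)
    · simp only [fderiv_cutoff, neg_neg]
      rw [Finset.mul_sum]
      refine Finset.sum_le_sum fun i hi => ?_
      have e1 : ((Ψ i).symm (x - x₀)).1 = wallDist Ψ c i x₀ - wallDist Ψ c i x := by
        simp only [wallDist, map_sub, Prod.fst_sub]
        ring
      rw [e1, mul_comm]
      -- where the layer is active, `x` is closer to the wall than `x₀` by at least `m / 2`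
      by_cases hl : 2 * δ < wallDist Ψ c i x
      · rw [layer_eq_zero hδ hl]; simp
      · refine mul_le_mul_of_nonneg_left ?_ (layer_nonneg hδ i x)
        linarith [hmle i hi]
  have h2 : ∫ x in T, cutoff s Ψ c δ x ∂μ ≤ μ.real T := by
    have := integral_mono (hcint _ (contDiff_cutoff (n := 0) δ).continuous)
      (integrable_const (1 : ℝ)) (μ := μ.restrict T) fun x => cutoff_le_one (s := s) (Ψ := Ψ)
        (c := c) δ x
    simpa [Measure.real] using this
  rw [integral_const_mul] at hrad h1
  rw [integral_neg] at h1
  have h3 : ∫ x in T, ∑ i ∈ s, layer s Ψ c δ i x ∂μ ≤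
      (m / 2)⁻¹ * ((n + 1 : ℕ) * μ.real T) := by
    rw [le_inv_mul_iff₀ (by positivity)]
    have : ((n + 1 : ℕ) : ℝ) * ∫ x in T, cutoff s Ψ c δ x ∂μ ≤ (n + 1 : ℕ) * μ.real T :=
      mul_le_mul_of_nonneg_left h2 (by positivity)
    linarith
  calc ∫ x in T, |fderiv ℝ (cutoff s Ψ c δ) x v| ∂μ
      ≤ ∫ x in T, A * ∑ i ∈ s, layer s Ψ c δ i x ∂μ := by
        refine integral_mono ?_ ((hcint _ hlc).const_mul _) fun x => ?_
        · refine (hcint _ ?_).abs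
          have := (contDiff_cutoff (n := 1) δ (s := s) (Ψ := Ψ)
            (c := c)).continuous_fderiv (by simp)
          exact this.clm_apply (by fun_prop)
        · simp only [fderiv_cutoff, abs_neg]
          refine (Finset.abs_sum_le_sum_abs _ _).trans ?_
          rw [Finset.mul_sum]
          refine Finset.sum_le_sum fun i hi => ?_
          rw [abs_mul, abs_of_nonneg (layer_nonneg hδ i x), mul_comm]
          exact mul_le_mul_of_nonneg_right (Finset.single_le_sum
            (f := fun i => |((Ψ i).symm v).1|) (fun _ _ => abs_nonneg _) hi)
            (layer_nonneg hδ i x)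
    _ ≤ _ := by
        rw [integral_const_mul]
        exact mul_le_mul_of_nonneg_left h3 hA0

end IsPolytope
end Cutoff

/-! ### Integration by parts for weak derivatives -/

section Weak

open Filter Topology

variable {E E' ι : Type*} [DecidableEq ι]
  [NormedAddCommGroup E] [NormedSpace ℝ E] [MeasurableSpace E] [BorelSpace E]
  [FiniteDimensional ℝ E]
  [NormedAddCommGroup E'] [NormedSpace ℝ E'] [MeasurableSpace E'] [BorelSpace E']
  [FiniteDimensional ℝ E']

namespace IsPolytope

variable {μ : Measure E} [μ.IsAddHaarMeasure] {μ' : Measure E'} [μ'.IsAddHaarMeasure]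
  {s : Finset ι} {Ψ : ι → (ℝ × E') ≃L[ℝ] E} {c : ι → E}
  {T : Set E} {D : ι → Set E'}

theorem integrableOn_of_continuousOn (P : IsPolytope μ' s T Ψ c D) {f : E → ℝ}
    (hf : ContinuousOn f (closure T)) : IntegrableOn f T μ :=
  (hf.integrableOn_compact P.isCompact_closure).mono_set subset_closure

/-- Dominated convergence for the cutoff functions. -/
theorem tendsto_integral_mul_cutoff (P : IsPolytope μ' s T Ψ c D) {f : E → ℝ}
    (hf : IntegrableOn f T μ) :
    Tendsto (fun δ => ∫ x in T, f x * cutoff s Ψ c δ x ∂μ) (𝓝[>] 0) (𝓝 (∫ x in T, f x ∂μ)) := by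
  refine tendsto_integral_filter_of_dominated_convergence (fun x => ‖f x‖) ?_ ?_ hf.norm ?_
  · exact Eventually.of_forall fun δ => hf.aestronglyMeasurable.mul
      (contDiff_cutoff (n := 0) δ).continuous.aestronglyMeasurable
  · refine Eventually.of_forall fun δ => Eventually.of_forall fun x => ?_
    rw [norm_mul, Real.norm_of_nonneg (cutoff_nonneg δ x)]
    exact mul_le_of_le_one_right (norm_nonneg _) (cutoff_le_one δ x)
  · refine (ae_restrict_mem P.isOpen.measurableSet).mono fun x hx => ?_
    refine tendsto_const_nhds.congr' ?_
    filter_upwards [P.eventually_cutoff_eq_one hx] with δ hδ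
    rw [hδ, mul_one]

/-- The boundary integral `∑ᵢ (v · νᵢ) ∫_{Dᵢ} g` as the limit of integrals over boundary layers,
for smooth functions. -/
theorem tendsto_layer_smooth (P : IsPolytope μ' s T Ψ c D) [Nontrivial E]
    (hΨ : ∀ i ∈ s, MeasurePreserving (Ψ i) ((volume : Measure ℝ).prod μ') μ) (v : E)
    {g : E → ℝ} (hg : ContDiff ℝ 1 g) :
    Tendsto (fun δ => ∫ x in T, g x * fderiv ℝ (cutoff s Ψ c δ) x v ∂μ) (𝓝[>] 0)
      (𝓝 (-∑ i ∈ s, ((Ψ i).symm v).1 * ∫ y in D i, g (hyperPt (Ψ i) (c i) y) ∂μ')) := by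
  have hg' := hg.continuous_fderiv one_ne_zero
  have hdg : ∀ x, HasFDerivAt g (fderiv ℝ g x) x := fun x =>
    (hg.differentiable one_ne_zero x).hasFDerivAt
  rw [← P.integral_fderiv hΨ (μ := μ) hg.continuous.continuousOn hg'.continuousOn
    (fun x _ => hdg x) v]
  have hgv : Continuous fun x => fderiv ℝ g x v := hg'.clm_apply continuous_const
  have h1 := (P.tendsto_integral_mul_cutoff (μ := μ)
    (P.integrableOn_of_continuousOn hgv.continuousOn)).neg
  refine h1.congr' ?_
  filter_upwards [self_mem_nhdsWithin] with δ hδ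
  have hχ := contDiff_cutoff (n := 1) δ (s := s) (Ψ := Ψ) (c := c)
  have hχ' := hχ.continuous_fderiv (by simp)
  have hχv : Continuous fun x => fderiv ℝ (cutoff s Ψ c δ) x v := hχ'.clm_apply continuous_const
  have h2 := P.integral_fderiv hΨ (μ := μ) (g := fun x => g x * cutoff s Ψ c δ x)
    (g' := fun x => g x • fderiv ℝ (cutoff s Ψ c δ) x + cutoff s Ψ c δ x • fderiv ℝ g x)
    (hg.continuous.mul hχ.continuous).continuousOn
    ((hg.continuous.smul hχ').add (hχ.continuous.smul hg')).continuousOn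
    (fun x _ => (hdg x).mul ((hχ.differentiable (by simp) x).hasFDerivAt)) v
  have hzero : ∑ i ∈ s, ((Ψ i).symm v).1 * ∫ y in D i, g (hyperPt (Ψ i) (c i) y) *
      cutoff s Ψ c δ (hyperPt (Ψ i) (c i) y) ∂μ' = 0 := by
    refine Finset.sum_eq_zero fun i hi => ?_
    rw [setIntegral_congr_fun (g := fun _ => (0 : ℝ)) (P.meas i hi) fun y hy => by
      simp only [P.cutoff_eq_zero hδ (P.facet i hi y hy), mul_zero]]
    simp
  simp only [_root_.add_apply, _root_.smul_apply, smul_eq_mul] at h2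
  rw [hzero, integral_add (P.integrableOn_of_continuousOn
      (f := fun x => g x * fderiv ℝ (cutoff s Ψ c δ) x v) (hg.continuous.mul hχv).continuousOn)
    (P.integrableOn_of_continuousOn (f := fun x => cutoff s Ψ c δ x * fderiv ℝ g x v)
      (hχ.continuous.mul hgv).continuousOn)] at h2
  simp_rw [mul_comm (fderiv ℝ g _ v)]
  linarith

/-- The same limit for continuous functions, by uniform approximation and the `L¹` bound on the
derivatives of the cutoff functions. -/
theorem tendsto_layer (P : IsPolytope μ' s T Ψ c D) [Nontrivial E]
    (hΨ : ∀ i ∈ s, MeasurePreserving (Ψ i) ((volume : Measure ℝ).prod μ') μ) (v : E)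
    {g : E → ℝ} (hg : ContinuousOn g (closure T)) :
    Tendsto (fun δ => ∫ x in T, g x * fderiv ℝ (cutoff s Ψ c δ) x v ∂μ) (𝓝[>] 0)
      (𝓝 (-∑ i ∈ s, ((Ψ i).symm v).1 * ∫ y in D i, g (hyperPt (Ψ i) (c i) y) ∂μ')) := by
  obtain ⟨C, hC0, hC⟩ := P.exists_integral_fderiv_cutoff_le hΨ v
  set B := ∑ i ∈ s, |((Ψ i).symm v).1| * μ'.real (D i) with hB
  have hB0 : 0 ≤ B := Finset.sum_nonneg fun _ _ => by positivity
  obtain ⟨f, hf⟩ := ContinuousMap.exists_restrict_eq (isClosed_closure (s := T))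
    ⟨(closure T).domRestrict g, continuousOn_iff_continuous_domRestrict.1 hg⟩
  have hfg : ∀ x ∈ closure T, f x = g x := fun x hx =>
    congrArg (fun k : C(closure T, ℝ) => k ⟨x, hx⟩) hf
  rw [Metric.tendsto_nhds]
  intro ε hε
  -- an error `η` in `g` changes the layer integral by at most `η C` and its limit by at most `η B`
  set η := ε / (2 * (C + B + 1)) with hη
  have hη0 : 0 < η := by positivity
  obtain ⟨p, hp, hpf, -⟩ := f.continuous.exists_contDiff_approx 1 (continuous_const (y := η))
    (fun _ => hη0)
  have hpg : ∀ x ∈ closure T, |g x - p x| ≤ η := fun x hx => by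
    have := hpf x
    rw [hfg x hx, Real.dist_eq, abs_sub_comm] at this
    exact this.le
  have hlim := Metric.tendsto_nhds.1 (P.tendsto_layer_smooth hΨ v hp) (ε / 2) (by positivity)
  filter_upwards [hC, hlim] with δ h1 h2
  have hχ := contDiff_cutoff (n := 1) δ (s := s) (Ψ := Ψ) (c := c)
  have hχv : Continuous fun x => fderiv ℝ (cutoff s Ψ c δ) x v :=
    (hχ.continuous_fderiv (by simp)).clm_apply continuous_const
  have d1 : |∫ x in T, g x * fderiv ℝ (cutoff s Ψ c δ) x v ∂μ -
      ∫ x in T, p x * fderiv ℝ (cutoff s Ψ c δ) x v ∂μ| ≤ η * C := by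
    rw [← integral_sub (P.integrableOn_of_continuousOn
        (f := fun x => g x * fderiv ℝ (cutoff s Ψ c δ) x v) (hg.mul hχv.continuousOn))
      (P.integrableOn_of_continuousOn (f := fun x => p x * fderiv ℝ (cutoff s Ψ c δ) x v)
        (hp.continuous.mul hχv).continuousOn)]
    refine (abs_integral_le_integral_abs).trans ?_
    refine le_trans ?_ (mul_le_mul_of_nonneg_left h1 hη0.le)
    rw [← integral_const_mul]
    refine setIntegral_mono_on
      ((P.integrableOn_of_continuousOn ((hg.mul hχv.continuousOn).sub
        (hp.continuous.mul hχv).continuousOn)).abs)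
      ((P.integrableOn_of_continuousOn hχv.continuousOn).abs.const_mul _)
      P.isOpen.measurableSet fun x hx => ?_
    rw [← sub_mul, abs_mul]
    exact mul_le_mul_of_nonneg_right (hpg x (subset_closure hx)) (abs_nonneg _)
  have hci : ∀ i ∈ s, ∀ h : E → ℝ, ContinuousOn h (closure T) →
      IntegrableOn (fun y => h (hyperPt (Ψ i) (c i) y)) (D i) μ' := fun i hi h hh =>
    ((hh.comp (continuous_hyperPt _ _).continuousOn fun y hy => frontier_subset_closure
      (P.closure_facet hi hy)).integrableOn_compact (P.isCompact_closure_facet hi)).mono_set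
      subset_closure
  have d2 : |(∑ i ∈ s, ((Ψ i).symm v).1 * ∫ y in D i, p (hyperPt (Ψ i) (c i) y) ∂μ') -
      ∑ i ∈ s, ((Ψ i).symm v).1 * ∫ y in D i, g (hyperPt (Ψ i) (c i) y) ∂μ'| ≤ η * B := by
    rw [← Finset.sum_sub_distrib, hB, Finset.mul_sum]
    refine (Finset.abs_sum_le_sum_abs _ _).trans (Finset.sum_le_sum fun i hi => ?_)
    rw [← mul_sub, abs_mul, mul_left_comm]
    refine mul_le_mul_of_nonneg_left ?_ (abs_nonneg _)
    rw [← integral_sub (hci i hi p hp.continuous.continuousOn) (hci i hi g hg)]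
    have hfin : μ' (D i) < ⊤ := (measure_mono subset_closure).trans_lt
      (P.isCompact_closure_facet hi).measure_lt_top
    rw [← Real.norm_eq_abs]
    refine norm_setIntegral_le_of_norm_le_const hfin fun y hy => ?_
    rw [Real.norm_eq_abs, abs_sub_comm]
    exact hpg _ (frontier_subset_closure (P.facet i hi y hy))
  rw [Real.dist_eq] at h2 ⊢
  have hsum : η * C + η * B < ε / 2 := by
    rw [hη, div_mul_eq_mul_div, div_mul_eq_mul_div, ← add_div, div_lt_div_iff₀ (by positivity)
      two_pos]
    nlinarith
  rw [abs_le] at d1 d2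
  rw [abs_lt] at h2 ⊢
  constructor <;> linarith [d1.1, d1.2, d2.1, d2.2, h2.1, h2.2]

/-- Integration by parts on a polytope for a function that is continuous up to the boundary and
has an integrable weak derivative `W` in the direction `v`. -/
theorem integral_weak (P : IsPolytope μ' s T Ψ c D) [Nontrivial E]
    (hΨ : ∀ i ∈ s, MeasurePreserving (Ψ i) ((volume : Measure ℝ).prod μ') μ) (v : E)
    {g W : E → ℝ} (hg : ContinuousOn g (closure T)) (hW : IntegrableOn W T μ)
    (hweak : ∀ φ : E → ℝ, ContDiff ℝ (⊤ : ℕ∞) φ → HasCompactSupport φ → tsupport φ ⊆ T →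
      ∫ x in T, g x * fderiv ℝ φ x v ∂μ = -∫ x in T, W x * φ x ∂μ)
    {p : E → ℝ} (hp : ContDiff ℝ (⊤ : ℕ∞) p) :
    ∫ x in T, W x * p x ∂μ + ∫ x in T, g x * fderiv ℝ p x v ∂μ =
      ∑ i ∈ s, ((Ψ i).symm v).1 * ∫ y in D i, g (hyperPt (Ψ i) (c i) y) *
        p (hyperPt (Ψ i) (c i) y) ∂μ' := by
  have hp1 : ContDiff ℝ 1 p := hp.of_le (by exact_mod_cast le_top)
  have hpc := hp1.continuous
  have hpv : Continuous fun x => fderiv ℝ p x v :=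
    (hp1.continuous_fderiv one_ne_zero).clm_apply continuous_const
  have hWp : IntegrableOn (fun x => W x * p x) T μ := by
    obtain ⟨M, hM⟩ := P.isCompact_closure.exists_bound_of_continuousOn hpc.continuousOn
    refine Integrable.mul_bdd (c := M) hW hpc.aestronglyMeasurable ?_
    exact (ae_restrict_mem P.isOpen.measurableSet).mono fun x hx => hM x (subset_closure hx)
  have h1 := P.tendsto_layer hΨ v (g := fun x => g x * p x) (hg.mul hpc.continuousOn)
  have h2 := ((P.tendsto_integral_mul_cutoff hWp).neg).sub
    (P.tendsto_integral_mul_cutoff (μ := μ) (f := fun x => g x * fderiv ℝ p x v)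
      (P.integrableOn_of_continuousOn (hg.mul hpv.continuousOn)))
  have h3 := tendsto_nhds_unique_of_eventuallyEq h1 h2 ?_
  · linarith
  · filter_upwards [self_mem_nhdsWithin] with δ hδ
    have hδ : (0 : ℝ) < δ := hδ
    have hχ := contDiff_cutoff (n := ⊤) δ (s := s) (Ψ := Ψ) (c := c)
    have hχ1 := contDiff_cutoff (n := 1) δ (s := s) (Ψ := Ψ) (c := c)
    have hχv : Continuous fun x => fderiv ℝ (cutoff s Ψ c δ) x v :=
      (hχ1.continuous_fderiv (by simp)).clm_apply continuous_const
    -- test the weak derivative with `p` times the cutoff function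
    have h4 := hweak (fun x => p x * cutoff s Ψ c δ x) (hp.mul hχ)
      ((P.cutoff_support hδ).1.mul_left)
      ((closure_mono (Function.support_mul_subset_right _ _)).trans (P.cutoff_support hδ).2)
    have h5 : ∀ x, fderiv ℝ (fun x => p x * cutoff s Ψ c δ x) x v =
        p x * fderiv ℝ (cutoff s Ψ c δ) x v + cutoff s Ψ c δ x * fderiv ℝ p x v := by
      intro x
      have := ((hp1.differentiable one_ne_zero x).hasFDerivAt.mul
        (hχ1.differentiable (by simp) x).hasFDerivAt).fderiv
      change fderiv ℝ (p * cutoff s Ψ c δ) x v = _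
      rw [this]
      rfl
    simp_rw [h5, mul_add, ← mul_assoc] at h4
    rw [integral_add (P.integrableOn_of_continuousOn
        (f := fun x => g x * p x * fderiv ℝ (cutoff s Ψ c δ) x v)
        ((hg.mul hpc.continuousOn).mul hχv.continuousOn))
      (P.integrableOn_of_continuousOn
        (f := fun x => g x * cutoff s Ψ c δ x * fderiv ℝ p x v)
        ((hg.mul hχ1.continuous.continuousOn).mul hpv.continuousOn))] at h4
    simp_rw [mul_right_comm (g _) (cutoff _ _ _ _ _)] at h4
    linarith

end IsPolytope
end Weak

/-! ### Polynomials -/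

section PolySpaces

open MvPolynomial (X C coeff)

variable {d : ℕ}

theorem mem_Poly_iff {m : ℤ} {p : Pol d} :
    p ∈ Poly d m ↔ ∀ s, coeff s p ≠ 0 → ((Finsupp.degree s : ℕ) : ℤ) ≤ m := by
  rw [Poly, MvPolynomial.mem_restrictSupport_iff]
  constructor
  · intro h s hs
    exact h (Finset.mem_coe.2 (MvPolynomial.mem_support_iff.2 hs))
  · intro h s hs
    exact h s (MvPolynomial.mem_support_iff.1 (Finset.mem_coe.1 hs))

theorem Poly_mono {m n : ℤ} (h : m ≤ n) : Poly d m ≤ Poly d n := fun _ hp =>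
  mem_Poly_iff.2 fun s hs => (mem_Poly_iff.1 hp s hs).trans h

theorem mul_mem_Poly {m n : ℤ} {p q : Pol d} (hp : p ∈ Poly d m) (hq : q ∈ Poly d n) :
    p * q ∈ Poly d (m + n) := by
  classical
  rw [mem_Poly_iff] at *
  intro s hs
  rw [MvPolynomial.coeff_mul] at hs
  obtain ⟨⟨a, b⟩, hab, hne⟩ := Finset.exists_ne_zero_of_sum_ne_zero hs
  have h1 := hp a (left_ne_zero_of_mul hne)
  have h2 := hq b (right_ne_zero_of_mul hne)
  rw [Finset.HasAntidiagonal.mem_antidiagonal] at hab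
  have h3 : Finsupp.degree s = Finsupp.degree a + Finsupp.degree b := by
    rw [← hab, map_add]
  rw [h3]
  push_cast
  linarith

theorem C_mem_Poly (a : ℝ) : (C a : Pol d) ∈ Poly d 0 := by
  classical
  rw [mem_Poly_iff]
  intro s hs
  rw [MvPolynomial.coeff_C] at hs
  have : s = 0 := by
    by_contra h
    exact hs (if_neg (Ne.symm h))
  simp [this]

theorem X_mem_Poly (i : Fin d) : (X i : Pol d) ∈ Poly d 1 := by
  classical
  rw [mem_Poly_iff]
  intro s hs
  rw [MvPolynomial.coeff_X] at hs
  have : Finsupp.single i 1 = s := by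
    by_contra h
    exact hs (if_neg h)
  simp [← this]

theorem X_sub_C_mem_Poly (i : Fin d) (a : ℝ) : (X i - C a : Pol d) ∈ Poly d 1 :=
  Submodule.sub_mem _ (X_mem_Poly i) (Poly_mono zero_le_one (C_mem_Poly a))

theorem dP_mem_Poly {m n : ℤ} (h : m - 1 = n) {p : Pol d} (hp : p ∈ Poly d m) (i : Fin d) :
    dP i p ∈ Poly d n := by
  subst h
  rw [mem_Poly_iff] at *
  intro s hs
  have h1 : coeff s (MvPolynomial.pderiv i p) ≠ 0 := hs
  rw [MvPolynomial.coeff_pderiv] at h1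
  have h2 := hp _ (left_ne_zero_of_mul h1)
  rw [map_add, Finsupp.degree_single] at h2
  push_cast at h2
  linarith

instance finiteDimensional_Poly (m : ℤ) : FiniteDimensional ℝ (Poly d m) := by
  have hfin : {s : Fin d →₀ ℕ | ((Finsupp.degree s : ℕ) : ℤ) ≤ m}.Finite := by
    refine (Finsupp.finite_of_degree_le m.toNat).subset fun s hs => ?_
    have : ((Finsupp.degree s : ℕ) : ℤ) ≤ m := hs
    change Finsupp.degree s ≤ m.toNat
    omega
  have := hfin.to_subtype
  exact Module.Finite.of_basis (MvPolynomial.basisRestrictSupport ℝ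
    {s : Fin d →₀ ℕ | ((Finsupp.degree s : ℕ) : ℤ) ≤ m})

theorem finiteDimensional_pi {M : Type*} [AddCommGroup M] [Module ℝ M] {ι : Type*} [Finite ι]
    (S : ι → Submodule ℝ M) [∀ i, FiniteDimensional ℝ (S i)] :
    FiniteDimensional ℝ (Submodule.pi Set.univ S) := by
  let f : (Submodule.pi Set.univ S) →ₗ[ℝ] (∀ i, S i) :=
    { toFun := fun v i => ⟨v.1 i, v.2 i trivial⟩
      map_add' := fun _ _ => rfl
      map_smul' := fun _ _ => rfl }
  refine FiniteDimensional.of_injective f fun v w h => ?_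
  ext i
  exact congrArg (fun z => (z i : M)) h

instance finiteDimensional_VPoly (c : ℕ) (m : ℤ) : FiniteDimensional ℝ (VPoly d c m) :=
  finiteDimensional_pi _

instance finiteDimensional_rows (c : ℕ) (S : Submodule ℝ (Fin d → Pol d))
    [FiniteDimensional ℝ S] : FiniteDimensional ℝ (rows c S) :=
  finiteDimensional_pi _

theorem mem_VPoly {c : ℕ} {m : ℤ} {v : Fin c → Pol d} :
    v ∈ VPoly d c m ↔ ∀ i, v i ∈ Poly d m := by
  simp [VPoly, Submodule.mem_pi]

theorem mem_rows {c : ℕ} {S : Submodule ℝ (Fin d → Pol d)} {V : Fin c → Fin d → Pol d} :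
    V ∈ rows c S ↔ ∀ i, V i ∈ S := by
  simp [rows, Submodule.mem_pi]

theorem rows_mono {c : ℕ} {S S' : Submodule ℝ (Fin d → Pol d)} (h : S ≤ S') :
    rows c S ≤ rows c S' := fun _ hV => mem_rows.2 fun i => h (mem_rows.1 hV i)

/-- Substitution of elements of degree one does not raise the degree, in any filtered algebra. -/
theorem aeval_mem_filtration {A : Type*} [CommRing A] [Algebra ℝ A] (F : ℤ → Submodule ℝ A)
    (hmono : Monotone F) (hone : (1 : A) ∈ F 0)
    (hmul : ∀ {m n : ℤ} {a b : A}, a ∈ F m → b ∈ F n → a * b ∈ F (m + n))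
    {g : Fin d → A} (hg : ∀ i, g i ∈ F 1) {m : ℤ} {p : Pol d} (hp : p ∈ Poly d m) :
    MvPolynomial.aeval g p ∈ F m := by
  have hpow : ∀ i (n : ℕ), g i ^ n ∈ F n := by
    intro i n
    induction n with
    | zero => simpa using hone
    | succ n ih =>
      rw [pow_succ]
      push_cast
      exact hmul ih (hg i)
  have hprod : ∀ (S : Finset (Fin d)) (s : Fin d →₀ ℕ),
      ∏ i ∈ S, g i ^ s i ∈ F (∑ i ∈ S, (s i : ℤ)) := by
    intro S s
    classical
    induction S using Finset.induction_on with
    | empty => simpa using hone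
    | insert a S ha ih =>
      rw [Finset.prod_insert ha, Finset.sum_insert ha]
      exact hmul (hpow a _) ih
  rw [MvPolynomial.aeval_def, MvPolynomial.eval₂_eq']
  refine Submodule.sum_mem _ fun s hs => ?_
  rw [← Algebra.smul_def]
  refine Submodule.smul_mem _ _ (hmono ?_ (hprod Finset.univ s))
  have := mem_Poly_iff.1 hp s (MvPolynomial.mem_support_iff.1 hs)
  rw [Finsupp.degree_eq_sum] at this
  exact_mod_cast this

theorem aeval_mem_Poly {d' : ℕ} {g : Fin d → Pol d'} (hg : ∀ i, g i ∈ Poly d' 1) {m : ℤ}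
    {p : Pol d} (hp : p ∈ Poly d m) : MvPolynomial.aeval g p ∈ Poly d' m :=
  aeval_mem_filtration (Poly d') (fun _ _ h => Poly_mono h)
    (by simpa using C_mem_Poly (d := d') 1) mul_mem_Poly hg hp

theorem hasFDerivAt_eval (p : Pol d) (x : Fin d → ℝ) :
    HasFDerivAt (fun x => eval x p)
      (∑ i, eval x (dP i p) • (ContinuousLinearMap.proj i : (Fin d → ℝ) →L[ℝ] ℝ)) x := by
  induction p using MvPolynomial.induction_on with
  | C a =>
    have : ∀ i, dP i (C a : Pol d) = 0 := fun i => MvPolynomial.pderiv_C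
    simp only [this, MvPolynomial.eval_C, map_zero, zero_smul, Finset.sum_const_zero]
    exact hasFDerivAt_const a x
  | add p q hp hq =>
    simp only [map_add, add_smul, Finset.sum_add_distrib]
    exact hp.add hq
  | mul_X p j hp =>
    have h1 : ∀ i, dP i (p * X j) = dP i p * X j + p * Pi.single (M := fun _ => Pol d) i 1 j := by
      intro i
      change MvPolynomial.pderiv i (p * X j) = _
      rw [MvPolynomial.pderiv_mul, MvPolynomial.pderiv_X]
      rfl
    have h2 : HasFDerivAt (fun x : Fin d → ℝ => x j)
        (ContinuousLinearMap.proj j : (Fin d → ℝ) →L[ℝ] ℝ) x := hasFDerivAt_apply j x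
    simp only [map_mul, MvPolynomial.eval_X]
    refine HasFDerivAt.congr_fderiv (f' := _) (hp.mul h2) ?_
    ext v
    simp only [h1, map_add, map_mul, MvPolynomial.eval_X, add_smul, Finset.sum_add_distrib]
    simp only [_root_.add_apply, _root_.smul_apply, FunLike.coe_sum, Finset.sum_apply,
      ContinuousLinearMap.proj_apply, smul_eq_mul, FunLike.coe_smul, Pi.smul_apply]
    rw [add_comm]
    congr 1
    · rw [Finset.mul_sum]
      exact Finset.sum_congr rfl fun i _ => by ring
    · rw [Finset.sum_eq_single j]
      · simp
      · intro b _ hb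
        simp [Ne.symm hb]
      · simp

theorem contDiff_eval (p : Pol d) {n : ℕ∞} : ContDiff ℝ n fun x => eval x p := by
  induction p using MvPolynomial.induction_on with
  | C a => simpa using contDiff_const
  | add p q hp hq => simpa using hp.add hq
  | mul_X p j hp => simpa using hp.mul (contDiff_apply ℝ ℝ j)

theorem continuous_eval (p : Pol d) : Continuous fun x => eval x p :=
  MvPolynomial.continuous_eval p

theorem dP_comm (i j : Fin d) (p : Pol d) : dP i (dP j p) = dP j (dP i p) := by
  ext s
  change coeff s (MvPolynomial.pderiv i (MvPolynomial.pderiv j p)) =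
    coeff s (MvPolynomial.pderiv j (MvPolynomial.pderiv i p))
  simp only [MvPolynomial.coeff_pderiv]
  rw [add_right_comm]
  rcases eq_or_ne i j with rfl | h
  · rfl
  · simp only [Finsupp.add_apply, Finsupp.single_eq_of_ne h, Finsupp.single_eq_of_ne h.symm,
      add_zero]
    ring

/-- A polynomial that vanishes on a nonempty open set is zero. -/
theorem eq_zero_of_eval_eq_zero {U : Set (Fin d → ℝ)} (hU : IsOpen U) (hne : U.Nonempty)
    {p : Pol d} (h : ∀ x ∈ U, eval x p = 0) : p = 0 := by
  obtain ⟨x₀, hx₀⟩ := hne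
  obtain ⟨ε, hε, hb⟩ := Metric.isOpen_iff.1 hU x₀ hx₀
  refine MvPolynomial.funext_set (fun i => Metric.ball (x₀ i) ε) (fun i => ?_) fun x hx => ?_
  · rw [Real.ball_eq_Ioo]
    exact Ioo_infinite (by linarith)
  · rw [map_zero]
    refine h x (hb ?_)
    rw [← ball_pi _ hε] at *
    exact hx

end PolySpaces

/-! ### The Euler operator -/

section Euler

open MvPolynomial (X C coeff)

variable {d : ℕ}

/-- The operator `a + (x - c) · ∇`. -/
def eulerP (c : Fin d → ℝ) (a : ℕ) : Pol d →ₗ[ℝ] Pol d :=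
  (a : ℝ) • LinearMap.id + ∑ i, LinearMap.mulLeft ℝ (X i - C (c i) : Pol d) ∘ₗ dP i

theorem eulerP_apply (c : Fin d → ℝ) (a : ℕ) (p : Pol d) :
    eulerP c a p = (a : ℝ) • p + ∑ i, (X i - C (c i)) * dP i p := by
  simp [eulerP]

theorem dP_mul (i : Fin d) (p q : Pol d) : dP i (p * q) = dP i p * q + p * dP i q :=
  MvPolynomial.pderiv_mul

theorem dP_X_sub_C (i j : Fin d) (a : ℝ) :
    dP i (X j - C a : Pol d) = if i = j then 1 else 0 := by
  rw [map_sub]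
  change MvPolynomial.pderiv i (X j) - MvPolynomial.pderiv i (C a) = _
  rw [MvPolynomial.pderiv_C, MvPolynomial.pderiv_X, sub_zero, Pi.single_apply]
  simp only [eq_comm]

theorem dP_eulerP (c : Fin d → ℝ) (a : ℕ) (j : Fin d) (p : Pol d) :
    dP j (eulerP c a p) = eulerP c (a + 1) (dP j p) := by
  simp only [eulerP_apply, map_add, map_smul, map_sum, dP_mul, dP_X_sub_C,
    Finset.sum_add_distrib, ite_mul, one_mul, zero_mul, Finset.sum_ite_eq, Finset.mem_univ,
    if_true, Nat.cast_add, Nat.cast_one, add_smul, one_smul, add_assoc]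
  simp_rw [dP_comm j]

theorem eulerP_mem {c : Fin d → ℝ} {a : ℕ} {m : ℤ} {p : Pol d} (hp : p ∈ Poly d m) :
    eulerP c a p ∈ Poly d m := by
  rw [eulerP_apply]
  refine Submodule.add_mem _ (Submodule.smul_mem _ _ hp) (Submodule.sum_mem _ fun i _ => ?_)
  have := mul_mem_Poly (X_sub_C_mem_Poly i (c i)) (dP_mem_Poly rfl hp i)
  rwa [add_sub_cancel] at this

/-- Along the rays from `c`, `t ^ a * p` has derivative `t ^ (a - 1) * (a + (x - c) · ∇) p`. -/
theorem eulerP_injective (c : Fin d → ℝ) {a : ℕ} (ha : a ≠ 0) :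
    Function.Injective (eulerP c a) := by
  rw [← LinearMap.ker_eq_bot, LinearMap.ker_eq_bot']
  intro p hp
  obtain ⟨b, rfl⟩ := Nat.exists_eq_succ_of_ne_zero ha
  refine MvPolynomial.funext fun x => ?_
  rw [map_zero]
  have hder : ∀ t : ℝ, HasDerivAt (fun t : ℝ => t ^ (b + 1) * eval (c + t • (x - c)) p) 0 t := by
    intro t
    have h1 : HasDerivAt (fun t : ℝ => c + t • (x - c)) (x - c) t := by
      simpa using ((hasDerivAt_id t).smul_const (x - c)).const_add c
    have h2 := (hasDerivAt_pow (b + 1) t).mul ((hasFDerivAt_eval p _).comp_hasDerivAt t h1)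
    refine HasDerivAt.congr_deriv (f' := _) h2 ?_
    have h3 := congrArg (eval (c + t • (x - c))) hp
    rw [eulerP_apply, map_zero, map_add, map_sum, MvPolynomial.smul_eval] at h3
    simp only [smul_eq_mul, map_mul, map_sub, MvPolynomial.eval_X, MvPolynomial.eval_C,
      Pi.add_apply, Pi.smul_apply, Pi.sub_apply, add_sub_cancel_left] at h3
    simp only [FunLike.coe_sum, Finset.sum_apply, ContinuousLinearMap.proj_apply, smul_eq_mul,
      Function.comp, Pi.smul_apply, Pi.sub_apply, FunLike.coe_smul]
    have h4 : ∑ i, t * (x i - c i) * eval (c + t • (x - c)) (dP i p) =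
        t * ∑ i, eval (c + t • (x - c)) (dP i p) * (x i - c i) := by
      rw [Finset.mul_sum]
      exact Finset.sum_congr rfl fun i _ => by ring
    rw [h4] at h3
    rw [Nat.succ_eq_add_one] at h3
    rw [Nat.add_sub_cancel, pow_succ]
    linear_combination t ^ b * h3
  have hconst := is_const_of_deriv_eq_zero (fun t => (hder t).differentiableAt)
    (fun t => (hder t).deriv) 1 0
  simpa using hconst

/-- The Euler operator is injective, hence bijective, on the finite-dimensional space `P^m`. -/
theorem exists_eulerP_eq (c : Fin d → ℝ) {a : ℕ} (ha : a ≠ 0) {m : ℤ} {p : Pol d}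
    (hp : p ∈ Poly d m) : ∃ u ∈ Poly d m, eulerP c a u = p := by
  let f : Poly d m →ₗ[ℝ] Poly d m := (eulerP c a).restrict fun _ h => eulerP_mem h
  have hinj : Function.Injective f := fun u v h => Subtype.ext
    (eulerP_injective c ha (congrArg Subtype.val h))
  obtain ⟨u, hu⟩ := LinearMap.injective_iff_surjective.1 hinj ⟨p, hp⟩
  exact ⟨u.1, u.2, congrArg Subtype.val hu⟩

theorem exists_eulerP_eq_vec {n : ℕ} (c : Fin d → ℝ) {a : ℕ} (ha : a ≠ 0) {m : ℤ}
    {v : Fin n → Pol d} (hv : v ∈ VPoly d n m) :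
    ∃ u ∈ VPoly d n m, ∀ i, eulerP c a (u i) = v i := by
  choose u hu using fun i => exists_eulerP_eq c ha (mem_VPoly.1 hv i)
  exact ⟨u, mem_VPoly.2 fun i => (hu i).1, fun i => (hu i).2⟩

end Euler

/-! ### Koszul operators and decompositions -/

section Koszul

open MvPolynomial (X C coeff)

variable {d : ℕ}

theorem divP_apply (v : Fin d → Pol d) : divP d v = ∑ i, dP i (v i) := by
  simp [divP, cP]

theorem koszul_apply (c : Fin d → ℝ) (p : Pol d) (i : Fin d) :
    koszul c p i = (X i - C (c i)) * p := rfl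

theorem gradP_apply (p : Pol d) (i : Fin d) : gradP d p i = dP i p := rfl

theorem divRows_apply {c : ℕ} (V : Fin c → Fin d → Pol d) (i : Fin c) :
    divRows d c V i = divP d (V i) := rfl

theorem trP_apply (V : Fin d → Fin d → Pol d) : trP d V = ∑ i, V i i := by
  simp [trP, cP]

theorem perp_apply (v : Fin 2 → Pol 2) : perp v = ![-v 1, v 0] := by
  ext1 i
  fin_cases i <;> rfl

theorem vrotP_apply (p : Pol 2) : vrotP p = ![dP 1 p, -dP 0 p] := by
  ext1 i
  fin_cases i <;> rfl

theorem rotP_apply (v : Fin 2 → Pol 2) : rotP v = dP 0 (v 1) - dP 1 (v 0) := rfl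

theorem curlP_apply (v : Fin 3 → Pol 3) : curlP v =
    ![dP 1 (v 2) - dP 2 (v 1), dP 2 (v 0) - dP 0 (v 2), dP 0 (v 1) - dP 1 (v 0)] := by
  ext1 i
  fin_cases i <;> rfl

theorem koszulCross_apply (c : R3) (v : Fin 3 → Pol 3) : koszulCross c v =
    ![(X 1 - C (c 1)) * v 2 - (X 2 - C (c 2)) * v 1,
      (X 2 - C (c 2)) * v 0 - (X 0 - C (c 0)) * v 2,
      (X 0 - C (c 0)) * v 1 - (X 1 - C (c 1)) * v 0] := rfl

theorem div_koszul (c : Fin d → ℝ) (p : Pol d) : divP d (koszul c p) = eulerP c d p := by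
  simp only [divP_apply, koszul_apply, dP_mul, dP_X_sub_C, if_true, one_mul,
    Finset.sum_add_distrib, eulerP_apply]
  simp [Nat.cast_smul_eq_nsmul]

theorem div_eulerP (c : Fin d → ℝ) (a : ℕ) (v : Fin d → Pol d) :
    divP d (fun i => eulerP c a (v i)) = eulerP c (a + 1) (divP d v) := by
  simp only [divP_apply, dP_eulerP, map_sum]

theorem eulerP_mul (c : Fin d → ℝ) (a : ℕ) (j : Fin d) (p : Pol d) :
    eulerP c a ((X j - C (c j)) * p) = (X j - C (c j)) * eulerP c (a + 1) p := by
  simp only [eulerP_apply, dP_mul, dP_X_sub_C, mul_add, Finset.sum_add_distrib, ite_mul, one_mul,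
    zero_mul, mul_ite, mul_zero, Finset.sum_ite_eq', Finset.mem_univ, if_true,
    Finset.mul_sum, Algebra.smul_def, Nat.cast_add, Nat.cast_one, map_add, map_one]
  have : ∑ i, (X i - C (c i)) * ((X j - C (c j)) * dP i p) =
      ∑ i, (X j - C (c j)) * ((X i - C (c i)) * dP i p) :=
    Finset.sum_congr rfl fun i _ => by ring
  rw [this]
  ring

/-- A gradient orthogonal to `x - c` vanishes. -/
theorem gradP_eq_zero_of_radial {c : Fin d → ℝ} {q : Pol d}
    (h : ∑ i, (X i - C (c i)) * gradP d q i = 0) : gradP d q = 0 := by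
  have h0 : eulerP c 0 q = 0 := by simpa [eulerP_apply, gradP_apply] using h
  ext1 j
  have h1 := dP_eulerP c 0 j q
  rw [h0, map_zero] at h1
  exact (map_eq_zero_iff _ (eulerP_injective c one_ne_zero)).1 h1.symm

theorem koszul_mem_VPoly {c : Fin d → ℝ} {m : ℤ} {p : Pol d} (hp : p ∈ Poly d (m - 1)) :
    koszul c p ∈ VPoly d d m := mem_VPoly.2 fun i => by
  have := mul_mem_Poly (X_sub_C_mem_Poly i (c i)) hp
  rwa [add_sub_cancel] at this

theorem RolyC_le (c : Fin d → ℝ) (m : ℤ) : RolyC d c m ≤ VPoly d d m := by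
  rintro _ ⟨p, hp, rfl⟩
  exact koszul_mem_VPoly hp

theorem Goly_le (m : ℤ) : Goly d m ≤ VPoly d d m := by
  rintro _ ⟨p, hp, rfl⟩
  exact mem_VPoly.2 fun i => dP_mem_Poly (by ring) hp i

theorem VPoly_mono {c : ℕ} {m n : ℤ} (h : m ≤ n) : VPoly d c m ≤ VPoly d c n := fun _ hv =>
  mem_VPoly.2 fun i => Poly_mono h (mem_VPoly.1 hv i)

theorem RolyC_mono (c : Fin d → ℝ) {m n : ℤ} (h : m ≤ n) : RolyC d c m ≤ RolyC d c n :=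
  Submodule.map_mono (Poly_mono (by linarith))

theorem divP_mem {m n : ℤ} (h : m - 1 = n) {v : Fin d → Pol d} (hv : v ∈ VPoly d d m) :
    divP d v ∈ Poly d n := by
  rw [divP_apply]
  exact Submodule.sum_mem _ fun i _ => dP_mem_Poly h (mem_VPoly.1 hv i) i

/-- `div` maps `R^{c,m+1}` onto `P^m`. -/
theorem exists_koszul_div (hd : d ≠ 0) (c : Fin d → ℝ) {m : ℤ} {p : Pol d} (hp : p ∈ Poly d m) :
    ∃ u ∈ Poly d m, divP d (koszul c u) = p := by
  simp_rw [div_koszul]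
  exact exists_eulerP_eq c hd hp

/-- `div` is injective on `R^{c,m}`. -/
theorem eq_zero_of_div_eq_zero (hd : d ≠ 0) {c : Fin d → ℝ} {m : ℤ} {r : Fin d → Pol d}
    (hr : r ∈ RolyC d c m) (h : divP d r = 0) : r = 0 := by
  obtain ⟨p, -, rfl⟩ := hr
  rw [div_koszul] at h
  rw [(map_eq_zero_iff _ (eulerP_injective c hd)).1 h, map_zero]

/-- The divergence of a trace-free matrix field with rows in `R^{c,m}` is orthogonal to `x - c`. -/
theorem radial_div_RolybC {c : Fin d → ℝ} {m : ℤ} {A : Fin d → Fin d → Pol d}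
    (hA : A ∈ RolybC d c m) : ∑ i, (X i - C (c i)) * divRows d d A i = 0 := by
  obtain ⟨h1, h2⟩ := hA
  choose p hp hpA using fun i => mem_rows.1 h1 i
  rw [SetLike.mem_coe, LinearMap.mem_ker, trP_apply] at h2
  simp_rw [divRows_apply, ← hpA, div_koszul]
  simp_rw [← hpA, koszul_apply] at h2
  rcases d with _ | d
  · simp
  · simp_rw [← eulerP_mul, ← map_sum, h2, map_zero]

theorem divRows_RolybC_mem {c : Fin d → ℝ} {m n : ℤ} (h : m - 1 = n)
    {A : Fin d → Fin d → Pol d} (hA : A ∈ RolybC d c m) : divRows d d A ∈ VPoly d d n :=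
  mem_VPoly.2 fun i => divP_mem h (RolyC_le c m (mem_rows.1 hA.1 i))

/-- The sum of the spaces `R_b^{c,m}`, `R_b^m` and divergence-free fields is direct. -/
theorem eq_zero_of_add_add_eq_zero (hd : d ≠ 0) {c : Fin d → ℝ} {R : Set (Fin d → ℝ)} {m n : ℤ}
    {A B D : Fin d → Fin d → Pol d} (hA : A ∈ RolybC d c m) (hB : B ∈ Rolyb d c R n)
    (hD : divRows d d D = 0) (h : A + B + D = 0) : A = 0 ∧ B = 0 ∧ D = 0 := by
  have h1 : divRows d d A + divRows d d B = 0 := by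
    rw [← map_add, ← map_zero (divRows d d), ← h, map_add _ (A + B), hD, add_zero]
  obtain ⟨q, -, hq⟩ := hB.2
  have h2 : divRows d d B = -divRows d d A := (neg_eq_of_add_eq_zero_right h1).symm
  have h3 : gradP d q = 0 := by
    refine gradP_eq_zero_of_radial (c := c) ?_
    rw [hq, h2]
    simp only [Pi.neg_apply, mul_neg, Finset.sum_neg_distrib, radial_div_RolybC hA, neg_zero]
  have hdB : divRows d d B = 0 := by rw [← hq, h3]
  have hdA : divRows d d A = 0 := by rw [hdB, add_zero] at h1; exact h1
  have hA0 : A = 0 := by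
    ext1 i
    exact eq_zero_of_div_eq_zero hd (mem_rows.1 hA.1 i) (congrFun hdA i)
  have hB0 : B = 0 := by
    ext1 i
    exact eq_zero_of_div_eq_zero hd (mem_rows.1 hB.1 i) (congrFun hdB i)
  refine ⟨hA0, hB0, ?_⟩
  rw [hA0, hB0] at h
  simpa using h

/-! ### Decompositions in the plane -/

theorem perp_koszul_apply (p : Pol 2) : perp (koszul 0 p) = ![-(X 1 * p), X 0 * p] := by
  rw [perp_apply, koszul_apply, koszul_apply]
  simp

theorem div_vrotP (r : Pol 2) : divP 2 (vrotP r) = 0 := by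
  simp [divP_apply, vrotP_apply, Fin.sum_univ_two, dP_comm 0 1]

/-- A divergence-free field in the plane is a rotated gradient. -/
theorem exists_vrotP_eq {m : ℤ} {w : Fin 2 → Pol 2} (hw : w ∈ VPoly 2 2 m)
    (h : divP 2 w = 0) : ∃ r ∈ Poly 2 (m + 1), vrotP r = w := by
  obtain ⟨u, hu, huw⟩ := exists_eulerP_eq_vec 0 one_ne_zero hw
  have hdiv : divP 2 u = 0 := by
    have h1 := div_eulerP 0 1 u
    simp_rw [huw] at h1
    exact (map_eq_zero_iff _ (eulerP_injective 0 (by norm_num))).1 (h1.symm.trans h)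
  rw [divP_apply, Fin.sum_univ_two] at hdiv
  have mm : ∀ i j, X i * u j ∈ Poly 2 (m + 1) := fun i j => by
    rw [add_comm]
    exact mul_mem_Poly (X_mem_Poly i) (mem_VPoly.1 hu j)
  -- since `1 + x · ∇` maps `u` to `w` and `div u = 0`, the stream function is `-(x^⊥ · u)`
  refine ⟨X 1 * u 0 - X 0 * u 1, Submodule.sub_mem _ (mm _ _) (mm _ _), ?_⟩
  have hX : ∀ i j : Fin 2, dP i (X j : Pol 2) = if i = j then 1 else 0 := fun i j => by
    simpa using dP_X_sub_C i j 0
  rw [vrotP_apply]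
  ext1 i
  rw [← huw i, eulerP_apply, Fin.sum_univ_two]
  fin_cases i
  · simp [dP_mul, hX]
    linear_combination -(X 0 : Pol 2) * hdiv
  · simp [dP_mul, hX]
    linear_combination -(X 1 : Pol 2) * hdiv

/-- `P^m(F)² = R^m(F) + R^{c,m}(F)`. -/
theorem exists_vrotP_add_koszul {m : ℤ} {w : Fin 2 → Pol 2} (hw : w ∈ VPoly 2 2 m) :
    ∃ r ∈ Poly 2 (m + 1), ∃ u ∈ Poly 2 (m - 1), w = vrotP r + koszul 0 u := by
  obtain ⟨u, hu, hdu⟩ := exists_koszul_div two_ne_zero 0 (divP_mem rfl hw)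
  obtain ⟨r, hr, hrw⟩ := exists_vrotP_eq (w := w - koszul 0 u)
    (Submodule.sub_mem _ hw (koszul_mem_VPoly hu)) (by rw [map_sub, hdu, sub_self])
  exact ⟨r, hr, u, hu, by rw [hrw, sub_add_cancel]⟩

/-- `P^m(F)² = G^m(F) + G^{c,m}(F)`. -/
theorem exists_gradP_add_perp {m : ℤ} {w : Fin 2 → Pol 2} (hw : w ∈ VPoly 2 2 m) :
    ∃ q ∈ Poly 2 (m + 1), ∃ s ∈ Poly 2 (m - 1), w = gradP 2 q + perp (koszul 0 s) := by
  -- rotate the decomposition into a rotated gradient and a field in `R^{c,m}`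
  have hw' : -perp w ∈ VPoly 2 2 m := by
    rw [mem_VPoly] at hw ⊢
    intro i
    rw [perp_apply]
    fin_cases i
    · simpa using hw 1
    · simpa using hw 0
  obtain ⟨q, hq, s, hs, h⟩ := exists_vrotP_add_koszul hw'
  refine ⟨q, hq, s, hs, ?_⟩
  have h2 : w = perp (-perp w) := by
    rw [map_neg, perp_apply, perp_apply]
    ext1 i
    fin_cases i <;> simp
  rw [h2, h, map_add]
  congr 1
  rw [perp_apply, vrotP_apply]
  ext1 i
  fin_cases i <;> simp [gradP_apply]

/-- A field `b` with `x · b = 0` is `x^⊥ s`, where `s` is determined by `rot b = (2 + x · ∇) s`. -/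
theorem mem_GolyC2_of_radial {m : ℤ} {b : Fin 2 → Pol 2} (hb : b ∈ VPoly 2 2 m)
    (h : X 0 * b 0 + X 1 * b 1 = 0) : b ∈ GolyC2 m := by
  have hrot : rotP b ∈ Poly 2 (m - 1) := Submodule.sub_mem _
    (dP_mem_Poly rfl (mem_VPoly.1 hb 1) 0) (dP_mem_Poly rfl (mem_VPoly.1 hb 0) 1)
  obtain ⟨s, hs, hsr⟩ := exists_eulerP_eq 0 two_ne_zero hrot
  refine ⟨s, hs, ?_⟩
  have hX : ∀ i j : Fin 2, dP i (X j : Pol 2) = if i = j then 1 else 0 := fun i j => by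
    simpa using dP_X_sub_C i j 0
  have h0 := congrArg (dP 0) h
  have h1 := congrArg (dP 1) h
  simp [dP_mul, hX] at h0 h1
  have key : ∀ j : Fin 2, eulerP 0 1 (X j * s) = X j * rotP b := fun j => by
    have := eulerP_mul (d := 2) 0 1 j s
    simp only [Pi.zero_apply, MvPolynomial.C_0, sub_zero] at this
    rw [this, hsr]
  rw [LinearMap.comp_apply, perp_koszul_apply]
  ext1 i
  -- both sides agree after applying `1 + x · ∇`, by differentiating `x · b = 0`
  apply eulerP_injective 0 one_ne_zero
  fin_cases i
  · change eulerP 0 1 (-(X 1 * s)) = eulerP 0 1 (b 0)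
    rw [map_neg, key, rotP_apply, eulerP_apply, Fin.sum_univ_two]
    simp
    linear_combination -h0
  · change eulerP 0 1 (X 0 * s) = eulerP 0 1 (b 1)
    rw [key, rotP_apply, eulerP_apply, Fin.sum_univ_two]
    simp
    linear_combination -h1

theorem divRows_RolybC_mem_GolyC2 {m n : ℤ} (hmn : m - 1 = n) {A : Fin 2 → Fin 2 → Pol 2}
    (hA : A ∈ RolybC 2 0 m) : divRows 2 2 A ∈ GolyC2 n := by
  refine mem_GolyC2_of_radial (divRows_RolybC_mem hmn hA) ?_
  simpa [Fin.sum_univ_two] using radial_div_RolybC hA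

/-! ### Decompositions in space -/

theorem div_curlP (r : Fin 3 → Pol 3) : divP 3 (curlP r) = 0 := by
  simp [divP_apply, curlP_apply, Fin.sum_univ_three, dP_comm 1 0, dP_comm 2 0, dP_comm 2 1]

/-- A divergence-free field in space is a curl. -/
theorem exists_curlP_eq (c : R3) {m : ℤ} {w : Fin 3 → Pol 3} (hw : w ∈ VPoly 3 3 m)
    (h : divP 3 w = 0) : ∃ r ∈ VPoly 3 3 (m + 1), curlP r = w := by
  obtain ⟨u, hu, huw⟩ := exists_eulerP_eq_vec c two_ne_zero hw
  have hdiv : divP 3 u = 0 := by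
    have h1 := div_eulerP c 2 u
    simp_rw [huw] at h1
    exact (map_eq_zero_iff _ (eulerP_injective c (by norm_num))).1 (h1.symm.trans h)
  rw [divP_apply, Fin.sum_univ_three] at hdiv
  have mm : ∀ i j, (X i - C (c i)) * u j ∈ Poly 3 (m + 1) := fun i j => by
    rw [add_comm]
    exact mul_mem_Poly (X_sub_C_mem_Poly i _) (mem_VPoly.1 hu j)
  -- with `(2 + (x - c) · ∇) u = w` and `div u = 0`, the field `-(x - c) × u` is a vector potential
  refine ⟨-koszulCross c u, Submodule.neg_mem _ (mem_VPoly.2 fun i => ?_), ?_⟩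
  · rw [koszulCross_apply]
    fin_cases i <;> exact Submodule.sub_mem _ (mm _ _) (mm _ _)
  · have hC2 : (C 2 : Pol 3) = 2 := map_ofNat C 2
    rw [map_neg, koszulCross_apply, curlP_apply]
    ext1 i
    rw [← huw i, eulerP_apply, Fin.sum_univ_three]
    fin_cases i
    · simp [dP_mul, dP_X_sub_C, MvPolynomial.smul_eq_C_mul, hC2]
      linear_combination -(X 0 - C (c 0) : Pol 3) * hdiv
    · simp [dP_mul, dP_X_sub_C, MvPolynomial.smul_eq_C_mul, hC2]
      linear_combination -(X 1 - C (c 1) : Pol 3) * hdiv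
    · simp [dP_mul, dP_X_sub_C, MvPolynomial.smul_eq_C_mul, hC2]
      linear_combination -(X 2 - C (c 2) : Pol 3) * hdiv

/-- `P^m(T)³ = R^m(T) + R^{c,m}(T)`. -/
theorem exists_curlP_add_koszul (c : R3) {m : ℤ} {w : Fin 3 → Pol 3} (hw : w ∈ VPoly 3 3 m) :
    ∃ r ∈ VPoly 3 3 (m + 1), ∃ u ∈ Poly 3 (m - 1), w = curlP r + koszul c u := by
  obtain ⟨u, hu, hdu⟩ := exists_koszul_div three_ne_zero c (divP_mem rfl hw)
  obtain ⟨r, hr, hrw⟩ := exists_curlP_eq c (w := w - koszul c u)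
    (Submodule.sub_mem _ hw (koszul_mem_VPoly hu)) (by rw [map_sub, hdu, sub_self])
  exact ⟨r, hr, u, hu, by rw [hrw, sub_add_cancel]⟩

theorem curlP_mem {m n : ℤ} (h : m - 1 = n) {r : Fin 3 → Pol 3} (hr : r ∈ VPoly 3 3 m) :
    curlP r ∈ VPoly 3 3 n := by
  rw [mem_VPoly] at hr ⊢
  intro i
  rw [curlP_apply]
  fin_cases i <;>
  exact Submodule.sub_mem _ (dP_mem_Poly h (hr _) _) (dP_mem_Poly h (hr _) _)

/-- A field `b` with `(x - c) · b = 0` is `-(x - c) × s`, where `curl b = (2 + (x - c) · ∇) s`. -/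
theorem mem_GolyC3_of_radial {c : R3} {m : ℤ} {b : Fin 3 → Pol 3} (hb : b ∈ VPoly 3 3 m)
    (h : ∑ i, (X i - C (c i)) * b i = 0) : b ∈ GolyC3 c m := by
  obtain ⟨s, hs, hsr⟩ := exists_eulerP_eq_vec c two_ne_zero (curlP_mem rfl hb)
  refine ⟨-s, Submodule.neg_mem _ hs, ?_⟩
  rw [Fin.sum_univ_three] at h
  have h0 := congrArg (dP 0) h
  have h1 := congrArg (dP 1) h
  have h2 := congrArg (dP 2) h
  simp only [map_add, dP_mul, dP_X_sub_C, map_zero] at h0 h1 h2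
  simp at h0 h1 h2
  have key : ∀ i j : Fin 3, eulerP c 1 ((X i - C (c i)) * s j) =
      (X i - C (c i)) * curlP b j := fun i j => by
    rw [eulerP_mul, hsr]
  rw [koszulCross_apply]
  ext1 i
  -- both sides agree after applying `1 + (x - c) · ∇`, by differentiating `(x - c) · b = 0`
  apply eulerP_injective c one_ne_zero
  fin_cases i
  · change eulerP c 1 ((X 1 - C (c 1)) * (-s 2) - (X 2 - C (c 2)) * (-s 1)) = eulerP c 1 (b 0)
    rw [map_sub, mul_neg, mul_neg, map_neg, map_neg, key, key, curlP_apply, eulerP_apply,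
      Fin.sum_univ_three]
    simp
    linear_combination -h0
  · change eulerP c 1 ((X 2 - C (c 2)) * (-s 0) - (X 0 - C (c 0)) * (-s 2)) = eulerP c 1 (b 1)
    rw [map_sub, mul_neg, mul_neg, map_neg, map_neg, key, key, curlP_apply, eulerP_apply,
      Fin.sum_univ_three]
    simp
    linear_combination -h1
  · change eulerP c 1 ((X 0 - C (c 0)) * (-s 1) - (X 1 - C (c 1)) * (-s 0)) = eulerP c 1 (b 2)
    rw [map_sub, mul_neg, mul_neg, map_neg, map_neg, key, key, curlP_apply, eulerP_apply,
      Fin.sum_univ_three]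
    simp
    linear_combination -h2

theorem divRows_RolybC_mem_GolyC3 {c : R3} {m n : ℤ} (hmn : m - 1 = n)
    {A : Fin 3 → Fin 3 → Pol 3} (hA : A ∈ RolybC 3 c m) : divRows 3 3 A ∈ GolyC3 c n :=
  mem_GolyC3_of_radial (divRows_RolybC_mem hmn hA) (radial_div_RolybC hA)

end Koszul

/-! ### Riesz representation and projections -/

theorem solve_spec {α : Type*} [Nonempty α] {p : α → Prop} (h : ∃ a, p a) : p (solve p) :=
  Classical.epsilon_spec h

theorem solve_congr {α : Type*} [Nonempty α] {p q : α → Prop} (h : ∀ a, p a ↔ q a) :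
    solve p = solve q := congrArg solve (funext fun a => propext (h a))

section Linear

variable {M N : Type*} [AddCommGroup M] [Module ℝ M] [AddCommGroup N] [Module ℝ N]

theorem _root_.IsLinearMap.fun_add {φ ψ : M → ℝ} (h : IsLinearMap ℝ φ) (h' : IsLinearMap ℝ ψ) :
    IsLinearMap ℝ fun x => φ x + ψ x := (h.mk' φ + h'.mk' ψ).isLinear

theorem _root_.IsLinearMap.fun_sub {φ ψ : M → ℝ} (h : IsLinearMap ℝ φ) (h' : IsLinearMap ℝ ψ) :
    IsLinearMap ℝ fun x => φ x - ψ x := (h.mk' φ - h'.mk' ψ).isLinear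

theorem _root_.IsLinearMap.fun_neg {φ : M → ℝ} (h : IsLinearMap ℝ φ) :
    IsLinearMap ℝ fun x => -φ x := (-h.mk' φ).isLinear

theorem _root_.IsLinearMap.fun_const_mul {φ : M → ℝ} (a : ℝ) (h : IsLinearMap ℝ φ) :
    IsLinearMap ℝ fun x => a * φ x := (a • h.mk' φ).isLinear

theorem _root_.IsLinearMap.fun_sum {ι : Type*} {s : Finset ι} {φ : ι → M → ℝ}
    (h : ∀ i ∈ s, IsLinearMap ℝ (φ i)) : IsLinearMap ℝ fun x => ∑ i ∈ s, φ i x where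
  map_add x y := by
    rw [← Finset.sum_add_distrib]
    exact Finset.sum_congr rfl fun i hi => (h i hi).map_add x y
  map_smul a x := by
    rw [Finset.smul_sum]
    exact Finset.sum_congr rfl fun i hi => (h i hi).map_smul a x

theorem _root_.IsLinearMap.fun_comp {φ : M → ℝ} (h : IsLinearMap ℝ φ) (L : N →ₗ[ℝ] M) :
    IsLinearMap ℝ fun x => φ (L x) := ((h.mk' φ).comp L).isLinear

/-- The Riesz representation theorem for a form that is definite on the image of a
finite-dimensional space. -/
theorem exists_representer [FiniteDimensional ℝ M] (J : M →ₗ[ℝ] N) (B : N → N → ℝ)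
    (hlin : ∀ v, IsLinearMap ℝ (B v)) (hsymm : ∀ v w, B v w = B w v)
    (hpos : ∀ x, B (J x) (J x) = 0 → x = 0) {φ : M → ℝ} (hφ : IsLinearMap ℝ φ) :
    ∃ x, ∀ y, B (J x) (J y) = φ y := by
  let T : M →ₗ[ℝ] Module.Dual ℝ M :=
    { toFun := fun x => ((hlin (J x)).mk' _).comp J
      map_add' := fun x y => by
        ext z
        change B (J (x + y)) (J z) = B (J x) (J z) + B (J y) (J z)
        rw [map_add, hsymm, (hlin _).map_add, hsymm (J z), hsymm (J z)]
      map_smul' := fun a x => by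
        ext z
        change B (J (a • x)) (J z) = a • B (J x) (J z)
        rw [map_smul, hsymm, (hlin _).map_smul, hsymm (J z)] }
  have hinj : Function.Injective T := by
    rw [← LinearMap.ker_eq_bot, LinearMap.ker_eq_bot']
    intro x hx
    exact hpos x (congrArg (fun f : Module.Dual ℝ M => f x) hx)
  have hsurj : Function.Surjective T :=
    (LinearMap.injective_iff_surjective_of_finrank_eq_finrank
      (Subspace.dual_finrank_eq (K := ℝ) (V := M)).symm).1 hinj
  obtain ⟨x, hx⟩ := hsurj (hφ.mk' φ)
  exact ⟨x, fun y => congrArg (fun f : Module.Dual ℝ M => f y) hx⟩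

end Linear

section Region

/-- A nonempty bounded open set. -/
structure IsRegion {d : ℕ} (R : Set (Fin d → ℝ)) : Prop where
  isOpen : IsOpen R
  bounded : Bornology.IsBounded R
  nonempty : R.Nonempty

variable {d c b : ℕ} {R : Set (Fin d → ℝ)}

namespace IsRegion

theorem integrableOn_of_continuousOn (hR : IsRegion R) {f : (Fin d → ℝ) → ℝ}
    (hf : ContinuousOn f (closure R)) : IntegrableOn f R :=
  (hf.integrableOn_compact hR.bounded.isCompact_closure).mono_set subset_closure

theorem integrableOn_eval (hR : IsRegion R) (p : Pol d) :
    IntegrableOn (fun x => eval x p) R :=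
  hR.integrableOn_of_continuousOn (continuous_eval p).continuousOn

theorem integrableOn_mul_eval (hR : IsRegion R) {f : (Fin d → ℝ) → ℝ} (hf : IntegrableOn f R)
    (p : Pol d) : IntegrableOn (fun x => f x * eval x p) R := by
  obtain ⟨M, hM⟩ := hR.bounded.isCompact_closure.exists_bound_of_continuousOn
    (continuous_eval p).continuousOn
  refine Integrable.mul_bdd (c := M) hf (continuous_eval p).aestronglyMeasurable ?_
  exact (ae_restrict_mem hR.isOpen.measurableSet).mono fun x hx => hM x (subset_closure hx)

theorem integral_dot (hR : IsRegion R) {f : (Fin d → ℝ) → Fin c → ℝ}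
    (hf : ∀ i, IntegrableOn (fun x => f x i) R) (v : Fin c → Pol d) :
    ∫ x in R, f x ⬝ᵥ evV v x = ∑ i, ∫ x in R, f x i * eval x (v i) := by
  simp only [dotProduct, evV]
  exact integral_finsetSum _ fun i _ => hR.integrableOn_mul_eval (hf i) (v i)

theorem integrableOn_dot (hR : IsRegion R) {f : (Fin d → ℝ) → Fin c → ℝ}
    (hf : ∀ i, IntegrableOn (fun x => f x i) R) (v : Fin c → Pol d) :
    IntegrableOn (fun x => f x ⬝ᵥ evV v x) R := by
  simp only [dotProduct, evV]
  exact integrable_finsetSum _ fun i _ => hR.integrableOn_mul_eval (hf i) (v i)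

theorem integral_ddot (hR : IsRegion R) {f : (Fin d → ℝ) → Fin b → Fin c → ℝ}
    (hf : ∀ i j, IntegrableOn (fun x => f x i j) R) (V : Fin b → Fin c → Pol d) :
    ∫ x in R, ddot (f x) (evM V x) = ∑ i, ∫ x in R, f x i ⬝ᵥ evV (V i) x := by
  simp only [ddot]
  exact integral_finsetSum _ fun i _ => hR.integrableOn_dot (hf i) (V i)

theorem isLinear_mul (hR : IsRegion R) {f : (Fin d → ℝ) → ℝ} (hf : IntegrableOn f R) :
    IsLinearMap ℝ fun p : Pol d => ∫ x in R, f x * eval x p where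
  map_add p q := by
    simp only [map_add, mul_add]
    exact integral_add (hR.integrableOn_mul_eval hf p) (hR.integrableOn_mul_eval hf q)
  map_smul a p := by
    simp only [MvPolynomial.smul_eval, smul_eq_mul]
    rw [← integral_const_mul]
    exact integral_congr_ae (Filter.Eventually.of_forall fun x => by ring)

theorem isLinear_dot (hR : IsRegion R) {f : (Fin d → ℝ) → Fin c → ℝ}
    (hf : ∀ i, IntegrableOn (fun x => f x i) R) :
    IsLinearMap ℝ fun v : Fin c → Pol d => ∫ x in R, f x ⬝ᵥ evV v x := by
  simp_rw [hR.integral_dot hf]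
  exact IsLinearMap.fun_sum fun i _ => (hR.isLinear_mul (hf i)).fun_comp (cP i)

theorem isLinear_ddot (hR : IsRegion R) {f : (Fin d → ℝ) → Fin b → Fin c → ℝ}
    (hf : ∀ i j, IntegrableOn (fun x => f x i j) R) :
    IsLinearMap ℝ fun V : Fin b → Fin c → Pol d => ∫ x in R, ddot (f x) (evM V x) := by
  simp_rw [hR.integral_ddot hf]
  exact IsLinearMap.fun_sum fun i _ => (hR.isLinear_dot (hf i)).fun_comp
    (LinearMap.proj (R := ℝ) (φ := fun _ : Fin b => Fin c → Pol d) i)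

theorem eq_zero_of_integral_sq (hR : IsRegion R) {p : Pol d}
    (h : ∫ x in R, eval x p * eval x p = 0) : p = 0 := by
  have h1 := (setIntegral_eq_zero_iff_of_nonneg_ae
    (Filter.Eventually.of_forall fun x => mul_self_nonneg (eval x p))
    (hR.integrableOn_mul_eval (hR.integrableOn_eval p) p)).1 h
  have h2 : EqOn (fun x => eval x p * eval x p) 0 R :=
    Measure.eqOn_open_of_ae_eq h1 hR.isOpen
      ((continuous_eval p).mul (continuous_eval p)).continuousOn continuousOn_const
  exact eq_zero_of_eval_eq_zero hR.isOpen hR.nonempty fun x hx => mul_self_eq_zero.1 (h2 hx)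

theorem eq_zero_of_integral_dot_self (hR : IsRegion R) {v : Fin c → Pol d}
    (h : ∫ x in R, evV v x ⬝ᵥ evV v x = 0) : v = 0 := by
  rw [hR.integral_dot (f := evV v) fun i => hR.integrableOn_eval (v i)] at h
  have h1 := (Finset.sum_eq_zero_iff_of_nonneg fun i _ =>
    integral_nonneg fun x => mul_self_nonneg (eval x (v i))).1 h
  ext1 i
  exact hR.eq_zero_of_integral_sq (h1 i (Finset.mem_univ i))

theorem eq_zero_of_integral_ddot_self (hR : IsRegion R) {V : Fin b → Fin c → Pol d}
    (h : ∫ x in R, ddot (evM V x) (evM V x) = 0) : V = 0 := by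
  rw [hR.integral_ddot (f := evM V) fun i j => hR.integrableOn_eval (V i j)] at h
  have h1 := (Finset.sum_eq_zero_iff_of_nonneg fun i _ =>
    integral_nonneg fun x => Finset.sum_nonneg fun j _ => mul_self_nonneg (eval x (V i j))).1 h
  ext1 i
  exact hR.eq_zero_of_integral_dot_self (h1 i (Finset.mem_univ i))

theorem ddot_comm (A B : Fin b → Fin c → ℝ) : ddot A B = ddot B A :=
  Finset.sum_congr rfl fun _ _ => dotProduct_comm _ _

theorem exists_repS (hR : IsRegion R) {M : Type*} [AddCommGroup M] [Module ℝ M]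
    [FiniteDimensional ℝ M] (J : M →ₗ[ℝ] Pol d) (hJ : Function.Injective J) {φ : M → ℝ}
    (hφ : IsLinearMap ℝ φ) : ∃ x, ∀ y, ∫ z in R, eval z (J x) * eval z (J y) = φ y :=
  exists_representer J (fun p q => ∫ z in R, eval z p * eval z q)
    (fun p => hR.isLinear_mul (hR.integrableOn_eval p)) (fun p q => by simp_rw [mul_comm])
    (fun x h => (map_eq_zero_iff J hJ).1 (hR.eq_zero_of_integral_sq h)) hφ

theorem exists_repV (hR : IsRegion R) {M : Type*} [AddCommGroup M] [Module ℝ M]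
    [FiniteDimensional ℝ M] (J : M →ₗ[ℝ] (Fin c → Pol d)) (hJ : Function.Injective J)
    {φ : M → ℝ} (hφ : IsLinearMap ℝ φ) :
    ∃ x, ∀ y, ∫ z in R, evV (J x) z ⬝ᵥ evV (J y) z = φ y :=
  exists_representer J (fun p q => ∫ z in R, evV p z ⬝ᵥ evV q z)
    (fun p => hR.isLinear_dot (f := evV p) fun i => hR.integrableOn_eval (p i))
    (fun p q => by simp_rw [dotProduct_comm])
    (fun x h => (map_eq_zero_iff J hJ).1 (hR.eq_zero_of_integral_dot_self h)) hφ

theorem exists_repM (hR : IsRegion R) {M : Type*} [AddCommGroup M] [Module ℝ M]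
    [FiniteDimensional ℝ M] (J : M →ₗ[ℝ] (Fin b → Fin c → Pol d)) (hJ : Function.Injective J)
    {φ : M → ℝ} (hφ : IsLinearMap ℝ φ) :
    ∃ x, ∀ y, ∫ z in R, ddot (evM (J x) z) (evM (J y) z) = φ y :=
  exists_representer J (fun p q => ∫ z in R, ddot (evM p z) (evM q z))
    (fun p => hR.isLinear_ddot fun i j => hR.integrableOn_eval (p i j))
    (fun p q => by simp_rw [ddot_comm])
    (fun x h => (map_eq_zero_iff J hJ).1 (hR.eq_zero_of_integral_ddot_self h)) hφ

theorem projS_spec (hR : IsRegion R) (S : Submodule ℝ (Pol d)) [FiniteDimensional ℝ S]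
    {f : (Fin d → ℝ) → ℝ} (hf : IntegrableOn f R) : ∀ r ∈ S,
    ∫ x in R, eval x (projS R S f).1 * eval x r = ∫ x in R, f x * eval x r := by
  obtain ⟨x, hx⟩ := hR.exists_repS S.subtype S.injective_subtype
    ((hR.isLinear_mul hf).fun_comp S.subtype)
  exact solve_spec (p := fun p : S => ∀ r ∈ S, ∫ x in R, eval x p.1 * eval x r =
    ∫ x in R, f x * eval x r) ⟨x, fun r hr => hx ⟨r, hr⟩⟩

theorem projV_spec (hR : IsRegion R) (S : Submodule ℝ (Fin c → Pol d)) [FiniteDimensional ℝ S]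
    {f : (Fin d → ℝ) → Fin c → ℝ} (hf : ∀ i, IntegrableOn (fun x => f x i) R) : ∀ r ∈ S,
    ∫ x in R, evV (projV R S f).1 x ⬝ᵥ evV r x = ∫ x in R, f x ⬝ᵥ evV r x := by
  obtain ⟨x, hx⟩ := hR.exists_repV S.subtype S.injective_subtype
    ((hR.isLinear_dot hf).fun_comp S.subtype)
  exact solve_spec (p := fun p : S => ∀ r ∈ S, ∫ x in R, evV p.1 x ⬝ᵥ evV r x =
    ∫ x in R, f x ⬝ᵥ evV r x) ⟨x, fun r hr => hx ⟨r, hr⟩⟩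

theorem projM_spec (hR : IsRegion R) (S : Submodule ℝ (Fin b → Fin c → Pol d))
    [FiniteDimensional ℝ S] {f : (Fin d → ℝ) → Fin b → Fin c → ℝ}
    (hf : ∀ i j, IntegrableOn (fun x => f x i j) R) : ∀ r ∈ S,
    ∫ x in R, ddot (evM (projM R S f).1 x) (evM r x) = ∫ x in R, ddot (f x) (evM r x) := by
  obtain ⟨x, hx⟩ := hR.exists_repM S.subtype S.injective_subtype
    ((hR.isLinear_ddot hf).fun_comp S.subtype)
  exact solve_spec (p := fun p : S => ∀ r ∈ S, ∫ x in R, ddot (evM p.1 x) (evM r x) =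
    ∫ x in R, ddot (f x) (evM r x)) ⟨x, fun r hr => hx ⟨r, hr⟩⟩

theorem projS_eq (hR : IsRegion R) (S : Submodule ℝ (Pol d)) [FiniteDimensional ℝ S]
    {f : (Fin d → ℝ) → ℝ} (hf : IntegrableOn f R) (p : S)
    (h : ∀ r ∈ S, ∫ x in R, eval x p.1 * eval x r = ∫ x in R, f x * eval x r) :
    projS R S f = p := by
  have h1 := hR.projS_spec S hf
  have hlin := fun p : Pol d => hR.isLinear_mul (hR.integrableOn_eval p)
  have h2 : ∫ x in R, eval x ((projS R S f).1 - p.1) * eval x ((projS R S f).1 - p.1) = 0 := by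
    have h3 := h1 _ (S.sub_mem (projS R S f).2 p.2)
    rw [← h _ (S.sub_mem (projS R S f).2 p.2)] at h3
    have h4 := (hlin ((projS R S f).1 - p.1)).map_sub (projS R S f).1 p.1
    simp_rw [mul_comm (eval _ ((projS R S f).1 - p.1))] at h4
    simp_rw [mul_comm (eval _ ((projS R S f).1 - p.1))]
    rw [h4, h3, sub_self]
  exact Subtype.ext (sub_eq_zero.1 (hR.eq_zero_of_integral_sq h2))

theorem projV_eq (hR : IsRegion R) (S : Submodule ℝ (Fin c → Pol d)) [FiniteDimensional ℝ S]
    {f : (Fin d → ℝ) → Fin c → ℝ} (hf : ∀ i, IntegrableOn (fun x => f x i) R) (p : S)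
    (h : ∀ r ∈ S, ∫ x in R, evV p.1 x ⬝ᵥ evV r x = ∫ x in R, f x ⬝ᵥ evV r x) :
    projV R S f = p := by
  have h1 := hR.projV_spec S hf
  have hlin := fun p : Fin c → Pol d =>
    hR.isLinear_dot (f := evV p) fun i => hR.integrableOn_eval (p i)
  set q := (projV R S f).1 - p.1 with hq
  have hqS : q ∈ S := S.sub_mem (projV R S f).2 p.2
  have h2 : ∫ x in R, evV q x ⬝ᵥ evV q x = 0 := by
    have h3 := h1 _ hqS
    rw [← h _ hqS] at h3
    have h4 := (hlin q).map_sub (projV R S f).1 p.1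
    simp_rw [dotProduct_comm (evV q _)] at h4 ⊢
    rw [← hq] at h4
    rw [h4, h3, sub_self]
  exact Subtype.ext (sub_eq_zero.1 (hR.eq_zero_of_integral_dot_self h2))

theorem projM_eq (hR : IsRegion R) (S : Submodule ℝ (Fin b → Fin c → Pol d))
    [FiniteDimensional ℝ S] {f : (Fin d → ℝ) → Fin b → Fin c → ℝ}
    (hf : ∀ i j, IntegrableOn (fun x => f x i j) R) (p : S)
    (h : ∀ r ∈ S, ∫ x in R, ddot (evM p.1 x) (evM r x) = ∫ x in R, ddot (f x) (evM r x)) :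
    projM R S f = p := by
  have h1 := hR.projM_spec S hf
  have hlin := fun p : Fin b → Fin c → Pol d =>
    hR.isLinear_ddot (f := evM p) fun i j => hR.integrableOn_eval (p i j)
  set q := (projM R S f).1 - p.1 with hq
  have hqS : q ∈ S := S.sub_mem (projM R S f).2 p.2
  have h2 : ∫ x in R, ddot (evM q x) (evM q x) = 0 := by
    have h3 := h1 _ hqS
    rw [← h _ hqS] at h3
    have h4 := (hlin q).map_sub (projM R S f).1 p.1
    simp_rw [ddot_comm (evM q _)] at h4 ⊢
    rw [← hq] at h4
    rw [h4, h3, sub_self]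
  exact Subtype.ext (sub_eq_zero.1 (hR.eq_zero_of_integral_ddot_self h2))

/-- Projections add up as soon as the projected functions do when tested with `S`. -/
theorem projV_add_eq (hR : IsRegion R) (S : Submodule ℝ (Fin c → Pol d))
    [FiniteDimensional ℝ S] {f g h : (Fin d → ℝ) → Fin c → ℝ}
    (hf : ∀ i, IntegrableOn (fun x => f x i) R) (hg : ∀ i, IntegrableOn (fun x => g x i) R)
    (hh : ∀ i, IntegrableOn (fun x => h x i) R)
    (hfgh : ∀ r ∈ S, (∫ x in R, f x ⬝ᵥ evV r x) + (∫ x in R, g x ⬝ᵥ evV r x) =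
      ∫ x in R, h x ⬝ᵥ evV r x) :
    projV R S f + projV R S g = projV R S h := by
  refine (hR.projV_eq S hh _ fun r hr => ?_).symm
  rw [← hfgh r hr, ← hR.projV_spec S hf r hr, ← hR.projV_spec S hg r hr]
  have hlin := hR.isLinear_dot (f := evV r) fun i => hR.integrableOn_eval (r i)
  have h4 := hlin.map_add (projV R S f).1 (projV R S g).1
  simp_rw [dotProduct_comm (evV r _)] at h4
  exact h4

end IsRegion
end Region

/-! ### Polynomials on edges -/

section EdgePoly

open Polynomial (X C)

theorem EP_mono {m n : ℤ} (h : m ≤ n) : EP m ≤ EP n :=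
  Polynomial.degreeLT_mono (by omega)

theorem mul_mem_EP {m n : ℤ} {p q : Polynomial ℝ} (hp : p ∈ EP m) (hq : q ∈ EP n) :
    p * q ∈ EP (m + n) := by
  by_cases h : p * q = 0
  · rw [h]; exact Submodule.zero_mem _
  have hp0 := left_ne_zero_of_mul h
  have hq0 := right_ne_zero_of_mul h
  unfold EP at *
  rw [Polynomial.mem_degreeLT] at *
  rw [Polynomial.degree_eq_natDegree hp0, Nat.cast_lt] at hp
  rw [Polynomial.degree_eq_natDegree hq0, Nat.cast_lt] at hq
  rw [Polynomial.degree_eq_natDegree h, Polynomial.natDegree_mul hp0 hq0, Nat.cast_lt]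
  omega

theorem C_mem_EP (a : ℝ) : (C a : Polynomial ℝ) ∈ EP 0 := by
  unfold EP
  rw [Polynomial.mem_degreeLT]
  exact Polynomial.degree_C_le.trans_lt (by norm_num)

theorem X_mem_EP : (X : Polynomial ℝ) ∈ EP 1 := by
  unfold EP
  rw [Polynomial.mem_degreeLT, Polynomial.degree_X]
  norm_num

instance finiteDimensional_EP (m : ℤ) : FiniteDimensional ℝ (EP m) :=
  Module.Finite.equiv (Polynomial.degreeLTEquiv ℝ (m + 1).toNat).symm

instance finiteDimensional_EPV (m : ℤ) : FiniteDimensional ℝ (EPV m) :=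
  finiteDimensional_pi _

theorem mem_EPV {m : ℤ} {v : Fin 3 → Polynomial ℝ} : v ∈ EPV m ↔ ∀ i, v i ∈ EP m := by
  simp [EPV, Submodule.mem_pi]

variable {L : ℝ} (hL : 0 < L)
include hL

theorem integrable_mul_eval {f : ℝ → ℝ} (hf : ContinuousOn f (Icc 0 L)) (r : Polynomial ℝ) :
    IntervalIntegrable (fun s => f s * r.eval s) volume 0 L := by
  refine ContinuousOn.intervalIntegrable ?_
  rw [uIcc_of_le hL.le]
  exact hf.mul r.continuous.continuousOn

theorem isLinear_mulE {f : ℝ → ℝ} (hf : ContinuousOn f (Icc 0 L)) :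
    IsLinearMap ℝ fun r : Polynomial ℝ => ∫ s in (0 : ℝ)..L, f s * r.eval s where
  map_add p q := by
    simp only [Polynomial.eval_add, mul_add]
    exact intervalIntegral.integral_add (integrable_mul_eval hL hf p)
      (integrable_mul_eval hL hf q)
  map_smul a p := by
    simp only [Polynomial.eval_smul, smul_eq_mul]
    rw [← intervalIntegral.integral_const_mul]
    exact intervalIntegral.integral_congr fun s _ => by ring

theorem integral_dotE {f : ℝ → Fin 3 → ℝ} (hf : ∀ i, ContinuousOn (fun s => f s i) (Icc 0 L))
    (v : Fin 3 → Polynomial ℝ) : ∫ s in (0 : ℝ)..L, f s ⬝ᵥ evE v s =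
      ∑ i, ∫ s in (0 : ℝ)..L, f s i * (v i).eval s := by
  simp only [dotProduct, evE]
  exact intervalIntegral.integral_finsetSum fun i _ => integrable_mul_eval hL (hf i) (v i)

theorem isLinear_dotE {f : ℝ → Fin 3 → ℝ} (hf : ∀ i, ContinuousOn (fun s => f s i) (Icc 0 L)) :
    IsLinearMap ℝ fun v : Fin 3 → Polynomial ℝ => ∫ s in (0 : ℝ)..L, f s ⬝ᵥ evE v s := by
  simp_rw [integral_dotE hL hf]
  exact IsLinearMap.fun_sum fun i _ => (isLinear_mulE hL (hf i)).fun_comp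
    (LinearMap.proj (R := ℝ) (φ := fun _ : Fin 3 => Polynomial ℝ) i)

theorem eq_zero_of_integral_weight {w : Polynomial ℝ} (hw : ∀ s ∈ Ioo 0 L, 0 < w.eval s)
    {p : Polynomial ℝ} (h : ∫ s in (0 : ℝ)..L, (w * p).eval s * p.eval s = 0) : p = 0 := by
  rw [intervalIntegral.integral_of_le hL.le, integral_Ioc_eq_integral_Ioo] at h
  have hcont : Continuous fun s => (w * p).eval s * p.eval s :=
    (w * p).continuous.mul p.continuous
  have hnn : ∀ s ∈ Ioo 0 L, 0 ≤ (w * p).eval s * p.eval s := fun s hs => by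
    rw [Polynomial.eval_mul, mul_assoc]
    exact mul_nonneg (hw s hs).le (mul_self_nonneg _)
  have h1 := (setIntegral_eq_zero_iff_of_nonneg_ae
    ((ae_restrict_mem measurableSet_Ioo).mono hnn)
    ((hcont.integrableOn_Icc (a := 0) (b := L)).mono_set Ioo_subset_Icc_self)).1 h
  have h2 : EqOn (fun s => (w * p).eval s * p.eval s) 0 (Ioo 0 L) :=
    Measure.eqOn_open_of_ae_eq h1 isOpen_Ioo hcont.continuousOn continuousOn_const
  refine Polynomial.eq_zero_of_infinite_isRoot p ((Ioo_infinite hL).mono fun s hs => ?_)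
  have h3 : (w * p).eval s * p.eval s = 0 := h2 hs
  rw [Polynomial.eval_mul, mul_assoc] at h3
  exact mul_self_eq_zero.1 ((mul_eq_zero.1 h3).resolve_left (hw s hs).ne')

theorem eq_zero_of_integral_dotE {v : Fin 3 → Polynomial ℝ}
    (h : ∫ s in (0 : ℝ)..L, evE v s ⬝ᵥ evE v s = 0) : v = 0 := by
  rw [integral_dotE hL (f := evE v) fun i => (v i).continuous.continuousOn] at h
  have h1 := (Finset.sum_eq_zero_iff_of_nonneg fun i _ =>
    intervalIntegral.integral_nonneg hL.le fun s _ => mul_self_nonneg ((v i).eval s)).1 h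
  ext1 i
  refine eq_zero_of_integral_weight hL (w := 1) (fun s _ => by simp) ?_
  simpa using h1 i (Finset.mem_univ i)

theorem projE_spec (S : Submodule ℝ (Fin 3 → Polynomial ℝ)) [FiniteDimensional ℝ S]
    {f : ℝ → Fin 3 → ℝ} (hf : ∀ i, ContinuousOn (fun s => f s i) (Icc 0 L)) : ∀ r ∈ S,
    ∫ s in (0 : ℝ)..L, evE (projE L S f).1 s ⬝ᵥ evE r s =
      ∫ s in (0 : ℝ)..L, f s ⬝ᵥ evE r s := by
  obtain ⟨x, hx⟩ := exists_representer S.subtype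
    (fun p q => ∫ s in (0 : ℝ)..L, evE p s ⬝ᵥ evE q s)
    (fun p => isLinear_dotE hL (f := evE p) fun i => (p i).continuous.continuousOn)
    (fun p q => by simp_rw [dotProduct_comm])
    (fun x h => Subtype.ext (eq_zero_of_integral_dotE hL h))
    ((isLinear_dotE hL hf).fun_comp S.subtype)
  exact solve_spec (p := fun p : S => ∀ r ∈ S, ∫ s in (0 : ℝ)..L, evE p.1 s ⬝ᵥ evE r s =
    ∫ s in (0 : ℝ)..L, f s ⬝ᵥ evE r s) ⟨x, fun r hr => hx ⟨r, hr⟩⟩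

theorem projE_eq (S : Submodule ℝ (Fin 3 → Polynomial ℝ)) [FiniteDimensional ℝ S]
    {f : ℝ → Fin 3 → ℝ} (hf : ∀ i, ContinuousOn (fun s => f s i) (Icc 0 L)) (p : S)
    (h : ∀ r ∈ S, ∫ s in (0 : ℝ)..L, evE p.1 s ⬝ᵥ evE r s =
      ∫ s in (0 : ℝ)..L, f s ⬝ᵥ evE r s) : projE L S f = p := by
  have h1 := projE_spec hL S hf
  have hlin := fun p : Fin 3 → Polynomial ℝ =>
    isLinear_dotE hL (f := evE p) fun i => (p i).continuous.continuousOn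
  set q := (projE L S f).1 - p.1 with hq
  have hqS : q ∈ S := S.sub_mem (projE L S f).2 p.2
  have h2 : ∫ s in (0 : ℝ)..L, evE q s ⬝ᵥ evE q s = 0 := by
    have h3 := h1 _ hqS
    rw [← h _ hqS] at h3
    have h4 := (hlin q).map_sub (projE L S f).1 p.1
    simp_rw [dotProduct_comm (evE q _)] at h4 ⊢
    rw [← hq] at h4
    rw [h4, h3, sub_self]
  exact Subtype.ext (sub_eq_zero.1 (eq_zero_of_integral_dotE hL h2))

/-- A polynomial of degree `m + 2` is prescribed by its moments of degree `m` and its values at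
the endpoints. -/
theorem exists_edge_interpolant {m n : ℤ} (hm : -1 ≤ m) (hn : n = m + 2) {f : ℝ → ℝ}
    (hf : ContinuousOn f (Icc 0 L)) (a b : ℝ) : ∃ p ∈ EP n,
      (∀ r ∈ EP m, ∫ s in (0 : ℝ)..L, p.eval s * r.eval s = ∫ s in (0 : ℝ)..L, f s * r.eval s) ∧
      p.eval 0 = a ∧ p.eval L = b := by
  subst hn
  -- the linear interpolant `ℓ` of the endpoint values, corrected by a multiple of the bubble `w`
  set ℓ : Polynomial ℝ := C a + C ((b - a) / L) * X with hℓ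
  set w : Polynomial ℝ := X * (C L - X) with hw
  have hℓm : ℓ ∈ EP (m + 2) := by
    refine EP_mono (by linarith) (Submodule.add_mem _ (EP_mono zero_le_one (C_mem_EP a)) ?_)
    have := mul_mem_EP (C_mem_EP ((b - a) / L)) X_mem_EP
    rwa [zero_add] at this
  have hwm : w ∈ EP 2 := by
    have := mul_mem_EP X_mem_EP (Submodule.sub_mem _ (EP_mono zero_le_one (C_mem_EP L)) X_mem_EP)
    norm_num at this
    exact this
  have hwpos : ∀ s ∈ Ioo 0 L, 0 < w.eval s := fun s hs => by
    simp only [hw, Polynomial.eval_mul, Polynomial.eval_X, Polynomial.eval_sub,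
      Polynomial.eval_C]
    exact mul_pos hs.1 (sub_pos.2 hs.2)
  have hlin : ∀ p : Polynomial ℝ, IsLinearMap ℝ fun q : Polynomial ℝ =>
      ∫ s in (0 : ℝ)..L, (w * p).eval s * q.eval s := fun p =>
    isLinear_mulE hL (f := fun s => (w * p).eval s) (w * p).continuous.continuousOn
  obtain ⟨r₀, hr₀⟩ := exists_representer (EP m).subtype
    (fun p q => ∫ s in (0 : ℝ)..L, (w * p).eval s * q.eval s) hlin
    (fun p q => intervalIntegral.integral_congr fun s _ => by
      simp only [Polynomial.eval_mul]; ring)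
    (fun x h => Subtype.ext (eq_zero_of_integral_weight hL hwpos h))
    (((isLinear_mulE hL hf).fun_sub (isLinear_mulE hL (f := fun s => ℓ.eval s)
      ℓ.continuous.continuousOn)).fun_comp (EP m).subtype)
  refine ⟨ℓ + w * r₀.1, Submodule.add_mem _ hℓm ?_, fun r hr => ?_, ?_, ?_⟩
  · rw [add_comm m 2]
    exact mul_mem_EP hwm r₀.2
  · have h1 := hr₀ ⟨r, hr⟩
    simp only [Submodule.subtype_apply] at h1
    simp only [Polynomial.eval_add, add_mul]
    rw [intervalIntegral.integral_add
      (integrable_mul_eval hL (f := fun s => ℓ.eval s) ℓ.continuous.continuousOn r)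
      (integrable_mul_eval hL (f := fun s => (w * r₀.1).eval s)
        (w * r₀.1).continuous.continuousOn r), h1]
    ring
  · simp [hℓ, hw]
  · simp only [hℓ, hw, Polynomial.eval_add, Polynomial.eval_mul, Polynomial.eval_C,
      Polynomial.eval_X, Polynomial.eval_sub, sub_self, mul_zero, zero_mul, add_zero]
    field_simp
    ring

end EdgePoly

/-! ### Interpolation on edges -/

namespace Cell

variable (K : Cell)

theorem len_pos (e : Fin K.nE) : 0 < K.len e := by
  unfold len
  apply Real.sqrt_pos.2
  have h1 : K.vert (K.tgt e) - K.vert (K.src e) ≠ 0 :=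
    sub_ne_zero.2 fun h => K.src_ne_tgt e (K.vert_injective h).symm
  have h2 : 0 ≤ (K.vert (K.tgt e) - K.vert (K.src e)) ⬝ᵥ (K.vert (K.tgt e) - K.vert (K.src e)) :=
    Finset.sum_nonneg fun i _ => mul_self_nonneg _
  exact lt_of_le_of_ne h2 fun h => h1 (dotProduct_self_eq_zero.1 h.symm)

theorem len_sq (e : Fin K.nE) : K.len e * K.len e =
    (K.vert (K.tgt e) - K.vert (K.src e)) ⬝ᵥ (K.vert (K.tgt e) - K.vert (K.src e)) :=
  Real.mul_self_sqrt (Finset.sum_nonneg fun _ _ => mul_self_nonneg _)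

theorem tE_unit (e : Fin K.nE) : K.tE e ⬝ᵥ K.tE e = 1 := by
  have := (K.len_pos e).ne'
  rw [tE, smul_dotProduct, dotProduct_smul, ← K.len_sq, smul_eq_mul, smul_eq_mul]
  field_simp

theorem edgePt_zero (e : Fin K.nE) : K.edgePt e 0 = K.vert (K.src e) := by
  simp [edgePt]

theorem edgePt_len (e : Fin K.nE) : K.edgePt e (K.len e) = K.vert (K.tgt e) := by
  rw [edgePt, tE, smul_smul, mul_inv_cancel₀ (K.len_pos e).ne', one_smul, add_sub_cancel]

theorem continuous_edgePt (e : Fin K.nE) : Continuous (K.edgePt e) := by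
  unfold edgePt
  fun_prop

theorem exists_EPC {m n : ℤ} (hm : -1 ≤ m) (hn : n = m + 2) {f : Fin K.nE → ℝ → ℝ}
    (hf : ∀ e, ContinuousOn (f e) (Icc 0 (K.len e))) (c : Fin K.nV → ℝ) :
    ∃ p : K.EPC n, (∀ e, ∀ r ∈ EP m, K.intE e (fun s => (p.1 e).eval s * r.eval s) =
        K.intE e fun s => f e s * r.eval s) ∧
      ∀ e, (p.1 e).eval 0 = c (K.src e) ∧ (p.1 e).eval (K.len e) = c (K.tgt e) := by
  choose p hp hmom h0 h1 using fun e =>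
    exists_edge_interpolant (K.len_pos e) hm hn (hf e) (c (K.src e)) (c (K.tgt e))
  exact ⟨⟨p, hp, c, fun e => ⟨h0 e, h1 e⟩⟩, hmom, fun e => ⟨h0 e, h1 e⟩⟩

theorem mem_EPCV {n : ℤ} {p : Fin K.nE → Fin 3 → Polynomial ℝ} :
    p ∈ K.EPCV n ↔ ∀ i, (fun e => p e i) ∈ K.EPC n := by
  rw [EPCV, Submodule.mem_iInf]
  rfl

theorem exists_EPCV {m n : ℤ} (hm : -1 ≤ m) (hn : n = m + 2) {f : Fin K.nE → ℝ → R3}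
    (hf : ∀ e i, ContinuousOn (fun s => f e s i) (Icc 0 (K.len e))) (c : Fin K.nV → R3) :
    ∃ p : K.EPCV n, (∀ e, ∀ r ∈ EPV m, K.intE e (fun s => evE (p.1 e) s ⬝ᵥ evE r s) =
        K.intE e fun s => f e s ⬝ᵥ evE r s) ∧
      ∀ e, evE (p.1 e) 0 = c (K.src e) ∧ evE (p.1 e) (K.len e) = c (K.tgt e) := by
  choose p hmom hend using fun i => K.exists_EPC hm hn (fun e => hf e i) fun v => c v i
  refine ⟨⟨fun e i => (p i).1 e, K.mem_EPCV.2 fun i => (p i).2⟩, fun e r hr => ?_,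
    fun e => ⟨funext fun i => (hend i e).1, funext fun i => (hend i e).2⟩⟩
  have h1 := integral_dotE (K.len_pos e) (f := evE fun i => (p i).1 e)
    (fun i => ((p i).1 e).continuous.continuousOn) r
  have h2 := integral_dotE (K.len_pos e) (hf e) r
  refine h1.trans (Eq.trans ?_ h2.symm)
  exact Finset.sum_congr rfl fun i _ => hmom i e (r i) (mem_EPV.1 hr i)

/-- Integration by parts along an edge against a polynomial, for a polynomial with prescribed
moments and prescribed values at the endpoints. -/
theorem intE_derivative {m : ℤ} (e : Fin K.nE) {p : Polynomial ℝ} {f f' : ℝ → ℝ}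
    (hf : ContinuousOn f (Icc 0 (K.len e)))
    (hf' : ContinuousOn f' (Icc 0 (K.len e)))
    (hd : ∀ s ∈ Ioo 0 (K.len e), HasDerivAt f (f' s) s)
    (hmom : ∀ r ∈ EP m, K.intE e (fun s => p.eval s * r.eval s) =
      K.intE e fun s => f s * r.eval s)
    (h0 : p.eval 0 = f 0) (h1 : p.eval (K.len e) = f (K.len e))
    {r : Polynomial ℝ} (hr : Polynomial.derivative r ∈ EP m) :
    K.intE e (fun s => (Polynomial.derivative p).eval s * r.eval s) =
      K.intE e fun s => f' s * r.eval s := by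
  have key : ∀ g g' : ℝ → ℝ, ContinuousOn g (Icc 0 (K.len e)) →
      ContinuousOn g' (Icc 0 (K.len e)) → (∀ s ∈ Ioo 0 (K.len e), HasDerivAt g (g' s) s) →
      K.intE e (fun s => g' s * r.eval s) = g (K.len e) * r.eval (K.len e) - g 0 * r.eval 0 -
        K.intE e (fun s => g s * (Polynomial.derivative r).eval s) := by
    intro g g' hg hg' hd
    have i1 := integrable_mul_eval (K.len_pos e) hg' r
    have i2 := integrable_mul_eval (K.len_pos e) hg (Polynomial.derivative r)
    have := intervalIntegral.integral_eq_sub_of_hasDerivAt_of_le (K.len_pos e).le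
      (f := fun s => g s * r.eval s)
      (f' := fun s => g' s * r.eval s + g s * (Polynomial.derivative r).eval s)
      (hg.mul r.continuous.continuousOn) (fun s hs => (hd s hs).mul (r.hasDerivAt s))
      (i1.add i2)
    rw [intervalIntegral.integral_add i1 i2] at this
    unfold intE
    linarith
  rw [key _ _ hf hf' hd, key (fun s => p.eval s) (fun s => (Polynomial.derivative p).eval s)
    p.continuous.continuousOn (Polynomial.derivative p).continuous.continuousOn
    fun s _ => p.hasDerivAt s, h0, h1, hmom _ hr]

end Cell

/-! ### Frames of the faces -/

/-- A convex open set lies strictly on one side of a hyperplane through a boundary point if it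
misses the hyperplane near that point. -/
theorem one_side {E : Type*} [NormedAddCommGroup E] [NormedSpace ℝ E] {T : Set E} (ho : IsOpen T)
    (hc : Convex ℝ T) (ℓ : E →L[ℝ] ℝ) {p : E} (hp : p ∈ closure T)
    (hloc : ∀ᶠ x in nhds p, ℓ x = ℓ p → x ∉ T) :
    (∀ x ∈ T, ℓ x < ℓ p) ∨ (∀ x ∈ T, ℓ p < ℓ x) := by
  have hne : ∀ x ∈ T, ℓ x ≠ ℓ p := by
    intro x hx heq
    have hcont : ContinuousAt (fun t : ℝ => p + t • (x - p)) 0 := by fun_prop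
    have h1 : ∀ᶠ t in nhds (0 : ℝ), ℓ (p + t • (x - p)) = ℓ p → p + t • (x - p) ∉ T := by
      have : nhds p = nhds ((fun t : ℝ => p + t • (x - p)) 0) := by simp
      rw [this] at hloc
      exact hcont.eventually hloc
    have h2 : ∀ᶠ t in nhdsWithin (0 : ℝ) (Ioi 0), p + t • (x - p) ∉ T ∧ t < 1 ∧ 0 < t := by
      filter_upwards [nhdsWithin_le_nhds h1, nhdsWithin_le_nhds (gt_mem_nhds one_pos),
        self_mem_nhdsWithin] with t ht ht1 ht0
      exact ⟨ht (by simp [heq]), ht1, ht0⟩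
    obtain ⟨t, ht, ht1, ht0⟩ := h2.exists
    have h3 := hc.openSegment_closure_interior_subset_interior hp (ho.interior_eq.symm ▸ hx)
    rw [ho.interior_eq] at h3
    refine ht (h3 ⟨1 - t, t, by linarith, ht0, by ring, ?_⟩)
    module
  by_contra! hcon
  obtain ⟨⟨a, ha, hpa⟩, ⟨b, hb, hbp⟩⟩ := hcon
  obtain ⟨x, hx, hxp⟩ := hc.isPreconnected.intermediate_value hb ha ℓ.continuous.continuousOn
    ⟨hbp, hpa⟩
  exact hne x hx hxp

theorem measurePreserving_mulVec {n : ℕ} {N : Matrix (Fin n) (Fin n) ℝ} (hN : Nᵀ * N = 1) :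
    MeasurePreserving (fun v : Fin n → ℝ => N *ᵥ v) volume volume := by
  have hdet : N.det * N.det = 1 := by
    have := congrArg Matrix.det hN
    rwa [Matrix.det_mul, Matrix.det_transpose, Matrix.det_one] at this
  have h0 : N.det ≠ 0 := left_ne_zero_of_mul_eq_one hdet
  have habs : |N.det⁻¹| = 1 := by
    have h1 : |N.det| * |N.det| = 1 := by rw [← abs_mul, hdet, abs_one]
    have h2 : |N.det| = 1 := by nlinarith [abs_nonneg N.det]
    rw [abs_inv, h2, inv_one]
  refine ⟨(Matrix.mulVecLin N).continuous_of_finiteDimensional.measurable, ?_⟩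
  have := Real.map_matrix_volume_pi_eq_smul_volume_pi h0
  rw [habs, ENNReal.ofReal_one, one_smul] at this
  exact this

namespace Cell

variable (K : Cell)

section Frame

variable (f : Fin K.nF)

theorem nrm_tan1 : K.nrm f ⬝ᵥ K.tan1 f = 0 := by rw [dotProduct_comm, K.tan1_nrm]

theorem frame_zero : K.frame f 0 = K.tan1 f := rfl
theorem frame_one : K.frame f 1 = K.nrm f ⨯₃ K.tan1 f := rfl
theorem frame_dot (i j : Fin 3) : K.frame f i ⬝ᵥ K.frame f j = if i = j then 1 else 0 := by
  have h1 := K.nrm_unit f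
  have h2 := K.tan1_unit f
  have h3 := K.tan1_nrm f
  have h4 := K.nrm_tan1 f
  have hx : (K.nrm f ⨯₃ K.tan1 f) ⬝ᵥ (K.nrm f ⨯₃ K.tan1 f) = 1 := by
    rw [cross_dot_cross, h1, h2, h3, h4]
    norm_num
  have ha : (K.nrm f ⨯₃ K.tan1 f) ⬝ᵥ K.tan1 f = 0 := by
    rw [dotProduct_comm]; exact dot_cross_self _ _
  have hb : (K.nrm f ⨯₃ K.tan1 f) ⬝ᵥ K.nrm f = 0 := by
    rw [dotProduct_comm]; exact dot_self_cross _ _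
  have ha' := dot_cross_self (K.nrm f) (K.tan1 f)
  have hb' := dot_self_cross (K.nrm f) (K.tan1 f)
  fin_cases i <;> fin_cases j <;> simp [frame, *]

/-- The orthogonal matrix whose rows are the vectors of the frame of a face. -/
def frameMat : Matrix (Fin 3) (Fin 3) ℝ := Matrix.of (K.frame f)

theorem frameMat_mul_transpose : K.frameMat f * (K.frameMat f)ᵀ = 1 := by
  ext i j
  rw [Matrix.mul_apply', Matrix.one_apply]
  exact K.frame_dot f i j

theorem transpose_mul_frameMat : (K.frameMat f)ᵀ * K.frameMat f = 1 :=
  mul_eq_one_comm.1 (K.frameMat_mul_transpose f)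

theorem comps_eq (v : R3) : K.comps f v = K.frameMat f *ᵥ v := by
  ext i
  exact dotProduct_comm _ _

theorem comps_dot (u v : R3) : K.comps f u ⬝ᵥ K.comps f v = u ⬝ᵥ v := by
  rw [comps_eq, comps_eq, Matrix.dotProduct_mulVec, ← Matrix.mulVec_transpose,
    Matrix.mulVec_mulVec, transpose_mul_frameMat, Matrix.one_mulVec]

theorem eq_sum_comps (v : R3) : v = ∑ i, K.comps f v i • K.frame f i := by
  have h : v = (K.frameMat f)ᵀ *ᵥ K.comps f v := by
    rw [comps_eq, Matrix.mulVec_mulVec, transpose_mul_frameMat, Matrix.one_mulVec]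
  conv_lhs => rw [h]
  ext j
  simp only [Matrix.mulVec, dotProduct, Finset.sum_apply, Pi.smul_apply, smul_eq_mul]
  exact Finset.sum_congr rfl fun i _ => mul_comm _ _

theorem tang_add (u v : R3) : K.tang f (u + v) = K.tang f u + K.tang f v := by
  ext i; exact add_dotProduct u v (K.frame f i.castSucc)

theorem tang_sub (u v : R3) : K.tang f (u - v) = K.tang f u - K.tang f v := by
  ext i; exact sub_dotProduct u v (K.frame f i.castSucc)

theorem tang_smul (a : ℝ) (v : R3) : K.tang f (a • v) = a • K.tang f v := by
  ext i; exact smul_dotProduct a v (K.frame f i.castSucc)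

theorem continuous_tang : Continuous (K.tang f) := by
  unfold tang comps dotProduct
  fun_prop

/-- The dot product in terms of tangential and normal parts. -/
theorem dot_eq (u v : R3) :
    u ⬝ᵥ v = K.tang f u ⬝ᵥ K.tang f v + (u ⬝ᵥ K.nrm f) * (v ⬝ᵥ K.nrm f) := by
  rw [← K.comps_dot f u v]
  exact Fin.sum_univ_castSucc fun i => K.comps f u i * K.comps f v i

theorem tang_frame (i j : Fin 2) :
    K.tang f (K.frame f i.castSucc) j = if i = j then 1 else 0 := by
  rw [tang, comps, K.frame_dot]
  simp

theorem tang_nrm : K.tang f (K.nrm f) = 0 := by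
  ext i
  change K.frame f 2 ⬝ᵥ K.frame f i.castSucc = 0
  rw [K.frame_dot]
  fin_cases i <;> simp

theorem frame_castSucc_nrm (i : Fin 2) : K.frame f i.castSucc ⬝ᵥ K.nrm f = 0 := by
  change K.frame f i.castSucc ⬝ᵥ K.frame f 2 = 0
  rw [K.frame_dot]
  fin_cases i <;> simp

theorem faceMap_sub (y : Fin 2 → ℝ) :
    K.faceMap f y - K.xF f = ∑ i : Fin 2, y i • K.frame f i.castSucc := by
  rw [faceMap, add_sub_cancel_left]

theorem tang_sum (y : Fin 2 → ℝ) : K.tang f (∑ i : Fin 2, y i • K.frame f i.castSucc) = y := by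
  ext j
  rw [Fin.sum_univ_two, tang_add, tang_smul, tang_smul]
  simp only [Pi.add_apply, Pi.smul_apply, smul_eq_mul, tang_frame]
  fin_cases j <;> simp

theorem tang_faceMap (y : Fin 2 → ℝ) : K.tang f (K.faceMap f y - K.xF f) = y := by
  rw [faceMap_sub, tang_sum]

theorem faceMap_nrm (y : Fin 2 → ℝ) : (K.faceMap f y - K.xF f) ⬝ᵥ K.nrm f = 0 := by
  rw [faceMap_sub, sum_dotProduct]
  exact Finset.sum_eq_zero fun i _ => by rw [smul_dotProduct, frame_castSucc_nrm, smul_zero]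

theorem eq_tang_add (v : R3) :
    v = ∑ i : Fin 2, K.tang f v i • K.frame f i.castSucc + (v ⬝ᵥ K.nrm f) • K.nrm f := by
  conv_lhs => rw [K.eq_sum_comps f v]
  rw [Fin.sum_univ_castSucc]
  rfl

theorem faceMap_tang {x : R3} (hx : (x - K.xF f) ⬝ᵥ K.nrm f = 0) :
    K.faceMap f (K.tang f (x - K.xF f)) = x := by
  have h := K.eq_tang_add f (x - K.xF f)
  rw [hx, zero_smul, add_zero] at h
  rw [faceMap, ← h, add_sub_cancel]

theorem continuous_faceMap : Continuous (K.faceMap f) := by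
  unfold faceMap
  fun_prop

end Frame

/-! ### The cell as a polytope -/

section FacePolytope

variable (f : Fin K.nF)

theorem face_plane {x : R3} (hx : x ∈ K.face f) : (x - K.xF f) ⬝ᵥ K.nrm f = 0 := by
  obtain ⟨U, -, hU⟩ := K.face_open f
  rw [hU] at hx
  exact hx.2

theorem closure_face_plane {x : R3} (hx : x ∈ closure (K.face f)) :
    (x - K.xF f) ⬝ᵥ K.nrm f = 0 := by
  have hcl : IsClosed {x : R3 | (x - K.xF f) ⬝ᵥ K.nrm f = 0} := by
    refine isClosed_eq ?_ continuous_const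
    unfold dotProduct
    fun_prop
  exact closure_minimal (fun x hx => K.face_plane f hx) hcl hx

theorem mem_closure_faceReg {y : Fin 2 → ℝ} :
    y ∈ closure (K.faceReg f) ↔ K.faceMap f y ∈ closure (K.face f) := by
  constructor
  · intro hy
    have := image_closure_subset_closure_image (K.continuous_faceMap f) (mem_image_of_mem _ hy)
    exact closure_mono (image_preimage_subset _ _) this
  · intro hy
    have hc : Continuous fun x => K.tang f (x - K.xF f) :=
      (K.continuous_tang f).comp (continuous_id.sub continuous_const)
    have := image_closure_subset_closure_image hc (mem_image_of_mem _ hy)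
    simp only [tang_faceMap] at this
    refine closure_mono ?_ this
    rintro _ ⟨x, hx, rfl⟩
    change K.faceMap f _ ∈ K.face f
    rwa [K.faceMap_tang f (K.face_plane f hx)]

theorem closure_face_subset : closure (K.face f) ⊆ frontier K.T := by
  rw [K.frontier_T]
  exact subset_iUnion (fun f => closure (K.face f)) f

theorem faceMap_mem_closure_T {y : Fin 2 → ℝ} (hy : y ∈ closure (K.faceReg f)) :
    K.faceMap f y ∈ closure K.T :=
  frontier_subset_closure (K.closure_face_subset f ((K.mem_closure_faceReg f).1 hy))

theorem isOpen_faceReg : IsOpen (K.faceReg f) := by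
  obtain ⟨U, hU, hUf⟩ := K.face_open f
  have : K.faceReg f = K.faceMap f ⁻¹' U := by
    ext y
    rw [faceReg, hUf]
    exact and_iff_left (K.faceMap_nrm f y)
  rw [this]
  exact hU.preimage (K.continuous_faceMap f)

theorem convex_faceReg : Convex ℝ (K.faceReg f) := by
  intro y hy z hz a b ha hb hab
  have h := K.convex_face f hy hz ha hb hab
  change K.faceMap f _ ∈ K.face f
  have heq : K.faceMap f (a • y + b • z) = a • K.faceMap f y + b • K.faceMap f z := by
    have hx : K.xF f = a • K.xF f + b • K.xF f := by rw [← add_smul, hab, one_smul]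
    simp only [faceMap, Fin.sum_univ_two, Pi.add_apply, Pi.smul_apply, smul_eq_mul, add_smul,
      smul_add, mul_smul]
    conv_lhs => rw [hx]
    abel
  rw [heq]
  exact h

theorem isRegion_T : IsRegion K.T := ⟨K.isOpen_T, K.bounded_T, ⟨K.xT, K.xT_mem⟩⟩

theorem isRegion_faceReg : IsRegion (K.faceReg f) := by
  refine ⟨K.isOpen_faceReg f, ?_, ⟨0, ?_⟩⟩
  · have h1 : IsCompact ((fun x => K.tang f (x - K.xF f)) '' closure K.T) :=
      K.bounded_T.isCompact_closure.image
        ((K.continuous_tang f).comp (continuous_id.sub continuous_const))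
    refine h1.isBounded.subset fun y hy => ?_
    exact ⟨_, K.faceMap_mem_closure_T f (subset_closure hy), K.tang_faceMap f y⟩
  · change K.faceMap f 0 ∈ K.face f
    have : K.faceMap f 0 = K.xF f := by simp [faceMap]
    rw [this]
    exact K.xF_mem f

theorem omT_sq : K.omT f * K.omT f = 1 := by
  unfold omT
  split_ifs <;> norm_num

/-- Linear functional `x ↦ x · u`. -/
def dotCLM {n : ℕ} (u : Fin n → ℝ) : (Fin n → ℝ) →L[ℝ] ℝ :=
  ∑ i, u i • ContinuousLinearMap.proj i

theorem dotCLM_apply {n : ℕ} (u x : Fin n → ℝ) : dotCLM u x = x ⬝ᵥ u := by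
  simp [dotCLM, dotProduct, mul_comm]

/-- The sign `ω_TF` is the right one: `ω_TF n_F` points out of the cell. Near `x_F` the plane of the
face lies in the boundary, so the convex set `T` is on one side of it. -/
theorem omT_neg {x : R3} (hx : x ∈ K.T) : K.omT f * ((x - K.xF f) ⬝ᵥ K.nrm f) < 0 := by
  have hxF : K.xF f ∈ frontier K.T := K.closure_face_subset f (subset_closure (K.xF_mem f))
  have hloc : ∀ᶠ x in nhds (K.xF f),
      dotCLM (K.nrm f) x = dotCLM (K.nrm f) (K.xF f) → x ∉ K.T := by
    obtain ⟨U, hU, hUf⟩ := K.face_open f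
    have hxU : K.xF f ∈ U := by
      have := K.xF_mem f
      rw [hUf] at this
      exact this.1
    filter_upwards [hU.mem_nhds hxU] with z hz heq hzT
    have hzf : z ∈ K.face f := by
      rw [hUf]
      refine ⟨hz, ?_⟩
      rw [dotCLM_apply, dotCLM_apply] at heq
      change (z - K.xF f) ⬝ᵥ K.nrm f = 0
      rw [sub_dotProduct, heq, sub_self]
    exact (K.isOpen_T.inter_frontier_eq.subset
      ⟨hzT, K.closure_face_subset f (subset_closure hzf)⟩ : z ∈ (∅ : Set R3))
  have h := one_side K.isOpen_T K.convex_T (dotCLM (K.nrm f)) (frontier_subset_closure hxF) hloc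
  simp only [dotCLM_apply] at h
  rcases h with h | h
  · have hom : K.omT f = 1 := if_pos fun z hz => by
      rw [sub_dotProduct]
      linarith [h z hz]
    rw [hom, one_mul, sub_dotProduct]
    linarith [h x hx]
  · have hom : K.omT f = -1 := if_neg fun hall => by
      have := hall K.xT K.xT_mem
      rw [sub_dotProduct] at this
      linarith [h K.xT K.xT_mem]
    rw [hom, sub_dotProduct]
    linarith [h x hx]

/-- Orthogonal coordinates `(r, y) ↦ r ω_TF n_F + ∑ᵢ yᵢ nᵢ` attached to a face. -/
def faceEquiv : (ℝ × (Fin 2 → ℝ)) ≃L[ℝ] R3 :=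
  LinearEquiv.toContinuousLinearEquiv
    { toFun := fun z => (z.1 * K.omT f) • K.nrm f + ∑ i : Fin 2, z.2 i • K.frame f i.castSucc
      invFun := fun x => (K.omT f * (x ⬝ᵥ K.nrm f), K.tang f x)
      map_add' := fun z w => by
        simp only [Prod.fst_add, Prod.snd_add, Pi.add_apply, add_mul, add_smul,
          Finset.sum_add_distrib]
        abel
      map_smul' := fun a z => by
        simp only [Prod.smul_fst, Prod.smul_snd, Pi.smul_apply, smul_eq_mul, mul_smul,
          Finset.smul_sum, smul_add, RingHom.id_apply]
      left_inv := fun z => by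
        ext1
        · simp only [add_dotProduct, smul_dotProduct, sum_dotProduct, frame_castSucc_nrm,
            K.nrm_unit, smul_eq_mul, mul_zero, Finset.sum_const_zero, add_zero, mul_one]
          rw [mul_left_comm, K.omT_sq, mul_one]
        · change K.tang f (_ + _) = z.2
          rw [tang_add, tang_smul, tang_nrm, smul_zero, zero_add, tang_sum]
      right_inv := fun x => by
        simp only
        rw [mul_right_comm, K.omT_sq, one_mul, add_comm]
        exact (K.eq_tang_add f x).symm }

theorem faceEquiv_apply (r : ℝ) (y : Fin 2 → ℝ) : K.faceEquiv f (r, y) =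
    (r * K.omT f) • K.nrm f + ∑ i : Fin 2, y i • K.frame f i.castSucc := rfl

theorem faceEquiv_symm_fst (x : R3) :
    ((K.faceEquiv f).symm x).1 = K.omT f * (x ⬝ᵥ K.nrm f) := rfl

theorem hyperPt_faceEquiv (y : Fin 2 → ℝ) :
    hyperPt (K.faceEquiv f) (K.xF f) y = K.faceMap f y := by
  rw [hyperPt, faceEquiv_apply, zero_mul, zero_smul, zero_add, faceMap]

theorem measurePreserving_faceEquiv :
    MeasurePreserving (K.faceEquiv f) ((volume : Measure ℝ).prod volume) volume := by
  set N : Matrix (Fin 3) (Fin 3) ℝ := Matrix.of fun i j =>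
    (Fin.cons (K.omT f • K.nrm f) (fun l : Fin 2 => K.frame f l.castSucc) : Fin 3 → R3) j i with hN
  have hNN : Nᵀ * N = 1 := by
    ext i j
    rw [Matrix.mul_apply']
    have h : ∀ j, (fun i => N i j) = (Fin.cons (K.omT f • K.nrm f)
      (fun l : Fin 2 => K.frame f l.castSucc) : Fin 3 → R3) j := fun j => rfl
    rw [h]
    change (fun l => N l i) ⬝ᵥ _ = _
    rw [h]
    refine Fin.cases ?_ (fun i => ?_) i <;> refine Fin.cases ?_ (fun j => ?_) j
    · simp only [Fin.cons_zero, smul_dotProduct, dotProduct_smul, K.nrm_unit, smul_eq_mul,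
        mul_one, K.omT_sq, Matrix.one_apply_eq]
    · rw [Fin.cons_zero, Fin.cons_succ, smul_dotProduct, dotProduct_comm, frame_castSucc_nrm,
        smul_zero, Matrix.one_apply_ne (Fin.succ_ne_zero j).symm]
    · rw [Fin.cons_zero, Fin.cons_succ, dotProduct_smul, frame_castSucc_nrm,
        smul_zero, Matrix.one_apply_ne (Fin.succ_ne_zero i)]
    · rw [Fin.cons_succ, Fin.cons_succ, frame_dot, Matrix.one_apply]
      simp
  have h1 := (volume_preserving_piFinSuccAbove (fun _ : Fin 3 => ℝ) 0).symm
  have h2 := (measurePreserving_mulVec hNN).comp h1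
  convert h2 using 1
  · ext1 z
    obtain ⟨r, y⟩ := z
    rw [faceEquiv_apply]
    ext i
    change _ = ∑ j, N i j * (Fin.insertNth (α := fun _ => ℝ) 0 r y : Fin 3 → ℝ) j
    rw [Fin.insertNth_zero', Fin.sum_univ_three, Fin.sum_univ_two]
    change (r * K.omT f) * K.nrm f i + (y 0 * K.frame f 0 i + y 1 * K.frame f 1 i) =
      (K.omT f * K.nrm f i) * r + K.frame f 0 i * y 0 + K.frame f 1 i * y 1
    ring
  · rfl

theorem isPolytope_T : IsPolytope (volume : Measure (Fin 2 → ℝ)) Finset.univ K.T K.faceEquiv K.xF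
    K.faceReg where
  isOpen := K.isOpen_T
  convex := K.convex_T
  bounded := K.bounded_T
  nonempty := ⟨K.xT, K.xT_mem⟩
  meas f _ := (K.isOpen_faceReg f).measurableSet
  null f _ := by
    have := (K.convex_faceReg f).addHaar_frontier volume
    rwa [frontier, (K.isOpen_faceReg f).interior_eq] at this
  neg f _ x hx := by
    rw [faceEquiv_symm_fst]
    exact K.omT_neg f hx
  facet f _ y hy := by
    rw [hyperPt_faceEquiv]
    exact K.closure_face_subset f (subset_closure hy)
  disj f _ g _ hfg y hy z hz := by
    rw [hyperPt_faceEquiv, hyperPt_faceEquiv]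
    intro h
    have hz' : K.faceMap g z ∈ K.face g := hz
    exact Set.disjoint_left.1 (K.faces_disjoint hfg) hy (h ▸ hz')
  cover x hx := by
    rw [K.frontier_T, mem_iUnion] at hx
    obtain ⟨f, hf⟩ := hx
    refine ⟨f, Finset.mem_univ _, K.tang f (x - K.xF f), ?_, ?_⟩
    · rw [mem_closure_faceReg, K.faceMap_tang f (K.closure_face_plane f hf)]
      exact hf
    · rw [hyperPt_faceEquiv, K.faceMap_tang f (K.closure_face_plane f hf)]

end FacePolytope
end Cell

/-! ### Edges, and faces as planar polytopes -/

/-- Coordinates `(r, s) ↦ r ω τ^⊥ + s τ` of the plane, for a unit vector `τ = (a, b)` and a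
sign `ω`. -/
def planeEquiv (ω a b : ℝ) (hω : ω * ω = 1) (h : a * a + b * b = 1) :
    (ℝ × ℝ) ≃L[ℝ] (Fin 2 → ℝ) :=
  LinearEquiv.toContinuousLinearEquiv
    { toFun := fun z => ![-(z.1 * ω * b) + z.2 * a, z.1 * ω * a + z.2 * b]
      invFun := fun x => (ω * (-(x 0 * b) + x 1 * a), x 0 * a + x 1 * b)
      map_add' := fun z w => by
        ext i
        fin_cases i <;> simp <;> ring
      map_smul' := fun c z => by
        ext i
        fin_cases i <;> simp <;> ring
      left_inv := fun z => by
        ext1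
        · change ω * (-((-(z.1 * ω * b) + z.2 * a) * b) + (z.1 * ω * a + z.2 * b) * a) = z.1
          linear_combination z.1 * ω * ω * h + z.1 * hω
        · change (-(z.1 * ω * b) + z.2 * a) * a + (z.1 * ω * a + z.2 * b) * b = z.2
          linear_combination z.2 * h
      right_inv := fun x => by
        ext i
        fin_cases i
        · change -(ω * (-(x 0 * b) + x 1 * a) * ω * b) + (x 0 * a + x 1 * b) * a = x 0
          linear_combination -(-(x 0 * b) + x 1 * a) * b * hω + x 0 * h
        · change ω * (-(x 0 * b) + x 1 * a) * ω * a + (x 0 * a + x 1 * b) * b = x 1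
          linear_combination (-(x 0 * b) + x 1 * a) * a * hω + x 1 * h }

theorem planeEquiv_apply {ω a b : ℝ} (hω : ω * ω = 1) (h : a * a + b * b = 1) (r s : ℝ) :
    planeEquiv ω a b hω h (r, s) = ![-(r * ω * b) + s * a, r * ω * a + s * b] := rfl

theorem planeEquiv_symm_fst {ω a b : ℝ} (hω : ω * ω = 1) (h : a * a + b * b = 1)
    (x : Fin 2 → ℝ) : ((planeEquiv ω a b hω h).symm x).1 = ω * (-(x 0 * b) + x 1 * a) := rfl

theorem measurePreserving_planeEquiv {ω a b : ℝ} (hω : ω * ω = 1) (h : a * a + b * b = 1) :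
    MeasurePreserving (planeEquiv ω a b hω h) ((volume : Measure ℝ).prod volume) volume := by
  set N : Matrix (Fin 2) (Fin 2) ℝ := !![-(ω * b), a; ω * a, b] with hN
  have hNN : Nᵀ * N = 1 := by
    ext i j
    rw [Matrix.mul_apply, Fin.sum_univ_two]
    fin_cases i <;> fin_cases j <;> simp [hN] <;>
      first | ring1 | linear_combination h | linear_combination (a * a + b * b) * hω + h
  have h1 := (volume_preserving_finTwoArrow ℝ).symm
  have h2 := (measurePreserving_mulVec hNN).comp h1
  have heq : ⇑(planeEquiv ω a b hω h) =
      (fun v => N *ᵥ v) ∘ ⇑(MeasurableEquiv.finTwoArrow (α := ℝ)).symm := by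
    funext ⟨r, s⟩
    rw [planeEquiv_apply]
    ext i
    change _ = ∑ j, N i j * (![r, s] : Fin 2 → ℝ) j
    rw [Fin.sum_univ_two]
    fin_cases i <;> simp [hN] <;> ring
  rw [heq]
  exact h2

namespace Cell

variable (K : Cell)

section Edges

variable (e : Fin K.nE)

theorem len_smul_tE : K.len e • K.tE e = K.vert (K.tgt e) - K.vert (K.src e) := by
  rw [tE, smul_smul, mul_inv_cancel₀ (K.len_pos e).ne', one_smul]

theorem edgePt_mem_segment {s : ℝ} (hs : s ∈ Icc 0 (K.len e)) :
    K.edgePt e s ∈ segment ℝ (K.vert (K.src e)) (K.vert (K.tgt e)) := by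
  have hL := K.len_pos e
  rw [segment_eq_image']
  refine ⟨s / K.len e, ⟨div_nonneg hs.1 hL.le, (div_le_one hL).2 hs.2⟩, ?_⟩
  simp only
  rw [← len_smul_tE, smul_smul, div_mul_cancel₀ _ hL.ne', edgePt]

theorem exists_edgePt_eq {x : R3}
    (hx : x ∈ segment ℝ (K.vert (K.src e)) (K.vert (K.tgt e))) :
    ∃ s ∈ Icc 0 (K.len e), K.edgePt e s = x := by
  have hL := K.len_pos e
  rw [segment_eq_image'] at hx
  obtain ⟨t, ht, rfl⟩ := hx
  refine ⟨t * K.len e, ⟨mul_nonneg ht.1 hL.le, ?_⟩, ?_⟩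
  · nlinarith [ht.2]
  · rw [edgePt, mul_smul, len_smul_tE]

theorem edgePt_mem_openSegment {s : ℝ} (hs : s ∈ Ioo 0 (K.len e)) :
    K.edgePt e s ∈ openSegment ℝ (K.vert (K.src e)) (K.vert (K.tgt e)) := by
  have hL := K.len_pos e
  rw [openSegment_eq_image']
  refine ⟨s / K.len e, ⟨div_pos hs.1 hL, (div_lt_one hL).2 hs.2⟩, ?_⟩
  simp only
  rw [← len_smul_tE, smul_smul, div_mul_cancel₀ _ hL.ne', edgePt]

variable {e} {f : Fin K.nF} (he : e ∈ K.edges f)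

include he

theorem edgePt_mem_closure_face_diff {s : ℝ} (hs : s ∈ Icc 0 (K.len e)) :
    K.edgePt e s ∈ closure (K.face f) \ K.face f := by
  rw [K.frontier_face, mem_iUnion₂]
  exact ⟨e, he, K.edgePt_mem_segment e hs⟩

theorem edgePt_plane_of_mem {s : ℝ} (hs : s ∈ Icc 0 (K.len e)) :
    (K.edgePt e s - K.xF f) ⬝ᵥ K.nrm f = 0 :=
  K.closure_face_plane f (K.edgePt_mem_closure_face_diff he hs).1

theorem tE_nrm : K.tE e ⬝ᵥ K.nrm f = 0 := by
  have hL := K.len_pos e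
  have h0 := K.edgePt_plane_of_mem he (s := 0) ⟨le_rfl, hL.le⟩
  have h1 := K.edgePt_plane_of_mem he (s := K.len e) ⟨hL.le, le_rfl⟩
  simp only [edgePt, sub_dotProduct, add_dotProduct, smul_dotProduct, smul_eq_mul] at h0 h1
  have : K.len e * (K.tE e ⬝ᵥ K.nrm f) = 0 := by linarith
  exact (mul_eq_zero.1 this).resolve_left hL.ne'

theorem edgePt_plane (s : ℝ) : (K.edgePt e s - K.xF f) ⬝ᵥ K.nrm f = 0 := by
  have h0 := K.edgePt_plane_of_mem he (s := 0) ⟨le_rfl, (K.len_pos e).le⟩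
  simp only [edgePt, sub_dotProduct, add_dotProduct, smul_dotProduct, smul_eq_mul,
    K.tE_nrm he] at h0 ⊢
  linarith

theorem faceMap_edgeInFace (s : ℝ) : K.faceMap f (K.edgeInFace f e s) = K.edgePt e s :=
  K.faceMap_tang f (K.edgePt_plane he s)

theorem tE_dot_eq (u : R3) : u ⬝ᵥ K.tE e = K.tang f u ⬝ᵥ K.tang f (K.tE e) := by
  rw [K.dot_eq f, K.tE_nrm he, mul_zero, add_zero]

theorem tang_tE_unit : K.tang f (K.tE e) ⬝ᵥ K.tang f (K.tE e) = 1 := by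
  rw [← K.tE_dot_eq he, K.tE_unit]

omit he in
theorem nFE_nrm (f : Fin K.nF) (e : Fin K.nE) : K.nFE f e ⬝ᵥ K.nrm f = 0 := by
  rw [nFE, dotProduct_comm]
  exact dot_self_cross _ _

omit he in
theorem nFE_dot_eq (f : Fin K.nF) (e : Fin K.nE) (u : R3) :
    u ⬝ᵥ K.nFE f e = K.tang f u ⬝ᵥ K.tang f (K.nFE f e) := by
  rw [K.dot_eq f, nFE_nrm, mul_zero, add_zero]

omit he in
theorem tang_nFE_zero (f : Fin K.nF) (e : Fin K.nE) :
    K.tang f (K.nFE f e) 0 = -K.tang f (K.tE e) 1 := by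
  change (K.nrm f ⨯₃ K.tE e) ⬝ᵥ K.tan1 f = -(K.tE e ⬝ᵥ (K.nrm f ⨯₃ K.tan1 f))
  simp only [cross_apply, dotProduct, Fin.sum_univ_three, Matrix.cons_val]
  ring

theorem tang_nFE_one : K.tang f (K.nFE f e) 1 = K.tang f (K.tE e) 0 := by
  change (K.nrm f ⨯₃ K.tE e) ⬝ᵥ (K.nrm f ⨯₃ K.tan1 f) = K.tE e ⬝ᵥ K.tan1 f
  rw [cross_dot_cross, K.nrm_unit, K.tE_nrm he]
  ring

omit he in
theorem edgeInFace_eq (f : Fin K.nF) (e : Fin K.nE) (s : ℝ) :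
    K.edgeInFace f e s = K.edgeInFace f e 0 + s • K.tang f (K.tE e) := by
  simp only [edgeInFace, edgePt, tang_sub, tang_add, tang_smul]
  module

omit he in
theorem continuous_edgeInFace (f : Fin K.nF) (e : Fin K.nE) : Continuous (K.edgeInFace f e) :=
  (K.continuous_tang f).comp ((K.continuous_edgePt e).sub continuous_const)

theorem edgeInFace_mem_frontier {s : ℝ} (hs : s ∈ Icc 0 (K.len e)) :
    K.edgeInFace f e s ∈ frontier (K.faceReg f) := by
  rw [frontier, (K.isOpen_faceReg f).interior_eq]
  have h := K.edgePt_mem_closure_face_diff he hs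
  refine ⟨?_, fun hmem => h.2 ?_⟩
  · rw [mem_closure_faceReg, K.faceMap_edgeInFace he]
    exact h.1
  · rw [← K.faceMap_edgeInFace he]
    exact hmem

theorem edgeInFace_mem_closure {s : ℝ} (hs : s ∈ Icc 0 (K.len e)) :
    K.edgeInFace f e s ∈ closure (K.faceReg f) :=
  frontier_subset_closure (K.edgeInFace_mem_frontier he hs)

omit he in
theorem omF_sq (f : Fin K.nF) (e : Fin K.nE) : K.omF f e * K.omF f e = 1 := by
  unfold omF
  split_ifs <;> norm_num

omit he in
theorem faceMap_sub_dot_nFE (f : Fin K.nF) (e : Fin K.nE) (y : Fin 2 → ℝ) :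
    (K.faceMap f y - K.vert (K.src e)) ⬝ᵥ K.nFE f e =
      (y - K.edgeInFace f e 0) ⬝ᵥ K.tang f (K.nFE f e) := by
  rw [K.nFE_dot_eq, edgeInFace, edgePt_zero]
  conv_rhs => rw [← K.tang_faceMap f y, ← K.tang_sub, sub_sub_sub_cancel_right]

/-- The planar analogue of `omT_neg`: `ω_FE n_FE` points out of the face. -/
theorem omF_neg {y : Fin 2 → ℝ} (hy : y ∈ K.faceReg f) :
    K.omF f e * ((y - K.edgeInFace f e 0) ⬝ᵥ K.tang f (K.nFE f e)) < 0 := by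
  have hL := K.len_pos e
  set N := K.tang f (K.nFE f e) with hN
  set τ := K.tang f (K.tE e) with hτ
  have h0 : N 0 = -τ 1 := K.tang_nFE_zero f e
  have h1 : N 1 = τ 0 := K.tang_nFE_one he
  have hu : τ 0 * τ 0 + τ 1 * τ 1 = 1 := by
    have := K.tang_tE_unit he
    rwa [dotProduct, Fin.sum_univ_two] at this
  have hmid : K.len e / 2 ∈ Icc 0 (K.len e) := ⟨by linarith, by linarith⟩
  -- near the midpoint of the edge, its line consists of boundary points of the face
  set p := K.edgeInFace f e (K.len e / 2) with hp
  have hpe : ∀ s, K.edgeInFace f e s = p + (s - K.len e / 2) • τ := fun s => by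
    rw [hp, K.edgeInFace_eq f e s, K.edgeInFace_eq f e (K.len e / 2)]
    module
  have hloc : ∀ᶠ x in nhds p, dotCLM N x = dotCLM N p → x ∉ K.faceReg f := by
    have hcont : Continuous fun x : Fin 2 → ℝ => dotCLM τ (x - p) := by fun_prop
    have hlim : Filter.Tendsto (fun x : Fin 2 → ℝ => |dotCLM τ (x - p)|) (nhds p) (nhds 0) := by
      have := hcont.abs.tendsto p
      simpa using this
    filter_upwards [hlim.eventually (gt_mem_nhds (half_pos hL))] with x hx heq hmem
    rw [dotCLM_apply, dotCLM_apply, dotProduct, dotProduct, Fin.sum_univ_two, Fin.sum_univ_two,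
      h0, h1] at heq
    set a := dotCLM τ (x - p) with ha
    have ha' : a = (x 0 - p 0) * τ 0 + (x 1 - p 1) * τ 1 := by
      rw [ha, dotCLM_apply, dotProduct, Fin.sum_univ_two]
      rfl
    have hxe : x = K.edgeInFace f e (K.len e / 2 + a) := by
      rw [hpe]
      ext i
      fin_cases i
      · change x 0 = p 0 + (K.len e / 2 + a - K.len e / 2) * τ 0
        rw [ha']
        linear_combination (p 0 - x 0) * hu - τ 1 * heq
      · change x 1 = p 1 + (K.len e / 2 + a - K.len e / 2) * τ 1
        rw [ha']
        linear_combination (p 1 - x 1) * hu + τ 0 * heq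
    have hab := abs_lt.1 hx
    have hfr := K.edgeInFace_mem_frontier he (s := K.len e / 2 + a)
      ⟨by linarith, by linarith⟩
    rw [← hxe, frontier, (K.isOpen_faceReg f).interior_eq] at hfr
    exact hfr.2 hmem
  have hpN : p ⬝ᵥ N = K.edgeInFace f e 0 ⬝ᵥ N := by
    have : τ ⬝ᵥ N = 0 := by
      rw [dotProduct, Fin.sum_univ_two, h0, h1]
      ring
    rw [hp, K.edgeInFace_eq, add_dotProduct, smul_dotProduct, this, smul_zero, add_zero]
  have h := one_side (K.isOpen_faceReg f) (K.convex_faceReg f) (dotCLM N)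
    (frontier_subset_closure (K.edgeInFace_mem_frontier he hmid)) hloc
  simp only [dotCLM_apply, ← hp, hpN] at h
  have hcond : (∀ x ∈ K.face f, (x - K.vert (K.src e)) ⬝ᵥ K.nFE f e ≤ 0) ↔
      ∀ z ∈ K.faceReg f, z ⬝ᵥ N ≤ K.edgeInFace f e 0 ⬝ᵥ N := by
    constructor
    · intro h z hz
      have := h _ hz
      rw [faceMap_sub_dot_nFE, sub_dotProduct] at this
      linarith
    · intro h x hx
      have hmx := K.faceMap_tang f (K.face_plane f hx)
      have := h (K.tang f (x - K.xF f)) (by change K.faceMap f _ ∈ K.face f; rwa [hmx])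
      rw [← hmx, faceMap_sub_dot_nFE, sub_dotProduct]
      linarith
  rcases h with h | h
  · have hom : K.omF f e = 1 := if_pos (hcond.2 fun z hz => (h z hz).le)
    rw [hom, one_mul, sub_dotProduct]
    linarith [h y hy]
  · have hom : K.omF f e = -1 := if_neg fun hall => by
      have := hcond.1 hall y hy
      linarith [h y hy]
    rw [hom, sub_dotProduct]
    linarith [h y hy]

omit he

variable (f)

/-- Orthogonal coordinates of the plane of a face attached to one of its edges. -/
def edgeEquiv (e : K.edges f) : (ℝ × ℝ) ≃L[ℝ] (Fin 2 → ℝ) :=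
  planeEquiv (K.omF f e) (K.tang f (K.tE e) 0) (K.tang f (K.tE e) 1) (K.omF_sq f e) (by
    have := K.tang_tE_unit e.2
    rwa [dotProduct, Fin.sum_univ_two] at this)

theorem hyperPt_edgeEquiv (e : K.edges f) (s : ℝ) :
    hyperPt (K.edgeEquiv f e) (K.edgeInFace f e 0) s = K.edgeInFace f e s := by
  rw [hyperPt, edgeEquiv, planeEquiv_apply, K.edgeInFace_eq f e s]
  congr 1
  ext i
  fin_cases i <;> simp

theorem edgeEquiv_symm_fst (e : K.edges f) (x : Fin 2 → ℝ) :
    ((K.edgeEquiv f e).symm x).1 = K.omF f e * (x ⬝ᵥ K.tang f (K.nFE f e)) := by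
  rw [edgeEquiv, planeEquiv_symm_fst, dotProduct, Fin.sum_univ_two, tang_nFE_zero,
    K.tang_nFE_one e.2]
  ring

theorem isPolytope_faceReg : IsPolytope (volume : Measure ℝ) Finset.univ (K.faceReg f)
    (K.edgeEquiv f) (fun e => K.edgeInFace f e 0) (fun e => Ioo 0 (K.len e)) where
  isOpen := K.isOpen_faceReg f
  convex := K.convex_faceReg f
  bounded := (K.isRegion_faceReg f).bounded
  nonempty := (K.isRegion_faceReg f).nonempty
  meas e _ := measurableSet_Ioo
  null e _ := by
    rw [closure_Ioo (K.len_pos e).ne, Icc_sdiff_Ioo_same (K.len_pos e).le]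
    exact (Set.toFinite _).measure_zero _
  neg e _ x hx := by
    rw [edgeEquiv_symm_fst]
    exact K.omF_neg e.2 hx
  facet e _ s hs := by
    rw [hyperPt_edgeEquiv]
    exact K.edgeInFace_mem_frontier e.2 ⟨hs.1.le, hs.2.le⟩
  disj e _ e' _ hne s hs s' hs' := by
    rw [hyperPt_edgeEquiv, hyperPt_edgeEquiv]
    intro h
    have h1 := congrArg (K.faceMap f) h
    rw [K.faceMap_edgeInFace e.2, K.faceMap_edgeInFace e'.2] at h1
    exact Set.disjoint_left.1 (K.edges_disjoint fun h => hne (Subtype.ext h))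
      (K.edgePt_mem_openSegment e.1 hs) (h1 ▸ K.edgePt_mem_openSegment e'.1 hs')
  cover x hx := by
    rw [frontier, (K.isOpen_faceReg f).interior_eq] at hx
    have h1 : K.faceMap f x ∈ closure (K.face f) \ K.face f :=
      ⟨(K.mem_closure_faceReg f).1 hx.1, hx.2⟩
    rw [K.frontier_face, mem_iUnion₂] at h1
    obtain ⟨e, he, hxe⟩ := h1
    obtain ⟨s, hs, hse⟩ := K.exists_edgePt_eq e hxe
    refine ⟨⟨e, he⟩, Finset.mem_univ _, s, ?_, ?_⟩
    · rwa [closure_Ioo (K.len_pos e).ne]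
    · rw [hyperPt_edgeEquiv, edgeInFace, hse, tang_faceMap]

variable (e)

theorem edgePt_mem_closure_T {s : ℝ} (hs : s ∈ Icc 0 (K.len e)) :
    K.edgePt e s ∈ closure K.T := by
  obtain ⟨f, he⟩ := K.edge_mem e
  exact frontier_subset_closure
    (K.closure_face_subset f (K.edgePt_mem_closure_face_diff he hs).1)

theorem vert_mem_closure_T (v : Fin K.nV) : K.vert v ∈ closure K.T := by
  obtain ⟨e, rfl | rfl⟩ := K.vert_mem v
  · rw [← K.edgePt_zero e]
    exact K.edgePt_mem_closure_T e ⟨le_rfl, (K.len_pos e).le⟩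
  · rw [← K.edgePt_len e]
    exact K.edgePt_mem_closure_T e ⟨(K.len_pos e).le, le_rfl⟩

end Edges
end Cell

/-! ### Calculus on the closed cell -/

section General

variable {d : ℕ} {E' ι : Type*} [NormedAddCommGroup E'] [NormedSpace ℝ E'] [MeasurableSpace E']
  [BorelSpace E'] [FiniteDimensional ℝ E'] {μ' : Measure E'} [μ'.IsAddHaarMeasure] {s : Finset ι}
  {T : Set (Fin d → ℝ)}
  {Ψ : ι → (ℝ × E') ≃L[ℝ] (Fin d → ℝ)} {c : ι → Fin d → ℝ} {D : ι → Set E'}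

theorem fderiv_eval_single (p : Pol d) (x : Fin d → ℝ) (j : Fin d) :
    fderiv ℝ (fun x => eval x p) x (Pi.single j 1) = eval x (dP j p) := by
  classical
  rw [(hasFDerivAt_eval p x).fderiv]
  simp [Pi.single_apply]

theorem IsPolytope.integral_fderiv_mul_eval (P : IsPolytope μ' s T Ψ c D) [Nontrivial (Fin d → ℝ)]
    (hΨ : ∀ i ∈ s, MeasurePreserving (Ψ i) ((volume : Measure ℝ).prod μ') volume)
    {g : (Fin d → ℝ) → ℝ} {g' : (Fin d → ℝ) → (Fin d → ℝ) →L[ℝ] ℝ}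
    (hg : ContinuousOn g (closure T)) (hg' : ContinuousOn g' (closure T))
    (hd : ∀ x ∈ T, HasFDerivAt g (g' x) x) (p : Pol d) (j : Fin d) :
    (∫ x in T, g' x (Pi.single j 1) * eval x p) + ∫ x in T, g x * eval x (dP j p) =
      ∑ i ∈ s, ((Ψ i).symm (Pi.single j 1)).1 *
        ∫ y in D i, g (hyperPt (Ψ i) (c i) y) * eval (hyperPt (Ψ i) (c i) y) p ∂μ' := by
  have hR : IsRegion T := ⟨P.isOpen, P.bounded, P.nonempty⟩
  have hpc := continuous_eval p
  have hp' : Continuous fun x => fderiv ℝ (fun x => eval x p) x :=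
    (contDiff_eval p (n := 1)).continuous_fderiv one_ne_zero
  have hdp : ∀ x, HasFDerivAt (fun x => eval x p) (fderiv ℝ (fun x => eval x p) x) x := fun x =>
    (hasFDerivAt_eval p x).differentiableAt.hasFDerivAt
  have h := P.integral_fderiv hΨ (g := fun x => g x * eval x p)
    (g' := fun x => g x • fderiv ℝ (fun x => eval x p) x + eval x p • g' x)
    (hg.mul hpc.continuousOn)
    ((hg.smul hp'.continuousOn).add (hpc.continuousOn.smul hg'))
    (fun x hx => (hd x hx).mul (hdp x)) (Pi.single j 1)
  rw [← h, ← integral_add]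
  · refine integral_congr_ae (Filter.Eventually.of_forall fun x => ?_)
    simp only [_root_.add_apply, _root_.smul_apply, smul_eq_mul,
      fderiv_eval_single]
    ring
  · exact hR.integrableOn_mul_eval (f := fun x => g' x (Pi.single j 1))
      (hR.integrableOn_of_continuousOn (hg'.clm_apply continuousOn_const)) p
  · exact hR.integrableOn_mul_eval (hR.integrableOn_of_continuousOn hg) _

end General

namespace Cell

variable (K : Cell)

theorem uniqueDiffOn_closure_T : UniqueDiffOn ℝ (closure K.T) :=
  uniqueDiffOn_convex K.convex_T.closure
    ⟨K.xT, interior_mono subset_closure (K.isOpen_T.interior_eq.symm ▸ K.xT_mem)⟩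

variable {K}

section Calculus

variable {F : Type*} [NormedAddCommGroup F] [NormedSpace ℝ F] {g : R3 → F}
  (hg : ContDiffOn ℝ 1 g (closure K.T))

include hg

theorem continuousOn_fderivWithin_T : ContinuousOn (fderivWithin ℝ g (closure K.T)) (closure K.T) :=
  hg.continuousOn_fderivWithin K.uniqueDiffOn_closure_T le_rfl

theorem hasFDerivWithinAt_T {x : R3} (hx : x ∈ closure K.T) :
    HasFDerivWithinAt g (fderivWithin ℝ g (closure K.T) x) (closure K.T) x :=
  (hg.differentiableOn one_ne_zero x hx).hasFDerivWithinAt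

theorem hasFDerivAt_T {x : R3} (hx : x ∈ K.T) :
    HasFDerivAt g (fderivWithin ℝ g (closure K.T) x) x :=
  (hasFDerivWithinAt_T hg (subset_closure hx)).hasFDerivAt
    (Filter.mem_of_superset (K.isOpen_T.mem_nhds hx) subset_closure)

end Calculus

theorem fderivWithin_apply (g : R3 → ℝ) (x u : R3) :
    fderivWithin ℝ g (closure K.T) x u = K.grad g x ⬝ᵥ u := by
  conv_lhs => rw [← Finset.univ_sum_single u]
  rw [map_sum]
  refine Finset.sum_congr rfl fun j _ => ?_
  have : (Pi.single j (u j) : R3) = u j • Pi.single j 1 := by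
    rw [← Pi.single_smul', smul_eq_mul, mul_one]
  rw [this, map_smul, smul_eq_mul, mul_comm]
  rfl

theorem continuousOn_grad {g : R3 → ℝ} (hg : ContDiffOn ℝ 1 g (closure K.T)) (j : Fin 3) :
    ContinuousOn (fun x => K.grad g x j) (closure K.T) :=
  (continuousOn_fderivWithin_T hg).clm_apply continuousOn_const

section Vector

variable {v : R3 → R3} (hv : ContDiffOn ℝ 1 v (closure K.T))

include hv

theorem contDiffOn_apply (i : Fin 3) : ContDiffOn ℝ 1 (fun x => v x i) (closure K.T) :=
  contDiffOn_pi.1 hv i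

theorem jac_eq_grad {x : R3} (hx : x ∈ closure K.T) (i : Fin 3) :
    K.jac v x i = K.grad (fun x => v x i) x := by
  ext j
  have h1 := hasFDerivWithinAt_pi'.1 (hasFDerivWithinAt_T hv hx) i
  rw [grad, h1.fderivWithin (K.uniqueDiffOn_closure_T x hx)]
  rfl

theorem continuousOn_jac (i j : Fin 3) : ContinuousOn (fun x => K.jac v x i j) (closure K.T) :=
  (continuousOn_grad (contDiffOn_apply hv i) j).congr fun x hx => by
    simp only [jac_eq_grad hv hx]

theorem contDiffOn_dot (u : R3) : ContDiffOn ℝ 1 (fun x => v x ⬝ᵥ u) (closure K.T) :=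
  ContDiffOn.sum fun i _ => (contDiffOn_apply hv i).mul contDiffOn_const

theorem grad_dot (u : R3) {x : R3} (hx : x ∈ closure K.T) (j : Fin 3) :
    K.grad (fun x => v x ⬝ᵥ u) x j = ∑ i, u i * K.jac v x i j := by
  have h1 : HasFDerivWithinAt (fun x => ∑ i, v x i * u i)
      (∑ i, u i • fderivWithin ℝ (fun x => v x i) (closure K.T) x) (closure K.T) x :=
    HasFDerivWithinAt.fun_sum fun i _ =>
      (hasFDerivWithinAt_T (contDiffOn_apply hv i) hx).mul_const (u i)
  rw [grad]
  change fderivWithin ℝ (fun x => ∑ i, v x i * u i) (closure K.T) x _ = _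
  rw [h1.fderivWithin (K.uniqueDiffOn_closure_T x hx), _root_.sum_apply]
  refine Finset.sum_congr rfl fun i _ => ?_
  rw [jac_eq_grad hv hx]
  rfl

end Vector

/-! ### Traces of smooth functions on faces and edges -/

theorem continuousOn_comp_faceMap (f : Fin K.nF) {F : Type*} [TopologicalSpace F] {g : R3 → F}
    (hg : ContinuousOn g (closure K.T)) :
    ContinuousOn (fun y => g (K.faceMap f y)) (closure (K.faceReg f)) :=
  hg.comp (K.continuous_faceMap f).continuousOn fun _ hy => K.faceMap_mem_closure_T f hy

theorem continuousOn_comp_edgePt (e : Fin K.nE) {F : Type*} [TopologicalSpace F] {g : R3 → F}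
    (hg : ContinuousOn g (closure K.T)) :
    ContinuousOn (fun s => g (K.edgePt e s)) (Icc 0 (K.len e)) :=
  hg.comp (K.continuous_edgePt e).continuousOn fun _ hs => K.edgePt_mem_closure_T e hs

theorem continuousOn_comp_edgeInFace {f : Fin K.nF} {e : Fin K.nE} (he : e ∈ K.edges f)
    {F : Type*} [TopologicalSpace F] {g : (Fin 2 → ℝ) → F}
    (hg : ContinuousOn g (closure (K.faceReg f))) :
    ContinuousOn (fun s => g (K.edgeInFace f e s)) (Icc 0 (K.len e)) :=
  hg.comp (K.continuous_edgeInFace f e).continuousOn fun _ hs => K.edgeInFace_mem_closure he hs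

/-- The linear part of the parametrisation of the plane of a face. -/
def faceLin (K : Cell) (f : Fin K.nF) : (Fin 2 → ℝ) →L[ℝ] R3 :=
  ∑ i : Fin 2, (ContinuousLinearMap.proj i : (Fin 2 → ℝ) →L[ℝ] ℝ).smulRight
    (K.frame f i.castSucc)

theorem faceLin_single (f : Fin K.nF) (j : Fin 2) :
    K.faceLin f (Pi.single j 1) = K.frame f j.castSucc := by
  fin_cases j <;> simp [faceLin, Fin.sum_univ_two]

theorem hasFDerivAt_faceMap (f : Fin K.nF) (y : Fin 2 → ℝ) :
    HasFDerivAt (K.faceMap f) (K.faceLin f) y := by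
  have h : K.faceMap f = fun y => K.xF f + K.faceLin f y := by
    funext y
    simp [faceMap, faceLin]
  rw [h]
  exact (K.faceLin f).hasFDerivAt.const_add _

theorem hasDerivAt_edgePt (e : Fin K.nE) (s : ℝ) : HasDerivAt (K.edgePt e) (K.tE e) s := by
  unfold edgePt
  simpa using ((hasDerivAt_id s).smul_const (K.tE e)).const_add (K.vert (K.src e))

theorem hasDerivAt_comp_edgePt {g : R3 → ℝ} (hg : ContDiffOn ℝ 1 g (closure K.T)) (e : Fin K.nE)
    {s : ℝ} (hs : s ∈ Ioo 0 (K.len e)) :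
    HasDerivAt (fun s => g (K.edgePt e s)) (K.grad g (K.edgePt e s) ⬝ᵥ K.tE e) s := by
  have h1 := hasFDerivWithinAt_T hg (K.edgePt_mem_closure_T e ⟨hs.1.le, hs.2.le⟩)
  have h2 := h1.comp_hasDerivWithinAt s
    ((hasDerivAt_edgePt e s).hasDerivWithinAt (s := Icc 0 (K.len e)))
    fun t ht => K.edgePt_mem_closure_T e ht
  rw [fderivWithin_apply] at h2
  exact h2.hasDerivAt (Icc_mem_nhds hs.1 hs.2)

/-! ### Green formulas -/

variable (K) in
/-- `G` is an integrable gradient of `g` in the cell, in the sense that the integration by parts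
formula with the boundary values of the continuous function `g` holds against polynomials. -/
structure GreenT (g : R3 → ℝ) (G : R3 → R3) : Prop where
  continuousOn : ContinuousOn g (closure K.T)
  integrableOn : ∀ j, IntegrableOn (fun x => G x j) K.T
  green : ∀ p j, K.intT (fun x => G x j * eval x p) + K.intT (fun x => g x * eval x (dP j p)) =
    K.bdT fun f y => g (K.faceMap f y) * eval (K.faceMap f y) p * K.nrm f j

/-- The planar version of `GreenT` on a face. -/
structure GreenF (f : Fin K.nF) (g : (Fin 2 → ℝ) → ℝ) (G : (Fin 2 → ℝ) → Fin 2 → ℝ) :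
    Prop where
  continuousOn : ContinuousOn g (closure (K.faceReg f))
  integrableOn : ∀ j, IntegrableOn (fun x => G x j) (K.faceReg f)
  green : ∀ p j,
    K.intF f (fun x => G x j * eval x p) + K.intF f (fun x => g x * eval x (dP j p)) =
      K.bdF f fun e s => g (K.edgeInFace f e s) * eval (K.edgeInFace f e s) p *
        K.tang f (K.nFE f e) j

theorem single_dotProduct_nrm (f : Fin K.nF) (j : Fin 3) :
    (Pi.single j 1 : R3) ⬝ᵥ K.nrm f = K.nrm f j := by
  rw [single_dotProduct, one_mul]

theorem bdT_eq_sum_symm (g : Fin K.nF → (Fin 2 → ℝ) → ℝ) (j : Fin 3) :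
    ∑ f, ((K.faceEquiv f).symm (Pi.single j 1)).1 * ∫ y in K.faceReg f, g f y =
      K.bdT fun f y => g f y * K.nrm f j := by
  refine Finset.sum_congr rfl fun f _ => ?_
  rw [faceEquiv_symm_fst, single_dotProduct_nrm, mul_assoc, intF, integral_mul_const,
    mul_comm (K.nrm f j)]

theorem greenT_of_contDiffOn {g : R3 → ℝ} (hg : ContDiffOn ℝ 1 g (closure K.T)) :
    K.GreenT g (K.grad g) where
  continuousOn := hg.continuousOn
  integrableOn j := K.isRegion_T.integrableOn_of_continuousOn (continuousOn_grad hg j)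
  green p j := by
    have h := K.isPolytope_T.integral_fderiv_mul_eval
      (fun f _ => K.measurePreserving_faceEquiv f) hg.continuousOn (continuousOn_fderivWithin_T hg)
      (fun x hx => hasFDerivAt_T hg hx) p j
    simp only [hyperPt_faceEquiv] at h
    rw [bdT_eq_sum_symm (fun f y => g (K.faceMap f y) * eval (K.faceMap f y) p) j] at h
    exact h

theorem greenT_of_isWeakJac {g : R3 → ℝ} (hg : ContinuousOn g (closure K.T)) {G : R3 → R3}
    (hG : ∀ j, IntegrableOn (fun x => G x j) K.T)
    (hweak : ∀ φ : R3 → ℝ, ContDiff ℝ (⊤ : ℕ∞) φ → HasCompactSupport φ → tsupport φ ⊆ K.T →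
      ∀ j, ∫ x in K.T, g x * fderiv ℝ φ x (Pi.single j 1) = -∫ x in K.T, G x j * φ x) :
    K.GreenT g G where
  continuousOn := hg
  integrableOn := hG
  green p j := by
    have h := K.isPolytope_T.integral_weak
      (fun f _ => K.measurePreserving_faceEquiv f) (Pi.single j 1) hg (hG j)
      (fun φ h1 h2 h3 => hweak φ h1 h2 h3 j) (contDiff_eval p)
    simp only [hyperPt_faceEquiv, fderiv_eval_single] at h
    rw [bdT_eq_sum_symm (fun f y => g (K.faceMap f y) * eval (K.faceMap f y) p) j] at h
    exact h

theorem intE_eq (e : Fin K.nE) (g : ℝ → ℝ) : K.intE e g = ∫ s in Ioo 0 (K.len e), g s := by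
  rw [intE, intervalIntegral.integral_of_le (K.len_pos e).le, integral_Ioc_eq_integral_Ioo]

theorem bdF_eq_sum_symm (f : Fin K.nF) (g : Fin K.nE → ℝ → ℝ) (j : Fin 2) :
    ∑ e : K.edges f, ((K.edgeEquiv f e).symm (Pi.single j 1)).1 *
      ∫ s in Ioo 0 (K.len e), g e s = K.bdF f fun e s => g e s * K.tang f (K.nFE f e) j := by
  rw [bdF, ← Finset.sum_coe_sort (K.edges f) fun e => K.omF f e *
    K.intE e fun s => g e s * K.tang f (K.nFE f e) j]
  refine Finset.sum_congr rfl fun e _ => ?_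
  rw [edgeEquiv_symm_fst, single_dotProduct, one_mul, mul_assoc, intE_eq, integral_mul_const,
    mul_comm (K.tang f (K.nFE f e) j)]

theorem greenF_of_contDiffOn {g : R3 → ℝ} (hg : ContDiffOn ℝ 1 g (closure K.T))
    (f : Fin K.nF) : GreenF f (fun y => g (K.faceMap f y))
      fun y => K.tang f (K.grad g (K.faceMap f y)) where
  continuousOn := continuousOn_comp_faceMap f hg.continuousOn
  integrableOn j := (K.isRegion_faceReg f).integrableOn_of_continuousOn <| by
    simp only [tang, comps, dotProduct]
    exact continuousOn_finsetSum _ fun i _ =>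
      (continuousOn_comp_faceMap f (continuousOn_grad hg i)).mul continuousOn_const
  green p j := by
    have h := (K.isPolytope_faceReg f).integral_fderiv_mul_eval
      (g := fun y => g (K.faceMap f y))
      (g' := fun y => (fderivWithin ℝ g (closure K.T) (K.faceMap f y)).comp (K.faceLin f))
      (fun e _ => measurePreserving_planeEquiv _ _)
      (continuousOn_comp_faceMap f hg.continuousOn)
      ((continuousOn_comp_faceMap f (continuousOn_fderivWithin_T hg)).clm_comp
        continuousOn_const)
      (fun y hy => by
        have h1 := hasFDerivWithinAt_T hg (K.faceMap_mem_closure_T f (subset_closure hy))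
        refine (h1.comp y (hasFDerivAt_faceMap f y).hasFDerivWithinAt
          (s := closure (K.faceReg f)) fun z hz => K.faceMap_mem_closure_T f hz).hasFDerivAt ?_
        exact Filter.mem_of_superset ((K.isOpen_faceReg f).mem_nhds hy) subset_closure) p j
    simp only [hyperPt_edgeEquiv, ContinuousLinearMap.comp_apply, faceLin_single,
      fderivWithin_apply] at h
    rw [bdF_eq_sum_symm f (fun e s => g (K.faceMap f (K.edgeInFace f e s)) *
      eval (K.edgeInFace f e s) p) j] at h
    exact h

end Cell

/-! ### Linearity of the boundary integrals -/

theorem continuousOn_dotProduct {X : Type*} [TopologicalSpace X] {S : Set X} {n : ℕ}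
    {u v : X → Fin n → ℝ} (hu : ∀ i, ContinuousOn (fun x => u x i) S)
    (hv : ∀ i, ContinuousOn (fun x => v x i) S) : ContinuousOn (fun x => u x ⬝ᵥ v x) S :=
  continuousOn_finsetSum _ fun i _ => (hu i).mul (hv i)

theorem isLinear_eval {d : ℕ} (x : Fin d → ℝ) : IsLinearMap ℝ fun p : Pol d => eval x p :=
  ⟨fun p q => map_add _ p q, fun a p => MvPolynomial.smul_eval x p a⟩

theorem isLinear_evV_dot {d c : ℕ} (x : Fin d → ℝ) (u : Fin c → ℝ) :
    IsLinearMap ℝ fun w : Fin c → Pol d => evV w x ⬝ᵥ u := by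
  refine IsLinearMap.fun_sum fun i _ => ?_
  simp_rw [mul_comm _ (u i)]
  exact ((isLinear_eval x).fun_comp (cP i)).fun_const_mul (u i)

theorem isLinear_dot_evM {d c b : ℕ} (x : Fin d → ℝ) (u : Fin c → ℝ) (n : Fin b → ℝ) :
    IsLinearMap ℝ fun V : Fin c → Fin b → Pol d => u ⬝ᵥ fun i => evM V x i ⬝ᵥ n :=
  IsLinearMap.fun_sum fun i _ => ((isLinear_evV_dot x n).fun_comp
    (LinearMap.proj (R := ℝ) (φ := fun _ : Fin c => Fin b → Pol d) i)).fun_const_mul (u i)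

theorem evV_add {d c : ℕ} (v w : Fin c → Pol d) (x : Fin d → ℝ) :
    evV (v + w) x = evV v x + evV w x := by ext i; simp [evV]

theorem continuous_evV_apply {d c : ℕ} (v : Fin c → Pol d) (i : Fin c) :
    Continuous fun x => evV v x i := continuous_eval (v i)

namespace Cell

variable {K : Cell}

section Boundary

variable {f : Fin K.nF}

theorem intervalIntegrable_of_continuousOn {e : Fin K.nE} {g : ℝ → ℝ}
    (hg : ContinuousOn g (Icc 0 (K.len e))) : IntervalIntegrable g volume 0 (K.len e) := by
  refine ContinuousOn.intervalIntegrable ?_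
  rwa [uIcc_of_le (K.len_pos e).le]

theorem intE_congr {e : Fin K.nE} {g h : ℝ → ℝ} (H : ∀ s ∈ Icc 0 (K.len e), g s = h s) :
    K.intE e g = K.intE e h :=
  intervalIntegral.integral_congr fun s hs => H s (by rwa [uIcc_of_le (K.len_pos e).le] at hs)

theorem bdF_congr {g h : Fin K.nE → ℝ → ℝ}
    (H : ∀ e ∈ K.edges f, K.intE e (g e) = K.intE e (h e)) : K.bdF f g = K.bdF f h :=
  Finset.sum_congr rfl fun e he => by rw [H e he]

theorem intF_congr {g h : (Fin 2 → ℝ) → ℝ} (H : ∀ y ∈ K.faceReg f, g y = h y) :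
    K.intF f g = K.intF f h :=
  setIntegral_congr_fun (K.isOpen_faceReg f).measurableSet H

theorem intT_congr {g h : R3 → ℝ} (H : ∀ x ∈ K.T, g x = h x) : K.intT g = K.intT h :=
  setIntegral_congr_fun K.isOpen_T.measurableSet H

theorem bdT_congr {g h : Fin K.nF → (Fin 2 → ℝ) → ℝ}
    (H : ∀ f, K.intF f (g f) = K.intF f (h f)) : K.bdT g = K.bdT h :=
  Finset.sum_congr rfl fun f _ => by rw [H f]

theorem intF_neg (g : (Fin 2 → ℝ) → ℝ) : K.intF f (fun y => -g y) = -K.intF f g :=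
  integral_neg _

theorem bdF_neg (g : Fin K.nE → ℝ → ℝ) : K.bdF f (fun e s => -g e s) = -K.bdF f g := by
  rw [bdF, bdF, ← Finset.sum_neg_distrib]
  refine Finset.sum_congr rfl fun e _ => ?_
  rw [intE, intervalIntegral.integral_neg, mul_neg]
  rfl

theorem bdF_sum {n : ℕ} {g : Fin n → Fin K.nE → ℝ → ℝ}
    (hg : ∀ i, ∀ e ∈ K.edges f, ContinuousOn (g i e) (Icc 0 (K.len e))) :
    K.bdF f (fun e s => ∑ i, g i e s) = ∑ i, K.bdF f (g i) := by
  simp only [bdF]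
  rw [Finset.sum_comm]
  refine Finset.sum_congr rfl fun e he => ?_
  rw [← Finset.mul_sum, intE, intervalIntegral.integral_finsetSum fun i _ =>
    intervalIntegrable_of_continuousOn (hg i e he)]
  rfl

theorem bdT_sum {n : ℕ} {g : Fin n → Fin K.nF → (Fin 2 → ℝ) → ℝ}
    (hg : ∀ i f, ContinuousOn (g i f) (closure (K.faceReg f))) :
    K.bdT (fun f y => ∑ i, g i f y) = ∑ i, K.bdT (g i) := by
  simp only [bdT]
  rw [Finset.sum_comm]
  refine Finset.sum_congr rfl fun f _ => ?_
  rw [← Finset.mul_sum, intF, integral_finsetSum _ fun i _ =>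
    (K.isRegion_faceReg f).integrableOn_of_continuousOn (hg i f)]
  rfl

theorem isLinear_bdF {M : Type*} [AddCommGroup M] [Module ℝ M] {H : M → Fin K.nE → ℝ → ℝ}
    (hc : ∀ w, ∀ e ∈ K.edges f, ContinuousOn (H w e) (Icc 0 (K.len e)))
    (hl : ∀ e s, IsLinearMap ℝ fun w => H w e s) : IsLinearMap ℝ fun w => K.bdF f (H w) := by
  refine IsLinearMap.fun_sum fun e he => IsLinearMap.fun_const_mul _ ⟨fun v w => ?_, fun a w => ?_⟩
  · simp only [intE, (hl e _).map_add]
    exact intervalIntegral.integral_add (intervalIntegrable_of_continuousOn (hc v e he))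
      (intervalIntegrable_of_continuousOn (hc w e he))
  · simp only [intE, (hl e _).map_smul, smul_eq_mul]
    exact intervalIntegral.integral_const_mul _ _

theorem isLinear_bdT {M : Type*} [AddCommGroup M] [Module ℝ M]
    {H : M → Fin K.nF → (Fin 2 → ℝ) → ℝ}
    (hc : ∀ w f, ContinuousOn (H w f) (closure (K.faceReg f)))
    (hl : ∀ f y, IsLinearMap ℝ fun w => H w f y) : IsLinearMap ℝ fun w => K.bdT (H w) := by
  refine IsLinearMap.fun_sum fun f _ => IsLinearMap.fun_const_mul _ ⟨fun v w => ?_, fun a w => ?_⟩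
  · simp only [intF, (hl f _).map_add]
    exact integral_add ((K.isRegion_faceReg f).integrableOn_of_continuousOn (hc v f))
      ((K.isRegion_faceReg f).integrableOn_of_continuousOn (hc w f))
  · simp only [intF, (hl f _).map_smul, smul_eq_mul]
    exact integral_const_mul _ _

end Boundary

/-! ### Vector and matrix forms of the Green formulas -/

theorem GreenT.dot {g : R3 → ℝ} {G : R3 → R3} (h : K.GreenT g G) (w : Fin 3 → Pol 3) :
    K.intT (fun x => G x ⬝ᵥ evV w x) = -K.intT (fun x => g x * eval x (divP 3 w)) +
      K.bdT fun f y => g (K.faceMap f y) * (evV w (K.faceMap f y) ⬝ᵥ K.nrm f) := by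
  have hlin := K.isRegion_T.isLinear_mul
    (K.isRegion_T.integrableOn_of_continuousOn h.continuousOn)
  have h1 : K.intT (fun x => g x * eval x (divP 3 w)) =
      ∑ j, K.intT fun x => g x * eval x (dP j (w j)) := by
    rw [divP_apply]
    exact map_sum (hlin.mk' _) _ _
  have h2 : K.bdT (fun f y => g (K.faceMap f y) * (evV w (K.faceMap f y) ⬝ᵥ K.nrm f)) =
      ∑ j, K.bdT fun f y => g (K.faceMap f y) * eval (K.faceMap f y) (w j) * K.nrm f j := by
    rw [← bdT_sum (g := fun j f y => g (K.faceMap f y) * eval (K.faceMap f y) (w j) * K.nrm f j)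
      fun j f => ((continuousOn_comp_faceMap f h.continuousOn).mul
      (continuousOn_comp_faceMap f (continuous_eval _).continuousOn)).mul continuousOn_const]
    refine bdT_congr fun f => intF_congr fun y _ => ?_
    simp only [dotProduct, evV, Finset.mul_sum, mul_assoc]
  have h3 : K.intT (fun x => G x ⬝ᵥ evV w x) = ∑ j, K.intT fun x => G x j * eval x (w j) :=
    K.isRegion_T.integral_dot h.integrableOn w
  rw [h1, h2, h3, ← Finset.sum_neg_distrib, ← Finset.sum_add_distrib]
  refine Finset.sum_congr rfl fun j _ => ?_
  rw [← h.green (w j) j]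
  ring

theorem GreenF.dot {f : Fin K.nF} {g : (Fin 2 → ℝ) → ℝ} {G : (Fin 2 → ℝ) → Fin 2 → ℝ}
    (h : GreenF f g G) (w : Fin 2 → Pol 2) :
    K.intF f (fun y => G y ⬝ᵥ evV w y) = -K.intF f (fun y => g y * eval y (divP 2 w)) +
      K.bdF f fun e s => g (K.edgeInFace f e s) *
        (evV w (K.edgeInFace f e s) ⬝ᵥ K.tang f (K.nFE f e)) := by
  have hR := K.isRegion_faceReg f
  have hlin := hR.isLinear_mul (hR.integrableOn_of_continuousOn h.continuousOn)
  have h1 : K.intF f (fun x => g x * eval x (divP 2 w)) =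
      ∑ j, K.intF f fun x => g x * eval x (dP j (w j)) := by
    rw [divP_apply]
    exact map_sum (hlin.mk' _) _ _
  have h2 : K.bdF f (fun e s => g (K.edgeInFace f e s) *
      (evV w (K.edgeInFace f e s) ⬝ᵥ K.tang f (K.nFE f e))) =
      ∑ j, K.bdF f fun e s => g (K.edgeInFace f e s) * eval (K.edgeInFace f e s) (w j) *
        K.tang f (K.nFE f e) j := by
    rw [← bdF_sum (g := fun j e s => g (K.edgeInFace f e s) * eval (K.edgeInFace f e s) (w j) *
        K.tang f (K.nFE f e) j) fun j e he => ((continuousOn_comp_edgeInFace he h.continuousOn).mul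
      (continuousOn_comp_edgeInFace he (continuous_eval _).continuousOn)).mul continuousOn_const]
    refine bdF_congr fun e _ => intE_congr fun s _ => ?_
    simp only [dotProduct, evV, Finset.mul_sum, mul_assoc]
  have h3 : K.intF f (fun x => G x ⬝ᵥ evV w x) = ∑ j, K.intF f fun x => G x j * eval x (w j) :=
    hR.integral_dot h.integrableOn w
  rw [h1, h2, h3, ← Finset.sum_neg_distrib, ← Finset.sum_add_distrib]
  refine Finset.sum_congr rfl fun j _ => ?_
  rw [← h.green (w j) j]
  ring

theorem GreenT.ddot {w : R3 → R3} {W : R3 → Fin 3 → Fin 3 → ℝ}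
    (h : ∀ i, K.GreenT (fun x => w x i) fun x => W x i) (V : Fin 3 → Fin 3 → Pol 3) :
    K.intT (fun x => DiscreteStokes.ddot (W x) (evM V x)) =
      -K.intT (fun x => w x ⬝ᵥ evV (divRows 3 3 V) x) +
      K.bdT fun f y => w (K.faceMap f y) ⬝ᵥ fun i => evM V (K.faceMap f y) i ⬝ᵥ K.nrm f := by
  have hR := K.isRegion_T
  have h1 : K.intT (fun x => w x ⬝ᵥ evV (divRows 3 3 V) x) =
      ∑ i, K.intT fun x => w x i * eval x (divP 3 (V i)) :=
    hR.integral_dot (fun i => hR.integrableOn_of_continuousOn (h i).continuousOn) _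
  have h2 : K.bdT (fun f y => w (K.faceMap f y) ⬝ᵥ
      fun i => evM V (K.faceMap f y) i ⬝ᵥ K.nrm f) =
      ∑ i, K.bdT fun f y => w (K.faceMap f y) i * (evV (V i) (K.faceMap f y) ⬝ᵥ K.nrm f) := by
    rw [← bdT_sum (g := fun i f y => w (K.faceMap f y) i *
      (evV (V i) (K.faceMap f y) ⬝ᵥ K.nrm f)) fun i f =>
      (continuousOn_comp_faceMap f (h i).continuousOn).mul
      (continuousOn_dotProduct (fun j => continuousOn_comp_faceMap f
        (continuous_evV_apply (V i) j).continuousOn) fun j => continuousOn_const)]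
    rfl
  have h3 : K.intT (fun x => DiscreteStokes.ddot (W x) (evM V x)) =
      ∑ i, K.intT fun x => W x i ⬝ᵥ evV (V i) x := hR.integral_ddot (fun i => (h i).integrableOn) V
  rw [h1, h2, h3, ← Finset.sum_neg_distrib, ← Finset.sum_add_distrib]
  exact Finset.sum_congr rfl fun i _ => (h i).dot (V i)

theorem GreenF.ddot {f : Fin K.nF} {c : ℕ} {w : (Fin 2 → ℝ) → Fin c → ℝ}
    {W : (Fin 2 → ℝ) → Fin c → Fin 2 → ℝ}
    (h : ∀ i, GreenF f (fun x => w x i) fun x => W x i) (V : Fin c → Fin 2 → Pol 2) :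
    K.intF f (fun x => DiscreteStokes.ddot (W x) (evM V x)) =
      -K.intF f (fun x => w x ⬝ᵥ evV (divRows 2 c V) x) +
      K.bdF f fun e s => w (K.edgeInFace f e s) ⬝ᵥ
        fun i => evM V (K.edgeInFace f e s) i ⬝ᵥ K.tang f (K.nFE f e) := by
  have hR := K.isRegion_faceReg f
  have h1 : K.intF f (fun x => w x ⬝ᵥ evV (divRows 2 c V) x) =
      ∑ i, K.intF f fun x => w x i * eval x (divP 2 (V i)) :=
    hR.integral_dot (fun i => hR.integrableOn_of_continuousOn (h i).continuousOn) _
  have h2 : K.bdF f (fun e s => w (K.edgeInFace f e s) ⬝ᵥ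
      fun i => evM V (K.edgeInFace f e s) i ⬝ᵥ K.tang f (K.nFE f e)) =
      ∑ i, K.bdF f fun e s => w (K.edgeInFace f e s) i *
        (evV (V i) (K.edgeInFace f e s) ⬝ᵥ K.tang f (K.nFE f e)) := by
    rw [← bdF_sum (g := fun i e s => w (K.edgeInFace f e s) i *
        (evV (V i) (K.edgeInFace f e s) ⬝ᵥ K.tang f (K.nFE f e))) fun i e he => (continuousOn_comp_edgeInFace he (h i).continuousOn).mul
      (continuousOn_dotProduct (fun j => continuousOn_comp_edgeInFace he
        (continuous_evV_apply (V i) j).continuousOn) fun j => continuousOn_const)]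
    rfl
  have h3 : K.intF f (fun x => DiscreteStokes.ddot (W x) (evM V x)) =
      ∑ i, K.intF f fun x => W x i ⬝ᵥ evV (V i) x := hR.integral_ddot (fun i => (h i).integrableOn) V
  rw [h1, h2, h3, ← Finset.sum_neg_distrib, ← Finset.sum_add_distrib]
  exact Finset.sum_congr rfl fun i _ => (h i).dot (V i)

theorem greenT_jac {v : R3 → R3} (hv : ContDiffOn ℝ 1 v (closure K.T)) (i : Fin 3) :
    K.GreenT (fun x => v x i) fun x => K.jac v x i where
  continuousOn := (contDiffOn_apply hv i).continuousOn
  integrableOn j := K.isRegion_T.integrableOn_of_continuousOn (continuousOn_jac hv i j)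
  green p j := by
    rw [← (greenT_of_contDiffOn (contDiffOn_apply hv i)).green p j]
    congr 1
    exact intT_congr fun x hx => by rw [jac_eq_grad hv (subset_closure hx)]

/-- The tangential derivatives of the frame components of a vector field on a face. -/
theorem greenF_comps {v : R3 → R3} (hv : ContDiffOn ℝ 1 v (closure K.T)) (f : Fin K.nF)
    (i : Fin 3) : GreenF f (fun y => K.comps f (v (K.faceMap f y)) i) fun y j =>
      K.frame f i ⬝ᵥ fun a => K.jac v (K.faceMap f y) a ⬝ᵥ K.frame f j.castSucc := by
  have h := greenF_of_contDiffOn (contDiffOn_dot hv (K.frame f i)) f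
  have heq : ∀ y ∈ closure (K.faceReg f), ∀ j,
      K.tang f (K.grad (fun x => v x ⬝ᵥ K.frame f i) (K.faceMap f y)) j =
        K.frame f i ⬝ᵥ fun a => K.jac v (K.faceMap f y) a ⬝ᵥ K.frame f j.castSucc := by
    intro y hy j
    simp only [tang, comps]
    rw [dotProduct]
    simp_rw [grad_dot hv _ (K.faceMap_mem_closure_T f hy)]
    simp only [dotProduct, Finset.sum_mul, Finset.mul_sum]
    rw [Finset.sum_comm]
    simp only [mul_assoc]
  refine ⟨h.continuousOn, fun j => (h.integrableOn j).congr_fun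
    (fun y hy => heq y (subset_closure hy) j) (K.isOpen_faceReg f).measurableSet, fun p j => ?_⟩
  refine Eq.trans ?_ (h.green p j)
  congr 1
  exact intF_congr fun y hy => by rw [heq y (subset_closure hy)]

/-- Integration by parts for the curl; only the tangential part of the field enters the boundary
term. -/
theorem intT_curl {v : R3 → R3} (hv : ContDiffOn ℝ 1 v (closure K.T)) (r : Fin 3 → Pol 3) :
    K.intT (fun x => K.curl v x ⬝ᵥ evV r x) = K.intT (fun x => v x ⬝ᵥ evV (curlP r) x) +
      K.bdT fun f y => K.tang f (v (K.faceMap f y)) ⬝ᵥ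
        K.tang f (evV r (K.faceMap f y) ⨯₃ K.nrm f) := by
  have h := GreenT.ddot (greenT_jac hv)
    ![![0, -r 2, r 1], ![r 2, 0, -r 0], ![-r 1, r 0, 0]]
  have h1 : K.intT (fun x => K.curl v x ⬝ᵥ evV r x) = K.intT fun x => DiscreteStokes.ddot
      (K.jac v x) (evM ![![0, -r 2, r 1], ![r 2, 0, -r 0], ![-r 1, r 0, 0]] x) := by
    refine intT_congr fun x _ => ?_
    simp [DiscreteStokes.ddot, evM, evV, dotProduct, Fin.sum_univ_three, curl]
    ring
  have h2 : K.intT (fun x => v x ⬝ᵥ evV (curlP r) x) = -K.intT fun x => v x ⬝ᵥ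
      evV (divRows 3 3 ![![0, -r 2, r 1], ![r 2, 0, -r 0], ![-r 1, r 0, 0]]) x := by
    rw [intT, intT, ← integral_neg]
    refine intT_congr fun x _ => ?_
    simp [evV, dotProduct, Fin.sum_univ_three, divRows_apply, divP_apply, curlP_apply]
    ring
  rw [h1, h, h2]
  congr 1
  refine bdT_congr fun f => intF_congr fun y _ => ?_
  have h3 : (evV r (K.faceMap f y) ⨯₃ K.nrm f) ⬝ᵥ K.nrm f = 0 := by
    rw [dotProduct_comm]
    exact dot_cross_self _ _
  have h4 := K.dot_eq f (v (K.faceMap f y)) (evV r (K.faceMap f y) ⨯₃ K.nrm f)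
  rw [h3, mul_zero, add_zero] at h4
  rw [← h4]
  simp [evM, evV, dotProduct, Fin.sum_univ_three, cross_apply]
  ring

end Cell

/-! ### Restriction of polynomials to faces and edges -/

theorem projV_congr {d c : ℕ} {R : Set (Fin d → ℝ)} {S : Submodule ℝ (Fin c → Pol d)}
    {f g : (Fin d → ℝ) → Fin c → ℝ}
    (h : ∀ r ∈ S, ∫ x in R, f x ⬝ᵥ evV r x = ∫ x in R, g x ⬝ᵥ evV r x) :
    projV R S f = projV R S g :=
  solve_congr fun p => forall₂_congr fun r hr => by rw [h r hr]

theorem IsRegion.exists_mem_repV {d c : ℕ} {R : Set (Fin d → ℝ)} (hR : IsRegion R)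
    (S : Submodule ℝ (Fin c → Pol d)) [FiniteDimensional ℝ S] {φ : (Fin c → Pol d) → ℝ}
    (hφ : IsLinearMap ℝ φ) : ∃ x : S, ∀ y ∈ S, ∫ z in R, evV x.1 z ⬝ᵥ evV y z = φ y := by
  obtain ⟨x, hx⟩ := hR.exists_repV S.subtype S.injective_subtype (hφ.fun_comp S.subtype)
  exact ⟨x, fun y hy => hx ⟨y, hy⟩⟩

namespace Cell

variable {K : Cell}

/-- The restriction of a polynomial to an edge, as a polynomial in the arc length. -/
theorem exists_restrict_edge {m : ℤ} {p : Pol 2} (hp : p ∈ Poly 2 m) (f : Fin K.nF)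
    (e : Fin K.nE) : ∃ r ∈ EP m, ∀ s, r.eval s = eval (K.edgeInFace f e s) p := by
  set g : Fin 2 → Polynomial ℝ := fun i => Polynomial.C (K.edgeInFace f e 0 i) +
    Polynomial.C (K.tang f (K.tE e) i) * Polynomial.X with hg
  refine ⟨MvPolynomial.aeval g p, aeval_mem_filtration EP (fun _ _ h => EP_mono h)
    (by simpa using C_mem_EP 1) mul_mem_EP (fun i => ?_) hp, fun s => ?_⟩
  · have h1 := mul_mem_EP (C_mem_EP (K.tang f (K.tE e) i)) X_mem_EP
    exact Submodule.add_mem _ (EP_mono zero_le_one (C_mem_EP _)) h1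
  · have h1 := MvPolynomial.comp_aeval_apply (f := g) (Polynomial.aeval (R := ℝ) s) p
    rw [Polynomial.coe_aeval_eq_eval] at h1
    rw [h1, MvPolynomial.aeval_eq_eval]
    congr 2
    funext i
    rw [K.edgeInFace_eq f e s, hg]
    simp only [Polynomial.eval_add, Polynomial.eval_mul, Polynomial.eval_C, Polynomial.eval_X,
      Pi.add_apply, Pi.smul_apply, smul_eq_mul, mul_comm s]

theorem exists_restrict_edge_dot {m : ℤ} {w : Fin 2 → Pol 2} (hw : w ∈ VPoly 2 2 m)
    (f : Fin K.nF) (e : Fin K.nE) (u : Fin 2 → ℝ) :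
    ∃ r ∈ EP m, ∀ s, r.eval s = evV w (K.edgeInFace f e s) ⬝ᵥ u := by
  choose r hr hrw using fun i => exists_restrict_edge (mem_VPoly.1 hw i) f e
  refine ⟨∑ i, u i • r i, Submodule.sum_mem _ fun i _ => Submodule.smul_mem _ _ (hr i),
    fun s => ?_⟩
  simp [hrw, dotProduct, evV, mul_comm]

/-- The restriction of a polynomial to a face, in the coordinates of the face. -/
theorem exists_restrict_face {m : ℤ} {p : Pol 3} (hp : p ∈ Poly 3 m) (f : Fin K.nF) :
    ∃ r ∈ Poly 2 m, ∀ y, eval y r = eval (K.faceMap f y) p := by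
  set g : Fin 3 → Pol 2 := fun j => MvPolynomial.C (K.xF f j) +
    ∑ i : Fin 2, K.frame f i.castSucc j • (MvPolynomial.X i : Pol 2) with hg
  refine ⟨MvPolynomial.aeval g p, aeval_mem_Poly (fun j => ?_) hp, fun y => ?_⟩
  · exact Submodule.add_mem _ (Poly_mono zero_le_one (C_mem_Poly _))
      (Submodule.sum_mem _ fun i _ => Submodule.smul_mem _ _ (X_mem_Poly i))
  · have h1 := MvPolynomial.comp_aeval_apply (f := g) (MvPolynomial.aeval (R := ℝ) y) p
    rw [MvPolynomial.aeval_eq_eval] at h1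
    rw [MvPolynomial.aeval_eq_eval] at h1
    refine h1.trans ?_
    congr 2
    funext j
    simp [hg, faceMap, Fin.sum_univ_two, mul_comm]

theorem exists_restrict_face_dot {m : ℤ} {w : Fin 3 → Pol 3} (hw : w ∈ VPoly 3 3 m)
    (f : Fin K.nF) (u : R3) :
    ∃ r ∈ Poly 2 m, ∀ y, eval y r = evV w (K.faceMap f y) ⬝ᵥ u := by
  choose r hr hrw using fun i => exists_restrict_face (mem_VPoly.1 hw i) f
  refine ⟨∑ i, u i • r i, Submodule.sum_mem _ fun i _ => Submodule.smul_mem _ _ (hr i),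
    fun y => ?_⟩
  simp [hrw, dotProduct, evV, mul_comm]

/-- On an edge the function `(x - x_F) · n_FE` is constant. -/
theorem exists_restrict_edge_koszul {m : ℤ} {p : Pol 2} (hp : p ∈ Poly 2 m) {f : Fin K.nF}
    {e : Fin K.nE} (he : e ∈ K.edges f) : ∃ r ∈ EP m, ∀ s, r.eval s =
      evV (koszul 0 p) (K.edgeInFace f e s) ⬝ᵥ K.tang f (K.nFE f e) := by
  obtain ⟨r, hr, hrp⟩ := exists_restrict_edge hp f e
  refine ⟨(K.edgeInFace f e 0 ⬝ᵥ K.tang f (K.nFE f e)) • r, Submodule.smul_mem _ _ hr,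
    fun s => ?_⟩
  have h0 : K.tang f (K.tE e) ⬝ᵥ K.tang f (K.nFE f e) = 0 := by
    rw [dotProduct, Fin.sum_univ_two, tang_nFE_zero, K.tang_nFE_one he]
    ring
  have h1 : K.edgeInFace f e s ⬝ᵥ K.tang f (K.nFE f e) =
      K.edgeInFace f e 0 ⬝ᵥ K.tang f (K.nFE f e) := by
    rw [K.edgeInFace_eq f e s, add_dotProduct, smul_dotProduct, h0, smul_zero, add_zero]
  rw [Polynomial.eval_smul, hrp, smul_eq_mul, ← h1]
  simp [dotProduct, evV, koszul_apply, Fin.sum_univ_two]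
  ring

/-- On a face the function `(x - x_T) · n_F` is constant. -/
theorem exists_restrict_face_koszul {m : ℤ} {p : Pol 3} (hp : p ∈ Poly 3 m) (f : Fin K.nF) :
    ∃ r ∈ Poly 2 m, ∀ y, eval y r = evV (koszul K.xT p) (K.faceMap f y) ⬝ᵥ K.nrm f := by
  obtain ⟨r, hr, hrp⟩ := exists_restrict_face hp f
  refine ⟨((K.xF f - K.xT) ⬝ᵥ K.nrm f) • r, Submodule.smul_mem _ _ hr, fun y => ?_⟩
  have h1 : (K.faceMap f y - K.xT) ⬝ᵥ K.nrm f = (K.xF f - K.xT) ⬝ᵥ K.nrm f := by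
    rw [← sub_add_sub_cancel _ (K.xF f), add_dotProduct, faceMap_nrm, zero_add]
  rw [MvPolynomial.smul_eval, hrp, ← h1]
  simp [dotProduct, evV, koszul_apply, Fin.sum_univ_three]
  ring

/-! ### Edge interpolation -/

/-- The interpolant defined by its moments and its values at the vertices exists. -/
theorem edgeInterp_spec {n m : ℤ} (hm : -1 ≤ m) (hn : n = m + 2) {v : R3 → R3}
    (hv : ContinuousOn v (closure K.T)) :
    (∀ e, ∀ r ∈ EPV m, K.intE e (fun s => evE ((K.edgeInterp n m v).1 e) s ⬝ᵥ evE r s) =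
        K.intE e fun s => v (K.edgePt e s) ⬝ᵥ evE r s) ∧
    ∀ e, evE ((K.edgeInterp n m v).1 e) 0 = v (K.vert (K.src e)) ∧
      evE ((K.edgeInterp n m v).1 e) (K.len e) = v (K.vert (K.tgt e)) := by
  have h := K.exists_EPCV hm hn (f := fun e s => v (K.edgePt e s))
    (fun e i => continuousOn_pi.1 (continuousOn_comp_edgePt e hv) i) (fun i => v (K.vert i))
  exact solve_spec (p := fun p : K.EPCV n =>
    (∀ e, ∀ r ∈ EPV m, K.intE e (fun s => evE (p.1 e) s ⬝ᵥ evE r s) =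
        K.intE e fun s => v (K.edgePt e s) ⬝ᵥ evE r s) ∧
    ∀ e, evE (p.1 e) 0 = v (K.vert (K.src e)) ∧
      evE (p.1 e) (K.len e) = v (K.vert (K.tgt e))) h

theorem intE_smul_single {e : Fin K.nE} (g : ℝ → R3) (r : Polynomial ℝ) (u : R3) :
    K.intE e (fun s => g s ⬝ᵥ evE (fun i => u i • r) s) =
      K.intE e fun s => (g s ⬝ᵥ u) * r.eval s := by
  refine intE_congr fun s _ => ?_
  simp only [dotProduct, evE, Polynomial.eval_smul, smul_eq_mul, Finset.sum_mul, mul_assoc]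

theorem smul_mem_EPV {m : ℤ} {r : Polynomial ℝ} (hr : r ∈ EP m) (u : R3) :
    (fun i => u i • r) ∈ EPV m := mem_EPV.2 fun _ => Submodule.smul_mem _ _ hr

/-- Moments of the components of the interpolant in a fixed direction. -/
theorem edgeInterp_moment_dot {n m : ℤ} (hm : -1 ≤ m) (hn : n = m + 2) {v : R3 → R3}
    (hv : ContinuousOn v (closure K.T)) (e : Fin K.nE) {r : Polynomial ℝ} (hr : r ∈ EP m)
    (u : R3) : K.intE e (fun s => (evE ((K.edgeInterp n m v).1 e) s ⬝ᵥ u) * r.eval s) =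
      K.intE e fun s => (v (K.edgePt e s) ⬝ᵥ u) * r.eval s := by
  rw [← intE_smul_single, ← intE_smul_single]
  exact (edgeInterp_spec hm hn hv).1 e _ (smul_mem_EPV hr u)

theorem intE_dot {e : Fin K.nE} {g : ℝ → R3}
    (hg : ∀ i, ContinuousOn (fun s => g s i) (Icc 0 (K.len e))) (r : Fin 3 → Polynomial ℝ) :
    K.intE e (fun s => g s ⬝ᵥ evE r s) = ∑ i, K.intE e fun s => g s i * (r i).eval s :=
  integral_dotE (K.len_pos e) hg r

/-- Differentiation along the edges commutes with interpolation followed by projection. -/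
theorem intE_dE_edgeInterp {n m m' : ℤ} (hm : -1 ≤ m) (hn : n = m + 2) (hm' : m' = m + 1)
    (h : n = m' + 1) {v : R3 → R3} (hv : ContDiffOn ℝ 1 v (closure K.T)) (e : Fin K.nE)
    {r : Fin 3 → Polynomial ℝ} (hr : r ∈ EPV m') :
    K.intE e (fun s => evE (K.dE m' h (K.edgeInterp n m v) e).1 s ⬝ᵥ evE r s) =
      K.intE e fun s => (fun i => K.jac v (K.edgePt e s) i ⬝ᵥ K.tE e) ⬝ᵥ evE r s := by
  have hspec := edgeInterp_spec hm hn hv.continuousOn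
  have hc : ∀ i, ContinuousOn (fun s => K.jac v (K.edgePt e s) i ⬝ᵥ K.tE e)
      (Icc 0 (K.len e)) := fun i => continuousOn_dotProduct
    (fun j => continuousOn_comp_edgePt e (continuousOn_jac hv i j)) fun j => continuousOn_const
  rw [intE_dot (g := evE (K.dE m' h (K.edgeInterp n m v) e).1)
    (fun i => (Polynomial.continuous _).continuousOn), intE_dot hc]
  refine Finset.sum_congr rfl fun i _ => ?_
  have hvi := contDiffOn_apply hv i
  refine K.intE_derivative (m := m) (f := fun s => v (K.edgePt e s) i) e
    (continuousOn_comp_edgePt e hvi.continuousOn) (hc i) (fun s hs => ?_) (fun ρ hρ => ?_) ?_ ?_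
    (derivative_mem_EP hm'.le (mem_EPV.1 hr i))
  · rw [jac_eq_grad hv (K.edgePt_mem_closure_T e ⟨hs.1.le, hs.2.le⟩)]
    exact hasDerivAt_comp_edgePt hvi e hs
  · have := edgeInterp_moment_dot hm hn hv.continuousOn e hρ (Pi.single i 1)
    simpa only [dotProduct_single, mul_one, evE] using this
  · have := congrFun (hspec.2 e).1 i
    rwa [← K.edgePt_zero e] at this
  · have := congrFun (hspec.2 e).2 i
    rwa [← K.edgePt_len e] at this

theorem cross_dotProduct (a t r : R3) : (a ⨯₃ t) ⬝ᵥ r = a ⬝ᵥ (t ⨯₃ r) := by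
  simp [cross_apply, dotProduct, Fin.sum_univ_three]
  ring

/-- `t × r` for a vector polynomial on an edge. -/
theorem exists_cross_edge {m : ℤ} (t : R3) {r : Fin 3 → Polynomial ℝ} (hr : r ∈ EPV m) :
    ∃ ρ ∈ EPV m, ∀ s, evE ρ s = t ⨯₃ evE r s := by
  refine ⟨-(r ⨯₃ fun i => Polynomial.C (t i)), Submodule.neg_mem _ (cross_mem_EPV hr t),
    fun s => ?_⟩
  ext i
  fin_cases i <;> simp [evE, cross_apply] <;> ring

theorem evE_dEcross {n : ℤ} (m : ℤ) (h : n = m + 1) (v : K.EPCV n) (e : Fin K.nE) (s : ℝ) :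
    evE (K.dEcross m h v e).1 s = evE (K.dE m h v e).1 s ⨯₃ K.tE e := by
  ext i
  simp only [dEcross, evE, cross_apply]
  fin_cases i <;> simp

theorem intE_dEcross_edgeInterp {n m m' : ℤ} (hm : -1 ≤ m) (hn : n = m + 2) (hm' : m' = m + 1)
    (h : n = m' + 1) {v : R3 → R3} (hv : ContDiffOn ℝ 1 v (closure K.T)) (e : Fin K.nE)
    {r : Fin 3 → Polynomial ℝ} (hr : r ∈ EPV m') :
    K.intE e (fun s => evE (K.dEcross m' h (K.edgeInterp n m v) e).1 s ⬝ᵥ evE r s) =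
      K.intE e fun s =>
        ((fun i => K.jac v (K.edgePt e s) i ⬝ᵥ K.tE e) ⨯₃ K.tE e) ⬝ᵥ evE r s := by
  obtain ⟨ρ, hρ, hρr⟩ := exists_cross_edge (K.tE e) hr
  simp_rw [evE_dEcross, cross_dotProduct, ← hρr]
  exact intE_dE_edgeInterp hm hn hm' h hv e hρ

end Cell

/-! ### The rotated Green formula on faces -/

theorem perp_mem_VPoly {m : ℤ} {w : Fin 2 → Pol 2} (hw : w ∈ VPoly 2 2 m) :
    perp w ∈ VPoly 2 2 m := by
  rw [mem_VPoly] at hw ⊢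
  intro i
  rw [perp_apply]
  fin_cases i
  · exact Submodule.neg_mem _ (hw 1)
  · exact hw 0

theorem rotP_mem {m n : ℤ} (h : m - 1 = n) {w : Fin 2 → Pol 2} (hw : w ∈ VPoly 2 2 m) :
    rotP w ∈ Poly 2 n :=
  Submodule.sub_mem _ (dP_mem_Poly h (mem_VPoly.1 hw 1) 0) (dP_mem_Poly h (mem_VPoly.1 hw 0) 1)

theorem Roly2_le {m : ℤ} : Roly2 m ≤ VPoly 2 2 m := by
  rintro _ ⟨r, hr, rfl⟩
  rw [mem_VPoly, vrotP_apply]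
  intro i
  fin_cases i
  · exact dP_mem_Poly (by ring) hr 1
  · exact Submodule.neg_mem _ (dP_mem_Poly (by ring) hr 0)

theorem Roly3_le {m : ℤ} : Roly3 m ≤ VPoly 3 3 m := by
  rintro _ ⟨r, hr, rfl⟩
  exact curlP_mem (by ring) hr

theorem GolyC2_le {m : ℤ} : GolyC2 m ≤ VPoly 2 2 m := by
  rintro _ ⟨p, hp, rfl⟩
  exact perp_mem_VPoly (koszul_mem_VPoly hp)

namespace Cell

variable {K : Cell} {k : ℕ}

theorem continuousOn_tang_comp {f : Fin K.nF} {v : R3 → R3}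
    (hv : ContinuousOn v (closure K.T)) (i : Fin 2) :
    ContinuousOn (fun y => K.tang f (v (K.faceMap f y)) i) (closure (K.faceReg f)) :=
  continuousOn_pi.1 ((K.continuous_tang f).comp_continuousOn (continuousOn_comp_faceMap f hv)) i

theorem continuousOn_dot_const {v : R3 → R3} (hv : ContinuousOn v (closure K.T)) (u : R3) :
    ContinuousOn (fun x => v x ⬝ᵥ u) (closure K.T) :=
  continuousOn_dotProduct (continuousOn_pi.1 hv) fun _ => continuousOn_const

/-- `n × u` in the plane of the face is the rotation of the tangential part of `u`. -/
theorem tang_cross_dot (f : Fin K.nF) (u : R3) (w : Fin 2 → Pol 2) (y : Fin 2 → ℝ) :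
    K.tang f (K.nrm f ⨯₃ u) ⬝ᵥ evV w y = -(K.tang f u ⬝ᵥ evV (perp w) y) := by
  have h0 : K.tang f (K.nrm f ⨯₃ u) 0 = -K.tang f u 1 := by
    change (K.nrm f ⨯₃ u) ⬝ᵥ K.tan1 f = -(u ⬝ᵥ (K.nrm f ⨯₃ K.tan1 f))
    simp only [cross_apply, dotProduct, Fin.sum_univ_three, Matrix.cons_val]
    ring
  have h1 : K.tang f (K.nrm f ⨯₃ u) 1 = K.tang f u 0 := by
    change (K.nrm f ⨯₃ u) ⬝ᵥ (K.nrm f ⨯₃ K.tan1 f) = u ⬝ᵥ K.tan1 f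
    rw [cross_dot_cross, K.nrm_unit, K.nrm_tan1]
    ring
  rw [dotProduct, dotProduct, Fin.sum_univ_two, Fin.sum_univ_two, h0, h1]
  simp only [evV, perp_apply, Matrix.cons_val, map_neg]
  ring

/-- Green's formula for the rotated tangential gradient of a scalar function. -/
theorem intF_cross_grad {g : R3 → ℝ} (hg : ContDiffOn ℝ 1 g (closure K.T)) (f : Fin K.nF)
    (w : Fin 2 → Pol 2) :
    K.intF f (fun y => K.tang f (K.nrm f ⨯₃ K.grad g (K.faceMap f y)) ⬝ᵥ evV w y) =
      -K.intF f (fun y => g (K.faceMap f y) * eval y (rotP w)) -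
      K.bdF f fun e s => g (K.edgePt e s) *
        (evV w (K.edgeInFace f e s) ⬝ᵥ K.tang f (K.tE e)) := by
  -- Green's formula for `w^⊥`: `div w^⊥ = -rot w` and `w^⊥ · n_FE = w · t_E`
  have h := (greenF_of_contDiffOn hg f).dot (perp w)
  have hdiv : divP 2 (perp w) = -rotP w := by
    rw [divP_apply, Fin.sum_univ_two, perp_apply, rotP_apply]
    simp only [Matrix.cons_val, map_neg]
    ring
  have h1 : K.intF f (fun y => g (K.faceMap f y) * eval y (divP 2 (perp w))) =
      -K.intF f (fun y => g (K.faceMap f y) * eval y (rotP w)) := by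
    rw [← intF_neg]
    simp only [hdiv, map_neg, mul_neg]
  have h2 : K.bdF f (fun e s => g (K.faceMap f (K.edgeInFace f e s)) *
      (evV (perp w) (K.edgeInFace f e s) ⬝ᵥ K.tang f (K.nFE f e))) =
      K.bdF f fun e s => g (K.edgePt e s) *
        (evV w (K.edgeInFace f e s) ⬝ᵥ K.tang f (K.tE e)) := by
    refine bdF_congr fun e he => intE_congr fun s _ => ?_
    rw [K.faceMap_edgeInFace he]
    congr 1
    rw [dotProduct, dotProduct, Fin.sum_univ_two, Fin.sum_univ_two, tang_nFE_zero,
      K.tang_nFE_one he]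
    simp only [evV, perp_apply, Matrix.cons_val, map_neg]
    ring
  rw [h1, h2, neg_neg] at h
  have h3 : K.intF f (fun y => K.tang f (K.nrm f ⨯₃ K.grad g (K.faceMap f y)) ⬝ᵥ evV w y) =
      -K.intF f fun y => K.tang f (K.grad g (K.faceMap f y)) ⬝ᵥ evV (perp w) y := by
    rw [← intF_neg]
    simp only [tang_cross_dot]
  rw [h3, h]
  ring

/-! ### The discrete gradient of an interpolate -/

section Gradient

variable {q : R3 → ℝ}

theorem contDiffOn_grad (hq : ContDiffOn ℝ 2 q (closure K.T)) :
    ContDiffOn ℝ 1 (K.grad q) (closure K.T) := by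
  rw [contDiffOn_pi]
  intro j
  have h := hq.fderivWithin K.uniqueDiffOn_closure_T (m := 1) (by norm_num)
  exact h.clm_apply contDiffOn_const

theorem jac_grad_symm (hq : ContDiffOn ℝ 2 q (closure K.T)) {x : R3} (hx : x ∈ closure K.T)
    (i j : Fin 3) : K.jac (K.grad q) x i j = K.jac (K.grad q) x j i := by
  have hu := K.uniqueDiffOn_closure_T x hx
  have hint : x ∈ closure (interior (closure K.T)) := by
    refine closure_mono ?_ hx
    exact K.isOpen_T.subset_interior_iff.2 subset_closure
  have hs := (hq x hx).isSymmSndFDerivWithinAt (by simp) K.uniqueDiffOn_closure_T hint hx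
  have hd := (hq.fderivWithin K.uniqueDiffOn_closure_T (m := 1) (by norm_num)).differentiableOn
    one_ne_zero x hx
  have key : ∀ i j, K.jac (K.grad q) x i j = fderivWithin ℝ (fderivWithin ℝ q (closure K.T))
      (closure K.T) x (Pi.single j 1) (Pi.single i 1) := by
    intro i j
    rw [jac_eq_grad (contDiffOn_grad hq) hx, grad]
    have h1 : HasFDerivWithinAt (fun y => K.grad q y i) _ (closure K.T) x :=
      hd.hasFDerivWithinAt.clm_apply (hasFDerivWithinAt_const (Pi.single i 1 : R3) x _)
    rw [h1.fderivWithin hu]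
    simp
  rw [key, key]
  exact hs _ _

theorem curl_grad (hq : ContDiffOn ℝ 2 q (closure K.T)) {x : R3} (hx : x ∈ closure K.T) :
    K.curl (K.grad q) x = 0 := by
  have h := jac_grad_symm hq hx
  ext i
  fin_cases i <;> simp [curl, h 2 1, h 2 0, h 1 0]

/-- For a gradient, the field `n × (∇v n)` is the rotated gradient of the normal derivative, because
the Hessian is symmetric. -/
theorem crossNormalDeriv_grad (hq : ContDiffOn ℝ 2 q (closure K.T)) (f : Fin K.nF)
    {y : Fin 2 → ℝ} (hy : y ∈ closure (K.faceReg f)) :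
    K.crossNormalDeriv f (K.grad q) y =
      K.tang f (K.nrm f ⨯₃ K.grad (fun x => K.grad q x ⬝ᵥ K.nrm f) (K.faceMap f y)) := by
  have hx := K.faceMap_mem_closure_T f hy
  rw [crossNormalDeriv]
  congr 2
  ext i
  rw [grad_dot (contDiffOn_grad hq) _ hx, dotProduct]
  exact Finset.sum_congr rfl fun j _ => by rw [jac_grad_symm hq hx, mul_comm]

variable (hq : ContDiffOn ℝ 2 q (closure K.T))

include hq

theorem qE_spec (k : ℕ) :
    (∀ e, ∀ r ∈ EP ((k : ℤ) - 1), K.intE e (fun s => ((K.IGrad k q).qE.1 e).eval s * r.eval s) =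
      K.intE e fun s => q (K.edgePt e s) * r.eval s) ∧
    ∀ e, ((K.IGrad k q).qE.1 e).eval 0 = q (K.vert (K.src e)) ∧
      ((K.IGrad k q).qE.1 e).eval (K.len e) = q (K.vert (K.tgt e)) := by
  have h := K.exists_EPC (m := (k : ℤ) - 1) (n := (k : ℤ) + 1) (by omega) (by ring)
    (f := fun e s => q (K.edgePt e s)) (fun e => continuousOn_comp_edgePt e hq.continuousOn)
    fun i => q (K.vert i)
  exact solve_spec (p := fun p : K.EPC (k + 1) =>
    (∀ e, ∀ r ∈ EP ((k : ℤ) - 1), K.intE e (fun s => (p.1 e).eval s * r.eval s) =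
        K.intE e fun s => q (K.edgePt e s) * r.eval s) ∧
    ∀ e, (p.1 e).eval 0 = q (K.vert (K.src e)) ∧
      (p.1 e).eval (K.len e) = q (K.vert (K.tgt e))) h

omit hq in
theorem mem_EPN {e : Fin K.nE} {m : ℤ} {v : Fin 3 → Polynomial ℝ} :
    v ∈ K.EPN e m ↔ v ∈ EPV m ∧ ∑ i, K.tE e i • v i = 0 := by
  rw [EPN, Submodule.mem_inf, LinearMap.mem_ker]
  simp

omit hq in
instance finiteDimensional_EPN (e : Fin K.nE) (m : ℤ) : FiniteDimensional ℝ (K.EPN e m) :=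
  Submodule.finiteDimensional_of_le (inf_le_left : _ ≤ EPV m)

omit hq in
theorem evE_dot_tE {e : Fin K.nE} {m : ℤ} {v : Fin 3 → Polynomial ℝ} (hv : v ∈ K.EPN e m)
    (s : ℝ) : evE v s ⬝ᵥ K.tE e = 0 := by
  have h := congrArg (Polynomial.eval s) (mem_EPN.1 hv).2
  rw [Fin.sum_univ_three] at h
  simp only [Polynomial.eval_add, Polynomial.eval_smul, Polynomial.eval_zero, smul_eq_mul] at h
  rw [dotProduct, Fin.sum_univ_three]
  simp only [evE]
  linarith

omit hq in
theorem cross_cross_dot (t c r : R3) (ht : t ⬝ᵥ t = 1) :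
    (t ⨯₃ (c ⨯₃ t)) ⬝ᵥ r = c ⬝ᵥ r - (c ⬝ᵥ t) * (t ⬝ᵥ r) := by
  simp only [cross_apply, dotProduct, Fin.sum_univ_three, Matrix.cons_val] at ht ⊢
  linear_combination (c 0 * r 0 + c 1 * r 1 + c 2 * r 2) * ht

/-- The normal part of the gradient on an edge, tested with normal fields. -/
theorem gE_spec (k : ℕ) (e : Fin K.nE) {r : Fin 3 → Polynomial ℝ} (hr : r ∈ K.EPN e k) :
    K.intE e (fun s => evE ((K.IGrad k q).gE e).1 s ⬝ᵥ evE r s) =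
      K.intE e fun s => K.grad q (K.edgePt e s) ⬝ᵥ evE r s := by
  have hc := continuousOn_pi.1 (continuousOn_comp_edgePt e (contDiffOn_grad hq).continuousOn)
  have hcont : ∀ i, ContinuousOn (fun s => (K.tE e ⨯₃ (K.grad q (K.edgePt e s) ⨯₃ K.tE e)) i)
      (Icc 0 (K.len e)) := by
    intro i
    have h0 := hc 0
    have h1 := hc 1
    have h2 := hc 2
    fin_cases i <;> simp only [cross_apply, Matrix.cons_val] <;> fun_prop
  have h := projE_spec (K.len_pos e) (K.EPN e k) hcont r hr
  refine h.trans (intE_congr fun s _ => ?_)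
  rw [cross_cross_dot _ _ _ (K.tE_unit e), dotProduct_comm (K.tE e), evE_dot_tE hr, mul_zero,
    sub_zero]

/-- The edge component: the tangential part of the gradient is the derivative of `q` along the edge,
and the normal part is interpolated directly. -/
theorem gradE_IGrad (k : ℕ) : gradE (K.IGrad k q) = K.edgeInterp (k + 2) k (K.grad q) := by
  have hv := contDiffOn_grad hq
  refine solve_congr fun p => and_congr_left' (forall_congr' fun e => forall₂_congr fun r hr => ?_)
  rw [eq_comm, @eq_comm _ (K.intE e _)]
  suffices h : K.intE e (fun s => ((Polynomial.derivative ((K.IGrad k q).qE.1 e)).eval s • K.tE e +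
      evE ((K.IGrad k q).gE e).1 s) ⬝ᵥ evE r s) =
      K.intE e fun s => K.grad q (K.edgePt e s) ⬝ᵥ evE r s by rw [h]
  -- split the test field into its tangential and normal parts
  set ρ : Polynomial ℝ := ∑ i, K.tE e i • r i with hρ
  have hρm : ρ ∈ EP k := Submodule.sum_mem _ fun i _ => Submodule.smul_mem _ _ (mem_EPV.1 hr i)
  have hρs : ∀ s, ρ.eval s = K.tE e ⬝ᵥ evE r s := fun s => by
    simp [hρ, Polynomial.eval_finsetSum, dotProduct, evE]
  set rn : Fin 3 → Polynomial ℝ := r - fun i => K.tE e i • ρ with hrn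
  have hrns : ∀ s, evE rn s = evE r s - ρ.eval s • K.tE e := fun s => by
    ext i
    simp [hrn, evE, mul_comm]
  have hrnm : rn ∈ K.EPN e k := by
    refine mem_EPN.2 ⟨Submodule.sub_mem _ hr (smul_mem_EPV hρm _), ?_⟩
    have ht := K.tE_unit e
    rw [dotProduct] at ht
    simp only [hrn, Pi.sub_apply, smul_sub, Finset.sum_sub_distrib, ← hρ, smul_smul]
    rw [← Finset.sum_smul, ht, one_smul, sub_self]
  have hqs := qE_spec hq k
  have hq1 : ContDiffOn ℝ 1 q (closure K.T) := hq.of_le one_le_two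
  have hgc := continuousOn_comp_edgePt e hv.continuousOn
  have hgt : ContinuousOn (fun s => K.grad q (K.edgePt e s) ⬝ᵥ K.tE e) (Icc 0 (K.len e)) :=
    continuousOn_dotProduct (continuousOn_pi.1 hgc) fun _ => continuousOn_const
  have ht : K.intE e (fun s => (Polynomial.derivative ((K.IGrad k q).qE.1 e)).eval s *
      ρ.eval s) = K.intE e fun s => (K.grad q (K.edgePt e s) ⬝ᵥ K.tE e) * ρ.eval s := by
    refine K.intE_derivative e (f := fun s => q (K.edgePt e s))
      (continuousOn_comp_edgePt e hq.continuousOn) hgt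
      (fun s hs => hasDerivAt_comp_edgePt hq1 e hs) (hqs.1 e) ?_ ?_
      (derivative_mem_EP (by ring_nf; exact le_rfl) hρm)
    · simpa only [edgePt_zero] using (hqs.2 e).1
    · simpa only [edgePt_len] using (hqs.2 e).2
  have hn := gE_spec hq k e hrnm
  have hL := K.len_pos e
  have e1 : K.intE e (fun s => ((Polynomial.derivative ((K.IGrad k q).qE.1 e)).eval s • K.tE e +
      evE ((K.IGrad k q).gE e).1 s) ⬝ᵥ evE r s) =
      K.intE e (fun s => (Polynomial.derivative ((K.IGrad k q).qE.1 e)).eval s * ρ.eval s) +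
      K.intE e (fun s => evE ((K.IGrad k q).gE e).1 s ⬝ᵥ evE rn s) := by
    rw [intE, intE, intE, ← intervalIntegral.integral_add]
    · refine intE_congr fun s _ => ?_
      rw [hrns, add_dotProduct, smul_dotProduct, dotProduct_sub, dotProduct_smul,
        evE_dot_tE ((K.IGrad k q).gE e).2, hρs, smul_eq_mul, smul_zero, sub_zero]
    · exact integrable_mul_eval hL (Polynomial.continuous _).continuousOn ρ
    · exact intervalIntegrable_of_continuousOn (continuousOn_dotProduct
        (fun i => (Polynomial.continuous _).continuousOn)
        fun i => (Polynomial.continuous _).continuousOn)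
  have e2 : K.intE e (fun s => K.grad q (K.edgePt e s) ⬝ᵥ evE r s) =
      K.intE e (fun s => (K.grad q (K.edgePt e s) ⬝ᵥ K.tE e) * ρ.eval s) +
      K.intE e (fun s => K.grad q (K.edgePt e s) ⬝ᵥ evE rn s) := by
    rw [intE, intE, intE, ← intervalIntegral.integral_add]
    · refine intE_congr fun s _ => ?_
      rw [hrns, dotProduct_sub, dotProduct_smul, smul_eq_mul]
      ring
    · exact integrable_mul_eval hL hgt ρ
    · exact intervalIntegrable_of_continuousOn (continuousOn_dotProduct
        (continuousOn_pi.1 hgc) fun i => (Polynomial.continuous _).continuousOn)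
  rw [e1, e2, ht, hn]

end Gradient

end Cell

/-! ### Solvability of the defining problems of the discrete gradient -/

/-- An object defined by a solvable problem satisfies the defining equations. -/
theorem of_eq_solve {α : Type*} [Nonempty α] {p : α → Prop} {x : α} (hx : x = solve p)
    (h : ∃ a, p a) : p x := hx ▸ solve_spec h

instance finiteDimensional_Roly2 (m : ℤ) : FiniteDimensional ℝ (Roly2 m) :=
  Submodule.finiteDimensional_of_le Roly2_le

instance finiteDimensional_Roly3 (m : ℤ) : FiniteDimensional ℝ (Roly3 m) :=
  Submodule.finiteDimensional_of_le Roly3_le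

instance finiteDimensional_RolyC {d : ℕ} (c : Fin d → ℝ) (m : ℤ) :
    FiniteDimensional ℝ (RolyC d c m) :=
  Submodule.finiteDimensional_of_le (RolyC_le c m)

instance finiteDimensional_Goly {d : ℕ} (m : ℤ) : FiniteDimensional ℝ (Goly d m) :=
  Submodule.finiteDimensional_of_le (Goly_le m)

instance finiteDimensional_GolyC2 (m : ℤ) : FiniteDimensional ℝ (GolyC2 m) :=
  Submodule.finiteDimensional_of_le GolyC2_le

namespace Cell

variable {K : Cell} {k : ℕ}

theorem continuousOn_evV_edge (f : Fin K.nF) (e : Fin K.nE) {c : ℕ} (w : Fin c → Pol 2)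
    (u : Fin c → ℝ) (S : Set ℝ) :
    ContinuousOn (fun s => evV w (K.edgeInFace f e s) ⬝ᵥ u) S :=
  continuousOn_dotProduct (fun i => ((continuous_evV_apply w i).comp
    (K.continuous_edgeInFace f e)).continuousOn) fun _ => continuousOn_const

theorem continuousOn_evV_face (f : Fin K.nF) {c : ℕ} (w : Fin c → Pol 3) (u : Fin c → ℝ)
    (S : Set (Fin 2 → ℝ)) : ContinuousOn (fun y => evV w (K.faceMap f y) ⬝ᵥ u) S :=
  continuousOn_dotProduct (fun i => ((continuous_evV_apply w i).comp
    (K.continuous_faceMap f)).continuousOn) fun _ => continuousOn_const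

theorem isLinear_intF_mul (f : Fin K.nF) (p : Pol 2) :
    IsLinearMap ℝ fun r : Pol 2 => K.intF f fun y => eval y p * eval y r :=
  (K.isRegion_faceReg f).isLinear_mul ((K.isRegion_faceReg f).integrableOn_eval p)

theorem isLinear_intF_dot (f : Fin K.nF) {c : ℕ} (v : Fin c → Pol 2) :
    IsLinearMap ℝ fun w : Fin c → Pol 2 => K.intF f fun y => evV v y ⬝ᵥ evV w y :=
  (K.isRegion_faceReg f).isLinear_dot (f := evV v)
    fun i => (K.isRegion_faceReg f).integrableOn_eval (v i)

/-- Linearity of the boundary terms on a face, for a weight `φ` and directions `u`. -/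
theorem isLinear_bdF_dot (f : Fin K.nF) {φ : Fin K.nE → ℝ → ℝ}
    (hφ : ∀ e ∈ K.edges f, ContinuousOn (φ e) (Icc 0 (K.len e))) (u : Fin K.nE → Fin 2 → ℝ) :
    IsLinearMap ℝ fun w : Fin 2 → Pol 2 => K.bdF f fun e s =>
      φ e s * (evV w (K.edgeInFace f e s) ⬝ᵥ u e) :=
  isLinear_bdF (fun w e he => (hφ e he).mul (continuousOn_evV_edge f e w (u e) _))
    fun e s => (isLinear_evV_dot _ (u e)).fun_const_mul (φ e s)

theorem GF_spec (q : K.XGrad k) (f : Fin K.nF) : ∀ w ∈ VPoly 2 2 k,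
    K.intF f (fun y => evV (GF q f).1 y ⬝ᵥ evV w y) =
      -K.intF f (fun y => eval y (q.qF f).1 * eval y (divP 2 w)) +
      K.bdF f fun e s =>
        (q.qE.1 e).eval s * (evV w (K.edgeInFace f e s) ⬝ᵥ K.tang f (K.nFE f e)) := by
  have hlin := ((isLinear_intF_mul f (q.qF f).1).fun_comp (divP 2)).fun_neg.fun_add
    (isLinear_bdF_dot f (φ := fun e s => (q.qE.1 e).eval s)
      (fun e _ => (Polynomial.continuous _).continuousOn) fun e => K.tang f (K.nFE f e))
  obtain ⟨g, hg⟩ := (K.isRegion_faceReg f).exists_mem_repV (VPoly 2 2 k) hlin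
  exact of_eq_solve (x := GF q f) rfl ⟨g, hg⟩

theorem GperpF_spec (q : K.XGrad k) (f : Fin K.nF) : ∀ w ∈ VPoly 2 2 k,
    K.intF f (fun y => evV (GperpF q f).1 y ⬝ᵥ evV w y) =
      -K.intF f (fun y => eval y (q.gF f).1 * eval y (rotP w)) -
      K.bdF f fun e s =>
        (evE (q.gE e).1 s ⬝ᵥ K.nrm f) * (evV w (K.edgeInFace f e s) ⬝ᵥ K.tang f (K.tE e)) := by
  have hlin := ((isLinear_intF_mul f (q.gF f).1).fun_comp rotP).fun_neg.fun_sub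
    (isLinear_bdF_dot f (φ := fun e s => evE (q.gE e).1 s ⬝ᵥ K.nrm f)
      (fun e _ => continuousOn_dotProduct (fun i => (Polynomial.continuous _).continuousOn)
        fun _ => continuousOn_const) fun e => K.tang f (K.tE e))
  obtain ⟨g, hg⟩ := (K.isRegion_faceReg f).exists_mem_repV (VPoly 2 2 k) hlin
  exact of_eq_solve (x := GperpF q f) rfl ⟨g, hg⟩

/-- The trace exists because `div` is an isomorphism from `R^{c,k+2}(F)` onto `P^{k+1}(F)`. -/
theorem traceGrad_spec (q : K.XGrad k) (f : Fin K.nF) : ∀ v ∈ RolyC 2 0 ((k : ℤ) + 2),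
    K.intF f (fun y => eval y (traceGrad q f).1 * eval y (divP 2 v)) =
      -K.intF f (fun y => evV (GF q f).1 y ⬝ᵥ evV v y) +
      K.bdF f fun e s =>
        (q.qE.1 e).eval s * (evV v (K.edgeInFace f e s) ⬝ᵥ K.tang f (K.nFE f e)) := by
  have hlin := (isLinear_intF_dot f (GF q f).1).fun_neg.fun_add
    (isLinear_bdF_dot f (φ := fun e s => (q.qE.1 e).eval s)
      (fun e _ => (Polynomial.continuous _).continuousOn) fun e => K.tang f (K.nFE f e))
  obtain ⟨x, hx⟩ := (K.isRegion_faceReg f).exists_repS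
    ((eulerP (0 : Fin 2 → ℝ) 2).comp (Poly 2 ((k : ℤ) + 1)).subtype)
    ((eulerP_injective 0 two_ne_zero).comp Subtype.val_injective)
    (hlin.fun_comp ((koszul 0).comp (Poly 2 ((k : ℤ) + 1)).subtype))
  refine of_eq_solve (x := traceGrad q f) rfl ⟨⟨eulerP 0 2 x.1, eulerP_mem x.2⟩, ?_⟩
  rintro _ ⟨p, hp, rfl⟩
  rw [div_koszul]
  exact hx ⟨p, Poly_mono (by omega) hp⟩

theorem isLinear_bdT_dot {φ : Fin K.nF → (Fin 2 → ℝ) → ℝ}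
    (hφ : ∀ f, ContinuousOn (φ f) (closure (K.faceReg f))) (u : Fin K.nF → R3) :
    IsLinearMap ℝ fun w : Fin 3 → Pol 3 => K.bdT fun f y =>
      φ f y * (evV w (K.faceMap f y) ⬝ᵥ u f) :=
  isLinear_bdT (fun w f => (hφ f).mul (continuousOn_evV_face f w (u f) _))
    fun f y => (isLinear_evV_dot _ (u f)).fun_const_mul (φ f y)

theorem GT_spec (q : K.XGrad k) : ∀ w ∈ VPoly 3 3 k,
    K.intT (fun x => evV (GT q).1 x ⬝ᵥ evV w x) =
      -K.intT (fun x => eval x q.qT.1 * eval x (divP 3 w)) +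
      K.bdT fun f y => eval y (traceGrad q f).1 * (evV w (K.faceMap f y) ⬝ᵥ K.nrm f) := by
  have hlin := ((K.isRegion_T.isLinear_mul (K.isRegion_T.integrableOn_eval q.qT.1)).fun_comp
    (divP 3)).fun_neg.fun_add (isLinear_bdT_dot (K := K)
      (φ := fun f y => eval y (traceGrad q f).1)
      (fun f => (continuous_eval _).continuousOn) K.nrm)
  obtain ⟨g, hg⟩ := K.isRegion_T.exists_mem_repV (VPoly 3 3 k) hlin
  exact of_eq_solve (x := GT q) rfl ⟨g, hg⟩

/-! ### Commutation of the discrete gradient -/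

section Consistency

variable {q : R3 → ℝ} (hq : ContDiffOn ℝ 2 q (closure K.T))

include hq

omit hq in
theorem integrableOn_comp_face {g : R3 → ℝ} (hg : ContinuousOn g (closure K.T)) (f : Fin K.nF) :
    IntegrableOn (fun y => g (K.faceMap f y)) (K.faceReg f) :=
  (K.isRegion_faceReg f).integrableOn_of_continuousOn (continuousOn_comp_faceMap f hg)

/-- The boundary terms of the interpolate are exact for fields whose normal components on the edges
have degree at most `k - 1`. -/
theorem bdF_qE (k : ℕ) (f : Fin K.nF) {w : Fin 2 → Pol 2}
    (hw : ∀ e ∈ K.edges f, ∃ r ∈ EP ((k : ℤ) - 1), ∀ s,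
      r.eval s = evV w (K.edgeInFace f e s) ⬝ᵥ K.tang f (K.nFE f e)) :
    K.bdF f (fun e s => ((K.IGrad k q).qE.1 e).eval s *
        (evV w (K.edgeInFace f e s) ⬝ᵥ K.tang f (K.nFE f e))) =
      K.bdF f fun e s => q (K.faceMap f (K.edgeInFace f e s)) *
        (evV w (K.edgeInFace f e s) ⬝ᵥ K.tang f (K.nFE f e)) := by
  refine bdF_congr fun e he => ?_
  obtain ⟨r, hr, hrw⟩ := hw e he
  simp_rw [← hrw, K.faceMap_edgeInFace he]
  exact (qE_spec hq k).1 e r hr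

/-- The discrete face gradient of the interpolate is exact against fields whose normal components on
the edges have degree at most `k - 1`. -/
theorem intF_GF (k : ℕ) (f : Fin K.nF) {w : Fin 2 → Pol 2} (hwk : w ∈ VPoly 2 2 k)
    (hw : ∀ e ∈ K.edges f, ∃ r ∈ EP ((k : ℤ) - 1), ∀ s,
      r.eval s = evV w (K.edgeInFace f e s) ⬝ᵥ K.tang f (K.nFE f e)) :
    K.intF f (fun y => evV (GF (K.IGrad k q) f).1 y ⬝ᵥ evV w y) =
      K.intF f fun y => K.tang f (K.grad q (K.faceMap f y)) ⬝ᵥ evV w y := by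
  rw [GF_spec _ f w hwk, bdF_qE hq k f hw,
    (greenF_of_contDiffOn (hq.of_le one_le_two) f).dot w]
  congr 2
  exact (K.isRegion_faceReg f).projS_spec (Poly 2 ((k : ℤ) - 1))
    (integrableOn_comp_face hq.continuousOn f) _ (divP_mem rfl hwk)

omit hq in
/-- Fields in `R^{c,m}` have normal components of degree `m - 1` on the edges. -/
theorem koszul_normal_mem {m : ℤ} {w : Fin 2 → Pol 2} (hw : w ∈ RolyC 2 0 m) (f : Fin K.nF) :
    ∀ e ∈ K.edges f, ∃ r ∈ EP (m - 1), ∀ s,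
      r.eval s = evV w (K.edgeInFace f e s) ⬝ᵥ K.tang f (K.nFE f e) := by
  obtain ⟨p, hp, rfl⟩ := hw
  exact fun e he => exists_restrict_edge_koszul hp he

/-- The trace of the interpolate reproduces the moments of degree `k - 1` on the face: `div` maps
`R^{c,k}` onto `P^{k-1}`, and the fields in `R^{c,k}` have normal components of degree `k - 1` on
the edges. -/
theorem intF_traceGrad (k : ℕ) (f : Fin K.nF) {p : Pol 2} (hp : p ∈ Poly 2 ((k : ℤ) - 1)) :
    K.intF f (fun y => eval y (traceGrad (K.IGrad k q) f).1 * eval y p) =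
      K.intF f fun y => q (K.faceMap f y) * eval y p := by
  obtain ⟨u, hu, rfl⟩ := exists_koszul_div two_ne_zero 0 hp
  have hk : koszul 0 u ∈ RolyC 2 0 (k : ℤ) := ⟨u, hu, rfl⟩
  have hn := koszul_normal_mem hk f
  rw [traceGrad_spec _ f _ (RolyC_mono 0 (by omega) hk), bdF_qE hq k f hn,
    intF_GF hq k f (RolyC_le _ _ hk) hn, (greenF_of_contDiffOn (hq.of_le one_le_two) f).dot]
  ring

/-- The cell gradient of the interpolate is exact against fields whose normal components on the
faces have degree at most `k - 1`. -/
theorem intT_GT (k : ℕ) {w : Fin 3 → Pol 3} (hwk : w ∈ VPoly 3 3 k)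
    (hw : ∀ f : Fin K.nF, ∃ r ∈ Poly 2 ((k : ℤ) - 1), ∀ y,
      eval y r = evV w (K.faceMap f y) ⬝ᵥ K.nrm f) :
    K.intT (fun x => evV (GT (K.IGrad k q)).1 x ⬝ᵥ evV w x) =
      K.intT fun x => K.grad q x ⬝ᵥ evV w x := by
  rw [GT_spec _ w hwk, (greenT_of_contDiffOn (hq.of_le one_le_two)).dot w]
  congr 1
  · congr 1
    exact K.isRegion_T.projS_spec (Poly 3 ((k : ℤ) - 1))
      (K.isRegion_T.integrableOn_of_continuousOn hq.continuousOn) _ (divP_mem rfl hwk)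
  · refine bdT_congr fun f => ?_
    obtain ⟨r, hr, hrw⟩ := hw f
    simp_rw [← hrw]
    exact intF_traceGrad hq k f hr

theorem intF_GperpF (k : ℕ) (f : Fin K.nF) {w : Fin 2 → Pol 2} (hw : w ∈ VPoly 2 2 k) :
    K.intF f (fun y => evV (GperpF (K.IGrad k q) f).1 y ⬝ᵥ evV w y) =
      K.intF f fun y => K.crossNormalDeriv f (K.grad q) y ⬝ᵥ evV w y := by
  have hv := contDiffOn_grad hq
  have h1 : K.intF f (fun y => K.crossNormalDeriv f (K.grad q) y ⬝ᵥ evV w y) =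
      K.intF f fun y => K.tang f (K.nrm f ⨯₃
        K.grad (fun x => K.grad q x ⬝ᵥ K.nrm f) (K.faceMap f y)) ⬝ᵥ evV w y :=
    intF_congr fun y hy => by rw [crossNormalDeriv_grad hq f (subset_closure hy)]
  rw [h1, intF_cross_grad (contDiffOn_dot hv (K.nrm f)), GperpF_spec _ f w hw]
  congr 1
  · congr 1
    exact (K.isRegion_faceReg f).projS_spec (Poly 2 ((k : ℤ) - 1))
      (integrableOn_comp_face (continuousOn_dot_const hv.continuousOn _) f) _
      (rotP_mem rfl hw)
  · refine bdF_congr fun e he => ?_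
    obtain ⟨r, hr, hrw⟩ := exists_restrict_edge_dot hw f e (K.tang f (K.tE e))
    have hrn : (fun i => K.nrm f i • r) ∈ K.EPN e k := by
      refine mem_EPN.2 ⟨smul_mem_EPV hr _, ?_⟩
      have h0 := K.tE_nrm he
      rw [dotProduct] at h0
      simp_rw [smul_smul]
      rw [← Finset.sum_smul, h0, zero_smul]
    simp_rw [← hrw]
    rw [← intE_smul_single, ← intE_smul_single]
    exact gE_spec hq k e hrn

/-- The discrete gradient commutes with the interpolators. -/
theorem discGrad_IGrad (k : ℕ) : discGrad (K.IGrad k q) = K.ICurl k (K.grad q) := by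
  have hv := contDiffOn_grad hq
  simp only [discGrad, ICurl, XCurl.mk.injEq]
  refine ⟨?_, gradE_IGrad hq k, ?_, ?_, ?_, rfl, ?_, ?_, ?_, ?_⟩
  · funext v
    exact (curl_grad hq (K.vert_mem_closure_T v)).symm
  · funext e
    rw [gradE_IGrad hq k]
    -- the curl vanishes and the Hessian is symmetric
    have hjac : ∀ s ∈ Icc 0 (K.len e), (K.curl (K.grad q) (K.edgePt e s) ⬝ᵥ K.tE e) • K.tE e +
        K.grad (fun x => K.grad q x ⬝ᵥ K.tE e) (K.edgePt e s) ⨯₃ K.tE e =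
        (fun i => K.jac (K.grad q) (K.edgePt e s) i ⬝ᵥ K.tE e) ⨯₃ K.tE e := by
      intro s hs
      have hx := K.edgePt_mem_closure_T e hs
      rw [curl_grad hq hx, zero_dotProduct, zero_smul, zero_add]
      congr 2
      ext i
      rw [grad_dot hv _ hx, dotProduct]
      exact Finset.sum_congr rfl fun j _ => by rw [jac_grad_symm hq hx, mul_comm]
    have hc : ∀ i, ContinuousOn (fun s =>
        ((fun i => K.jac (K.grad q) (K.edgePt e s) i ⬝ᵥ K.tE e) ⨯₃ K.tE e) i)
        (Icc 0 (K.len e)) := by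
      have h := fun i => continuousOn_dotProduct
        (fun j => continuousOn_comp_edgePt e (continuousOn_jac hv i j))
        fun j => continuousOn_const (c := K.tE e j)
      have h0 := h 0
      have h1 := h 1
      have h2 := h 2
      intro i
      fin_cases i <;> simp only [cross_apply] <;> fun_prop
    refine (projE_eq (K.len_pos e) (EPV (k + 1)) (fun i => (hc i).congr fun s hs => ?_) _
      fun r hr => ?_).symm
    · rw [hjac s hs]
    · refine (intE_dEcross_edgeInterp (by omega) rfl rfl _ hv e hr).trans
        (intE_congr fun s hs => ?_)
      rw [hjac s hs]
  · funext f
    refine projV_congr fun r hr => intF_GF hq k f ?_ fun e _ => ?_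
    · exact VPoly_mono (by omega) (Roly2_le hr)
    · exact exists_restrict_edge_dot (Roly2_le hr) f e _
  · funext f
    exact projV_congr fun r hr => intF_GF hq k f (RolyC_le _ _ hr) (koszul_normal_mem hr f)
  · funext f
    exact projV_congr fun r hr => intF_GperpF hq k f (Goly_le _ hr)
  · funext f
    exact projV_congr fun r hr => intF_GperpF hq k f (GolyC2_le hr)
  · refine projV_congr fun r hr => intT_GT hq k ?_ fun f => ?_
    · exact VPoly_mono (by omega) (Roly3_le hr)
    · exact exists_restrict_face_dot (Roly3_le hr) f _
  · refine projV_congr fun r hr => intT_GT hq k (RolyC_le _ _ hr) fun f => ?_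
    obtain ⟨p, hp, rfl⟩ := hr
    exact exists_restrict_face_koszul hp f

end Consistency

end Cell

/-! ### Polynomials of zero mean -/

section ZeroMean

variable {d : ℕ} {R : Set (Fin d → ℝ)} {m : ℤ}

theorem IsRegion.mem_Poly0 (hR : IsRegion R) {p : Pol d} :
    p ∈ Poly0 R m ↔ p ∈ Poly d m ∧ ∫ x in R, eval x p = 0 := by
  refine ⟨fun hp => ?_, fun hp => Submodule.subset_span hp⟩
  have hlin : IsLinearMap ℝ fun p : Pol d => ∫ x in R, eval x p := by
    have h := hR.isLinear_mul (f := fun _ => 1)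
      (hR.integrableOn_of_continuousOn continuousOn_const)
    simpa only [one_mul] using h
  have hle : Poly0 R m ≤ Poly d m ⊓ LinearMap.ker (hlin.mk' _) :=
    Submodule.span_le.2 fun q hq => ⟨hq.1, hq.2⟩
  exact hle hp

theorem IsRegion.Poly0_le (hR : IsRegion R) : Poly0 R m ≤ Poly d m := fun _ hp =>
  (hR.mem_Poly0.1 hp).1

theorem IsRegion.measureReal_pos (hR : IsRegion R) : 0 < volume.real R :=
  ENNReal.toReal_pos (hR.isOpen.measure_pos volume hR.nonempty).ne' hR.bounded.measure_lt_top.ne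

theorem IsRegion.exists_sub_C_mem_Poly0 (hR : IsRegion R) (hm : 0 ≤ m) {p : Pol d}
    (hp : p ∈ Poly d m) : ∃ a : ℝ, p - MvPolynomial.C a ∈ Poly0 R m := by
  have hv := hR.measureReal_pos
  refine ⟨(∫ x in R, eval x p) / volume.real R, hR.mem_Poly0.2
    ⟨Submodule.sub_mem _ hp (Poly_mono hm (C_mem_Poly _)), ?_⟩⟩
  simp only [map_sub, MvPolynomial.eval_C]
  rw [integral_sub (hR.integrableOn_eval p) (hR.integrableOn_of_continuousOn continuousOn_const),
    setIntegral_const, smul_eq_mul]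
  field_simp
  ring

theorem dP_C (i : Fin d) (a : ℝ) : dP i (MvPolynomial.C a : Pol d) = 0 := MvPolynomial.pderiv_C

theorem IsRegion.eq_zero_of_dP_eq_zero (hR : IsRegion R) {p : Pol d} (hp : p ∈ Poly0 R m)
    (h : ∀ i, dP i p = 0) : p = 0 := by
  have hconst : ∀ x, eval x p = eval 0 p := fun x => by
    refine is_const_of_fderiv_eq_zero (𝕜 := ℝ) (f := fun x => eval x p)
      (fun x => (hasFDerivAt_eval p x).differentiableAt) (fun x => ?_) x 0
    rw [(hasFDerivAt_eval p x).fderiv]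
    simp [h]
  have h0 := (hR.mem_Poly0.1 hp).2
  simp_rw [hconst] at h0
  rw [setIntegral_const, smul_eq_mul] at h0
  have h1 := (mul_eq_zero.1 h0).resolve_left hR.measureReal_pos.ne'
  exact MvPolynomial.funext fun x => by rw [hconst, h1, map_zero]

end ZeroMean

namespace Cell

variable {K : Cell} {k : ℕ}

/-! ### Solvability of the defining problems of the discrete curl -/

theorem continuousOn_evE_dot (e : Fin K.nE) (v : Fin 3 → Polynomial ℝ) (u : R3) :
    ContinuousOn (fun s => evE v s ⬝ᵥ u) (Icc 0 (K.len e)) :=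
  continuousOn_dotProduct (fun i => (Polynomial.continuous (v i)).continuousOn)
    fun _ => continuousOn_const

theorem isLinear_bdF_eval (f : Fin K.nF) {φ : Fin K.nE → ℝ → ℝ}
    (hφ : ∀ e ∈ K.edges f, ContinuousOn (φ e) (Icc 0 (K.len e))) :
    IsLinearMap ℝ fun r : Pol 2 => K.bdF f fun e s => φ e s * eval (K.edgeInFace f e s) r :=
  isLinear_bdF (fun r e he => (hφ e he).mul ((continuous_eval r).comp
    (K.continuous_edgeInFace f e)).continuousOn)
    fun e s => (isLinear_eval _).fun_const_mul (φ e s)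

theorem CF_spec (v : K.XCurl k) (f : Fin K.nF) : ∀ r ∈ Poly 2 k,
    K.intF f (fun y => eval y (CF v f).1 * eval y r) =
      K.intF f (fun y => evV (v.vRF f).1 y ⬝ᵥ evV (vrotP r) y) -
      K.bdF f fun e s => (evE (v.vE.1 e) s ⬝ᵥ K.tE e) * eval (K.edgeInFace f e s) r := by
  have hlin := ((isLinear_intF_dot f (v.vRF f).1).fun_comp vrotP).fun_sub
    (isLinear_bdF_eval f (φ := fun e s => evE (v.vE.1 e) s ⬝ᵥ K.tE e)
      fun e _ => continuousOn_evE_dot e _ _)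
  obtain ⟨g, hg⟩ := (K.isRegion_faceReg f).exists_repS (Poly 2 (k : ℤ)).subtype
    Subtype.val_injective (hlin.fun_comp (Poly 2 (k : ℤ)).subtype)
  exact of_eq_solve (x := CF v f) rfl ⟨g, fun r hr => hg ⟨r, hr⟩⟩

theorem CvecF_spec (v : K.XCurl k) (f : Fin K.nF) : ∀ r ∈ VPoly 2 2 k,
    K.intF f (fun y => evV (CvecF v f).1 y ⬝ᵥ evV r y) =
      K.intF f (fun y => eval y (v.vF f).1 * eval y (rotP r)) +
      K.bdF f fun e s =>
        (evE (v.vE.1 e) s ⬝ᵥ K.nrm f) * (evV r (K.edgeInFace f e s) ⬝ᵥ K.tang f (K.tE e)) := by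
  have hlin := ((isLinear_intF_mul f (v.vF f).1).fun_comp rotP).fun_add
    (isLinear_bdF_dot f (φ := fun e s => evE (v.vE.1 e) s ⬝ᵥ K.nrm f)
      (fun e _ => continuousOn_evE_dot e _ _) fun e => K.tang f (K.tE e))
  obtain ⟨g, hg⟩ := (K.isRegion_faceReg f).exists_mem_repV (VPoly 2 2 k) hlin
  exact of_eq_solve (x := CvecF v f) rfl ⟨g, hg⟩

/-- The trace exists because `P^k(F)²` is the direct sum of `rot P^{0,k+1}(F)` and `R^{c,k}(F)`. -/
theorem traceCurl_spec (v : K.XCurl k) (f : Fin K.nF) :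
    ∀ r ∈ Poly0 (K.faceReg f) ((k : ℤ) + 1), ∀ w ∈ RolyC 2 0 k,
    K.intF f (fun y => evV (traceCurl v f).1 y ⬝ᵥ evV (vrotP r + w) y) =
      K.intF f (fun y => eval y (CF v f).1 * eval y r) +
      K.bdF f (fun e s => (evE (v.vE.1 e) s ⬝ᵥ K.tE e) * eval (K.edgeInFace f e s) r) +
      K.intF f fun y => evV (v.vRcF f).1 y ⬝ᵥ evV w y := by
  have hR := K.isRegion_faceReg f
  have hlin1 := (isLinear_intF_mul f (CF v f).1).fun_add
    (isLinear_bdF_eval f (φ := fun e s => evE (v.vE.1 e) s ⬝ᵥ K.tE e)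
      fun e _ => continuousOn_evE_dot e _ _)
  have hlin2 := isLinear_intF_dot f (v.vRcF f).1
  have : FiniteDimensional ℝ (Poly0 (K.faceReg f) ((k : ℤ) + 1)) :=
    Submodule.finiteDimensional_of_le hR.Poly0_le
  let L1 : Poly0 (K.faceReg f) ((k : ℤ) + 1) × RolyC 2 0 (k : ℤ) →ₗ[ℝ] Pol 2 :=
    (Submodule.subtype _).comp (LinearMap.fst ℝ _ _)
  let L2 : Poly0 (K.faceReg f) ((k : ℤ) + 1) × RolyC 2 0 (k : ℤ) →ₗ[ℝ] (Fin 2 → Pol 2) :=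
    (Submodule.subtype _).comp (LinearMap.snd ℝ _ _)
  have hinj : Function.Injective (vrotP.comp L1 + L2) := by
    rw [← LinearMap.ker_eq_bot, LinearMap.ker_eq_bot']
    rintro ⟨r, w⟩ h
    change vrotP r.1 + w.1 = 0 at h
    have hw : w.1 = 0 := by
      refine eq_zero_of_div_eq_zero two_ne_zero w.2 ?_
      have h1 := congrArg (divP 2) h
      rwa [map_add, div_vrotP, zero_add, map_zero] at h1
    rw [hw, add_zero, vrotP_apply] at h
    have hr : r.1 = 0 := by
      refine hR.eq_zero_of_dP_eq_zero r.2 fun i => ?_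
      fin_cases i
      · exact neg_eq_zero.1 (congrFun h 1)
      · exact congrFun h 0
    exact Prod.ext (Subtype.ext hr) (Subtype.ext hw)
  obtain ⟨g, hg⟩ := hR.exists_repV (vrotP.comp L1 + L2) hinj
    ((hlin1.fun_comp L1).fun_add (hlin2.fun_comp L2))
  refine of_eq_solve (x := traceCurl v f) rfl ⟨⟨(vrotP.comp L1 + L2) g, ?_⟩,
    fun r hr w hw => hg (⟨r, hr⟩, ⟨w, hw⟩)⟩
  exact Submodule.add_mem _ (Roly2_le ⟨g.1.1, hR.Poly0_le g.1.2, rfl⟩) (RolyC_le _ _ g.2.2)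

theorem isLinear_dot_tang_cross (f : Fin K.nF) (a : Fin 2 → ℝ) (x : R3) :
    IsLinearMap ℝ fun r : Fin 3 → Pol 3 => a ⬝ᵥ K.tang f (evV r x ⨯₃ K.nrm f) where
  map_add r r' := by
    rw [evV_add, map_add, LinearMap.add_apply, tang_add, dotProduct_add]
  map_smul c r := by
    have : evV (c • r) x = c • evV r x := by
      ext i
      simp [evV]
    rw [this, map_smul, LinearMap.smul_apply, tang_smul, dotProduct_smul]

theorem CT_spec (v : K.XCurl k) : ∀ r ∈ VPoly 3 3 k,
    K.intT (fun x => evV (CT v).1 x ⬝ᵥ evV r x) =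
      K.intT (fun x => evV v.vRT.1 x ⬝ᵥ evV (curlP r) x) +
      K.bdT fun f y => evV (traceCurl v f).1 y ⬝ᵥ
        K.tang f (evV r (K.faceMap f y) ⨯₃ K.nrm f) := by
  have hlin := ((K.isRegion_T.isLinear_dot (f := evV v.vRT.1)
    fun i => K.isRegion_T.integrableOn_eval (v.vRT.1 i)).fun_comp curlP).fun_add
    (isLinear_bdT (K := K) (H := fun (r : Fin 3 → Pol 3) f y => evV (traceCurl v f).1 y ⬝ᵥ
        K.tang f (evV r (K.faceMap f y) ⨯₃ K.nrm f)) (fun r f => ?_)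
      fun f y => isLinear_dot_tang_cross f _ _)
  · obtain ⟨g, hg⟩ := K.isRegion_T.exists_mem_repV (VPoly 3 3 k) hlin
    exact of_eq_solve (x := CT v) rfl ⟨g, hg⟩
  · refine continuousOn_dotProduct (fun i => (continuous_evV_apply _ i).continuousOn) fun i => ?_
    have h : Continuous fun y => K.tang f (evV r (K.faceMap f y) ⨯₃ K.nrm f) i := by
      have h1 := fun j => (continuous_evV_apply r j).comp (K.continuous_faceMap f)
      have h10 := h1 0
      have h11 := h1 1
      have h12 := h1 2
      simp only [Function.comp_def] at h10 h11 h12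
      simp only [tang, comps, cross_apply, dotProduct, Fin.sum_univ_three, Matrix.cons_val]
      fun_prop
    exact h.continuousOn

section Consistency

variable {v : R3 → R3}

/-! ### The discrete curl of an interpolate -/

/-- The tangential trace of the interpolate is exact on `P^{k-1}(F)² + R^{c,k}(F)`. -/
theorem intF_traceCurl (hv : ContinuousOn v (closure K.T)) (k : ℕ) (f : Fin K.nF)
    {w : Fin 2 → Pol 2} (hw : w ∈ VPoly 2 2 ((k : ℤ) - 1) ⊔ RolyC 2 0 (k : ℤ)) :
    K.intF f (fun y => evV (traceCurl (K.ICurl k v) f).1 y ⬝ᵥ evV w y) =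
      K.intF f fun y => K.tang f (v (K.faceMap f y)) ⬝ᵥ evV w y := by
  have hR := K.isRegion_faceReg f
  obtain ⟨w₁, hw₁, w₂, hw₂, rfl⟩ := Submodule.mem_sup.1 hw
  obtain ⟨r, hr, u, hu, rfl⟩ := exists_vrotP_add_koszul hw₁
  rw [sub_add_cancel] at hr
  obtain ⟨a, ha⟩ := hR.exists_sub_C_mem_Poly0 (Int.natCast_nonneg k) hr
  -- `rot r` does not change if `r` is normalised to zero mean
  set r' := r - MvPolynomial.C a with hr'
  have hvr : vrotP r' = vrotP r := by
    have hC : vrotP (MvPolynomial.C a) = 0 := by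
      rw [vrotP_apply, dP_C, dP_C, neg_zero]
      ext1 i
      fin_cases i <;> rfl
    rw [hr', map_sub, hC, sub_zero]
  have hr'k : r' ∈ Poly 2 (k : ℤ) := hR.Poly0_le ha
  have hr'0 : r' ∈ Poly0 (K.faceReg f) ((k : ℤ) + 1) :=
    hR.mem_Poly0.2 ⟨Poly_mono (by omega) hr'k, (hR.mem_Poly0.1 ha).2⟩
  have hw' : koszul 0 u + w₂ ∈ RolyC 2 0 (k : ℤ) :=
    Submodule.add_mem _ ⟨u, Poly_mono (by omega) hu, rfl⟩ hw₂
  have hint : ∀ i, IntegrableOn (fun y => K.tang f (v (K.faceMap f y)) i) (K.faceReg f) :=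
    fun i => hR.integrableOn_of_continuousOn (continuousOn_tang_comp hv i)
  have h1 := traceCurl_spec (K.ICurl k v) f r' hr'0 _ hw'
  rw [CF_spec _ f r' hr'k, sub_add_cancel, hvr] at h1
  have h2 := hR.projV_spec (Roly2 ((k : ℤ) - 1)) hint (vrotP r) ⟨r, by rwa [sub_add_cancel], rfl⟩
  have h3 := hR.projV_spec (RolyC 2 0 (k : ℤ)) hint _ hw'
  rw [add_assoc, h1]
  refine (congrArg₂ (· + ·) h2 h3).trans ?_
  exact ((hR.isLinear_dot hint).map_add _ _).symm

theorem evV_koszulCross (c : R3) (p : Fin 3 → Pol 3) (x : R3) :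
    evV (koszulCross c p) x = (x - c) ⨯₃ evV p x := by
  ext i
  rw [koszulCross_apply, cross_apply]
  fin_cases i <;> simp [evV]

theorem exists_restrict_face_cross {m : ℤ} {r : Fin 3 → Pol 3} (hr : r ∈ VPoly 3 3 m)
    (f : Fin K.nF) : ∃ w ∈ VPoly 2 2 m, ∀ y,
      evV w y = K.tang f (evV r (K.faceMap f y) ⨯₃ K.nrm f) := by
  choose w hw hwr using fun i : Fin 2 =>
    exists_restrict_face_dot hr f (K.nrm f ⨯₃ K.frame f i.castSucc)
  refine ⟨w, mem_VPoly.2 hw, fun y => funext fun i => (hwr i y).trans ?_⟩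
  exact (cross_dotProduct _ _ _).symm

/-- For `r = (x - x_T) × p` the field `r × n_F` restricts to `P^{m-1}(F)² + R^{c,m}(F)`: it equals
`((x - x_T) · n_F) p - (p · n_F) (x - x_T)`, and `(x - x_T) · n_F` is constant on the face. -/
theorem exists_restrict_face_koszulCross {m : ℤ} {r : Fin 3 → Pol 3} (hr : r ∈ GolyC3 K.xT m)
    (f : Fin K.nF) : ∃ w ∈ VPoly 2 2 (m - 1) ⊔ RolyC 2 0 m, ∀ y,
      evV w y = K.tang f (evV r (K.faceMap f y) ⨯₃ K.nrm f) := by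
  obtain ⟨p, hp, rfl⟩ := hr
  choose w hw hwr using fun i : Fin 2 => exists_restrict_face_dot hp f (K.frame f i.castSucc)
  obtain ⟨pn, hpn, hpnr⟩ := exists_restrict_face_dot hp f (K.nrm f)
  set a := K.xF f - K.xT with ha
  refine ⟨(fun i => (a ⬝ᵥ K.nrm f) • w i - K.tang f a i • pn) + -koszul 0 pn,
    Submodule.add_mem_sup (mem_VPoly.2 fun i => Submodule.sub_mem _
      (Submodule.smul_mem _ _ (hw i)) (Submodule.smul_mem _ _ hpn))
      (Submodule.neg_mem _ ⟨pn, hpn, rfl⟩), fun y => ?_⟩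
  have hfm : K.faceMap f y - K.xT = (K.faceMap f y - K.xF f) + a := by
    rw [ha, sub_add_sub_cancel]
  have key : ∀ b p n e : R3, ((b ⨯₃ p) ⨯₃ n) ⬝ᵥ e =
      (b ⬝ᵥ n) * (p ⬝ᵥ e) - (b ⬝ᵥ e) * (p ⬝ᵥ n) := fun b p n e => by
    simp only [cross_apply, dotProduct, Fin.sum_univ_three, Matrix.cons_val]
    ring
  ext i
  rw [evV_koszulCross]
  change _ = ((_ ⨯₃ _) ⨯₃ _) ⬝ᵥ K.frame f i.castSucc
  rw [key, hfm, add_dotProduct, faceMap_nrm, zero_add, add_dotProduct]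
  have h1 : (K.faceMap f y - K.xF f) ⬝ᵥ K.frame f i.castSucc = y i :=
    congrFun (K.tang_faceMap f y) i
  rw [h1, ← hwr, ← hpnr]
  simp only [evV, Pi.add_apply, Pi.neg_apply, koszul_apply, map_add, map_sub, map_neg, map_mul,
    MvPolynomial.smul_eval, Pi.zero_apply, MvPolynomial.eval_X, MvPolynomial.eval_C, sub_zero]
  change _ = (a ⬝ᵥ K.nrm f) * _ - (_ + K.tang f a i) * _
  ring

/-- The cell curl of the interpolate is exact against fields `r` for which `r × n_F` belongs on each
face to the space where the tangential trace is exact. -/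
theorem intT_CT (hv : ContDiffOn ℝ 1 v (closure K.T)) (k : ℕ) {r : Fin 3 → Pol 3}
    (hrk : r ∈ VPoly 3 3 k)
    (hr : ∀ f : Fin K.nF, ∃ w ∈ VPoly 2 2 ((k : ℤ) - 1) ⊔ RolyC 2 0 (k : ℤ), ∀ y,
      evV w y = K.tang f (evV r (K.faceMap f y) ⨯₃ K.nrm f)) :
    K.intT (fun x => evV (CT (K.ICurl k v)).1 x ⬝ᵥ evV r x) =
      K.intT fun x => K.curl v x ⬝ᵥ evV r x := by
  rw [CT_spec _ r hrk, intT_curl hv]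
  congr 1
  · exact K.isRegion_T.projV_spec (Roly3 ((k : ℤ) - 1)) (fun i =>
      K.isRegion_T.integrableOn_of_continuousOn (continuousOn_pi.1 hv.continuousOn i)) _
      ⟨r, by rwa [sub_add_cancel], rfl⟩
  · refine bdT_congr fun f => ?_
    obtain ⟨w, hw, hwr⟩ := hr f
    simp_rw [← hwr]
    exact intF_traceCurl hv.continuousOn k f hw

end Consistency

end Cell

/-! ### Commutation of the discrete curl -/

instance finiteDimensional_GolyC3 (c : R3) (m : ℤ) : FiniteDimensional ℝ (GolyC3 c m) :=
  inferInstanceAs (FiniteDimensional ℝ ((VPoly 3 3 (m - 1)).map (koszulCross c)))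

theorem koszulCross_mem {c : R3} {m : ℤ} {p : Fin 3 → Pol 3} (hp : p ∈ VPoly 3 3 (m - 1)) :
    koszulCross c p ∈ VPoly 3 3 m := by
  have h : ∀ i j, (MvPolynomial.X i - MvPolynomial.C (c i)) * p j ∈ Poly 3 m := fun i j => by
    have := mul_mem_Poly (X_sub_C_mem_Poly i (c i)) (mem_VPoly.1 hp j)
    rwa [add_sub_cancel] at this
  rw [mem_VPoly, koszulCross_apply]
  intro i
  fin_cases i <;> exact Submodule.sub_mem _ (h _ _) (h _ _)

namespace Cell

variable {K : Cell} {k : ℕ} {v : R3 → R3}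

theorem continuousOn_curl (hv : ContDiffOn ℝ 1 v (closure K.T)) :
    ContinuousOn (K.curl v) (closure K.T) := by
  have h := continuousOn_jac hv
  have h01 := h 0 1
  have h02 := h 0 2
  have h10 := h 1 0
  have h12 := h 1 2
  have h20 := h 2 0
  have h21 := h 2 1
  refine continuousOn_pi.2 fun i => ?_
  fin_cases i <;> simp [curl] <;> fun_prop

theorem curl_dot_cross (x a b : R3) : K.curl v x ⬝ᵥ (a ⨯₃ b) =
    (b ⬝ᵥ fun i => K.jac v x i ⬝ᵥ a) - a ⬝ᵥ fun i => K.jac v x i ⬝ᵥ b := by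
  simp only [curl, cross_apply, dotProduct, Fin.sum_univ_three, Matrix.cons_val]
  ring

theorem curl_cross (x t : R3) : K.curl v x ⨯₃ t =
    (fun i => K.jac v x i ⬝ᵥ t) - fun i => ∑ j, t j * K.jac v x j i := by
  ext i
  fin_cases i <;>
    simp only [curl, cross_apply, dotProduct, Fin.sum_univ_three, Matrix.cons_val,
      Pi.sub_apply, Fin.zero_eta, Fin.mk_one, Fin.reduceFinMk] <;> ring

theorem frame_cross (f : Fin K.nF) : K.frame f 0 ⨯₃ K.frame f 1 = K.nrm f := by
  have h1 := K.tan1_unit f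
  have h2 := K.tan1_nrm f
  rw [frame_zero, frame_one]
  simp only [dotProduct, Fin.sum_univ_three] at h1 h2
  ext i
  fin_cases i <;> simp [cross_apply]
  · linear_combination K.nrm f 0 * h1 - K.tan1 f 0 * h2
  · linear_combination K.nrm f 1 * h1 - K.tan1 f 1 * h2
  · linear_combination K.nrm f 2 * h1 - K.tan1 f 2 * h2

/-- The normal component of the curl is the planar scalar curl of the tangential part. -/
theorem intF_curl_normal (hv : ContDiffOn ℝ 1 v (closure K.T)) (f : Fin K.nF) (r : Pol 2) :
    K.intF f (fun y => (K.curl v (K.faceMap f y) ⬝ᵥ K.nrm f) * eval y r) =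
      K.intF f (fun y => K.tang f (v (K.faceMap f y)) ⬝ᵥ evV (vrotP r) y) -
      K.bdF f fun e s => (v (K.edgePt e s) ⬝ᵥ K.tE e) * eval (K.edgeInFace f e s) r := by
  -- Green's formula for `∇v_t` against the skew matrix field with entries `∓r`
  have h := GreenF.ddot (f := f) (c := 2) (w := fun y => K.tang f (v (K.faceMap f y)))
    (fun i => greenF_comps hv f i.castSucc) ![![0, -r], ![r, 0]]
  have h1 : K.intF f (fun y => (K.curl v (K.faceMap f y) ⬝ᵥ K.nrm f) * eval y r) =
      K.intF f fun y => DiscreteStokes.ddot (fun (i j : Fin 2) => K.frame f i.castSucc ⬝ᵥ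
        fun a => K.jac v (K.faceMap f y) a ⬝ᵥ K.frame f j.castSucc)
        (evM ![![0, -r], ![r, 0]] y) := by
    refine intF_congr fun y _ => ?_
    rw [← frame_cross, curl_dot_cross]
    simp only [DiscreteStokes.ddot, evM, dotProduct, Fin.sum_univ_two, Matrix.cons_val, map_neg,
      map_zero, Fin.castSucc_zero, Fin.castSucc_one]
    ring
  have h2 : K.intF f (fun y => K.tang f (v (K.faceMap f y)) ⬝ᵥ evV (vrotP r) y) =
      -K.intF f fun y => K.tang f (v (K.faceMap f y)) ⬝ᵥ
        evV (divRows 2 2 ![![0, -r], ![r, 0]]) y := by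
    rw [← intF_neg]
    refine intF_congr fun y _ => ?_
    simp only [dotProduct, Fin.sum_univ_two, evV, divRows_apply, divP_apply, vrotP_apply,
      Matrix.cons_val, map_neg, map_zero, map_add]
    ring
  have h3 : K.bdF f (fun e s => K.tang f (v (K.faceMap f (K.edgeInFace f e s))) ⬝ᵥ
      fun i => evM ![![0, -r], ![r, 0]] (K.edgeInFace f e s) i ⬝ᵥ K.tang f (K.nFE f e)) =
      -K.bdF f fun e s => (v (K.edgePt e s) ⬝ᵥ K.tE e) * eval (K.edgeInFace f e s) r := by
    rw [← bdF_neg]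
    refine bdF_congr fun e he => intE_congr fun s _ => ?_
    rw [K.faceMap_edgeInFace he, K.tE_dot_eq he]
    simp only [dotProduct, Fin.sum_univ_two, evM, Matrix.cons_val, map_neg, map_zero,
      tang_nFE_zero, K.tang_nFE_one he]
    ring
  rw [h1, h, h2, h3]
  ring

variable (hv : ContDiffOn ℝ 1 v (closure K.T))

include hv

theorem CF_ICurl (k : ℕ) (f : Fin K.nF) : CF (K.ICurl k v) f =
    projS (K.faceReg f) (Poly 2 k) fun y => K.curl v (K.faceMap f y) ⬝ᵥ K.nrm f := by
  have hR := K.isRegion_faceReg f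
  have hc := continuousOn_dot_const (continuousOn_curl hv) (K.nrm f)
  refine (hR.projS_eq _ (hR.integrableOn_of_continuousOn (continuousOn_comp_faceMap f hc)) _
    fun r hr => ?_).symm
  refine (CF_spec _ f r hr).trans (Eq.trans ?_ (intF_curl_normal hv f r).symm)
  congr 1
  · exact hR.projV_spec (Roly2 ((k : ℤ) - 1)) (fun i => hR.integrableOn_of_continuousOn
      (continuousOn_tang_comp hv.continuousOn i)) _ ⟨r, by rwa [sub_add_cancel], rfl⟩
  · refine bdF_congr fun e _ => ?_
    obtain ⟨ρ, hρ, hρr⟩ := exists_restrict_edge hr f e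
    simp_rw [← hρr]
    exact edgeInterp_moment_dot (by omega) rfl hv.continuousOn e hρ (K.tE e)

theorem continuousOn_crossNormalDeriv (f : Fin K.nF) (i : Fin 2) :
    ContinuousOn (fun y => K.crossNormalDeriv f v y i) (closure (K.faceReg f)) := by
  have h := fun i => continuousOn_dotProduct
    (fun j => continuousOn_comp_faceMap f (continuousOn_jac hv i j))
    fun j => continuousOn_const (c := K.nrm f j)
  have h0 := h 0
  have h1 := h 1
  have h2 := h 2
  have hx : ∀ i, ContinuousOn (fun y => (K.nrm f ⨯₃ fun i =>
      K.jac v (K.faceMap f y) i ⬝ᵥ K.nrm f) i) (closure (K.faceReg f)) := by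
    intro i
    fin_cases i <;> simp only [cross_apply] <;> fun_prop
  exact continuousOn_dotProduct hx fun _ => continuousOn_const

/-- The tangential part of the curl, split according to `n × (curl v × n)`. -/
theorem tang_curl (f : Fin K.nF) {y : Fin 2 → ℝ} (hy : y ∈ closure (K.faceReg f)) :
    K.tang f (K.curl v (K.faceMap f y)) = K.crossNormalDeriv f v y -
      K.tang f (K.nrm f ⨯₃ K.grad (fun x => v x ⬝ᵥ K.nrm f) (K.faceMap f y)) := by
  have hx := K.faceMap_mem_closure_T f hy
  have hg : K.grad (fun x => v x ⬝ᵥ K.nrm f) (K.faceMap f y) =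
      fun i => ∑ j, K.nrm f j * K.jac v (K.faceMap f y) j i := funext fun i => grad_dot hv _ hx i
  rw [hg, crossNormalDeriv, ← tang_sub, ← map_sub (crossProduct (K.nrm f)), ← curl_cross]
  ext i
  change K.curl v (K.faceMap f y) ⬝ᵥ K.frame f i.castSucc =
    (K.nrm f ⨯₃ (K.curl v (K.faceMap f y) ⨯₃ K.nrm f)) ⬝ᵥ K.frame f i.castSucc
  rw [cross_cross_dot _ _ _ (K.nrm_unit f), dotProduct_comm (K.nrm f), frame_castSucc_nrm,
    mul_zero, sub_zero]

theorem intF_CvecF (k : ℕ) (f : Fin K.nF) {r : Fin 2 → Pol 2} (hr : r ∈ VPoly 2 2 k) :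
    K.intF f (fun y => evV (CvecF (K.ICurl k v) f).1 y ⬝ᵥ evV r y) +
      K.intF f (fun y => K.crossNormalDeriv f v y ⬝ᵥ evV r y) =
      K.intF f fun y => K.tang f (K.curl v (K.faceMap f y)) ⬝ᵥ evV r y := by
  have hR := K.isRegion_faceReg f
  have h1 : K.intF f (fun y => evV (CvecF (K.ICurl k v) f).1 y ⬝ᵥ evV r y) =
      -K.intF f fun y => K.tang f (K.nrm f ⨯₃
        K.grad (fun x => v x ⬝ᵥ K.nrm f) (K.faceMap f y)) ⬝ᵥ evV r y := by
    rw [intF_cross_grad (contDiffOn_dot hv _), CvecF_spec _ f r hr, neg_sub, sub_neg_eq_add,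
      add_comm]
    congr 1
    · refine bdF_congr fun e _ => ?_
      obtain ⟨ρ, hρ, hρr⟩ := exists_restrict_edge_dot hr f e (K.tang f (K.tE e))
      simp_rw [← hρr]
      exact edgeInterp_moment_dot (by omega) rfl hv.continuousOn e hρ (K.nrm f)
    · exact hR.projS_spec (Poly 2 ((k : ℤ) - 1)) (integrableOn_comp_face
        (continuousOn_dot_const hv.continuousOn _) f) _ (rotP_mem rfl hr)
  have hc := fun i => hR.integrableOn_of_continuousOn (continuousOn_crossNormalDeriv hv f i)
  have hcurl := fun i => hR.integrableOn_of_continuousOn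
    (continuousOn_tang_comp (f := f) (continuousOn_curl hv) i)
  have h2 : K.intF f (fun y => K.tang f (K.nrm f ⨯₃
      K.grad (fun x => v x ⬝ᵥ K.nrm f) (K.faceMap f y)) ⬝ᵥ evV r y) =
      K.intF f (fun y => K.crossNormalDeriv f v y ⬝ᵥ evV r y) -
      K.intF f fun y => K.tang f (K.curl v (K.faceMap f y)) ⬝ᵥ evV r y := by
    rw [intF, intF, intF, ← integral_sub (hR.integrableOn_dot hc r) (hR.integrableOn_dot hcurl r)]
    refine intF_congr fun y hy => ?_
    rw [tang_curl hv f (subset_closure hy), sub_dotProduct, sub_sub_cancel]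
  rw [h1, h2]
  ring

/-- The edge component: `r_E - ∂_t v × t_E` recombines to the curl, whose part normal to `t_E` is
`∇(v · t_E) × t_E - ∂_t v × t_E`. -/
theorem CE_ICurl (k : ℕ) : CE (K.ICurl k v) = K.edgeInterp (k + 3) (k + 1) (K.curl v) := by
  refine solve_congr fun p => and_congr_left' (forall_congr' fun e => forall₂_congr fun r hr => ?_)
  suffices h : K.intE e (fun s => (evE ((K.ICurl k v).rE e).1 s -
      evE (K.dEcross (k + 1) (by ring) (K.ICurl k v).vE e).1 s) ⬝ᵥ evE r s) =
      K.intE e fun s => K.curl v (K.edgePt e s) ⬝ᵥ evE r s by rw [h]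
  have hgrad : ∀ i, ContinuousOn (fun s => K.grad (fun x => v x ⬝ᵥ K.tE e) (K.edgePt e s) i)
      (Icc 0 (K.len e)) := fun i =>
    continuousOn_comp_edgePt e (continuousOn_grad (contDiffOn_dot hv (K.tE e)) i)
  have hcurl := continuousOn_comp_edgePt e (continuousOn_curl hv)
  have hcurli := continuousOn_pi.1 hcurl
  have hjt := fun i => continuousOn_dotProduct
    (fun j => continuousOn_comp_edgePt e (continuousOn_jac hv i j))
    fun j => continuousOn_const (c := K.tE e j)
  have hf : ∀ i, ContinuousOn (fun s => ((K.curl v (K.edgePt e s) ⬝ᵥ K.tE e) • K.tE e +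
      K.grad (fun x => v x ⬝ᵥ K.tE e) (K.edgePt e s) ⨯₃ K.tE e) i) (Icc 0 (K.len e)) := by
    have hct : ContinuousOn (fun s => K.curl v (K.edgePt e s) ⬝ᵥ K.tE e) (Icc 0 (K.len e)) :=
      continuousOn_dotProduct hcurli fun _ => continuousOn_const
    have h0 := hgrad 0
    have h1 := hgrad 1
    have h2 := hgrad 2
    intro i
    fin_cases i <;> simp only [cross_apply, Pi.add_apply, Pi.smul_apply] <;> fun_prop
  have hd : ∀ i, ContinuousOn (fun s =>
      ((fun i => K.jac v (K.edgePt e s) i ⬝ᵥ K.tE e) ⨯₃ K.tE e) i) (Icc 0 (K.len e)) := by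
    have h0 := hjt 0
    have h1 := hjt 1
    have h2 := hjt 2
    intro i
    fin_cases i <;> simp only [cross_apply] <;> fun_prop
  have hp : ∀ u : Fin 3 → Polynomial ℝ, ∀ i, ContinuousOn (fun s => evE u s i)
      (Icc 0 (K.len e)) := fun u i => (Polynomial.continuous (u i)).continuousOn
  have hint : ∀ g : ℝ → R3, (∀ i, ContinuousOn (fun s => g s i) (Icc 0 (K.len e))) →
      IntervalIntegrable (fun s => g s ⬝ᵥ evE r s) volume 0 (K.len e) := fun g hg =>
    intervalIntegrable_of_continuousOn (continuousOn_dotProduct hg (hp r))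
  have hr' : r ∈ EPV ((k : ℤ) + 1) := hr
  have h1 := projE_spec (K.len_pos e) (EPV (k + 1)) hf r hr'
  have h2 := intE_dEcross_edgeInterp (n := (k : ℤ) + 2) (by omega) rfl rfl (by ring) hv e hr'
  simp only [sub_dotProduct]
  rw [intE, intervalIntegral.integral_sub (hint _ (hp _)) (hint _ (hp _))]
  refine (congrArg₂ (· - ·) h1 h2).trans ?_
  rw [intE, ← intervalIntegral.integral_sub (hint _ hf) (hint _ hd)]
  refine intE_congr fun s hs => ?_
  have hx := K.edgePt_mem_closure_T e hs
  have hg : K.grad (fun x => v x ⬝ᵥ K.tE e) (K.edgePt e s) =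
      fun i => ∑ j, K.tE e j * K.jac v (K.edgePt e s) j i := funext fun i => grad_dot hv _ hx i
  have hcc := curl_cross (K := K) (v := v) (K.edgePt e s) (K.tE e)
  rw [← hg] at hcc
  rw [← sub_dotProduct, add_sub_assoc, ← LinearMap.sub_apply, ← map_sub crossProduct,
    ← neg_sub, ← hcc, map_neg, LinearMap.neg_apply, cross_anticomm, add_dotProduct,
    smul_dotProduct, cross_cross_dot _ _ _ (K.tE_unit e), smul_eq_mul, add_sub_cancel]

/-- The discrete curl commutes with the interpolators. -/
theorem discCurl_ICurl (k : ℕ) : discCurl (K.ICurl k v) = K.INabla k (K.curl v) := by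
  have hR := K.isRegion_faceReg
  have hadd : ∀ (f : Fin K.nF) (S : Submodule ℝ (Fin 2 → Pol 2)) [FiniteDimensional ℝ S],
      S ≤ VPoly 2 2 k → projV (K.faceReg f) S (evV (CvecF (K.ICurl k v) f).1) +
        projV (K.faceReg f) S (K.crossNormalDeriv f v) =
        projV (K.faceReg f) S fun y => K.tang f (K.curl v (K.faceMap f y)) :=
    fun f S _ hS => (hR f).projV_add_eq S (fun i => (hR f).integrableOn_eval _)
      (fun i => (hR f).integrableOn_of_continuousOn (continuousOn_crossNormalDeriv hv f i))
      (fun i => (hR f).integrableOn_of_continuousOn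
        (continuousOn_tang_comp (continuousOn_curl hv) i))
      fun r hr => intF_CvecF hv k f (hS hr)
  simp only [discCurl, INabla, XNabla.mk.injEq]
  refine ⟨CE_ICurl hv k, funext (CF_ICurl hv k), funext fun f => hadd f _ (Goly_le _),
    funext fun f => hadd f _ GolyC2_le, ?_, ?_⟩
  · refine projV_congr fun r hr => intT_CT hv k (VPoly_mono (by omega) (Goly_le _ hr)) fun f => ?_
    obtain ⟨w, hw, hwr⟩ := exists_restrict_face_cross (Goly_le _ hr) f
    exact ⟨w, Submodule.mem_sup_left hw, hwr⟩
  · refine projV_congr fun r hr => intT_CT hv k ?_ fun f => exists_restrict_face_koszulCross hr f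
    obtain ⟨p, hp, rfl⟩ := hr
    exact koszulCross_mem hp

end Cell

/-! ### The matrix-valued polynomial spaces -/

section Spaces

variable {d : ℕ} {c : Fin d → ℝ} {R : Set (Fin d → ℝ)} {m : ℤ}

theorem RolybC_le : RolybC d c m ≤ rows d (RolyC d c m) := inf_le_left

theorem Rolyb_le : Rolyb d c R m ≤ rows d (RolyC d c m) := inf_le_left

instance finiteDimensional_RolybC : FiniteDimensional ℝ (RolybC d c m) :=
  Submodule.finiteDimensional_of_le RolybC_le

instance finiteDimensional_Rolyb : FiniteDimensional ℝ (Rolyb d c R m) :=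
  Submodule.finiteDimensional_of_le Rolyb_le

theorem divRows_Rolyb_mem (hR : IsRegion R) {B : Fin d → Fin d → Pol d}
    (hB : B ∈ Rolyb d c R m) : divRows d d B ∈ Goly d (m - 1) := by
  obtain ⟨q, hq, hqB⟩ := hB.2
  exact ⟨q, Poly_mono (by omega) (hR.Poly0_le hq), hqB⟩

/-- A matrix field with rows in `R^{c,m}` and with gradient divergence lies in `R_b^m`. -/
theorem IsRegion.mem_Rolyb (hR : IsRegion R) (hm : 0 ≤ m) {B : Fin d → Fin d → Pol d}
    (hB : B ∈ rows d (RolyC d c m)) {q : Pol d} (hq : q ∈ Poly d m)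
    (h : divRows d d B = gradP d q) : B ∈ Rolyb d c R m := by
  obtain ⟨a, ha⟩ := hR.exists_sub_C_mem_Poly0 hm hq
  refine ⟨hB, _, ha, ?_⟩
  rw [h]
  ext1 i
  rw [gradP_apply, map_sub, dP_C, sub_zero, gradP_apply]

theorem divRows_rows_Roly2 {C : Fin 2 → Fin 2 → Pol 2} (hC : C ∈ rows 2 (Roly2 m)) :
    divRows 2 2 C = 0 := by
  ext1 i
  obtain ⟨r, -, hr⟩ := mem_rows.1 hC i
  rw [divRows_apply, ← hr, div_vrotP]
  rfl

theorem divRows_rows_Roly3 {C : Fin 3 → Fin 3 → Pol 3} (hC : C ∈ rows 3 (Roly3 m)) :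
    divRows 3 3 C = 0 := by
  ext1 i
  obtain ⟨r, -, hr⟩ := mem_rows.1 hC i
  rw [divRows_apply, ← hr, div_curlP]
  rfl

/-- In the plane, matrix fields with rows in `R^{c,m+1}` split into a trace-free part, which carries
the part of the divergence in `G^{c,m}`, and a part whose divergence is a gradient. -/
theorem rows_RolyC_le (hm : 0 ≤ m) {R : Set (Fin 2 → ℝ)} (hR : IsRegion R) :
    rows 2 (RolyC 2 0 (m + 1)) ≤ RolybC 2 0 (m + 1) ⊔ Rolyb 2 0 R (m + 1) := by
  intro V hV
  have hdiv : divRows 2 2 V ∈ VPoly 2 2 m := mem_VPoly.2 fun i =>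
    divP_mem (by ring) (RolyC_le _ _ (mem_rows.1 hV i))
  obtain ⟨q, hq, s, hs, hqs⟩ := exists_gradP_add_perp hdiv
  -- `A = s' x^⊥ ⊗ x` is trace-free with divergence `(3 + x · ∇) s' x^⊥ = s x^⊥`
  obtain ⟨s', hs', hss⟩ := exists_eulerP_eq (0 : Fin 2 → ℝ) three_ne_zero hs
  set α : Fin 2 → Pol 2 := perp (koszul 0 s') with hα
  have hαm : α ∈ VPoly 2 2 m := perp_mem_VPoly (koszul_mem_VPoly hs')
  set A : Fin 2 → Fin 2 → Pol 2 := fun i => koszul 0 (α i) with hA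
  have hArows : A ∈ rows 2 (RolyC 2 0 (m + 1)) := mem_rows.2 fun i =>
    ⟨α i, by rw [add_sub_cancel_right]; exact mem_VPoly.1 hαm i, rfl⟩
  have hAtr : A ∈ RolybC 2 0 (m + 1) := by
    refine ⟨hArows, ?_⟩
    rw [SetLike.mem_coe, LinearMap.mem_ker, trP_apply, Fin.sum_univ_two]
    simp only [hA, hα, perp_koszul_apply, koszul_apply, Matrix.cons_val, Pi.zero_apply,
      map_zero, sub_zero]
    ring
  have hAdiv : divRows 2 2 A = perp (koszul 0 s) := by
    have key : ∀ j : Fin 2, eulerP (0 : Fin 2 → ℝ) 2 (MvPolynomial.X j * s') =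
        MvPolynomial.X j * s := fun j => by
      have h := eulerP_mul (0 : Fin 2 → ℝ) 2 j s'
      rw [hss] at h
      simpa using h
    ext1 i
    rw [divRows_apply, hA]
    simp only [div_koszul]
    rw [hα, perp_koszul_apply, perp_koszul_apply]
    fin_cases i
    · exact (map_neg _ _).trans (congrArg _ (key 1))
    · exact key 0
  have hB : V - A ∈ Rolyb 2 0 R (m + 1) := by
    refine hR.mem_Rolyb (by omega) (Submodule.sub_mem _ hV hArows) hq ?_
    rw [map_sub, hAdiv, hqs, add_sub_cancel_right]
  exact Submodule.mem_sup.2 ⟨A, hAtr, V - A, hB, add_sub_cancel _ _⟩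

/-- The matrix field with rows `W 0`, `W 1` and `n`. -/
def stack : (Fin 2 → Fin 2 → Pol 2) × (Fin 2 → Pol 2) →ₗ[ℝ] (Fin 3 → Fin 2 → Pol 2) :=
  LinearMap.pi ![LinearMap.proj 0 ∘ₗ LinearMap.fst ℝ _ _, LinearMap.proj 1 ∘ₗ LinearMap.fst ℝ _ _,
    LinearMap.snd ℝ _ _]

theorem stack_apply (W : Fin 2 → Fin 2 → Pol 2) (n : Fin 2 → Pol 2) :
    stack (W, n) = ![W 0, W 1, n] := by
  ext1 i
  fin_cases i <;> rfl

theorem stack_castSucc (W : Fin 2 → Fin 2 → Pol 2) (n : Fin 2 → Pol 2) (i : Fin 2) :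
    stack (W, n) i.castSucc = W i := by
  fin_cases i <;> rfl

theorem stack_last (W : Fin 2 → Fin 2 → Pol 2) (n : Fin 2 → Pol 2) :
    stack (W, n) 2 = n := rfl

theorem eq_stack (V : Fin 3 → Fin 2 → Pol 2) : V = stack (fun i => V i.castSucc, V 2) := by
  ext1 i
  fin_cases i <;> rfl

end Spaces

namespace Cell

variable {K : Cell} {k : ℕ} {m : ℤ}

theorem mem_FRTb {f : Fin K.nF} {V : Fin 3 → Fin 2 → Pol 2} : V ∈ K.FRTb f m ↔
    ∃ A ∈ RolybC 2 0 m, ∃ B ∈ Rolyb 2 0 (K.faceReg f) m, ∃ C ∈ rows 2 (Roly2 m),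
      ∃ n ∈ VPoly 2 2 m, V = stack (A + B + C, n) := by
  have h : V ∈ K.FRTb f m ↔ (fun i : Fin 2 => V i.castSucc) ∈
      RolybC 2 0 m ⊔ (Rolyb 2 0 (K.faceReg f) m ⊔ rows 2 (Roly2 m)) ∧ V 2 ∈ VPoly 2 2 m := Iff.rfl
  rw [h]
  constructor
  · rintro ⟨h1, h2⟩
    obtain ⟨A, hA, D, hD, hAD⟩ := Submodule.mem_sup.1 h1
    obtain ⟨B, hB, C, hC, rfl⟩ := Submodule.mem_sup.1 hD
    refine ⟨A, hA, B, hB, C, hC, V 2, h2, ?_⟩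
    rw [add_assoc, hAD]
    exact eq_stack V
  · rintro ⟨A, hA, B, hB, C, hC, n, hn, rfl⟩
    refine ⟨?_, hn⟩
    simp only [stack_castSucc]
    rw [add_assoc]
    exact Submodule.add_mem_sup hA (Submodule.add_mem_sup hB hC)

theorem mem_RTb {V : Fin 3 → Fin 3 → Pol 3} : V ∈ K.RTb m ↔
    ∃ A ∈ RolybC 3 K.xT m, ∃ B ∈ Rolyb 3 K.xT K.T (m - 1), ∃ C ∈ rows 3 (Roly3 (m - 1)),
      V = A + B + C := by
  rw [RTb]
  constructor
  · intro h
    obtain ⟨A, hA, D, hD, rfl⟩ := Submodule.mem_sup.1 h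
    obtain ⟨B, hB, C, hC, rfl⟩ := Submodule.mem_sup.1 hD
    exact ⟨A, hA, B, hB, C, hC, (add_assoc _ _ _).symm⟩
  · rintro ⟨A, hA, B, hB, C, hC, rfl⟩
    rw [add_assoc]
    exact Submodule.add_mem_sup hA (Submodule.add_mem_sup hB hC)

theorem FRTb_le (f : Fin K.nF) : K.FRTb f m ≤ rows 3 (VPoly 2 2 m) := by
  intro V hV
  obtain ⟨A, hA, B, hB, C, hC, n, hn, rfl⟩ := mem_FRTb.1 hV
  rw [mem_rows]
  refine Fin.lastCases hn fun i => ?_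
  rw [stack_castSucc]
  exact Submodule.add_mem _ (Submodule.add_mem _ (RolyC_le _ _ (mem_rows.1 (RolybC_le hA) i))
    (RolyC_le _ _ (mem_rows.1 (Rolyb_le hB) i))) (Roly2_le (mem_rows.1 hC i))

instance finiteDimensional_FRTb (f : Fin K.nF) : FiniteDimensional ℝ (K.FRTb f m) :=
  Submodule.finiteDimensional_of_le (FRTb_le f)

instance finiteDimensional_RTb : FiniteDimensional ℝ (K.RTb m) := by
  unfold RTb
  infer_instance

/-! ### Solvability of the defining problems of the discrete Jacobian -/

theorem isLinear_bdF_stack (f : Fin K.nF) (z : Fin K.nE → Fin 3 → Polynomial ℝ) :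
    IsLinearMap ℝ fun V : Fin 3 → Fin 2 → Pol 2 => K.bdF f fun e s =>
      K.comps f (evE (z e) s) ⬝ᵥ
        fun i => evM V (K.edgeInFace f e s) i ⬝ᵥ K.tang f (K.nFE f e) := by
  refine isLinear_bdF (fun V e _ => ?_) fun e s => isLinear_dot_evM _ _ _
  exact continuousOn_dotProduct (fun i => continuousOn_evE_dot e _ _)
    fun i => continuousOn_evV_edge f e (V i) _ _

/-- The problem is solvable because the sum defining the test space is direct. -/
theorem nablaF_spec (w : K.XNabla k) (f : Fin K.nF) :
    ∀ A ∈ RolybC 2 0 ((k : ℤ) + 1), ∀ B ∈ Rolyb 2 0 (K.faceReg f) ((k : ℤ) + 1),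
    ∀ C ∈ rows 2 (Roly2 ((k : ℤ) + 1)), ∀ n ∈ VPoly 2 2 ((k : ℤ) + 1),
    K.intF f (fun y => ddot (evM (nablaF w f).1 y) (evM (stack (A + B + C, n)) y)) =
      -K.intF f (fun y => evV (w.wGcF f).1 y ⬝ᵥ evV (divRows 2 2 A) y) -
      K.intF f (fun y => evV (w.wGF f).1 y ⬝ᵥ evV (divRows 2 2 B) y) -
      K.intF f (fun y => eval y (w.wF f).1 * eval y (divP 2 n)) +
      K.bdF f fun e s => K.comps f (evE (w.wE.1 e) s) ⬝ᵥ
        fun i => evM (stack (A + B + C, n)) (K.edgeInFace f e s) i ⬝ᵥ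
          K.tang f (K.nFE f e) := by
  have hR := K.isRegion_faceReg f
  let M := RolybC 2 (0 : Fin 2 → ℝ) ((k : ℤ) + 1) × Rolyb 2 0 (K.faceReg f) ((k : ℤ) + 1) ×
    rows 2 (Roly2 ((k : ℤ) + 1)) × VPoly 2 2 ((k : ℤ) + 1)
  let LA : M →ₗ[ℝ] (Fin 2 → Fin 2 → Pol 2) := Submodule.subtype _ ∘ₗ LinearMap.fst ℝ _ _
  let LB : M →ₗ[ℝ] (Fin 2 → Fin 2 → Pol 2) :=
    Submodule.subtype _ ∘ₗ LinearMap.fst ℝ _ _ ∘ₗ LinearMap.snd ℝ _ _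
  let LC : M →ₗ[ℝ] (Fin 2 → Fin 2 → Pol 2) :=
    Submodule.subtype _ ∘ₗ LinearMap.fst ℝ _ _ ∘ₗ LinearMap.snd ℝ _ _ ∘ₗ LinearMap.snd ℝ _ _
  let Ln : M →ₗ[ℝ] (Fin 2 → Pol 2) :=
    Submodule.subtype _ ∘ₗ LinearMap.snd ℝ _ _ ∘ₗ LinearMap.snd ℝ _ _ ∘ₗ LinearMap.snd ℝ _ _
  let J : M →ₗ[ℝ] (Fin 3 → Fin 2 → Pol 2) := stack ∘ₗ (LA + LB + LC).prod Ln
  have hJ : Function.Injective J := by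
    rw [← LinearMap.ker_eq_bot, LinearMap.ker_eq_bot']
    rintro ⟨A, B, C, n⟩ h
    change stack (A.1 + B.1 + C.1, n.1) = 0 at h
    have h1 : A.1 + B.1 + C.1 = 0 := by
      ext1 i
      rw [← stack_castSucc (A.1 + B.1 + C.1) n.1, h]
      rfl
    have h2 : n.1 = 0 := congrFun h 2
    obtain ⟨hA, hB, hC⟩ := eq_zero_of_add_add_eq_zero two_ne_zero A.2 B.2
      (divRows_rows_Roly2 C.2) h1
    exact Prod.ext (Subtype.ext hA) (Prod.ext (Subtype.ext hB)
      (Prod.ext (Subtype.ext hC) (Subtype.ext h2)))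
  have hlin := ((((isLinear_intF_dot f (w.wGcF f).1).fun_comp (divRows 2 2 ∘ₗ LA)).fun_neg.fun_sub
    ((isLinear_intF_dot f (w.wGF f).1).fun_comp (divRows 2 2 ∘ₗ LB))).fun_sub
    ((isLinear_intF_mul f (w.wF f).1).fun_comp (divP 2 ∘ₗ Ln))).fun_add
    ((isLinear_bdF_stack f w.wE.1).fun_comp J)
  obtain ⟨g, hg⟩ := hR.exists_repM J hJ hlin
  have hgm : J g ∈ K.FRTb f ((k : ℤ) + 1) :=
    mem_FRTb.2 ⟨_, g.1.2, _, g.2.1.2, _, g.2.2.1.2, _, g.2.2.2.2, rfl⟩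
  have h := of_eq_solve (x := nablaF w f) rfl ⟨⟨J g, hgm⟩, fun A hA B hB C hC n hn => by
    have := hg (⟨A, hA⟩, ⟨B, hB⟩, ⟨C, hC⟩, ⟨n, hn⟩)
    intro V
    have hV : V = J (⟨A, hA⟩, ⟨B, hB⟩, ⟨C, hC⟩, ⟨n, hn⟩) := (stack_apply _ _).symm
    rw [hV]
    exact this⟩
  intro A hA B hB C hC n hn
  have := h A hA B hB C hC n hn
  rw [← stack_apply] at this
  exact this

/-- The trace exists because the row-wise divergence is an isomorphism from the matrix fields with
rows in `R^{c,k+3}(F)` onto `P^{k+2}(F)³`. -/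
theorem traceNabla_spec (w : K.XNabla k) (f : Fin K.nF) :
    ∀ V ∈ rows 3 (RolyC 2 0 ((k : ℤ) + 3)),
    K.intF f (fun y => evV (traceNabla w f).1 y ⬝ᵥ evV (divRows 2 3 V) y) =
      -K.intF f (fun y => ddot (evM (nablaF w f).1 y) (evM V y)) +
      K.bdF f fun e s => K.comps f (evE (w.wE.1 e) s) ⬝ᵥ
        fun i => evM V (K.edgeInFace f e s) i ⬝ᵥ K.tang f (K.nFE f e) := by
  have hR := K.isRegion_faceReg f
  let J : VPoly 2 3 ((k : ℤ) + 2) →ₗ[ℝ] (Fin 3 → Pol 2) :=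
    (LinearMap.pi fun i => eulerP 0 2 ∘ₗ LinearMap.proj i) ∘ₗ Submodule.subtype _
  let L : VPoly 2 3 ((k : ℤ) + 2) →ₗ[ℝ] (Fin 3 → Fin 2 → Pol 2) :=
    (LinearMap.pi fun i => koszul 0 ∘ₗ LinearMap.proj i) ∘ₗ Submodule.subtype _
  have hJ : Function.Injective J := fun p q h => Subtype.ext <| funext fun i =>
    eulerP_injective 0 two_ne_zero (congrFun h i)
  have hlin := (hR.isLinear_ddot (f := evM (nablaF w f).1)
    fun i j => hR.integrableOn_eval ((nablaF w f).1 i j)).fun_neg.fun_add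
    (isLinear_bdF_stack f w.wE.1)
  obtain ⟨g, hg⟩ := hR.exists_repV J hJ (hlin.fun_comp L)
  have hgm : J g ∈ VPoly 2 3 ((k : ℤ) + 2) :=
    mem_VPoly.2 fun i => eulerP_mem (mem_VPoly.1 g.2 i)
  refine of_eq_solve (x := traceNabla w f) rfl ⟨⟨J g, hgm⟩, fun V hV => ?_⟩
  choose p hp hpV using fun i => mem_rows.1 hV i
  have hpm : p ∈ VPoly 2 3 ((k : ℤ) + 2) := mem_VPoly.2 fun i => Poly_mono (by omega) (hp i)
  have hVL : V = L ⟨p, hpm⟩ := funext fun i => (hpV i).symm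
  have hdiv : divRows 2 3 V = J ⟨p, hpm⟩ := by
    ext1 i
    rw [divRows_apply, ← hpV, div_koszul]
    rfl
  rw [hdiv, hVL]
  exact hg ⟨p, hpm⟩

end Cell

namespace Cell

variable {K : Cell} {k : ℕ}

/-! ### The discrete Jacobian of an interpolate -/

section Face

variable {w : R3 → R3}

/-- The face components of the interpolate only enter through exact `L²` products. -/
theorem intF_INabla (hw : ContinuousOn w (closure K.T)) (k : ℕ) (f : Fin K.nF)
    {A B C : Fin 2 → Fin 2 → Pol 2} {n : Fin 2 → Pol 2}
    (hA : A ∈ RolybC 2 0 ((k : ℤ) + 1)) (hB : B ∈ Rolyb 2 0 (K.faceReg f) ((k : ℤ) + 1))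
    (hC : C ∈ rows 2 (Roly2 ((k : ℤ) + 1))) (hn : n ∈ VPoly 2 2 ((k : ℤ) + 1)) :
    -K.intF f (fun y => evV ((K.INabla k w).wGcF f).1 y ⬝ᵥ evV (divRows 2 2 A) y) -
      K.intF f (fun y => evV ((K.INabla k w).wGF f).1 y ⬝ᵥ evV (divRows 2 2 B) y) -
      K.intF f (fun y => eval y ((K.INabla k w).wF f).1 * eval y (divP 2 n)) =
    -K.intF f fun y => K.comps f (w (K.faceMap f y)) ⬝ᵥ
      evV (divRows 2 3 (stack (A + B + C, n))) y := by
  have hR := K.isRegion_faceReg f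
  have ht : ∀ i, IntegrableOn (fun y => K.tang f (w (K.faceMap f y)) i) (K.faceReg f) :=
    fun i => hR.integrableOn_of_continuousOn (continuousOn_tang_comp hw i)
  have hN : IntegrableOn (fun y => w (K.faceMap f y) ⬝ᵥ K.nrm f) (K.faceReg f) :=
    integrableOn_comp_face (continuousOn_dot_const hw _) f
  have h1 : K.intF f (fun y => evV ((K.INabla k w).wGcF f).1 y ⬝ᵥ evV (divRows 2 2 A) y) =
      K.intF f fun y => K.tang f (w (K.faceMap f y)) ⬝ᵥ evV (divRows 2 2 A) y :=
    hR.projV_spec (GolyC2 k) ht _ (divRows_RolybC_mem_GolyC2 (by ring) hA)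
  have h2 : K.intF f (fun y => evV ((K.INabla k w).wGF f).1 y ⬝ᵥ evV (divRows 2 2 B) y) =
      K.intF f fun y => K.tang f (w (K.faceMap f y)) ⬝ᵥ evV (divRows 2 2 B) y := by
    refine hR.projV_spec (Goly 2 k) ht _ ?_
    have := divRows_Rolyb_mem hR hB
    rwa [add_sub_cancel_right] at this
  have h3 : K.intF f (fun y => eval y ((K.INabla k w).wF f).1 * eval y (divP 2 n)) =
      K.intF f fun y => (w (K.faceMap f y) ⬝ᵥ K.nrm f) * eval y (divP 2 n) :=
    hR.projS_spec (Poly 2 k) hN _ (divP_mem (by ring) hn)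
  have hdiv : divRows 2 2 (A + B + C) = divRows 2 2 A + divRows 2 2 B := by
    rw [map_add, map_add, divRows_rows_Roly2 hC, add_zero]
  have h4 : K.intF f (fun y => K.comps f (w (K.faceMap f y)) ⬝ᵥ
      evV (divRows 2 3 (stack (A + B + C, n))) y) =
      K.intF f (fun y => K.tang f (w (K.faceMap f y)) ⬝ᵥ evV (divRows 2 2 A) y) +
      K.intF f (fun y => K.tang f (w (K.faceMap f y)) ⬝ᵥ evV (divRows 2 2 B) y) +
      K.intF f (fun y => (w (K.faceMap f y) ⬝ᵥ K.nrm f) * eval y (divP 2 n)) := by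
    have hadd : K.intF f (fun y => K.tang f (w (K.faceMap f y)) ⬝ᵥ
        evV (divRows 2 2 A + divRows 2 2 B) y) =
        K.intF f (fun y => K.tang f (w (K.faceMap f y)) ⬝ᵥ evV (divRows 2 2 A) y) +
        K.intF f (fun y => K.tang f (w (K.faceMap f y)) ⬝ᵥ evV (divRows 2 2 B) y) :=
      (hR.isLinear_dot ht).map_add _ _
    rw [← hadd, intF, intF, intF, ← integral_add (hR.integrableOn_dot ht _)
      (hR.integrableOn_mul_eval hN _)]
    refine intF_congr fun y _ => ?_
    rw [← hdiv]
    generalize A + B + C = V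
    have hs : ∀ i : Fin 2, evV (divRows 2 3 (stack (V, n))) y i.castSucc =
        evV (divRows 2 2 V) y i := fun i => by
      rw [evV, evV, divRows_apply, divRows_apply, stack_castSucc]
    have hl : evV (divRows 2 3 (stack (V, n))) y (Fin.last 2) = eval y (divP 2 n) := by
      rw [evV, divRows_apply, show (Fin.last 2) = 2 from rfl, stack_last]
    rw [dotProduct, Fin.sum_univ_castSucc, hl]
    simp_rw [hs]
    rfl
  rw [h1, h2, h3, h4]
  ring

/-- The trace of the interpolate is exact against `P^k(F)³`. -/
theorem intF_traceNabla (hw : ContinuousOn w (closure K.T)) (k : ℕ) (f : Fin K.nF)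
    {p : Fin 3 → Pol 2} (hp : p ∈ VPoly 2 3 k) :
    K.intF f (fun y => evV (traceNabla (K.INabla k w) f).1 y ⬝ᵥ evV p y) =
      K.intF f fun y => K.comps f (w (K.faceMap f y)) ⬝ᵥ evV p y := by
  have hR := K.isRegion_faceReg f
  -- write `p = div V` with rows of `V` in `R^{c,k+1}`; such a `V` is also a test field for `∇_F`
  choose u hu hup using fun i => exists_koszul_div two_ne_zero 0 (mem_VPoly.1 hp i)
  set V : Fin 3 → Fin 2 → Pol 2 := fun i => koszul 0 (u i) with hV
  have hVrow : ∀ i, V i ∈ RolyC 2 0 ((k : ℤ) + 1) := fun i =>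
    ⟨u i, by rw [add_sub_cancel_right]; exact hu i, rfl⟩
  have hdiv : divRows 2 3 V = p := funext fun i => hup i
  obtain ⟨A, hA, B, hB, hAB⟩ := Submodule.mem_sup.1 (rows_RolyC_le (Int.natCast_nonneg k) hR
    (mem_rows.2 fun i : Fin 2 => hVrow i.castSucc))
  have hVs : stack (A + B + 0, V 2) = V := by
    rw [add_zero, hAB]
    exact (eq_stack V).symm
  have hC : (0 : Fin 2 → Fin 2 → Pol 2) ∈ rows 2 (Roly2 ((k : ℤ) + 1)) := Submodule.zero_mem _
  have hn : V 2 ∈ VPoly 2 2 ((k : ℤ) + 1) := RolyC_le _ _ (hVrow 2)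
  have h1 := nablaF_spec (K.INabla k w) f A hA B hB 0 hC (V 2) hn
  have h2 := intF_INabla hw k f hA hB hC hn
  rw [h2, hVs] at h1
  have h3 := traceNabla_spec (K.INabla k w) f V
    (mem_rows.2 fun i => RolyC_mono 0 (by omega) (hVrow i))
  rw [hdiv] at h3 h1
  linarith

theorem comps_dot_eq (f : Fin K.nF) (u : R3) (z : Fin 3 → ℝ) :
    K.comps f u ⬝ᵥ z = u ⬝ᵥ ∑ i, z i • K.frame f i := by
  rw [dotProduct_sum, dotProduct]
  refine Finset.sum_congr rfl fun i _ => ?_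
  rw [dotProduct_smul, smul_eq_mul, mul_comm]
  rfl

/-- The edge interpolant reproduces the moments of degree `k + 1`, hence the boundary terms of all
the test fields of degree `k + 1`. -/
theorem bdF_INabla (hw : ContinuousOn w (closure K.T)) (k : ℕ) (f : Fin K.nF)
    {V : Fin 3 → Fin 2 → Pol 2} (hV : V ∈ rows 3 (VPoly 2 2 ((k : ℤ) + 1))) :
    K.bdF f (fun e s => K.comps f (evE ((K.INabla k w).wE.1 e) s) ⬝ᵥ
        fun i => evM V (K.edgeInFace f e s) i ⬝ᵥ K.tang f (K.nFE f e)) =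
      K.bdF f fun e s => K.comps f (w (K.faceMap f (K.edgeInFace f e s))) ⬝ᵥ
        fun i => evM V (K.edgeInFace f e s) i ⬝ᵥ K.tang f (K.nFE f e) := by
  refine bdF_congr fun e he => ?_
  choose r hr hrV using fun i =>
    exists_restrict_edge_dot (mem_rows.1 hV i) f e (K.tang f (K.nFE f e))
  set ρ : Fin 3 → Polynomial ℝ := ∑ i, fun a => K.frame f i a • r i with hρ
  have hρm : ρ ∈ EPV ((k : ℤ) + 1) := Submodule.sum_mem _ fun i _ => smul_mem_EPV (hr i) _
  have hρs : ∀ s, evE ρ s =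
      ∑ i, (evM V (K.edgeInFace f e s) i ⬝ᵥ K.tang f (K.nFE f e)) • K.frame f i := fun s => by
    have h : ∀ i, evM V (K.edgeInFace f e s) i ⬝ᵥ K.tang f (K.nFE f e) = (r i).eval s :=
      fun i => (hrV i s).symm
    simp only [h]
    ext a
    simp [hρ, evE, Polynomial.eval_finsetSum, mul_comm]
  simp_rw [comps_dot_eq, ← hρs, K.faceMap_edgeInFace he]
  exact (edgeInterp_spec (by omega) (by ring) hw).1 e ρ hρm

theorem nablaF_INabla (hw : ContDiffOn ℝ 1 w (closure K.T)) (k : ℕ) (f : Fin K.nF) :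
    nablaF (K.INabla k w) f = ((K.ITensor k (K.jac w)).WF f) := by
  have hR := K.isRegion_faceReg f
  have hg := greenF_comps hw f
  refine (hR.projM_eq (K.FRTb f (k + 1)) (fun i j => (hg i).integrableOn j) _
    fun V hV => ?_).symm
  refine Eq.trans ?_ (GreenF.ddot hg V).symm
  rw [← bdF_INabla hw.continuousOn k f (FRTb_le f hV)]
  obtain ⟨A, hA, B, hB, C, hC, n, hn, rfl⟩ := mem_FRTb.1 hV
  rw [← intF_INabla hw.continuousOn k f hA hB hC hn]
  exact nablaF_spec _ f A hA B hB C hC n hn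

/-- If the rows of `V` have normal components of degree `m` on a face, then `V n_F` has degree `m`
there. -/
theorem comps_restrict (f : Fin K.nF) {m : ℤ} {V : Fin 3 → Fin 3 → Pol 3}
    (hV : ∀ i, ∃ r ∈ Poly 2 m, ∀ y, eval y r = evV (V i) (K.faceMap f y) ⬝ᵥ K.nrm f) :
    ∃ p ∈ VPoly 2 3 m, ∀ y,
      evV p y = K.comps f fun i => evM V (K.faceMap f y) i ⬝ᵥ K.nrm f := by
  choose r hr hrV using hV
  refine ⟨fun i => ∑ a, K.frame f i a • r a, mem_VPoly.2 fun i =>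
    Submodule.sum_mem _ fun a _ => Submodule.smul_mem _ _ (hr a), fun y => ?_⟩
  ext i
  simp only [evV, comps, map_sum, MvPolynomial.smul_eval, hrV]
  exact Finset.sum_congr rfl fun a _ => mul_comm _ _

end Face

section Cell

variable {w : R3 → R3} {W : R3 → Fin 3 → Fin 3 → ℝ}

/-- The cell component of the discrete Jacobian is the projection of any Jacobian for which the
integration by parts formula is available. -/
theorem nablaT_INabla (hW : ∀ i, K.GreenT (fun x => w x i) fun x => W x i) (k : ℕ) :
    nablaT (K.INabla k w) = projM K.T (K.RTb (k + 1)) W := by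
  have hR := K.isRegion_T
  have hw : ContinuousOn w (closure K.T) := continuousOn_pi.2 fun i => (hW i).continuousOn
  have hwi : ∀ i, IntegrableOn (fun x => w x i) K.T := fun i =>
    hR.integrableOn_of_continuousOn (hW i).continuousOn
  have key : ∀ A ∈ RolybC 3 K.xT ((k : ℤ) + 1), ∀ B ∈ Rolyb 3 K.xT K.T k,
      ∀ C ∈ rows 3 (Roly3 k),
      K.intT (fun x => ddot (W x) (evM (A + B + C) x)) =
      -K.intT (fun x => evV (K.INabla k w).wGcT.1 x ⬝ᵥ evV (divRows 3 3 A) x) -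
      K.intT (fun x => evV (K.INabla k w).wGT.1 x ⬝ᵥ evV (divRows 3 3 B) x) +
      K.bdT fun f y => evV (traceNabla (K.INabla k w) f).1 y ⬝ᵥ
        K.comps f fun i => evM (A + B + C) (K.faceMap f y) i ⬝ᵥ K.nrm f := by
    intro A hA B hB C hC
    have h1 : K.intT (fun x => evV (K.INabla k w).wGcT.1 x ⬝ᵥ evV (divRows 3 3 A) x) =
        K.intT fun x => w x ⬝ᵥ evV (divRows 3 3 A) x :=
      hR.projV_spec (GolyC3 K.xT k) hwi _ (divRows_RolybC_mem_GolyC3 (by ring) hA)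
    have h2 : K.intT (fun x => evV (K.INabla k w).wGT.1 x ⬝ᵥ evV (divRows 3 3 B) x) =
        K.intT fun x => w x ⬝ᵥ evV (divRows 3 3 B) x :=
      hR.projV_spec (Goly 3 ((k : ℤ) - 1)) hwi _ (divRows_Rolyb_mem hR hB)
    have h3 : K.intT (fun x => w x ⬝ᵥ evV (divRows 3 3 (A + B + C)) x) =
        K.intT (fun x => w x ⬝ᵥ evV (divRows 3 3 A) x) +
        K.intT fun x => w x ⬝ᵥ evV (divRows 3 3 B) x := by
      rw [map_add, map_add, divRows_rows_Roly3 hC, add_zero]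
      exact (hR.isLinear_dot hwi).map_add _ _
    rw [GreenT.ddot hW, h1, h2, h3, neg_add', add_right_inj]
    refine bdT_congr fun f => ?_
    -- the normal components on the faces have degree `k`, although `A` has degree `k + 1`
    obtain ⟨p, hp, hpV⟩ := comps_restrict (m := k) f (V := A + B + C) fun i => by
      have hk : ∀ {V : Fin 3 → Fin 3 → Pol 3}, V ∈ rows 3 (RolyC 3 K.xT ((k : ℤ) + 1)) →
          ∃ r ∈ Poly 2 (k : ℤ), ∀ y, eval y r = evV (V i) (K.faceMap f y) ⬝ᵥ K.nrm f := by
        intro V hV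
        obtain ⟨p, hp, hpV⟩ := mem_rows.1 hV i
        rw [← hpV]
        exact exists_restrict_face_koszul (Poly_mono (by omega) hp) f
      obtain ⟨r₁, hr₁, h₁⟩ := hk (RolybC_le hA)
      obtain ⟨r₂, hr₂, h₂⟩ := hk (rows_mono (RolyC_mono _ (by omega)) (Rolyb_le hB))
      obtain ⟨r₃, hr₃, h₃⟩ := exists_restrict_face_dot (Roly3_le (mem_rows.1 hC i)) f (K.nrm f)
      refine ⟨r₁ + r₂ + r₃, Submodule.add_mem _ (Submodule.add_mem _ hr₁ hr₂) hr₃, fun y => ?_⟩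
      rw [map_add, map_add, h₁, h₂, h₃, ← add_dotProduct, ← add_dotProduct, ← evV_add, ← evV_add]
      rfl
    simp_rw [← hpV]
    rw [intF_traceNabla hw k f hp]
    simp_rw [hpV, comps_dot]
  refine solve_congr fun g => ?_
  constructor
  · intro h V hV
    obtain ⟨A, hA, B, hB, C, hC, rfl⟩ := mem_RTb.1 hV
    rw [add_sub_cancel_right] at hB hC
    exact (h A hA B hB C hC).trans (key A hA B hB C hC).symm
  · intro h A hA B hB C hC
    rw [← key A hA B hB C hC]
    refine h _ (mem_RTb.2 ⟨A, hA, B, ?_, C, ?_, rfl⟩)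
    · rwa [add_sub_cancel_right]
    · rwa [add_sub_cancel_right]

theorem dE_INabla (hw : ContDiffOn ℝ 1 w (closure K.T)) (k : ℕ) (e : Fin K.nE) :
    (discNabla (K.INabla k w)).WE e = (K.ITensor k (K.jac w)).WE e := by
  have hc : ∀ i, ContinuousOn (fun s => K.jac w (K.edgePt e s) i ⬝ᵥ K.tE e) (Icc 0 (K.len e)) :=
    fun i => continuousOn_dotProduct
      (fun j => continuousOn_comp_edgePt e (continuousOn_jac hw i j)) fun j => continuousOn_const
  have h : ∀ r ∈ EPV ((k : ℤ) + 2),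
      K.intE e (fun s => evE ((discNabla (K.INabla k w)).WE e).1 s ⬝ᵥ evE r s) =
        K.intE e fun s => (fun i => K.jac w (K.edgePt e s) i ⬝ᵥ K.tE e) ⬝ᵥ evE r s :=
    fun r hr => intE_dE_edgeInterp (m := (k : ℤ) + 1) (by omega) (by ring) (by ring) (by ring)
      hw e hr
  exact (projE_eq (K.len_pos e) (EPV ((k : ℤ) + 2)) hc _ h).symm

/-- The discrete Jacobian commutes with the interpolators. -/
theorem discNabla_INabla (hw : ContDiffOn ℝ 1 w (closure K.T)) (k : ℕ) :
    discNabla (K.INabla k w) = K.ITensor k (K.jac w) :=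
  XTensor.mk.injEq .. |>.mpr ⟨funext (dE_INabla hw k), funext (nablaF_INabla hw k),
    nablaT_INabla (greenT_jac hw) k⟩

/-! ### The discrete divergence -/

/-- The only part of the test space of degree `k + 1` is trace-free. -/
theorem trP_RTb_mem {V : Fin 3 → Fin 3 → Pol 3} (hV : V ∈ K.RTb ((k : ℤ) + 1)) :
    trP 3 V ∈ Poly 3 (k : ℤ) := by
  obtain ⟨A, hA, B, hB, C, hC, rfl⟩ := mem_RTb.1 hV
  rw [add_sub_cancel_right] at hB hC
  rw [map_add, map_add, LinearMap.mem_ker.1 hA.2, zero_add, trP_apply, trP_apply]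
  exact Submodule.add_mem _
    (Submodule.sum_mem _ fun i _ => mem_VPoly.1 (RolyC_le _ _ (mem_rows.1 (Rolyb_le hB) i)) i)
    (Submodule.sum_mem _ fun i _ => mem_VPoly.1 (Roly3_le (mem_rows.1 hC i)) i)

/-- Multiples of the identity by polynomials of degree `k` belong to the test space: the rows
`p eᵢ` split into curls and fields in `R^{c,k}`, and the divergence of `p I` is `∇p`. -/
theorem scalar_mem_RTb {p : Pol 3} (hp : p ∈ Poly 3 (k : ℤ)) :
    (fun i j => if i = j then p else 0) ∈ K.RTb ((k : ℤ) + 1) := by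
  set P : Fin 3 → Fin 3 → Pol 3 := fun i j => if i = j then p else 0 with hP
  have hPm : ∀ i, P i ∈ VPoly 3 3 (k : ℤ) := fun i => mem_VPoly.2 fun j => by
    simp only [hP]
    split_ifs
    · exact hp
    · exact Submodule.zero_mem _
  choose r hr u hu hru using fun i => exists_curlP_add_koszul K.xT (hPm i)
  set B : Fin 3 → Fin 3 → Pol 3 := fun i => koszul K.xT (u i) with hB
  set C : Fin 3 → Fin 3 → Pol 3 := fun i => curlP (r i) with hC
  have hCm : C ∈ rows 3 (Roly3 (k : ℤ)) := mem_rows.2 fun i => ⟨r i, hr i, rfl⟩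
  have hPBC : P = C + B := funext hru
  have hdiv : divRows 3 3 B = gradP 3 p := by
    have h1 : divRows 3 3 P = gradP 3 p := by
      ext1 i
      rw [divRows_apply, divP_apply, gradP_apply]
      simp [hP, apply_ite]
    rw [← h1, hPBC, map_add, divRows_rows_Roly3 hCm, zero_add]
  have hBm : B ∈ Rolyb 3 K.xT K.T (k : ℤ) := K.isRegion_T.mem_Rolyb (Int.natCast_nonneg k)
    (mem_rows.2 fun i => ⟨u i, hu i, rfl⟩) hp hdiv
  refine mem_RTb.2 ⟨0, Submodule.zero_mem _, B, ?_, C, ?_, ?_⟩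
  · rwa [add_sub_cancel_right]
  · rwa [add_sub_cancel_right]
  · rw [hPBC, zero_add, add_comm]

/-- The discrete divergence of an interpolate is the projection of the trace of any Jacobian for
which the integration by parts formula is available. -/
theorem discDiv_INabla (hW : ∀ i, K.GreenT (fun x => w x i) fun x => W x i) (k : ℕ) :
    discDiv (K.INabla k w) = (projS K.T (Poly 3 k) fun x => ∑ i, W x i i : Pol 3) := by
  have hR := K.isRegion_T
  rw [discDiv, nablaT_INabla hW]
  have hWi : IntegrableOn (fun x => ∑ i, W x i i) K.T :=
    integrable_finsetSum _ fun i _ => (hW i).integrableOn i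
  have hspec := hR.projM_spec (K.RTb ((k : ℤ) + 1)) fun i j => (hW i).integrableOn j
  set N := projM K.T (K.RTb ((k : ℤ) + 1)) W with hN
  have h := hR.projS_eq (Poly 3 (k : ℤ)) hWi ⟨trP 3 N.1, trP_RTb_mem N.2⟩ fun p hp => ?_
  · rw [h]
  · have htr : ∀ (A : Fin 3 → Fin 3 → ℝ) x,
        ddot A (evM (fun i j => if i = j then p else 0) x) = (∑ i, A i i) * eval x p := by
      intro A x
      simp [ddot, evM, dotProduct, Fin.sum_univ_three]
      ring
    have h1 := hspec _ (scalar_mem_RTb hp)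
    simp only [htr] at h1
    rw [← h1]
    simp only [trP_apply, map_sum, evM]

end Cell

end Cell

end DiscreteStokes

end

open DiscreteStokes MeasureTheory in
theorem mainTheorem11 (K : Cell) (k : ℕ) :
    (∀ q : R3 → ℝ, ContDiffOn ℝ 2 q (closure K.T) →
      Cell.discGrad (K.IGrad k q) = K.ICurl k (K.grad q)) ∧
    (∀ v : R3 → R3, ContDiffOn ℝ 1 v (closure K.T) →
      Cell.discCurl (K.ICurl k v) = K.INabla k (K.curl v)) ∧
    (∀ w : R3 → R3, ContDiffOn ℝ 1 w (closure K.T) →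
      Cell.discNabla (K.INabla k w) = K.ITensor k (K.jac w)) ∧
    (∀ (w : R3 → R3) (W : R3 → Fin 3 → Fin 3 → ℝ), ContinuousOn w (closure K.T) →
      (∀ i j, MemLp (fun x => W x i j) 2 (volume.restrict K.T)) → K.IsWeakJac w W →
      Cell.discDiv (K.INabla k w) = (projS K.T (Poly 3 k) fun x => ∑ i, W x i i : Pol 3)) := by
  refine ⟨fun q hq => Cell.discGrad_IGrad hq k, fun v hv => Cell.discCurl_ICurl hv k,
    fun w hw => Cell.discNabla_INabla hw k, fun w W hw hL2 hweak => ?_⟩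
  have : IsFiniteMeasure (volume.restrict K.T) :=
    isFiniteMeasure_restrict.2 K.bounded_T.measure_lt_top.ne
  refine Cell.discDiv_INabla (fun i => Cell.greenT_of_isWeakJac (continuousOn_pi.1 hw i)
    (fun j => (hL2 i j).integrable one_le_two) fun φ h1 h2 h3 j => ?_) k
  exact hweak φ h1 h2 h3 i j
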